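/- **Setting.** Everything is over $\mathbb C$. A *cocyclic module* $X$ consists of vector spaces $X^n$ $(n\ge 0)$, cofaces $\partial_i:X^n\to X^{n+1}$ $(0\le i\le n+1)$, codegeneracies $\sigma_j:X^{n+1}\to X^n$ $(0\le j\le n)$ and operators $\tau_n:X^n\to X^n$ with the usual cosimplicial identities and $\tau_n\partial_i=\partial_{i-1}\tau_{n-1}$ $(1\le i\le n)$, $\tau_n\partial_0=\partial_n$, $\tau_n\sigma_i=\sigma_{i-1}\tau_{n+1}$ $(1\le i\le n)$, $\tau_n\sigma_0=\sigma_n\tau_{n+1}^2$, $\tau_n^{n+1}=1$. Put $b=\sum_{i}(-1)^i\partial_i$ and, on $X^{n}$ with $n\ge1$, $B=\big(\sum_{i=0}^{n-1}\lambda^i\big)\,\sigma_{n-1}\tau_n\,(1-(-1)^n\tau_n)$, where $\lambda=(-1)^{n-1}\tau_{n-1}$ on $X^{n-1}$. $HC^n(X)$ is the cohomology of the total complex $\bigoplus_{m+2k=n}X^mu^k$ with differential $b+uB$. The *diagonal* $\mathfrak D(X\otimes Y)$ of two cocyclic modules is the cocyclic module $X^n\otimes Y^n$ with the structure maps $\partial_i\otimes\partial_i$,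 $\sigma_j\otimes\sigma_j$, $\tau_n\otimes\tau_n$; $\mathrm{Tot}(X\otimes Y)$ is the mixed complex with $\bigoplus_{p+q=n}X^p\otimes Y^q$ in degree $n$ and differentials $(-1)^q\,b\otimes1+1\otimes b$ and $(-1)^qB\otimes1+1\otimes B$ on $X^p\otimes Y^q$. A *cyclic Alexander–Whitney map* $AW$ is a $\mathbb C[u]$-linear chain map from the total complex of $\mathrm{Tot}(X\otimes Y)$ to that of $\mathfrak D(X\otimes Y)$, natural in the cocyclic modules $X$ and $Y$, whose $u^0$-coefficient is the Alexander–Whitney map $x\otimes y\mapsto\partial_0^{\,q}x\otimes\partial_{p+q}\cdots\partial_{q+1}y$ for $x\in X^p$, $y\in Y^q$. Let $\mathcal H$ be a Hopf algebra with bijective antipode $S$, and let $M$ be a right-left SAYD module: a right module and left comodule with $m_{(0)}m_{(-1)}=m$ and $(mh)_{(-1)}\otimes(mh)_{(0)}=S(h_{(3)})m_{(-1)}h_{(1)}\otimes m_{(0)}h_{(2)}$. Let $A$ be a (unital) left $\mathcal H$-module algebra and $C$ a left $\mathcal H$-module coalgebra. * $C^n_{\mathcal H}(C,M)=M\otimes_{\mathcal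 H}C^{\otimes n+1}$, where $\partial_i$ $(i\le n)$ applies $\Delta$ to $c^i$, $\partial_{n+1}(m\otimes c^0\otimes\cdots\otimes c^n)=m_{(0)}\otimes c^0_{(2)}\otimes c^1\otimes\cdots\otimes c^n\otimes m_{(-1)}c^0_{(1)}$, $\sigma_j$ applies $\varepsilon$ to $c^{j+1}$, and $\tau(m\otimes c^0\otimes\cdots\otimes c^n)=m_{(0)}\otimes c^1\otimes\cdots\otimes c^n\otimes m_{(-1)}c^0$. * $C^n_{\mathcal H}(A,M)=\mathrm{Hom}_{\mathcal H}(M\otimes A^{\otimes n+1},\mathbb C)$ is the space of linear forms $\varphi$ with $\varphi(mh_{(1)}\otimes S(h_{(2)})\tilde a)=\varepsilon(h)\varphi(m\otimes\tilde a)$; here $\partial_i$ $(i\le n)$ multiplies $a^i$ and $a^{i+1}$, $(\partial_{n+1}\varphi)(m\otimes a^0\otimes\cdots\otimes a^{n+1})=\varphi(m_{(0)}\otimes(S^{-1}(m_{(-1)})a^{n+1})a^0\otimes a^1\otimes\cdots\otimes a^n)$, $\sigma_j$ inserts $1$ behind $a^j$, and $(\tau\varphi)(m\otimes a^0\otimes\cdots\otimes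 a^n)=\varphi(m_{(0)}\otimes S^{-1}(m_{(-1)})a^n\otimes a^0\otimes\cdots\otimes a^{n-1})$. * $C^n(B)=\mathrm{Hom}(B^{\otimes n+1},\mathbb C)$ is the ordinary cocyclic module of a unital algebra $B$. $HC^n_{\mathcal H}(C,M)$, $HC^n_{\mathcal H}(A,M)$ and $HC^n(B)$ denote the cyclic cohomologies. **Theorem.** Cyclic Alexander–Whitney maps exist, and for $\mathcal H$ and $A$ as above the following holds. 1. Let $C$ act on $A$ by a linear map $C\otimes A\to A$ with $(hc)a=h(ca)$, $c(ab)=(c_{(1)}a)(c_{(2)}b)$, $c(1)=\varepsilon(c)1$. Let $\mathrm{Hom}_{\mathcal H}(C,A)$ be the convolution algebra of $\mathcal H$-linear maps $C\to A$ and $\natural:A\to\mathrm{Hom}_{\mathcal H}(C,A)$, $\natural(a)(c)=ca$. Then $C^*_{\mathcal H}(A,M)$, $C^*_{\mathcal H}(C,M)$, $C^*(\mathrm{Hom}_{\mathcal H}(C,A))$ and $C^*(A)$ are cocyclic modules, and $$\Psi_c(\varphi\otimes m\otimes c^0\otimes\cdots\otimes c^n)(f^0\otimes\cdots\otimes f^n)=\varphi(m\otimes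 f^0(c^0)\otimes\cdots\otimes f^n(c^n)),$$ $$\Psi(\varphi\otimes m\otimes c^0\otimes\cdots\otimes c^n)(a^0\otimes\cdots\otimes a^n)=\varphi(m\otimes c^0a^0\otimes\cdots\otimes c^na^n)$$ are well defined maps of cocyclic modules from $\mathfrak D(C^*_{\mathcal H}(A,M)\otimes C^*_{\mathcal H}(C,M))$ to $C^*(\mathrm{Hom}_{\mathcal H}(C,A))$ and to $C^*(A)$, with $\Psi=\natural^*\circ\Psi_c$. Hence they induce maps from $HC^n$ of the diagonal to $HC^n(\mathrm{Hom}_{\mathcal H}(C,A))$ and $HC^n(A)$. Composing the exterior product, a cyclic Alexander–Whitney map, and these maps gives cup products $$HC^p_{\mathcal H}(A,M)\otimes HC^q_{\mathcal H}(C,M)\to HC^{p+q}(A),\qquad HC^p_{\mathcal H}(A,M)\otimes HC^q_{\mathcal H}(C,M)\to HC^{p+q}(\mathrm{Hom}_{\mathcal H}(C,A)),$$ which do not depend on the choice of the cyclic Alexander–Whitney map. 2. Let $\mathcal K\subseteq\mathcal H$ be a sub-Hopf algebra, $\mathcal C=\mathcal H\otimes_{\mathcal K}\mathbb C$, $C^*_{\mathcal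 H}(\mathcal H,\mathcal K;M)=C^*_{\mathcal H}(\mathcal C,M)$, with cyclic cohomology $HC^*_{\mathcal H}(\mathcal H,\mathcal K;M)$, and $A^{\mathcal K}=\{a\in A: ka=\varepsilon(k)a\ \text{for all}\ k\in\mathcal K\}$. Then $C^*_{\mathcal H}(A,M)$, $C^*_{\mathcal H}(\mathcal H,\mathcal K;M)$ and $C^*(A^{\mathcal K})$ are cocyclic modules, and $$\Psi_r(\varphi\otimes m\otimes \bar h^0\otimes\cdots\otimes\bar h^n)(a^0\otimes\cdots\otimes a^n)=\varphi(m\otimes h^0a^0\otimes\cdots\otimes h^na^n),$$ where $\bar h$ is the class of $h\in\mathcal H$ in $\mathcal C$, is a well defined map of cocyclic modules from $\mathfrak D(C^*_{\mathcal H}(A,M)\otimes C^*_{\mathcal H}(\mathcal H,\mathcal K;M))$ to $C^*(A^{\mathcal K})$. It induces a map from $HC^n$ of the diagonal to $HC^n(A^{\mathcal K})$ and a cup product $HC^p_{\mathcal H}(A,M)\otimes HC^q_{\mathcal H}(\mathcal H,\mathcal K;M)\to HC^{p+q}(A^{\mathcal K})$, which does not depend on the choice of the cyclic Alexander–Whitney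 map. 3. The cup product generalizes the characteristic map of Connes and Moscovici. Let $(\delta,\sigma)$ be a modular pair in involution: a character $\delta$ of $\mathcal H$ and a group-like $\sigma\in\mathcal H$ with $\delta(\sigma)=1$ and $\tilde S_\delta^2(h)=\sigma h\sigma^{-1}$, where $\tilde S_\delta(h)=\delta(h_{(1)})S(h_{(2)})$. Let ${}^\sigma\mathbb C_\delta$ be the SAYD module $\mathbb C$ with action $zh=\delta(h)z$ and coaction $z\mapsto\sigma\otimes z$, and let $\mathcal H^\natural_{(\delta,\sigma)}$ have $\mathcal H^{\otimes n}$ in degree $n$, with $\partial_0x=1\otimes x$, $\partial_i=\Delta$ at the $i$-th factor $(1\le i\le n)$, $\partial_{n+1}x=x\otimes\sigma$, $\sigma_j=\varepsilon$ at the $(j+1)$-st factor, $\tau_n(h^1\otimes\cdots\otimes h^n)=\tilde S_\delta(h^1)\cdot(h^2\otimes\cdots\otimes h^n\otimes\sigma)$ (diagonal action) and $\tau_0=\mathrm{id}$. This is a cocyclic module, and $$\mathcal I(z\otimes h^0\otimes\cdots\otimes h^n)=z\,\tilde S_\delta(h^0)\cdot(h^1\otimes\cdots\otimes h^n)$$ is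 an isomorphism of cocyclic modules $C^*_{\mathcal H}(\mathcal H,{}^\sigma\mathbb C_\delta)\to\mathcal H^\natural_{(\delta,\sigma)}$. Let $\mathrm{tr}:A\to\mathbb C$ be a $\delta$-invariant $\sigma$-trace, i.e. linear with $\mathrm{tr}(ha)=\delta(h)\mathrm{tr}(a)$ and $\mathrm{tr}(ab)=\mathrm{tr}(b\,\sigma(a))$. Then $$\chi(h^1\otimes\cdots\otimes h^n)(a^0\otimes\cdots\otimes a^n)=\mathrm{tr}(a^0\,h^1(a^1)\cdots h^n(a^n))$$ is a map of cocyclic modules $\mathcal H^\natural_{(\delta,\sigma)}\to C^*(A)$; the form $\varphi(z\otimes a)=z\,\mathrm{tr}(a)$ is a cyclic cocycle in $C^0_{\mathcal H}(A,{}^\sigma\mathbb C_\delta)$; and for the action of $C=\mathcal H$ on $A$ and every $x\in HC^n_{\mathcal H}(\mathcal H,{}^\sigma\mathbb C_\delta)$, $$[\varphi]\cup x=\chi(\mathcal I(x))\in HC^n(A).$$ -/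

import Mathlib

open scoped TensorProduct
open Coalgebra HopfAlgebra

universe u v w w'

noncomputable section
namespace HopfCyclic

/-! ### Tensor powers -/
section TensorPowers

variable (V : Type u) [AddCommGroup V] [Module ℂ V]

/-- The tensor power `V ⊗ ⋯ ⊗ V` with `n` factors. -/
abbrev TP (n : ℕ) : Type u := ⨂[ℂ]^n V

/-- `v ⊗ (v₁ ⊗ ⋯ ⊗ vₙ) ↦ v ⊗ v₁ ⊗ ⋯ ⊗ vₙ`. -/
def consE (n : ℕ) : V ⊗[ℂ] TP V n ≃ₗ[ℂ] TP V (n + 1) :=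
  (TensorProduct.congr (PiTensorProduct.subsingletonEquiv (R := ℂ) (s := fun _ => V)
    (0 : Fin 1)).symm (LinearEquiv.refl ℂ _)).trans
  ((PiTensorProduct.tmulEquiv ℂ V).trans
    (PiTensorProduct.reindex ℂ (fun _ => V) (finSumFinEquiv.trans (finCongr (Nat.add_comm 1 n)))))

/-- `(v₁ ⊗ ⋯ ⊗ vₙ) ⊗ v ↦ v₁ ⊗ ⋯ ⊗ vₙ ⊗ v`. -/
def snocE (n : ℕ) : TP V n ⊗[ℂ] V ≃ₗ[ℂ] TP V (n + 1) :=
  (TensorProduct.congr (LinearEquiv.refl ℂ _) (PiTensorProduct.subsingletonEquiv (R := ℂ)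
    (s := fun _ => V) (0 : Fin 1)).symm).trans
  ((PiTensorProduct.tmulEquiv ℂ V).trans
    (PiTensorProduct.reindex ℂ (fun _ => V) finSumFinEquiv))

/-- The isomorphism of the zeroth tensor power with the ground field. -/
def nilE : TP V 0 ≃ₗ[ℂ] ℂ := PiTensorProduct.isEmptyEquiv (Fin 0)

variable {V}

lemma consE_tprod {n : ℕ} (v : V) (x : Fin n → V) :
    consE V n (v ⊗ₜ PiTensorProduct.tprod ℂ x) =
      PiTensorProduct.tprod ℂ (Fin.cons v x : Fin (n + 1) → V) := by
  simp only [consE, LinearEquiv.trans_apply, TensorProduct.congr_tmul,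
    PiTensorProduct.subsingletonEquiv_symm_apply, LinearEquiv.refl_apply,
    PiTensorProduct.tmulEquiv_apply]
  rw [PiTensorProduct.reindex_tprod]
  congr 1
  ext i
  refine Fin.cases ?_ (fun j => ?_) i
  · have : (finSumFinEquiv.trans (finCongr (Nat.add_comm 1 n))).symm (0 : Fin (n + 1)) =
        Sum.inl (0 : Fin 1) := by
      rw [Equiv.symm_apply_eq]; ext; simp
    rw [this]; simp
  · have : (finSumFinEquiv.trans (finCongr (Nat.add_comm 1 n))).symm (j.succ : Fin (n + 1)) =
        Sum.inr j := by
      rw [Equiv.symm_apply_eq]; ext; simp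
    rw [this]; simp

lemma snocE_tprod {n : ℕ} (x : Fin n → V) (v : V) :
    snocE V n (PiTensorProduct.tprod ℂ x ⊗ₜ v) =
      PiTensorProduct.tprod ℂ (Fin.snoc x v : Fin (n + 1) → V) := by
  simp only [snocE, LinearEquiv.trans_apply, TensorProduct.congr_tmul,
    PiTensorProduct.subsingletonEquiv_symm_apply, LinearEquiv.refl_apply,
    PiTensorProduct.tmulEquiv_apply]
  rw [PiTensorProduct.reindex_tprod]
  congr 1
  ext i
  refine Fin.lastCases ?_ (fun j => ?_) i
  · have : (finSumFinEquiv : Fin n ⊕ Fin 1 ≃ Fin (n + 1)).symm (Fin.last n) =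
        Sum.inr (0 : Fin 1) := by
      rw [Equiv.symm_apply_eq]; ext; simp
    rw [this]; simp
  · have : (finSumFinEquiv : Fin n ⊕ Fin 1 ≃ Fin (n + 1)).symm j.castSucc =
        Sum.inl j := by
      rw [Equiv.symm_apply_eq]; ext; simp
    rw [this]; simp

/-- Left concatenation with a vector. -/
def cons {n : ℕ} (v : V) (x : TP V n) : TP V (n + 1) := consE V n (v ⊗ₜ x)

/-- Right concatenation with a vector. -/
def snoc {n : ℕ} (x : TP V n) (v : V) : TP V (n + 1) := snocE V n (x ⊗ₜ v)

lemma cons_add {n : ℕ} (v : V) (x y : TP V n) : cons v (x + y) = cons v x + cons v y := by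
  simp [cons, TensorProduct.tmul_add]

lemma add_cons {n : ℕ} (v w : V) (x : TP V n) : cons (v + w) x = cons v x + cons w x := by
  simp [cons, TensorProduct.add_tmul]

lemma cons_smul {n : ℕ} (r : ℂ) (v : V) (x : TP V n) : cons v (r • x) = r • cons v x := by
  rw [cons, TensorProduct.tmul_smul, map_smul]; rfl

lemma smul_cons {n : ℕ} (r : ℂ) (v : V) (x : TP V n) : cons (r • v) x = r • cons v x := by
  rw [cons, ← TensorProduct.smul_tmul', map_smul]; rfl

lemma snoc_add {n : ℕ} (x : TP V n) (v w : V) : snoc x (v + w) = snoc x v + snoc x w := by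
  simp [snoc, TensorProduct.tmul_add]

lemma add_snoc {n : ℕ} (x y : TP V n) (v : V) : snoc (x + y) v = snoc x v + snoc y v := by
  simp [snoc, TensorProduct.add_tmul]

lemma snoc_smul {n : ℕ} (r : ℂ) (x : TP V n) (v : V) : snoc x (r • v) = r • snoc x v := by
  rw [snoc, TensorProduct.tmul_smul, map_smul]; rfl

lemma smul_snoc {n : ℕ} (r : ℂ) (x : TP V n) (v : V) : snoc (r • x) v = r • snoc x v := by
  rw [snoc, ← TensorProduct.smul_tmul', map_smul]; rfl

lemma cons_tprod {n : ℕ} (v : V) (x : Fin n → V) :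
    cons v (PiTensorProduct.tprod ℂ x) =
      PiTensorProduct.tprod ℂ (Fin.cons v x : Fin (n + 1) → V) := consE_tprod v x

lemma snoc_tprod {n : ℕ} (x : Fin n → V) (v : V) :
    snoc (PiTensorProduct.tprod ℂ x) v =
      PiTensorProduct.tprod ℂ (Fin.snoc x v : Fin (n + 1) → V) := snocE_tprod x v

lemma snoc_cons {n : ℕ} (a : V) (x : TP V n) (b : V) :
    snoc (cons a x) b = cons a (snoc x b) := by
  induction x using PiTensorProduct.induction_on with
  | smul_tprod r x =>
    simp only [cons_smul, smul_snoc, cons_tprod, snoc_tprod]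
    rw [Fin.cons_snoc_eq_snoc_cons]
  | add x y hx hy => simp only [cons_add, add_snoc, hx, hy]

lemma snoc_nil (x : TP V 0) (b : V) : snoc x b = cons b x := by
  induction x using PiTensorProduct.induction_on with
  | smul_tprod r x =>
    simp only [cons_smul, smul_snoc, cons_tprod, snoc_tprod]
    congr 2
    funext i; fin_cases i; simp [Fin.snoc]
  | add x y hx hy => simp only [cons_add, add_snoc, hx, hy]

@[elab_as_elim]
lemma TP.cons_induction {n : ℕ} {P : TP V (n + 1) → Prop} (x : TP V (n + 1))
    (h : ∀ v y, P (cons v y)) (hadd : ∀ x y, P x → P y → P (x + y)) : P x := by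
  obtain ⟨z, rfl⟩ := (consE V n).surjective x
  induction z with
  | zero => simpa [cons] using h 0 0
  | tmul v y => exact h v y
  | add a b ha hb => rw [map_add]; exact hadd _ _ ha hb

@[elab_as_elim]
lemma TP.snoc_induction {n : ℕ} {P : TP V (n + 1) → Prop} (x : TP V (n + 1))
    (h : ∀ y v, P (snoc y v)) (hadd : ∀ x y, P x → P y → P (x + y)) : P x := by
  obtain ⟨z, rfl⟩ := (snocE V n).surjective x
  induction z with
  | zero => simpa [snoc] using h 0 0
  | tmul v y => exact h v y
  | add a b ha hb => rw [map_add]; exact hadd _ _ ha hb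

end TensorPowers

/-! ### Elementary operations on tensor powers -/
section Elementary

section Shift
variable {V : Type u} [AddCommGroup V] [Module ℂ V]

/-- `id ⊗ f`. -/
def shift {n m : ℕ} (f : TP V n →ₗ[ℂ] TP V m) : TP V (n + 1) →ₗ[ℂ] TP V (m + 1) :=
  (consE V m).toLinearMap ∘ₗ f.lTensor V ∘ₗ (consE V n).symm.toLinearMap

lemma shift_cons {n m : ℕ} (f : TP V n →ₗ[ℂ] TP V m) (v : V) (x : TP V n) :
    shift f (cons v x) = cons v (f x) := by
  simp [shift, cons]

/-- `v ⊗ w ↦ v ⊗ w ⊗ x`. -/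
def cons₂ {n : ℕ} (x : TP V n) : V ⊗[ℂ] V →ₗ[ℂ] TP V (n + 2) :=
  (consE V (n + 1)).toLinearMap ∘ₗ (consE V n).toLinearMap.lTensor V ∘ₗ
    (TensorProduct.assoc ℂ V V (TP V n)).toLinearMap ∘ₗ (TensorProduct.mk ℂ _ _).flip x

lemma cons₂_tmul {n : ℕ} (x : TP V n) (v w : V) : cons₂ x (v ⊗ₜ w) = cons v (cons w x) := by
  simp [cons₂, cons]

/-- `w ↦ cons w x` -/
def consL {n : ℕ} (x : TP V n) : V →ₗ[ℂ] TP V (n + 1) where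
  toFun v := cons v x
  map_add' := fun _ _ => add_cons _ _ _
  map_smul' := fun _ _ => smul_cons _ _ _

end Shift

section Coalg
variable {C : Type u} [AddCommGroup C] [Module ℂ C] [Coalgebra ℂ C]

/-- Comultiplication in position `i`:
`c₀ ⊗ ⋯ ⊗ cₙ ↦ c₀ ⊗ ⋯ ⊗ Δ(cᵢ) ⊗ ⋯ ⊗ cₙ` for `i ≤ n`. -/
def comulAt : (n i : ℕ) → TP C (n + 1) →ₗ[ℂ] TP C (n + 2)
  | n, 0 => (consE C (n + 1)).toLinearMap ∘ₗ (consE C n).toLinearMap.lTensor C ∘ₗ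
      (TensorProduct.assoc ℂ C C (TP C n)).toLinearMap ∘ₗ
      (comul (R := ℂ) (A := C)).rTensor (TP C n) ∘ₗ (consE C n).symm.toLinearMap
  | 0, _ + 1 => 0
  | n + 1, i + 1 => shift (comulAt n i)

/-- Counit in position `i`:
`c₀ ⊗ ⋯ ⊗ cₙ ↦ c₀ ⊗ ⋯ ⊗ ε(cᵢ) ⊗ ⋯ ⊗ cₙ` for `i ≤ n`. -/
def counitAt : (n i : ℕ) → TP C (n + 1) →ₗ[ℂ] TP C n
  | n, 0 => (TensorProduct.lid ℂ (TP C n)).toLinearMap ∘ₗ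
      (counit (R := ℂ) (A := C)).rTensor (TP C n) ∘ₗ (consE C n).symm.toLinearMap
  | 0, _ + 1 => 0
  | n + 1, i + 1 => shift (counitAt n i)

lemma comulAt_zero_cons (n : ℕ) (c : C) (x : TP C n) :
    comulAt n 0 (cons c x) = cons₂ x (comul c) := by
  simp [comulAt, cons₂, cons]

lemma comulAt_succ_cons (n i : ℕ) (c : C) (x : TP C (n + 1)) :
    comulAt (n + 1) (i + 1) (cons c x) = cons c (comulAt n i x) := by
  rw [comulAt, shift_cons]

lemma counitAt_zero_cons (n : ℕ) (c : C) (x : TP C n) :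
    counitAt n 0 (cons c x) = counit (R := ℂ) c • x := by
  simp [counitAt, cons]

lemma counitAt_succ_cons (n i : ℕ) (c : C) (x : TP C (n + 1)) :
    counitAt (n + 1) (i + 1) (cons c x) = cons c (counitAt n i x) := by
  rw [counitAt, shift_cons]

end Coalg

section Alg
variable {A : Type u} [Ring A] [Algebra ℂ A]

/-- Multiplication of neighbours:
`a₀ ⊗ ⋯ ⊗ aₙ₊₁ ↦ a₀ ⊗ ⋯ ⊗ aᵢ aᵢ₊₁ ⊗ ⋯ ⊗ aₙ₊₁` for `i ≤ n`. -/
def mulAt : (n i : ℕ) → TP A (n + 2) →ₗ[ℂ] TP A (n + 1)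
  | n, 0 => (consE A n).toLinearMap ∘ₗ (LinearMap.mul' ℂ A).rTensor (TP A n) ∘ₗ
      (TensorProduct.assoc ℂ A A (TP A n)).symm.toLinearMap ∘ₗ
      (consE A n).symm.toLinearMap.lTensor A ∘ₗ (consE A (n + 1)).symm.toLinearMap
  | 0, _ + 1 => 0
  | n + 1, i + 1 => shift (mulAt n i)

/-- Insertion of the unit in front of position `i`:
`a₀ ⊗ ⋯ ⊗ aₙ₋₁ ↦ a₀ ⊗ ⋯ ⊗ aᵢ₋₁ ⊗ 1 ⊗ aᵢ ⊗ ⋯ ⊗ aₙ₋₁` for `i ≤ n`. -/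
def oneAt : (n i : ℕ) → TP A n →ₗ[ℂ] TP A (n + 1)
  | n, 0 => (consE A n).toLinearMap ∘ₗ TensorProduct.mk ℂ A (TP A n) 1
  | 0, _ + 1 => 0
  | n + 1, i + 1 => shift (oneAt n i)

lemma mulAt_zero_cons (n : ℕ) (a b : A) (x : TP A n) :
    mulAt n 0 (cons a (cons b x)) = cons (a * b) x := by
  simp [mulAt, cons]

lemma mulAt_succ_cons (n i : ℕ) (a : A) (x : TP A (n + 2)) :
    mulAt (n + 1) (i + 1) (cons a x) = cons a (mulAt n i x) := by
  rw [mulAt, shift_cons]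

lemma oneAt_zero (n : ℕ) (x : TP A n) : oneAt n 0 x = cons 1 x := by
  simp [oneAt, cons]

lemma oneAt_succ_cons (n i : ℕ) (a : A) (x : TP A n) :
    oneAt (n + 1) (i + 1) (cons a x) = cons a (oneAt n i x) := by
  rw [oneAt, shift_cons]

lemma TP.cons_cons_induction {V : Type u} [AddCommGroup V] [Module ℂ V] {n : ℕ}
    {P : TP V (n + 2) → Prop} (x : TP V (n + 2))
    (h : ∀ v w y, P (cons v (cons w y))) (hadd : ∀ x y, P x → P y → P (x + y)) : P x := by
  induction x using TP.cons_induction with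
  | hadd x y hx hy => exact hadd _ _ hx hy
  | h v y =>
    induction y using TP.cons_induction with
    | hadd x y hx hy => rw [cons_add]; exact hadd _ _ hx hy
    | h w y => exact h v w y

end Alg
end Elementary

/-! ### Module algebras, module coalgebras and coefficients -/
section Actions

variable (H : Type u) [Ring H] [HopfAlgebra ℂ H]

/-- The antipode of `H` is invertible. -/
class BijectiveAntipode : Prop where
  bijective : Function.Bijective (antipode ℂ : H →ₗ[ℂ] H)

/-- The inverse `S⁻¹` of the antipode. -/
def antipodeInv [BijectiveAntipode H] : H →ₗ[ℂ] H :=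
  (LinearEquiv.ofBijective (antipode ℂ : H →ₗ[ℂ] H) BijectiveAntipode.bijective).symm.toLinearMap

section LeftAction
variable (V : Type u) [AddCommGroup V] [Module ℂ V] [Module H V] [IsScalarTower ℂ H V]

/-- The left action, `h ↦ (v ↦ h v)`. -/
def lAct : H →ₐ[ℂ] Module.End ℂ V := Algebra.lsmul ℂ ℂ V

/-- The diagonal action of `H` on the tensor powers of a left `H`-module,
`h (v₁ ⊗ ⋯ ⊗ vₙ) = h₍₁₎ v₁ ⊗ ⋯ ⊗ h₍ₙ₎ vₙ`. -/
def diagAct : (n : ℕ) → H →ₐ[ℂ] Module.End ℂ (TP V n)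
  | 0 => (Algebra.ofId ℂ _).comp (Bialgebra.counitAlgHom ℂ H)
  | n + 1 => (((consE V n).conjAlgEquiv ℂ).toAlgHom.comp
      (Module.endTensorEndAlgHom (R := ℂ) (S := ℂ) (A := ℂ))).comp
      ((Algebra.TensorProduct.map (lAct H V) (diagAct n)).comp (Bialgebra.comulAlgHom ℂ H))

end LeftAction

/-- A left `H`-module algebra: `h (a b) = (h₍₁₎ a) (h₍₂₎ b)` and `h 1 = ε(h) 1`. -/
class ModuleAlgebra (A : Type u) [Ring A] [Algebra ℂ A] [Module H A] [IsScalarTower ℂ H A] :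
    Prop where
  smul_mul : ∀ (h : H) (a b : A), h • (a * b) =
    LinearMap.mul' ℂ A
      (TensorProduct.map₂ (lAct H A).toLinearMap (lAct H A).toLinearMap (comul h) (a ⊗ₜ b))
  smul_one : ∀ h : H, h • (1 : A) = counit (R := ℂ) h • (1 : A)

/-- A left `H`-module coalgebra: `Δ(h c) = h₍₁₎ c₍₁₎ ⊗ h₍₂₎ c₍₂₎` and `ε(h c) = ε(h) ε(c)`. -/
class ModuleCoalgebra (C : Type u) [AddCommGroup C] [Module ℂ C] [Coalgebra ℂ C] [Module H C]
    [IsScalarTower ℂ H C] : Prop where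
  comul_smul : ∀ (h : H) (c : C), comul (R := ℂ) (h • c) =
    TensorProduct.map₂ (lAct H C).toLinearMap (lAct H C).toLinearMap (comul h) (comul c)
  counit_smul : ∀ (h : H) (c : C),
    counit (R := ℂ) (h • c) = counit (R := ℂ) h * counit (R := ℂ) c

section RightAction
variable (M : Type v) [AddCommGroup M] [Module ℂ M] [Module Hᵐᵒᵖ M] [IsScalarTower ℂ Hᵐᵒᵖ M]

/-- The right action of `H` on a right `H`-module, `h ↦ (m ↦ m h)`. -/
def rAct : H →ₗ[ℂ] Module.End ℂ M :=
  (Algebra.lsmul ℂ ℂ M : Hᵐᵒᵖ →ₐ[ℂ] Module.End ℂ M).toLinearMap ∘ₗ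
    (MulOpposite.opLinearEquiv ℂ).toLinearMap

/-- `h₁ ⊗ h₃ ↦ (g ↦ S(h₃) g h₁)`. -/
def sandwich : H ⊗[ℂ] H →ₗ[ℂ] Module.End ℂ H :=
  TensorProduct.lift (((LinearMap.mul ℂ (Module.End ℂ H)).flip ∘ₗ (LinearMap.mul ℂ H).flip).compl₂
    (LinearMap.mul ℂ H ∘ₗ antipode ℂ))

/-- `h₁ ⊗ h₂ ⊗ h₃ ↦ (g ⊗ m ↦ S(h₃) g h₁ ⊗ m h₂)`. -/
def antiYDMap : H ⊗[ℂ] (H ⊗[ℂ] H) →ₗ[ℂ] Module.End ℂ (H ⊗[ℂ] M) :=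
  TensorProduct.homTensorHomMap (RingHom.id ℂ) H M H M ∘ₗ
    (TensorProduct.comm ℂ _ _).toLinearMap ∘ₗ
    TensorProduct.map (rAct H M) (sandwich H) ∘ₗ
    (TensorProduct.leftComm ℂ H H H).toLinearMap

/-- A right-left stable anti-Yetter-Drinfeld module over `H`: a right `H`-module `M` with a left
coaction `m ↦ m₍₋₁₎ ⊗ m₍₀₎` such that `m₍₀₎ m₍₋₁₎ = m` and
`(m h)₍₋₁₎ ⊗ (m h)₍₀₎ = S(h₍₃₎) m₍₋₁₎ h₍₁₎ ⊗ m₍₀₎ h₍₂₎`. -/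
class SAYD where
  /-- The coaction. -/
  coact : M →ₗ[ℂ] H ⊗[ℂ] M
  coassoc : ∀ m, TensorProduct.assoc ℂ H H M ((comul (R := ℂ)).rTensor M (coact m)) =
    coact.lTensor H (coact m)
  counit_coact : ∀ m, TensorProduct.lid ℂ M ((counit (R := ℂ)).rTensor M (coact m)) = m
  stable : ∀ m, TensorProduct.lift (rAct H M) (coact m) = m
  antiYD : ∀ (m : M) (h : H), coact (rAct H M h m) =
    antiYDMap H M ((comul (R := ℂ)).lTensor H (comul h)) (coact m)

end RightAction

lemma antipodeInv_antipode [BijectiveAntipode H] (h : H) :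
    antipodeInv H (antipode ℂ h) = h :=
  (LinearEquiv.ofBijective (antipode ℂ : H →ₗ[ℂ] H) BijectiveAntipode.bijective).symm_apply_apply h

lemma antipode_antipodeInv [BijectiveAntipode H] (h : H) :
    antipode ℂ (antipodeInv H h) = h :=
  (LinearEquiv.ofBijective (antipode ℂ : H →ₗ[ℂ] H) BijectiveAntipode.bijective).apply_symm_apply h

end Actions

section ActionLemmas
variable {H : Type u} [Ring H] [HopfAlgebra ℂ H]

section
variable {V : Type u} [AddCommGroup V] [Module ℂ V] [Module H V] [IsScalarTower ℂ H V]

@[simp] lemma lAct_apply (h : H) (v : V) : lAct H V h v = h • v := rfl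

/-- `h ⊗ g ↦ (h v) ⊗ (g x)`. -/
def consAct {n : ℕ} (v : V) (x : TP V n) : H ⊗[ℂ] H →ₗ[ℂ] TP V (n + 1) :=
  (consE V n).toLinearMap ∘ₗ TensorProduct.map ((lAct H V).toLinearMap.flip v)
    ((diagAct H V n).toLinearMap.flip x)

lemma consAct_tmul {n : ℕ} (v : V) (x : TP V n) (h g : H) :
    consAct v x (h ⊗ₜ g) = cons (h • v) (diagAct H V n g x) := rfl

/-- `h ⊗ g ↦ (h x) ⊗ (g v)`. -/
def snocAct {n : ℕ} (x : TP V n) (v : V) : H ⊗[ℂ] H →ₗ[ℂ] TP V (n + 1) :=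
  (snocE V n).toLinearMap ∘ₗ TensorProduct.map ((diagAct H V n).toLinearMap.flip x)
    ((lAct H V).toLinearMap.flip v)

lemma snocAct_tmul {n : ℕ} (x : TP V n) (v : V) (h g : H) :
    snocAct x v (h ⊗ₜ g) = snoc (diagAct H V n h x) (g • v) := rfl

lemma diagAct_zero (h : H) (x : TP V 0) : diagAct H V 0 h x = counit (R := ℂ) h • x := by
  simp [diagAct, Algebra.ofId_apply, Algebra.algebraMap_eq_smul_one]

lemma diagAct_cons {n : ℕ} (h : H) (v : V) (x : TP V n) :
    diagAct H V (n + 1) h (cons v x) = consAct v x (comul h) := by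
  have : ∀ t : H ⊗[ℂ] H, ((consE V n).conjAlgEquiv ℂ) (Module.endTensorEndAlgHom (R := ℂ) (S := ℂ)
      (A := ℂ) (Algebra.TensorProduct.map (lAct H V) (diagAct H V n) t)) (cons v x) =
      consAct v x t := by
    intro t
    induction t with
    | zero => simp
    | add s t hs ht => simp only [map_add, LinearMap.add_apply, hs, ht]
    | tmul s t =>
      rw [Algebra.TensorProduct.map_tmul, Module.endTensorEndAlgHom_apply, consAct_tmul]
      simp [cons, LinearEquiv.conjAlgEquiv]
  exact this (comul h)

lemma consAct_comul_add {n : ℕ} (v : V) (x y : TP V n) (t : H ⊗[ℂ] H) :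
    consAct v (x + y) t = consAct v x t + consAct v y t := by
  induction t with
  | zero => simp
  | add s t hs ht => simp only [map_add, hs, ht]; abel
  | tmul s t => simp [consAct_tmul, cons_add]

lemma snocAct_comul_add {n : ℕ} (v : V) (x y : TP V n) (t : H ⊗[ℂ] H) :
    snocAct (x + y) v t = snocAct x v t + snocAct y v t := by
  induction t with
  | zero => simp
  | add s t hs ht => simp only [map_add, hs, ht]; abel
  | tmul s t => simp [snocAct_tmul, add_snoc]

lemma diagAct_snoc {n : ℕ} (h : H) (x : TP V n) (v : V) :
    diagAct H V (n + 1) h (snoc x v) = snocAct x v (comul h) := by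
  induction n generalizing h with
  | zero =>
    rw [snoc_nil, diagAct_cons]
    have e1 : consAct v x = (consL x ∘ₗ (lAct H V).toLinearMap.flip v) ∘ₗ
        (TensorProduct.rid ℂ H).toLinearMap ∘ₗ (counit (R := ℂ) (A := H)).lTensor H := by
      ext a b
      simp [consAct_tmul, diagAct_zero, consL, cons_smul, smul_cons]
    have e2 : snocAct x v = (consL x ∘ₗ (lAct H V).toLinearMap.flip v) ∘ₗ
        (TensorProduct.lid ℂ H).toLinearMap ∘ₗ (counit (R := ℂ) (A := H)).rTensor H := by
      ext a b
      simp [snocAct_tmul, diagAct_zero, consL, snoc_nil, cons_smul, smul_cons]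
    rw [e1, e2]
    simp
  | succ n ih =>
    induction x using TP.cons_induction with
    | hadd x y hx hy => simp only [map_add, add_snoc, snocAct_comul_add, hx, hy]
    | h w y =>
      rw [snoc_cons, diagAct_cons]
      have e1 : consAct w (snoc y v) = (consE V (n + 1)).toLinearMap ∘ₗ
          TensorProduct.map ((lAct H V).toLinearMap.flip w) (snocAct y v) ∘ₗ
            (comul (R := ℂ) (A := H)).lTensor H := by
        ext a b
        simp [consAct_tmul, ih, cons]
      have e2 : snocAct (cons w y) v = (consE V (n + 1)).toLinearMap ∘ₗ
          TensorProduct.map ((lAct H V).toLinearMap.flip w) (snocAct y v) ∘ₗ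
          (TensorProduct.assoc ℂ H H H).toLinearMap ∘ₗ (comul (R := ℂ) (A := H)).rTensor H := by
        ext a b
        simp only [TensorProduct.AlgebraTensorModule.curry_apply, LinearMap.restrictScalars_self,
          TensorProduct.curry_apply, snocAct_tmul, diagAct_cons, LinearMap.comp_apply,
          LinearMap.rTensor_tmul]
        generalize comul (R := ℂ) a = t
        induction t with
        | zero => simp [snoc]
        | add s t hs ht => simp only [map_add, hs, ht, TensorProduct.add_tmul, add_snoc]
        | tmul s t =>
          simp only [consAct_tmul, snoc_cons, TensorProduct.assoc_tmul, TensorProduct.map_tmul,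
            snocAct_tmul]
          rfl
      rw [e1, e2]
      simp only [LinearMap.comp_apply]
      congr 2
      exact (Coalgebra.coassoc_apply h).symm

end

section Antipode

lemma sum_lTensor_antipode (b : H) {ι : Type*} (s : Finset ι) (l r : ι → H)
    (hb : comul (R := ℂ) b = ∑ i ∈ s, l i ⊗ₜ r i) :
    ∑ i ∈ s, (LinearMap.mulRight ℂ (antipode ℂ (r i))).lTensor H (comul (l i)) =
      b ⊗ₜ[ℂ] (1 : H) := by
  let Φ : H ⊗[ℂ] (H ⊗[ℂ] H) →ₗ[ℂ] H ⊗[ℂ] H :=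
    (LinearMap.mul' ℂ H ∘ₗ (antipode ℂ (A := H)).lTensor H).lTensor H
  have h1 : Φ (TensorProduct.assoc ℂ H H H ((comul (R := ℂ)).rTensor H (comul b))) =
      ∑ i ∈ s, (LinearMap.mulRight ℂ (antipode ℂ (r i))).lTensor H (comul (l i)) := by
    rw [hb]
    simp only [map_sum, LinearMap.rTensor_tmul]
    refine Finset.sum_congr rfl fun i _ => ?_
    generalize comul (R := ℂ) (l i) = t
    induction t with
    | zero => simp
    | add s t hs ht => simp only [map_add, hs, ht, TensorProduct.add_tmul]
    | tmul s t => simp [Φ]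
  rw [← h1, Coalgebra.coassoc_apply]
  have h2 : Φ ∘ₗ (comul (R := ℂ)).lTensor H =
      (Algebra.linearMap ℂ H ∘ₗ counit (R := ℂ) (A := H)).lTensor H := by
    rw [← HopfAlgebra.mul_antipode_lTensor_comul, ← LinearMap.comp_assoc]
    simp only [Φ, ← LinearMap.lTensor_comp]
  have h3 := LinearMap.congr_fun h2 (comul (R := ℂ) b)
  rw [LinearMap.comp_apply] at h3
  rw [h3, LinearMap.lTensor_comp, LinearMap.comp_apply, Coalgebra.lTensor_counit_comul]
  simp

end Antipode

section Sand
variable {M : Type v} [AddCommGroup M] [Module ℂ M] [Module Hᵐᵒᵖ M] [IsScalarTower ℂ Hᵐᵒᵖ M]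

@[simp] lemma rAct_apply (h : H) (m : M) : rAct H M h m = MulOpposite.op h • m := rfl

lemma antiYDMap_tmul (h₁ h₂ h₃ g : H) (m : M) :
    antiYDMap H M (h₁ ⊗ₜ (h₂ ⊗ₜ h₃)) (g ⊗ₜ m) =
      (antipode ℂ h₃ * (g * h₁)) ⊗ₜ (MulOpposite.op h₂ • m) := by
  simp [antiYDMap, sandwich]

end Sand
end ActionLemmas

/-! ### Cyclic rotations with coefficients -/
section Rotation
variable {M : Type v} {V : Type u} [AddCommGroup M] [Module ℂ M] [AddCommGroup V] [Module ℂ V]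

/-- `(m ⊗ v) ⊗ x ↦ m ⊗ (v ⊗ x)`. -/
def slotL (M : Type v) (V : Type u) [AddCommGroup M] [Module ℂ M] [AddCommGroup V] [Module ℂ V] (n : ℕ) :
    (M ⊗[ℂ] V) ⊗[ℂ] TP V n ≃ₗ[ℂ] M ⊗[ℂ] TP V (n + 1) :=
  (TensorProduct.assoc ℂ M V (TP V n)).trans
    (TensorProduct.congr (LinearEquiv.refl ℂ M) (consE V n))

/-- `(m ⊗ v) ⊗ x ↦ m ⊗ (x ⊗ v)`. -/
def slotR (M : Type v) (V : Type u) [AddCommGroup M] [Module ℂ M] [AddCommGroup V] [Module ℂ V] (n : ℕ) :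
    (M ⊗[ℂ] V) ⊗[ℂ] TP V n ≃ₗ[ℂ] M ⊗[ℂ] TP V (n + 1) :=
  (TensorProduct.assoc ℂ M V (TP V n)).trans
    (TensorProduct.congr (LinearEquiv.refl ℂ M)
      ((TensorProduct.comm ℂ V (TP V n)).trans (snocE V n)))

/-- `m ⊗ (v₀ ⊗ v₁ ⊗ ⋯ ⊗ vₙ) ↦ m' ⊗ (v₁ ⊗ ⋯ ⊗ vₙ ⊗ v')` where `κ(m ⊗ v₀) = m' ⊗ v'`. -/
def rotL (κ : M ⊗[ℂ] V →ₗ[ℂ] M ⊗[ℂ] V) (n : ℕ) :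
    M ⊗[ℂ] TP V (n + 1) →ₗ[ℂ] M ⊗[ℂ] TP V (n + 1) :=
  (slotR M V n).toLinearMap ∘ₗ κ.rTensor (TP V n) ∘ₗ (slotL M V n).symm.toLinearMap

/-- `m ⊗ (v₀ ⊗ ⋯ ⊗ vₙ₋₁ ⊗ vₙ) ↦ m' ⊗ (v' ⊗ v₀ ⊗ ⋯ ⊗ vₙ₋₁)` where `θ(m ⊗ vₙ) = m' ⊗ v'`. -/
def rotR (θ : M ⊗[ℂ] V →ₗ[ℂ] M ⊗[ℂ] V) (n : ℕ) :
    M ⊗[ℂ] TP V (n + 1) →ₗ[ℂ] M ⊗[ℂ] TP V (n + 1) :=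
  (slotL M V n).toLinearMap ∘ₗ θ.rTensor (TP V n) ∘ₗ (slotR M V n).symm.toLinearMap

/-- `m ⊗ v ↦ m ⊗ (v ⊗ x)`. -/
def withL {n : ℕ} (x : TP V n) : M ⊗[ℂ] V →ₗ[ℂ] M ⊗[ℂ] TP V (n + 1) :=
  (slotL M V n).toLinearMap ∘ₗ (TensorProduct.mk ℂ _ _).flip x

/-- `m ⊗ v ↦ m ⊗ (x ⊗ v)`. -/
def withR {n : ℕ} (x : TP V n) : M ⊗[ℂ] V →ₗ[ℂ] M ⊗[ℂ] TP V (n + 1) :=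
  (slotR M V n).toLinearMap ∘ₗ (TensorProduct.mk ℂ _ _).flip x

lemma withL_tmul {n : ℕ} (x : TP V n) (m : M) (v : V) :
    withL x (m ⊗ₜ[ℂ] v) = m ⊗ₜ cons v x := rfl

lemma withR_tmul {n : ℕ} (x : TP V n) (m : M) (v : V) :
    withR x (m ⊗ₜ[ℂ] v) = m ⊗ₜ snoc x v := rfl

lemma withL_add {n : ℕ} (x y : TP V n) (t : M ⊗[ℂ] V) :
    withL (x + y) t = withL x t + withL y t := by
  simp [withL]

lemma withR_add {n : ℕ} (x y : TP V n) (t : M ⊗[ℂ] V) :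
    withR (x + y) t = withR x t + withR y t := by
  simp [withR]

lemma rotL_withL (κ : M ⊗[ℂ] V →ₗ[ℂ] M ⊗[ℂ] V) {n : ℕ} (x : TP V n) (t : M ⊗[ℂ] V) :
    rotL κ n (withL x t) = withR x (κ t) := by
  simp [rotL, withL, withR]

lemma rotR_withR (θ : M ⊗[ℂ] V →ₗ[ℂ] M ⊗[ℂ] V) {n : ℕ} (x : TP V n) (t : M ⊗[ℂ] V) :
    rotR θ n (withR x t) = withL x (θ t) := by
  simp [rotR, withL, withR]

lemma rotL_cons (κ : M ⊗[ℂ] V →ₗ[ℂ] M ⊗[ℂ] V) {n : ℕ} (m : M) (v : V) (x : TP V n) :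
    rotL κ n (m ⊗ₜ cons v x) = withR x (κ (m ⊗ₜ v)) := by
  rw [← withL_tmul, rotL_withL]

lemma rotR_snoc (θ : M ⊗[ℂ] V →ₗ[ℂ] M ⊗[ℂ] V) {n : ℕ} (m : M) (v : V) (x : TP V n) :
    rotR θ n (m ⊗ₜ snoc x v) = withL x (θ (m ⊗ₜ v)) := by
  rw [← withR_tmul, rotR_withR]

end Rotation

section Coaction
variable {H : Type u} [Ring H] [HopfAlgebra ℂ H]
variable {M : Type v} [AddCommGroup M] [Module ℂ M] [Module Hᵐᵒᵖ M] [IsScalarTower ℂ Hᵐᵒᵖ M]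
variable [SAYD H M]
variable {V : Type u} [AddCommGroup V] [Module ℂ V] [Module H V] [IsScalarTower ℂ H V]

/-- `g ⊗ m ↦ m ⊗ f(g) v`. -/
def twistAux (M : Type v) [AddCommGroup M] [Module ℂ M] (f : H →ₗ[ℂ] H) (v : V) :
    H ⊗[ℂ] M →ₗ[ℂ] M ⊗[ℂ] V :=
  (TensorProduct.comm ℂ V M).toLinearMap ∘ₗ
    ((lAct H V).toLinearMap.flip v ∘ₗ f).rTensor M

lemma twistAux_tmul (f : H →ₗ[ℂ] H) (v : V) (g : H) (m : M) :
    twistAux M f v (g ⊗ₜ m) = m ⊗ₜ (f g • v) := rfl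

variable (H M V) in
/-- The twisting map `m ⊗ v ↦ m₍₀₎ ⊗ f(m₍₋₁₎) v`. -/
def twist (f : H →ₗ[ℂ] H) : M ⊗[ℂ] V →ₗ[ℂ] M ⊗[ℂ] V :=
  TensorProduct.lift
    { toFun := fun m =>
        { toFun := fun v => twistAux M f v (SAYD.coact (H := H) m)
          map_add' := fun v w => by
            generalize SAYD.coact (H := H) m = t
            induction t with
            | zero => simp
            | add s t hs ht => simp only [map_add, hs, ht]; abel
            | tmul g m => simp [twistAux_tmul, TensorProduct.tmul_add]
          map_smul' := fun r v => by
            generalize SAYD.coact (H := H) m = t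
            induction t with
            | zero => simp
            | add s t hs ht => simp only [map_add, hs, ht, smul_add]
            | tmul g m =>
              simp only [twistAux_tmul, RingHom.id_apply, smul_comm (f g) r v,
                TensorProduct.tmul_smul] }
      map_add' := fun m m' => by ext v; simp
      map_smul' := fun r m => by ext v; simp }

lemma twist_tmul (f : H →ₗ[ℂ] H) (m : M) (v : V) :
    twist H M V f (m ⊗ₜ v) = twistAux M f v (SAYD.coact m) := rfl

/-- The cyclic operator is the rotation along `m ⊗ v ↦ m₍₀₎ ⊗ m₍₋₁₎ v`. -/
abbrev cyc (H : Type u) (M : Type v) (V : Type u) [Ring H] [HopfAlgebra ℂ H] [AddCommGroup M] [Module ℂ M]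
    [Module Hᵐᵒᵖ M] [IsScalarTower ℂ Hᵐᵒᵖ M] [SAYD H M] [AddCommGroup V] [Module ℂ V]
    [Module H V] [IsScalarTower ℂ H V] (n : ℕ) :
    M ⊗[ℂ] TP V (n + 1) →ₗ[ℂ] M ⊗[ℂ] TP V (n + 1) :=
  rotL (twist H M V LinearMap.id) n

/-- The rotation along `m ⊗ v ↦ m₍₀₎ ⊗ S⁻¹(m₍₋₁₎) v`. -/
abbrev cycInv (H : Type u) (M : Type v) (V : Type u) [Ring H] [HopfAlgebra ℂ H] [BijectiveAntipode H]
    [AddCommGroup M] [Module ℂ M]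
    [Module Hᵐᵒᵖ M] [IsScalarTower ℂ Hᵐᵒᵖ M] [SAYD H M] [AddCommGroup V] [Module ℂ V]
    [Module H V] [IsScalarTower ℂ H V] (n : ℕ) :
    M ⊗[ℂ] TP V (n + 1) →ₗ[ℂ] M ⊗[ℂ] TP V (n + 1) :=
  rotR (twist H M V (antipodeInv H)) n

end Coaction

/-! ### Compatibility with the action of the Hopf algebra -/
section Relations
variable {H : Type u} [Ring H] [HopfAlgebra ℂ H]
variable {V W : Type u} [AddCommGroup V] [Module ℂ V] [Module H V] [IsScalarTower ℂ H V]
  [AddCommGroup W] [Module ℂ W] [Module H W] [IsScalarTower ℂ H W]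

variable (H) in
/-- `H`-linearity for the diagonal actions. -/
def Equivariant {n k : ℕ} (f : TP V n →ₗ[ℂ] TP V k) : Prop :=
  ∀ (h : H) (x : TP V n), f (diagAct H V n h x) = diagAct H V k h (f x)

lemma shift_equivariant {n k : ℕ} {f : TP V n →ₗ[ℂ] TP V k} (hf : Equivariant H f) :
    Equivariant H (shift f) := by
  intro h x
  induction x using TP.cons_induction with
  | hadd x y hx hy => simp only [map_add, hx, hy]
  | h v y =>
    rw [shift_cons, diagAct_cons, diagAct_cons]
    generalize comul (R := ℂ) h = t
    induction t with
    | zero => simp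
    | add s t hs ht => simp only [map_add, hs, ht]
    | tmul a b => rw [consAct_tmul, consAct_tmul, shift_cons, hf]

section
variable {C : Type u} [AddCommGroup C] [Module ℂ C] [Coalgebra ℂ C] [Module H C]
  [IsScalarTower ℂ H C] [ModuleCoalgebra H C]

lemma comulAt_equivariant (n i : ℕ) : Equivariant H (comulAt (C := C) n i) := by
  induction i generalizing n with
  | zero =>
    intro h x
    induction x using TP.cons_induction with
    | hadd x y hx hy => simp only [map_add, hx, hy]
    | h c y =>
      rw [comulAt_zero_cons, diagAct_cons]
      obtain ⟨s, hs⟩ := TensorProduct.exists_finset (comul (R := ℂ) c)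
      let Φ : C × C → H ⊗[ℂ] (H ⊗[ℂ] H) →ₗ[ℂ] TP C (n + 2) := fun p =>
        (consE C (n + 1)).toLinearMap ∘ₗ
          TensorProduct.map ((lAct H C).toLinearMap.flip p.1) (consAct p.2 y)
      have e1 : ∀ p : C × C, diagAct H C (n + 2) h (cons₂ y (p.1 ⊗ₜ p.2)) =
          Φ p ((comul (R := ℂ)).lTensor H (comul h)) := by
        intro p
        rw [cons₂_tmul, diagAct_cons]
        generalize comul (R := ℂ) h = t
        induction t with
        | zero => simp
        | add s t hs ht => simp only [map_add, hs, ht]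
        | tmul a b => rw [LinearMap.lTensor_tmul, consAct_tmul, diagAct_cons]; rfl
      have e2 : ∀ t : H ⊗[ℂ] H, comulAt n 0 (consAct c y t) =
          ∑ p ∈ s, Φ p (TensorProduct.assoc ℂ H H H ((comul (R := ℂ)).rTensor H t)) := by
        intro t
        induction t with
        | zero => simp
        | add s t hs ht => simp only [map_add, hs, ht, Finset.sum_add_distrib]
        | tmul a b =>
          rw [consAct_tmul, comulAt_zero_cons, ModuleCoalgebra.comul_smul, LinearMap.rTensor_tmul,
            hs, map_sum, map_sum]
          refine Finset.sum_congr rfl fun p _ => ?_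
          generalize comul (R := ℂ) a = u
          induction u with
          | zero => simp
          | add u u' hu hu' =>
            simp only [map_add, hu, hu', LinearMap.add_apply, TensorProduct.add_tmul]
          | tmul a a' =>
            rw [TensorProduct.map₂_apply_tmul, TensorProduct.map_tmul, cons₂_tmul,
              TensorProduct.assoc_tmul]
            rfl
      rw [e2, hs, map_sum, map_sum]
      exact (Finset.sum_congr rfl fun p _ => by rw [e1, Coalgebra.coassoc_apply]).symm
  | succ i ih =>
    cases n with
    | zero => intro h x; simp [comulAt]
    | succ n => exact shift_equivariant (ih n)

lemma counitAt_equivariant (n i : ℕ) : Equivariant H (counitAt (C := C) n i) := by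
  induction i generalizing n with
  | zero =>
    intro h x
    induction x using TP.cons_induction with
    | hadd x y hx hy => simp only [map_add, hx, hy]
    | h c y =>
      rw [counitAt_zero_cons, diagAct_cons]
      have e : ∀ t : H ⊗[ℂ] H, counitAt n 0 (consAct c y t) = counit (R := ℂ) c •
          diagAct H C n (TensorProduct.lid ℂ H ((counit (R := ℂ)).rTensor H t)) y := by
        intro t
        induction t with
        | zero => simp
        | add s t hs ht => simp only [map_add, hs, ht, smul_add, LinearMap.add_apply]
        | tmul a b =>
          rw [consAct_tmul, counitAt_zero_cons, ModuleCoalgebra.counit_smul,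
            LinearMap.rTensor_tmul, TensorProduct.lid_tmul, map_smul, LinearMap.smul_apply,
            smul_smul, mul_comm]
      rw [e, Coalgebra.rTensor_counit_comul]
      simp
  | succ i ih =>
    cases n with
    | zero => intro h x; simp [counitAt]
    | succ n => exact shift_equivariant (ih n)

end

section
variable {A : Type u} [Ring A] [Algebra ℂ A] [Module H A] [IsScalarTower ℂ H A]
  [ModuleAlgebra H A]

lemma mulAt_equivariant (n i : ℕ) : Equivariant H (mulAt (A := A) n i) := by
  induction i generalizing n with
  | zero =>
    intro h x
    induction x using TP.cons_cons_induction with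
    | hadd x y hx hy => simp only [map_add, hx, hy]
    | h a b y =>
      rw [mulAt_zero_cons, diagAct_cons, diagAct_cons]
      let Φ : H ⊗[ℂ] (H ⊗[ℂ] H) →ₗ[ℂ] TP A (n + 1) :=
        mulAt n 0 ∘ₗ (consE A (n + 1)).toLinearMap ∘ₗ
          TensorProduct.map ((lAct H A).toLinearMap.flip a) (consAct b y)
      have e1 : ∀ t : H ⊗[ℂ] H, mulAt n 0 (consAct a (cons b y) t) =
          Φ ((comul (R := ℂ)).lTensor H t) := by
        intro t
        induction t with
        | zero => simp
        | add s t hs ht => simp only [map_add, hs, ht]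
        | tmul g g' => rw [consAct_tmul, diagAct_cons]; rfl
      have e2 : ∀ t : H ⊗[ℂ] H, consAct (a * b) y t =
          Φ (TensorProduct.assoc ℂ H H H ((comul (R := ℂ)).rTensor H t)) := by
        intro t
        induction t with
        | zero => simp
        | add s t hs ht => simp only [map_add, hs, ht]
        | tmul g g' =>
          rw [consAct_tmul, ModuleAlgebra.smul_mul, LinearMap.rTensor_tmul]
          generalize comul (R := ℂ) g = s
          induction s with
          | zero => simp [cons]
          | add s s' hs hs' =>
            simp only [map_add, LinearMap.add_apply, TensorProduct.add_tmul, add_cons, hs, hs']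
          | tmul s s' =>
            rw [TensorProduct.map₂_apply_tmul, TensorProduct.map_tmul, TensorProduct.assoc_tmul]
            simp only [Φ, LinearMap.comp_apply, TensorProduct.map_tmul, consAct_tmul]
            exact (mulAt_zero_cons _ _ _ _).symm
      rw [e1, e2, Coalgebra.coassoc_apply]
  | succ i ih =>
    cases n with
    | zero => intro h x; simp [mulAt]
    | succ n => exact shift_equivariant (ih n)

lemma oneAt_equivariant (n i : ℕ) : Equivariant H (oneAt (A := A) n i) := by
  induction i generalizing n with
  | zero =>
    intro h x
    rw [oneAt_zero, oneAt_zero, diagAct_cons]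
    have e : ∀ t : H ⊗[ℂ] H, consAct (1 : A) x t =
        cons 1 (diagAct H A n (TensorProduct.lid ℂ H ((counit (R := ℂ)).rTensor H t)) x) := by
      intro t
      induction t with
      | zero => simp [cons]
      | add s t hs ht => simp only [map_add, hs, ht, cons_add, LinearMap.add_apply]
      | tmul a b =>
        rw [consAct_tmul, ModuleAlgebra.smul_one]
        simp [smul_cons, cons_smul]
    rw [e, Coalgebra.rTensor_counit_comul]
    simp
  | succ i ih =>
    cases n with
    | zero => intro h x; simp [oneAt]
    | succ n => exact shift_equivariant (ih n)

end

section
variable (H) (M : Type v) [AddCommGroup M] [Module ℂ M] [Module Hᵐᵒᵖ M] [IsScalarTower ℂ Hᵐᵒᵖ M]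
variable (V)

/-- The subspace of `M ⊗ V^{⊗ n}` spanned by the elements `m h ⊗ x - m ⊗ h x`. -/
def relSub (n : ℕ) : Submodule ℂ (M ⊗[ℂ] TP V n) :=
  Submodule.span ℂ {z | ∃ (h : H) (m : M) (x : TP V n),
    z = (MulOpposite.op h • m) ⊗ₜ[ℂ] x - m ⊗ₜ[ℂ] diagAct H V n h x}

variable {H M V}

lemma relSub_le_comap {n : ℕ} {E : Type*} [AddCommGroup E] [Module ℂ E]
    (f : M ⊗[ℂ] TP V n →ₗ[ℂ] E) (P : Submodule ℂ E)
    (hf : ∀ (h : H) (m : M) (x : TP V n), f ((MulOpposite.op h • m) ⊗ₜ[ℂ] x) -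
      f (m ⊗ₜ[ℂ] diagAct H V n h x) ∈ P) : relSub H V M n ≤ P.comap f := by
  rw [relSub, Submodule.span_le]
  rintro _ ⟨h, m, x, rfl⟩
  simpa using hf h m x

lemma lTensor_relSub {n k : ℕ} {f : TP V n →ₗ[ℂ] TP V k} (hf : Equivariant H f) :
    relSub H V M n ≤ (relSub H V M k).comap (f.lTensor M) := by
  refine relSub_le_comap _ _ fun h m x => ?_
  rw [LinearMap.lTensor_tmul, LinearMap.lTensor_tmul, hf]
  exact Submodule.subset_span ⟨h, m, f x, rfl⟩

lemma mkQ_rel {n : ℕ} (h : H) (m : M) (x : TP V n) :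
    (relSub H V M n).mkQ ((MulOpposite.op h • m) ⊗ₜ[ℂ] x) =
      (relSub H V M n).mkQ (m ⊗ₜ[ℂ] diagAct H V n h x) := by
  rw [← sub_eq_zero, ← map_sub, Submodule.mkQ_apply, Submodule.Quotient.mk_eq_zero]
  exact Submodule.subset_span ⟨h, m, x, rfl⟩

variable [SAYD H M]

lemma cyc_relSub (n : ℕ) :
    relSub H V M (n + 1) ≤ (relSub H V M (n + 1)).comap (cyc H M V n) := by
  refine relSub_le_comap _ _ fun h m x => ?_
  rw [← Submodule.Quotient.mk_eq_zero, Submodule.Quotient.mk_sub, sub_eq_zero,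
    ← Submodule.mkQ_apply, ← Submodule.mkQ_apply]
  induction x using TP.cons_induction with
  | hadd x y hx hy => simp only [map_add, TensorProduct.tmul_add, hx, hy]
  | h v x =>
    rw [rotL_cons, twist_tmul, ← rAct_apply, SAYD.antiYD, diagAct_cons]
    obtain ⟨s, hs⟩ := TensorProduct.exists_finset (comul (R := ℂ) h)
    have key : ∀ (b : H) (w : V) (m' : M) (a g : H),
        (relSub H V M (n + 1)).mkQ (withR x (twistAux M LinearMap.id v
          (antiYDMap H M (a ⊗ₜ comul (R := ℂ) b) (g ⊗ₜ m')))) =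
        (relSub H V M (n + 1)).mkQ
          (withR (diagAct H V n b x) (twistAux M LinearMap.id (a • v) (g ⊗ₜ m'))) := by
      intro b _ m' a g
      obtain ⟨s, hs⟩ := TensorProduct.exists_finset (comul (R := ℂ) b)
      rw [hs, TensorProduct.tmul_sum, map_sum, LinearMap.sum_apply, map_sum, map_sum, map_sum]
      have h1 : ∀ i ∈ s, (relSub H V M (n + 1)).mkQ (withR x (twistAux M LinearMap.id v
          (antiYDMap H M (a ⊗ₜ (i.1 ⊗ₜ i.2)) (g ⊗ₜ m')))) =
          (relSub H V M (n + 1)).mkQ (m' ⊗ₜ (snocAct x (g • a • v)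
            ((LinearMap.mulRight ℂ (antipode ℂ i.2)).lTensor H (comul i.1)))) := by
        intro i _
        rw [antiYDMap_tmul, twistAux_tmul, withR_tmul, mkQ_rel, diagAct_snoc]
        congr 2
        generalize comul (R := ℂ) i.1 = t
        induction t with
        | zero => simp
        | add s t hs ht => simp only [map_add, hs, ht]
        | tmul p q => simp [snocAct_tmul, mul_smul]
      rw [Finset.sum_congr rfl h1, ← map_sum, ← TensorProduct.tmul_sum, ← map_sum,
        sum_lTensor_antipode b s (fun i => i.1) (fun i => i.2) hs, snocAct_tmul,
        twistAux_tmul, withR_tmul, one_smul]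
      rfl
    rw [hs]
    simp only [map_sum, LinearMap.sum_apply, LinearMap.lTensor_tmul, TensorProduct.tmul_sum,
      consAct_tmul, rotL_cons, twist_tmul]
    refine Finset.sum_congr rfl fun i _ => ?_
    generalize SAYD.coact (H := H) m = t
    induction t with
    | zero => simp
    | add s t hs ht => simp only [map_add, hs, ht]
    | tmul g m' => exact key i.2 v m' i.1 g

lemma comul_antipodeInv [BijectiveAntipode H] (a : H) {ι : Type*} (s : Finset ι) (l r : ι → H)
    (ha : comul (R := ℂ) a = ∑ i ∈ s, l i ⊗ₜ r i) :
    ∑ i ∈ s, (LinearMap.mulRight ℂ (antipodeInv H (l i))).rTensor H (comul (r i)) =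
      (1 : H) ⊗ₜ[ℂ] a := by
  let μ : H ⊗[ℂ] H →ₗ[ℂ] H := LinearMap.mul' ℂ H ∘ₗ (TensorProduct.comm ℂ H H).toLinearMap ∘ₗ
    (antipodeInv H).rTensor H
  have hμ : ∀ t, antipode ℂ (μ t) =
      LinearMap.mul' ℂ H ((antipode ℂ (A := H)).lTensor H t) := by
    intro t
    induction t with
    | zero => simp
    | add s t hs ht => simp only [map_add, hs, ht]
    | tmul p q => simp [μ, antipode_mul_antidistrib, antipode_antipodeInv]
  have hμ2 : μ ∘ₗ comul (R := ℂ) = Algebra.linearMap ℂ H ∘ₗ counit (R := ℂ) (A := H) := by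
    ext h
    apply (BijectiveAntipode.bijective (H := H)).1
    rw [LinearMap.comp_apply, hμ, HopfAlgebra.mul_antipode_lTensor_comul_apply]
    simp [Algebra.algebraMap_eq_smul_one]
  let Φ : H ⊗[ℂ] (H ⊗[ℂ] H) →ₗ[ℂ] H ⊗[ℂ] H :=
    μ.rTensor H ∘ₗ (TensorProduct.assoc ℂ H H H).symm.toLinearMap
  have h1 : Φ ((comul (R := ℂ)).lTensor H (comul a)) =
      ∑ i ∈ s, (LinearMap.mulRight ℂ (antipodeInv H (l i))).rTensor H (comul (r i)) := by
    rw [ha]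
    simp only [map_sum, LinearMap.lTensor_tmul]
    refine Finset.sum_congr rfl fun i _ => ?_
    generalize comul (R := ℂ) (r i) = t
    induction t with
    | zero => simp
    | add s t hs ht => simp only [map_add, hs, ht, TensorProduct.tmul_add]
    | tmul s t => simp [Φ, μ]
  rw [← h1, ← Coalgebra.coassoc_apply]
  simp only [Φ, LinearMap.comp_apply, LinearEquiv.coe_coe, LinearEquiv.symm_apply_apply]
  rw [← LinearMap.comp_apply, ← LinearMap.rTensor_comp, hμ2, LinearMap.rTensor_comp,
    LinearMap.comp_apply, Coalgebra.rTensor_counit_comul]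
  simp

lemma cycInv_relSub [BijectiveAntipode H] (n : ℕ) :
    relSub H V M (n + 1) ≤ (relSub H V M (n + 1)).comap (cycInv H M V n) := by
  refine relSub_le_comap _ _ fun h m x => ?_
  rw [← Submodule.Quotient.mk_eq_zero, Submodule.Quotient.mk_sub, sub_eq_zero,
    ← Submodule.mkQ_apply, ← Submodule.mkQ_apply]
  induction x using TP.snoc_induction with
  | hadd x y hx hy => simp only [map_add, TensorProduct.tmul_add, hx, hy]
  | h x v =>
    rw [rotR_snoc, twist_tmul, ← rAct_apply, SAYD.antiYD, diagAct_snoc, ← Coalgebra.coassoc_apply]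
    obtain ⟨s, hs⟩ := TensorProduct.exists_finset (comul (R := ℂ) h)
    have hinv : ∀ p q : H, antipodeInv H (p * q) = antipodeInv H q * antipodeInv H p := by
      intro p q
      apply (BijectiveAntipode.bijective (H := H)).1
      simp [antipode_mul_antidistrib, antipode_antipodeInv]
    have key : ∀ (b : H) (m' : M) (a g : H),
        (relSub H V M (n + 1)).mkQ (withL x (twistAux M (antipodeInv H) v
          (antiYDMap H M (TensorProduct.assoc ℂ H H H (comul (R := ℂ) a ⊗ₜ b)) (g ⊗ₜ m')))) =
        (relSub H V M (n + 1)).mkQ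
          (withL (diagAct H V n a x) (twistAux M (antipodeInv H) (b • v) (g ⊗ₜ m'))) := by
      intro b m' a g
      obtain ⟨s, hs⟩ := TensorProduct.exists_finset (comul (R := ℂ) a)
      rw [hs, TensorProduct.sum_tmul, map_sum, map_sum, LinearMap.sum_apply, map_sum, map_sum,
        map_sum]
      have h1 : ∀ i ∈ s, (relSub H V M (n + 1)).mkQ (withL x (twistAux M (antipodeInv H) v
          (antiYDMap H M (TensorProduct.assoc ℂ H H H ((i.1 ⊗ₜ i.2) ⊗ₜ b)) (g ⊗ₜ m')))) =
          (relSub H V M (n + 1)).mkQ (m' ⊗ₜ (consAct (antipodeInv H g • b • v) x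
            ((LinearMap.mulRight ℂ (antipodeInv H i.1)).rTensor H (comul i.2)))) := by
        intro i _
        rw [TensorProduct.assoc_tmul, antiYDMap_tmul, twistAux_tmul, withL_tmul, mkQ_rel,
          diagAct_cons, hinv, hinv, antipodeInv_antipode]
        congr 2
        generalize comul (R := ℂ) i.2 = t
        induction t with
        | zero => simp
        | add s t hs ht => simp only [map_add, hs, ht]
        | tmul p q => simp [consAct_tmul, mul_smul]
      rw [Finset.sum_congr rfl h1, ← map_sum, ← TensorProduct.tmul_sum, ← map_sum,
        comul_antipodeInv a s (fun i => i.1) (fun i => i.2) hs, consAct_tmul,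
        twistAux_tmul, withL_tmul, one_smul]
    rw [hs]
    simp only [map_sum, LinearMap.sum_apply, LinearMap.rTensor_tmul, TensorProduct.tmul_sum,
      snocAct_tmul, rotR_snoc, twist_tmul]
    refine Finset.sum_congr rfl fun i _ => ?_
    generalize SAYD.coact (H := H) m = t
    induction t with
    | zero => simp
    | add s t hs ht => simp only [map_add, hs, ht]
    | tmul g m' => exact key i.2 m' i.1 g

end
end Relations

/-! ### Cocyclic modules and mixed complexes -/
section Cocyclic

/-- A sequence of vector spaces with cofaces `δ n i : Xⁿ → Xⁿ⁺¹` (`i ≤ n + 1`), codegeneracies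
`σ n j : Xⁿ⁺¹ → Xⁿ` (`j ≤ n`) and cyclic operators `τ n : Xⁿ → Xⁿ`. The values of `δ n i` and
`σ n j` outside these ranges carry no information. -/
structure CocyclicData where
  obj : ℕ → Type w
  [acg : ∀ n, AddCommGroup (obj n)]
  [mod : ∀ n, Module ℂ (obj n)]
  δ : ∀ n : ℕ, ℕ → (obj n →ₗ[ℂ] obj (n + 1))
  σ : ∀ n : ℕ, ℕ → (obj (n + 1) →ₗ[ℂ] obj n)
  τ : ∀ n, obj n →ₗ[ℂ] obj n

attribute [instance] CocyclicData.acg CocyclicData.mod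

/-- The identities of a cocyclic module. -/
structure CocyclicData.IsCocyclic (X : CocyclicData.{w}) : Prop where
  δ_δ : ∀ n i j, i < j → j ≤ n + 2 → X.δ (n + 1) j ∘ₗ X.δ n i = X.δ (n + 1) i ∘ₗ X.δ n (j - 1)
  σ_σ : ∀ n i j, i ≤ j → j ≤ n → X.σ n j ∘ₗ X.σ (n + 1) i = X.σ n i ∘ₗ X.σ (n + 1) (j + 1)
  σ_δ_lt : ∀ n i j, i < j → j ≤ n + 1 →
    X.σ (n + 1) j ∘ₗ X.δ (n + 1) i = X.δ n i ∘ₗ X.σ n (j - 1)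
  σ_δ_self : ∀ n j, j ≤ n → X.σ n j ∘ₗ X.δ n j = LinearMap.id
  σ_δ_succ : ∀ n j, j ≤ n → X.σ n j ∘ₗ X.δ n (j + 1) = LinearMap.id
  σ_δ_gt : ∀ n i j, j + 1 < i → i ≤ n + 2 →
    X.σ (n + 1) j ∘ₗ X.δ (n + 1) i = X.δ n (i - 1) ∘ₗ X.σ n j
  τ_δ : ∀ n i, 1 ≤ i → i ≤ n + 1 → X.τ (n + 1) ∘ₗ X.δ n i = X.δ n (i - 1) ∘ₗ X.τ n
  τ_δ_zero : ∀ n, X.τ (n + 1) ∘ₗ X.δ n 0 = X.δ n (n + 1)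
  τ_σ : ∀ n i, 1 ≤ i → i ≤ n → X.τ n ∘ₗ X.σ n i = X.σ n (i - 1) ∘ₗ X.τ (n + 1)
  τ_σ_zero : ∀ n, X.τ n ∘ₗ X.σ n 0 = X.σ n n ∘ₗ X.τ (n + 1) ∘ₗ X.τ (n + 1)
  τ_pow : ∀ n, X.τ n ^ (n + 1) = 1

/-- A cocyclic module over `ℂ`. -/
structure CocyclicModule extends CocyclicData.{w} where
  laws : toCocyclicData.IsCocyclic

/-- Maps commuting with the cofaces, the codegeneracies and the cyclic operators. -/
structure CocyclicData.Hom (X : CocyclicData.{w}) (Y : CocyclicData.{w'}) where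
  app : ∀ n, X.obj n →ₗ[ℂ] Y.obj n
  app_δ : ∀ n i, i ≤ n + 1 → app (n + 1) ∘ₗ X.δ n i = Y.δ n i ∘ₗ app n
  app_σ : ∀ n j, j ≤ n → app n ∘ₗ X.σ n j = Y.σ n j ∘ₗ app (n + 1)
  app_τ : ∀ n, app n ∘ₗ X.τ n = Y.τ n ∘ₗ app n

/-- The diagonal of the bicocyclic object `X ⊗ Y`. -/
abbrev CocyclicData.diag (X : CocyclicData.{w}) (Y : CocyclicData.{w'}) :
    CocyclicData.{max w w'} where
  obj n := X.obj n ⊗[ℂ] Y.obj n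
  δ n i := TensorProduct.map (X.δ n i) (Y.δ n i)
  σ n j := TensorProduct.map (X.σ n j) (Y.σ n j)
  τ n := TensorProduct.map (X.τ n) (Y.τ n)

/-- A cochain complex with a second operator `B` of degree `-1`. -/
structure MixedData where
  obj : ℕ → Type w
  [acg : ∀ n, AddCommGroup (obj n)]
  [mod : ∀ n, Module ℂ (obj n)]
  b : ∀ n, obj n →ₗ[ℂ] obj (n + 1)
  B : ∀ n, obj (n + 1) →ₗ[ℂ] obj n

attribute [instance] MixedData.acg MixedData.mod

/-- Hochschild's `b = ∑ (-1)ⁱ δᵢ` and Connes' `B = A B₀`, where `B₀ = σₙ τ (1 - (-1)ⁿ⁺¹ τ)` on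
`Xⁿ⁺¹` and `A = ∑ λⁱ` with `λ = (-1)ⁿ τ` on `Xⁿ`. -/
abbrev CocyclicData.mixed (X : CocyclicData.{w}) : MixedData.{w} where
  obj := X.obj
  b n := ∑ i ∈ Finset.range (n + 2), (-1 : ℂ) ^ i • X.δ n i
  B n := (∑ i ∈ Finset.range (n + 1), ((-1 : ℂ) ^ n • X.τ n) ^ i) ∘ₗ X.σ n n ∘ₗ X.τ (n + 1) ∘ₗ
    (LinearMap.id - (-1 : ℂ) ^ (n + 1) • X.τ (n + 1))

namespace MixedData
variable (X : MixedData.{w}) (Y : MixedData.{w'})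

/-- The total complex of the `(b, B)`-bicomplex in degree `n`: the sum of the `X^m` with
`m + 2 k = n`. -/
abbrev TC (n : ℕ) : Type w := ∀ s : {s : ℕ × ℕ // s.1 + 2 * s.2 = n}, X.obj s.1.1

/-- `b`, extended by zero to degree zero. -/
def bPart {n : ℕ} (x : X.TC n) : ∀ m k : ℕ, m + 2 * k = n + 1 → X.obj m
  | 0, _, _ => 0
  | m + 1, k, h => X.b m (x ⟨(m, k), by omega⟩)

/-- `B`, lowering `m` by one and raising `k` by one. -/
def BPart {n : ℕ} (x : X.TC n) : ∀ m k : ℕ, m + 2 * k = n + 1 → X.obj m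
  | _, 0, _ => 0
  | m, k + 1, h => X.B m (x ⟨(m + 1, k), by omega⟩)

/-- The differential `b + B`. -/
def d (n : ℕ) : X.TC n →ₗ[ℂ] X.TC (n + 1) where
  toFun x s := X.bPart x s.1.1 s.1.2 s.2 + X.BPart x s.1.1 s.1.2 s.2
  map_add' x y := by
    funext ⟨⟨m, k⟩, h⟩
    rcases m with _ | m <;> rcases k with _ | k <;> simp [bPart, BPart] <;> abel
  map_smul' r x := by
    funext ⟨⟨m, k⟩, h⟩
    rcases m with _ | m <;> rcases k with _ | k <;> simp [bPart, BPart]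

/-- The coboundaries. -/
def bdry : (n : ℕ) → Submodule ℂ (X.TC n)
  | 0 => ⊥
  | n + 1 => LinearMap.range (X.d n)

/-- Cyclic cohomology, as the cohomology of the total complex of the `(b, B)`-bicomplex. -/
abbrev HC (n : ℕ) : Type w :=
  LinearMap.ker (X.d n) ⧸ (X.bdry n).comap (LinearMap.ker (X.d n)).subtype

variable {X Y}

/-- The map on cyclic cohomology induced by a map of total complexes. -/
def HC.map (F : ∀ n, X.TC n →ₗ[ℂ] Y.TC n) (hF : ∀ n x, Y.d n (F n x) = F (n + 1) (X.d n x))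
    (n : ℕ) : X.HC n →ₗ[ℂ] Y.HC n :=
  Submodule.mapQ _ _
    ((F n).restrict (p := LinearMap.ker (X.d n)) (q := LinearMap.ker (Y.d n)) fun x hx => by
      rw [LinearMap.mem_ker] at hx ⊢
      rw [hF, hx, map_zero])
    (by
      rintro ⟨x, hx⟩ hb
      simp only [Submodule.mem_comap, Submodule.subtype_apply, LinearMap.coe_restrict_apply] at hb ⊢
      cases n with
      | zero =>
        have : x = 0 := hb
        subst this
        simp
      | succ n =>
        obtain ⟨y, hy⟩ := hb
        exact ⟨F n y, by rw [hF, hy]⟩)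

/-- The class of a cocycle in degree zero. -/
def HC.ofZero (t : X.obj 0) (ht : X.b 0 t = 0) : X.HC 0 :=
  Submodule.Quotient.mk ⟨fun s => match s with
    | ⟨(0, _), _⟩ => t
    | ⟨(_ + 1, _), _⟩ => 0, by
    rw [LinearMap.mem_ker]
    funext ⟨⟨m, k⟩, h⟩
    obtain ⟨rfl, rfl⟩ : m = 1 ∧ k = 0 := by omega
    simp [d, bPart, BPart, ht]⟩

variable (X Y)

/-- `b ⊗ 1`, with its sign. -/
def bLeft {n : ℕ} (z : ∀ s : {s : ℕ × ℕ // s.1 + s.2 = n}, X.obj s.1.1 ⊗[ℂ] Y.obj s.1.2) :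
    ∀ p q : ℕ, p + q = n + 1 → X.obj p ⊗[ℂ] Y.obj q
  | 0, _, _ => 0
  | p + 1, q, h => (-1 : ℂ) ^ q • (X.b p).rTensor (Y.obj q) (z ⟨(p, q), by omega⟩)

/-- `1 ⊗ b`. -/
def bRight {n : ℕ} (z : ∀ s : {s : ℕ × ℕ // s.1 + s.2 = n}, X.obj s.1.1 ⊗[ℂ] Y.obj s.1.2) :
    ∀ p q : ℕ, p + q = n + 1 → X.obj p ⊗[ℂ] Y.obj q
  | _, 0, _ => 0
  | p, q + 1, h => (Y.b q).lTensor (X.obj p) (z ⟨(p, q), by omega⟩)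

/-- The tensor product, `⨁_{p + q = n} X^p ⊗ Y^q` with `b = (-1)^q b ⊗ 1 + 1 ⊗ b` and
`B = (-1)^q B ⊗ 1 + 1 ⊗ B`. -/
abbrev tensor : MixedData.{max w w'} where
  obj n := ∀ s : {s : ℕ × ℕ // s.1 + s.2 = n}, X.obj s.1.1 ⊗[ℂ] Y.obj s.1.2
  b n :=
    { toFun := fun z s => X.bLeft Y z s.1.1 s.1.2 s.2 + X.bRight Y z s.1.1 s.1.2 s.2
      map_add' := fun x y => by
        funext ⟨⟨p, q⟩, h⟩
        rcases p with _ | p <;> rcases q with _ | q <;> simp [bLeft, bRight] <;> abel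
      map_smul' := fun r x => by
        funext ⟨⟨p, q⟩, h⟩
        rcases p with _ | p <;> rcases q with _ | q <;>
          simp [bLeft, bRight, smul_comm _ r] }
  B n :=
    { toFun := fun z s =>
        (-1 : ℂ) ^ s.1.2 • (X.B s.1.1).rTensor (Y.obj s.1.2)
            (z ⟨(s.1.1 + 1, s.1.2), by have := s.2; omega⟩) +
          (Y.B s.1.2).lTensor (X.obj s.1.1) (z ⟨(s.1.1, s.1.2 + 1), by have := s.2; omega⟩)
      map_add' := fun x y => by
        funext s
        simp; abel
      map_smul' := fun r x => by
        funext s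
        simp [smul_comm _ r] }

variable {X Y}

/-- The component of a cochain in position `(m, k)`, zero if there is none. -/
def ext {p : ℕ} (x : X.TC p) (m k : ℕ) : X.obj m := if h : m + 2 * k = p then x ⟨(m, k), h⟩ else 0

/-- `b` on components. -/
def bExt {p : ℕ} (x : X.TC p) : ∀ m, ℕ → X.obj m
  | 0, _ => 0
  | m + 1, k => X.b m (ext x m k)

/-- `B` on components. -/
def BExt {p : ℕ} (x : X.TC p) : ∀ m, ℕ → X.obj m
  | _, 0 => 0
  | m, k + 1 => X.B m (ext x (m + 1) k)

lemma ext_d {p : ℕ} (x : X.TC p) (m k : ℕ) : ext (X.d p x) m k = bExt x m k + BExt x m k := by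
  by_cases h : m + 2 * k = p + 1
  · rw [ext, dif_pos h]
    rcases m with _ | m <;> rcases k with _ | k <;> simp only [d, bExt, BExt, ext, bPart, BPart, LinearMap.coe_mk, AddHom.coe_mk]
    · rw [dif_pos (by omega)]
    · rw [dif_pos (by omega)]
    · rw [dif_pos (by omega), dif_pos (by omega)]
  · rw [ext, dif_neg h]
    rcases m with _ | m <;> rcases k with _ | k <;> simp only [bExt, BExt, ext]
    · simp
    · rw [dif_neg (by omega)]; simp
    · rw [dif_neg (by omega)]; simp
    · rw [dif_neg (by omega), dif_neg (by omega)]; simp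

/-- The exterior product of cochains: `(u^i x) × (u^j y) = u^{i+j} (x ⊗ y)`. -/
def prodTC {p q n : ℕ} (x : X.TC p) (y : Y.TC q) : (X.tensor Y).TC n :=
  fun s t => ∑ ij ∈ Finset.HasAntidiagonal.antidiagonal s.1.2, ext x t.1.1 ij.1 ⊗ₜ[ℂ] ext y t.1.2 ij.2

lemma ext_add {p : ℕ} (x y : X.TC p) (m k : ℕ) : ext (x + y) m k = ext x m k + ext y m k := by
  unfold ext; split <;> simp

lemma ext_smul {p : ℕ} (r : ℂ) (x : X.TC p) (m k : ℕ) : ext (r • x) m k = r • ext x m k := by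
  unfold ext; split <;> simp

lemma prodTC_apply {p q n : ℕ} (x : X.TC p) (y : Y.TC q) (s : {s : ℕ × ℕ // s.1 + 2 * s.2 = n})
    (t : {t : ℕ × ℕ // t.1 + t.2 = s.1.1}) :
    (prodTC x y s : ∀ t : {t : ℕ × ℕ // t.1 + t.2 = s.1.1}, X.obj t.1.1 ⊗[ℂ] Y.obj t.1.2) t =
      ∑ ij ∈ Finset.HasAntidiagonal.antidiagonal s.1.2,
        ext x t.1.1 ij.1 ⊗ₜ[ℂ] ext y t.1.2 ij.2 := rfl

lemma tensor_ext {n : ℕ} {x y : (X.tensor Y).TC n} (h : ∀ s t,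
    (x s : ∀ t : {t : ℕ × ℕ // t.1 + t.2 = s.1.1}, X.obj t.1.1 ⊗[ℂ] Y.obj t.1.2) t = y s t) :
    x = y := by
  funext s
  exact funext (h s)

lemma tensor_add_apply {n : ℕ} (x y : (X.tensor Y).TC n) (s : {s : ℕ × ℕ // s.1 + 2 * s.2 = n})
    (t : {t : ℕ × ℕ // t.1 + t.2 = s.1.1}) :
    ((x + y) s : ∀ t : {t : ℕ × ℕ // t.1 + t.2 = s.1.1}, X.obj t.1.1 ⊗[ℂ] Y.obj t.1.2) t =
      x s t + y s t := rfl

lemma tensor_smul_apply {n : ℕ} (r : ℂ) (x : (X.tensor Y).TC n)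
    (s : {s : ℕ × ℕ // s.1 + 2 * s.2 = n}) (t : {t : ℕ × ℕ // t.1 + t.2 = s.1.1}) :
    ((r • x) s : ∀ t : {t : ℕ × ℕ // t.1 + t.2 = s.1.1}, X.obj t.1.1 ⊗[ℂ] Y.obj t.1.2) t =
      r • (x s t : X.obj t.1.1 ⊗[ℂ] Y.obj t.1.2) := rfl

lemma prodTC_add_left {p q n : ℕ} (x x' : X.TC p) (y : Y.TC q) :
    prodTC (n := n) (x + x') y = prodTC x y + prodTC x' y := by
  refine tensor_ext fun s t => ?_
  simp only [tensor_add_apply, prodTC_apply, ext_add, TensorProduct.add_tmul,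
    Finset.sum_add_distrib]

lemma prodTC_add_right {p q n : ℕ} (x : X.TC p) (y y' : Y.TC q) :
    prodTC (n := n) x (y + y') = prodTC x y + prodTC x y' := by
  refine tensor_ext fun s t => ?_
  simp only [tensor_add_apply, prodTC_apply, ext_add, TensorProduct.tmul_add,
    Finset.sum_add_distrib]

lemma prodTC_smul_left {p q n : ℕ} (r : ℂ) (x : X.TC p) (y : Y.TC q) :
    prodTC (n := n) (r • x) y = r • prodTC x y := by
  refine tensor_ext fun s t => ?_
  simp only [tensor_smul_apply, prodTC_apply, ext_smul, ← TensorProduct.smul_tmul',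
    Finset.smul_sum]

lemma prodTC_smul_right {p q n : ℕ} (r : ℂ) (x : X.TC p) (y : Y.TC q) :
    prodTC (n := n) x (r • y) = r • prodTC x y := by
  refine tensor_ext fun s t => ?_
  simp only [tensor_smul_apply, prodTC_apply, ext_smul, TensorProduct.tmul_smul,
    Finset.smul_sum]

lemma ext_sign {q : ℕ} (y : Y.TC q) (m k : ℕ) :
    (-1 : ℂ) ^ q • ext y m k = (-1 : ℂ) ^ m • ext y m k := by
  unfold ext
  split_ifs with h
  · have : (-1 : ℂ) ^ q = (-1 : ℂ) ^ m := by
      rw [← show m + 2 * k = q from h, pow_add, pow_mul]; simp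
    rw [this]
  · simp

lemma prodTC_d {p q n : ℕ} (x : X.TC p) (y : Y.TC q) :
    (X.tensor Y).d n (prodTC x y) =
      (-1 : ℂ) ^ q • prodTC (X.d p x) y + prodTC x (Y.d q y) := by
  refine tensor_ext fun s t => ?_
  rw [tensor_add_apply, tensor_smul_apply, prodTC_apply, prodTC_apply]
  obtain ⟨⟨m, k⟩, hs⟩ := s
  obtain ⟨⟨p', q'⟩, ht⟩ := t
  have hsg : ∀ j, (-1 : ℂ) ^ q • ext y q' j = (-1 : ℂ) ^ q' • ext y q' j := ext_sign y q'
  have e : (-1 : ℂ) ^ q • (∑ ij ∈ Finset.HasAntidiagonal.antidiagonal k,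
        ext (X.d p x) p' ij.1 ⊗ₜ[ℂ] ext y q' ij.2) +
      ∑ ij ∈ Finset.HasAntidiagonal.antidiagonal k, ext x p' ij.1 ⊗ₜ[ℂ] ext (Y.d q y) q' ij.2 =
      (∑ ij ∈ Finset.HasAntidiagonal.antidiagonal k,
          (-1 : ℂ) ^ q' • bExt x p' ij.1 ⊗ₜ[ℂ] ext y q' ij.2 +
        ∑ ij ∈ Finset.HasAntidiagonal.antidiagonal k, ext x p' ij.1 ⊗ₜ[ℂ] bExt y q' ij.2) +
      (∑ ij ∈ Finset.HasAntidiagonal.antidiagonal k,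
          (-1 : ℂ) ^ q' • BExt x p' ij.1 ⊗ₜ[ℂ] ext y q' ij.2 +
        ∑ ij ∈ Finset.HasAntidiagonal.antidiagonal k, ext x p' ij.1 ⊗ₜ[ℂ] BExt y q' ij.2) := by
    simp only [ext_d, TensorProduct.add_tmul,
      TensorProduct.tmul_add, Finset.sum_add_distrib, Finset.smul_sum, smul_add,
      ← TensorProduct.tmul_smul, hsg]
    abel
  refine Eq.trans ?_ e.symm
  have e2 : ((X.tensor Y).d n (prodTC x y) ⟨(m, k), hs⟩ :
      ∀ t : {t : ℕ × ℕ // t.1 + t.2 = m}, X.obj t.1.1 ⊗[ℂ] Y.obj t.1.2) ⟨(p', q'), ht⟩ =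
      ((X.tensor Y).bPart (prodTC (n := n) x y) m k hs :
        ∀ t : {t : ℕ × ℕ // t.1 + t.2 = m}, X.obj t.1.1 ⊗[ℂ] Y.obj t.1.2) ⟨(p', q'), ht⟩ +
      ((X.tensor Y).BPart (prodTC (n := n) x y) m k hs :
        ∀ t : {t : ℕ × ℕ // t.1 + t.2 = m}, X.obj t.1.1 ⊗[ℂ] Y.obj t.1.2) ⟨(p', q'), ht⟩ := rfl
  rw [e2]
  congr 1
  · rcases m with _ | m
    · obtain ⟨rfl, rfl⟩ : p' = 0 ∧ q' = 0 := by simp at ht; omega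
      simp [bPart, bExt]
      rfl
    · change bLeft X Y _ p' q' _ + bRight X Y _ p' q' _ = _
      congr 1
      · rcases p' with _ | p'
        · simp [bLeft, bExt]
        · simp only [bLeft, bExt, prodTC_apply, map_sum, LinearMap.rTensor_tmul, Finset.smul_sum]
      · rcases q' with _ | q'
        · simp [bRight, bExt]
        · simp only [bRight, bExt, prodTC_apply, map_sum, LinearMap.lTensor_tmul]
  · rcases k with _ | k
    · simp [BPart, BExt]
      rfl
    · change (-1 : ℂ) ^ q' • (X.B p').rTensor (Y.obj q') _ + (Y.B q').lTensor (X.obj p') _ = _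
      congr 1
      · rw [prodTC_apply, Finset.Nat.antidiagonal_succ]
        simp [BExt, Finset.smul_sum]
      · rw [prodTC_apply, Finset.Nat.antidiagonal_succ']
        simp [BExt]

end MixedData
end Cocyclic

/-! ### Exterior products and the cyclic Alexander-Whitney map -/
section Products

namespace MixedData
variable {X : MixedData.{w}} {Y : MixedData.{w'}}

lemma prodTC_mem_bdry_left {p q n : ℕ} (h : p + q = n) {x : X.TC p} (hx : x ∈ X.bdry p)
    {y : Y.TC q} (hy : Y.d q y = 0) : prodTC x y ∈ (X.tensor Y).bdry n := by
  cases p with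
  | zero =>
    have h0 : x = 0 := hx
    have h1 := prodTC_smul_left (n := n) 0 x y
    rw [zero_smul, zero_smul] at h1
    rw [h0, h1]; exact zero_mem _
  | succ p =>
    obtain ⟨z, rfl⟩ := hx
    obtain ⟨n, rfl⟩ : ∃ m, n = m + 1 := ⟨n - 1, by omega⟩
    refine ⟨(-1 : ℂ) ^ q • prodTC z y, ?_⟩
    have h0 : prodTC (n := n + 1) z (0 : Y.TC (q + 1)) = 0 := by
      have := prodTC_smul_right (n := n + 1) 0 z (0 : Y.TC (q + 1))
      rwa [zero_smul, zero_smul] at this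
    rw [map_smul, prodTC_d, hy, h0, add_zero, smul_smul, ← mul_pow]
    simp

lemma prodTC_mem_bdry_right {p q n : ℕ} (h : p + q = n) {x : X.TC p} (hx : X.d p x = 0)
    {y : Y.TC q} (hy : y ∈ Y.bdry q) : prodTC x y ∈ (X.tensor Y).bdry n := by
  cases q with
  | zero =>
    have h0 : y = 0 := hy
    have h1 := prodTC_smul_right (n := n) 0 x y
    rw [zero_smul, zero_smul] at h1
    rw [h0, h1]; exact zero_mem _
  | succ q =>
    obtain ⟨z, rfl⟩ := hy
    obtain ⟨n, rfl⟩ : ∃ m, n = m + 1 := ⟨n - 1, by omega⟩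
    refine ⟨prodTC x z, ?_⟩
    have h0 : prodTC (n := n + 1) (0 : X.TC (p + 1)) z = 0 := by
      have := prodTC_smul_left (n := n + 1) 0 (0 : X.TC (p + 1)) z
      rwa [zero_smul, zero_smul] at this
    rw [prodTC_d, hx, h0, smul_zero, zero_add]

/-- The exterior product of cocycles. -/
def prodZ {p q n : ℕ} : LinearMap.ker (X.d p) →ₗ[ℂ] LinearMap.ker (Y.d q) →ₗ[ℂ]
    LinearMap.ker ((X.tensor Y).d n) :=
  LinearMap.mk₂ ℂ (fun x y => ⟨prodTC x.1 y.1, by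
      have h0 : prodTC (n := n + 1) (0 : X.TC (p + 1)) y.1 = 0 := by
        have := prodTC_smul_left (n := n + 1) 0 (0 : X.TC (p + 1)) y.1
        rwa [zero_smul, zero_smul] at this
      have h1 : prodTC (n := n + 1) x.1 (0 : Y.TC (q + 1)) = 0 := by
        have := prodTC_smul_right (n := n + 1) 0 x.1 (0 : Y.TC (q + 1))
        rwa [zero_smul, zero_smul] at this
      rw [LinearMap.mem_ker, prodTC_d, LinearMap.mem_ker.1 x.2, LinearMap.mem_ker.1 y.2, h0, h1,
        smul_zero, add_zero]⟩)
    (fun _ _ _ => Subtype.ext (prodTC_add_left _ _ _))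
    (fun _ _ _ => Subtype.ext (prodTC_smul_left _ _ _))
    (fun _ _ _ => Subtype.ext (prodTC_add_right _ _ _))
    (fun _ _ _ => Subtype.ext (prodTC_smul_right _ _ _))

/-- The exterior product `HC^p(X) ⊗ HC^q(Y) → HC^n(X ⊗ Y)`, `n = p + q`. -/
def HC.prod {p q n : ℕ} (h : p + q = n) : X.HC p →ₗ[ℂ] Y.HC q →ₗ[ℂ] (X.tensor Y).HC n :=
  (Submodule.liftQ _ (Submodule.liftQ _ (prodZ.compr₂ (Submodule.mkQ
      (((X.tensor Y).bdry n).comap (LinearMap.ker ((X.tensor Y).d n)).subtype)))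
    (fun x hx => by
      rw [LinearMap.mem_ker]
      ext y
      exact (Submodule.Quotient.mk_eq_zero _).2
        (prodTC_mem_bdry_left h hx (LinearMap.mem_ker.1 y.2)))).flip
    (fun y hy => by
      rw [LinearMap.mem_ker]
      refine LinearMap.ext fun x => ?_
      induction x using Submodule.Quotient.induction_on with
      | H x =>
        exact (Submodule.Quotient.mk_eq_zero _).2
          (prodTC_mem_bdry_right h (LinearMap.mem_ker.1 x.2) hy))).flip

end MixedData

namespace CocyclicData

/-- The iterated coface `δ₀ ⋯ δ₀`, with `q` factors. -/
def zeroFaces (X : CocyclicData.{w}) : (q p n : ℕ) → p + q = n → (X.obj p →ₗ[ℂ] X.obj n)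
  | 0, p, n, h => by
      obtain rfl : p = n := h
      exact LinearMap.id
  | q + 1, p, n, h => X.zeroFaces q (p + 1) n (by omega) ∘ₗ X.δ p 0

/-- The iterated last coface `δ_{q + p} ⋯ δ_{q + 1}`, with `p` factors. -/
def lastFaces (Y : CocyclicData.{w}) : (p q n : ℕ) → p + q = n → (Y.obj q →ₗ[ℂ] Y.obj n)
  | 0, q, n, h => by
      obtain rfl : q = n := by omega
      exact LinearMap.id
  | p + 1, q, n, h => Y.lastFaces p (q + 1) n (by omega) ∘ₗ Y.δ q (q + 1)

/-- The Alexander-Whitney map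
`X^p ⊗ Y^q → X^n ⊗ Y^n`, `x ⊗ y ↦ (δ₀)^q x ⊗ δₙ ⋯ δ_{q + 1} y`, `n = p + q`. -/
def alexanderWhitney (X : CocyclicData.{w}) (Y : CocyclicData.{w'}) {p q n : ℕ} (h : p + q = n) :
    X.obj p ⊗[ℂ] Y.obj q →ₗ[ℂ] X.obj n ⊗[ℂ] Y.obj n :=
  TensorProduct.map (X.zeroFaces q p n h) (Y.lastFaces p q n h)

/-- A family of maps `X^p ⊗ Y^q → X^r ⊗ Y^r`, assembled to a `ℂ[u]`-linear map from the total
complex of `X ⊗ Y` to the one of the diagonal; the maps with `p + q = r + 2 i` are the coefficients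
of `u^i`. -/
def uMap (X : CocyclicData.{w}) (Y : CocyclicData.{w'})
    (f : ∀ p q r : ℕ, X.obj p ⊗[ℂ] Y.obj q →ₗ[ℂ] X.obj r ⊗[ℂ] Y.obj r) (n : ℕ) :
    (X.mixed.tensor Y.mixed).TC n →ₗ[ℂ] (X.diag Y).mixed.TC n where
  toFun z s := ∑ i : Fin (s.1.2 + 1),
    ∑ t ∈ (Finset.HasAntidiagonal.antidiagonal (s.1.1 + 2 * i.1)).attach,
      f t.1.1 t.1.2 s.1.1 ((z ⟨(s.1.1 + 2 * i.1, s.1.2 - i.1), by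
        have := s.2; have := i.2; dsimp only; omega⟩ :
          ∀ t : {t : ℕ × ℕ // t.1 + t.2 = s.1.1 + 2 * i.1}, X.obj t.1.1 ⊗[ℂ] Y.obj t.1.2)
        ⟨t.1, Finset.HasAntidiagonal.mem_antidiagonal.1 t.2⟩)
  map_add' x y := by
    funext s
    simp only [MixedData.tensor_add_apply, map_add, Finset.sum_add_distrib]
    rfl
  map_smul' r x := by
    funext s
    simp only [MixedData.tensor_smul_apply, map_smul, ← Finset.smul_sum]
    rfl

end CocyclicData

/-- The maps on total complexes induced by a map of cocyclic modules. -/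
def CocyclicData.Hom.tc {X : CocyclicData.{w}} {Y : CocyclicData.{w'}} (f : X.Hom Y) (n : ℕ) :
    X.mixed.TC n →ₗ[ℂ] Y.mixed.TC n where
  toFun x s := f.app s.1.1 (x s)
  map_add' x y := by funext s; exact map_add _ _ _
  map_smul' r x := by funext s; exact map_smul _ _ _

lemma CocyclicData.Hom.app_b {X : CocyclicData.{w}} {Y : CocyclicData.{w'}} (f : X.Hom Y) (n : ℕ)
    (x : X.obj n) : Y.mixed.b n (f.app n x) = f.app (n + 1) (X.mixed.b n x) := by
  simp only [CocyclicData.mixed, LinearMap.sum_apply, LinearMap.smul_apply, map_sum, map_smul]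
  refine Finset.sum_congr rfl fun i hi => ?_
  congr 1
  exact (LinearMap.congr_fun (f.app_δ n i (by simp at hi; omega)) x).symm

lemma CocyclicData.Hom.app_B {X : CocyclicData.{w}} {Y : CocyclicData.{w'}} (f : X.Hom Y) (n : ℕ)
    (x : X.obj (n + 1)) : Y.mixed.B n (f.app (n + 1) x) = f.app n (X.mixed.B n x) := by
  have hτ : ∀ n (r : ℂ) x, (r • Y.τ n) (f.app n x) = f.app n ((r • X.τ n) x) := by
    intro n r x
    have := LinearMap.congr_fun (f.app_τ n) x
    simp only [LinearMap.comp_apply] at this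
    simp [this]
  have hpow : ∀ n (r : ℂ) i x, ((r • Y.τ n) ^ i) (f.app n x) =
      f.app n (((r • X.τ n) ^ i) x) := by
    intro n r i
    induction i with
    | zero => intro x; simp
    | succ i ih => intro x; rw [pow_succ, pow_succ, Module.End.mul_apply, hτ, ih]; rfl
  have hσ := fun x => LinearMap.congr_fun (f.app_σ n n le_rfl) x
  have hτ1 := fun x => LinearMap.congr_fun (f.app_τ (n + 1)) x
  simp only [LinearMap.comp_apply] at hσ hτ1
  simp only [CocyclicData.mixed, LinearMap.comp_apply, LinearMap.sub_apply, LinearMap.id_apply, hτ,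
    ← map_sub, ← hτ1, ← hσ, LinearMap.sum_apply, hpow, map_sum]

lemma CocyclicData.Hom.tc_d {X : CocyclicData.{w}} {Y : CocyclicData.{w'}} (f : X.Hom Y) (n : ℕ)
    (x : X.mixed.TC n) : Y.mixed.d n (f.tc n x) = f.tc (n + 1) (X.mixed.d n x) := by
  funext ⟨⟨m, k⟩, h⟩
  have e : ∀ m k h, Y.mixed.bPart (f.tc n x) m k h = f.app m (X.mixed.bPart x m k h) := by
    intro m k h
    cases m with
    | zero => exact (map_zero _).symm
    | succ m => exact f.app_b m _
  have e' : ∀ m k h, Y.mixed.BPart (f.tc n x) m k h = f.app m (X.mixed.BPart x m k h) := by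
    intro m k h
    cases k with
    | zero => exact (map_zero _).symm
    | succ k => exact f.app_B m _
  refine Eq.trans ?_ (map_add (f.app m) (X.mixed.bPart x m k h) (X.mixed.BPart x m k h)).symm
  exact congrArg₂ (· + ·) (e m k h) (e' m k h)

/-- Cyclic cohomology of a cocyclic module. -/
abbrev CocyclicData.HC (X : CocyclicData.{w}) (n : ℕ) : Type w := X.mixed.HC n

/-- The map on cyclic cohomology induced by a map of cocyclic modules. -/
def CocyclicData.Hom.hc {X : CocyclicData.{w}} {Y : CocyclicData.{w'}} (f : X.Hom Y) (n : ℕ) :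
    X.HC n →ₗ[ℂ] Y.HC n :=
  MixedData.HC.map f.tc f.tc_d n

/-- A cyclic Alexander-Whitney map: a natural map of complexes over `ℂ[u]` from the total complex of
the tensor product of the mixed complexes of two cocyclic modules to the total complex of the
diagonal, whose coefficient of `u^0` is the Alexander-Whitney map. -/
structure CyclicAW where
  comp : ∀ (X Y : CocyclicModule.{w}) (p q r : ℕ),
    X.obj p ⊗[ℂ] Y.obj q →ₗ[ℂ] X.obj r ⊗[ℂ] Y.obj r
  natural : ∀ {X X' Y Y' : CocyclicModule.{w}} (f : X.Hom X'.toCocyclicData)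
    (g : Y.Hom Y'.toCocyclicData) (p q r : ℕ),
    TensorProduct.map (f.app r) (g.app r) ∘ₗ comp X Y p q r =
      comp X' Y' p q r ∘ₗ TensorProduct.map (f.app p) (g.app q)
  leading : ∀ (X Y : CocyclicModule.{w}) {p q n : ℕ} (h : p + q = n),
    comp X Y p q n = X.alexanderWhitney Y.toCocyclicData h
  chain : ∀ (X Y : CocyclicModule.{w}) (n : ℕ) (z : (X.mixed.tensor Y.mixed).TC n),
    (X.diag Y.toCocyclicData).mixed.d n (X.uMap Y.toCocyclicData (comp X Y) n z) =
      X.uMap Y.toCocyclicData (comp X Y) (n + 1) ((X.mixed.tensor Y.mixed).d n z)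

/-- The map `HC^n(X ⊗ Y) → HC^n(diag(X ⊗ Y))` induced by a cyclic Alexander-Whitney map. -/
def CyclicAW.hc (AW : CyclicAW.{w}) (X Y : CocyclicModule.{w}) (n : ℕ) :
    (X.mixed.tensor Y.mixed).HC n →ₗ[ℂ] (X.diag Y.toCocyclicData).HC n :=
  MixedData.HC.map (X.uMap Y.toCocyclicData (AW.comp X Y)) (AW.chain X Y) n

/-- The cup product `HC^p(X) ⊗ HC^q(Y) → HC^n(Z)`, `n = p + q`, determined by a map `Ψ` from the
diagonal of `X ⊗ Y` to `Z`: the exterior product, followed by the cyclic Alexander-Whitney map and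
by the map induced by `Ψ`. -/
def cup (AW : CyclicAW.{w}) {X Y : CocyclicModule.{w}} {Z : CocyclicData.{w'}}
    (Ψ : (X.diag Y.toCocyclicData).Hom Z) {p q n : ℕ} (h : p + q = n) :
    X.HC p →ₗ[ℂ] Y.HC q →ₗ[ℂ] Z.HC n :=
  (MixedData.HC.prod h).compr₂ (Ψ.hc n ∘ₗ AW.hc X Y n)

end Products

/-! ### The cocyclic modules of Hopf-cyclic cohomology -/
section HopfCocyclic

section Coalgebras
variable (H : Type u) [Ring H] [HopfAlgebra ℂ H]
variable (C : Type u) [AddCommGroup C] [Module ℂ C] [Coalgebra ℂ C] [Module H C]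
  [IsScalarTower ℂ H C] [ModuleCoalgebra H C]
variable (M : Type v) [AddCommGroup M] [Module ℂ M] [Module Hᵐᵒᵖ M] [IsScalarTower ℂ Hᵐᵒᵖ M]

/-- `M ⊗_H V^{⊗ n}`, for the diagonal action of `H` on `V^{⊗ n}`. -/
abbrev CoinvTP (V : Type u) [AddCommGroup V] [Module ℂ V] [Module H V] [IsScalarTower ℂ H V]
    (n : ℕ) : Type (max u v) :=
  (M ⊗[ℂ] TP V n) ⧸ relSub H V M n

/-- The map `M ⊗_H C^{⊗ n} → M ⊗_H C^{⊗ k}` induced by an `H`-linear map. -/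
def coinvMap {n k : ℕ} (f : TP C n →ₗ[ℂ] TP C k) (hf : Equivariant H f) :
    CoinvTP H M C n →ₗ[ℂ] CoinvTP H M C k :=
  Submodule.mapQ _ _ (f.lTensor M) (lTensor_relSub hf)

variable [SAYD H M]

/-- The cyclic operator
`m ⊗ c⁰ ⊗ ⋯ ⊗ cⁿ ↦ m₍₀₎ ⊗ c¹ ⊗ ⋯ ⊗ cⁿ ⊗ m₍₋₁₎ c⁰`. -/
def coalgCyc (n : ℕ) : CoinvTP H M C (n + 1) →ₗ[ℂ] CoinvTP H M C (n + 1) :=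
  Submodule.mapQ _ _ (cyc H M C n) (cyc_relSub n)

/-- The cocyclic module `Cⁿ_H(C, M) = M ⊗_H C^{⊗ (n + 1)}` of a module coalgebra: `δᵢ` is `Δ` at
`cⁱ` for `i ≤ n`, `δₙ₊₁` is
`m ⊗ c⁰ ⊗ ⋯ ⊗ cⁿ ↦ m₍₀₎ ⊗ c⁰₍₂₎ ⊗ c¹ ⊗ ⋯ ⊗ cⁿ ⊗ m₍₋₁₎ c⁰₍₁₎`, and `σⱼ` is `ε` at `cʲ⁺¹`. -/
abbrev coalgData : CocyclicData.{max u v} where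
  obj n := CoinvTP H M C (n + 1)
  δ n i :=
    if i ≤ n then coinvMap H C M (comulAt n i) (comulAt_equivariant n i)
    else coalgCyc H C M (n + 1) ∘ₗ coinvMap H C M (comulAt n 0) (comulAt_equivariant n 0)
  σ n j := coinvMap H C M (counitAt (n + 1) (j + 1)) (counitAt_equivariant (n + 1) (j + 1))
  τ n := coalgCyc H C M n

end Coalgebras

section Algebras
variable (H : Type u) [Ring H] [HopfAlgebra ℂ H]
variable (M : Type v) [AddCommGroup M] [Module ℂ M] [Module Hᵐᵒᵖ M] [IsScalarTower ℂ Hᵐᵒᵖ M]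

/-- The diagonal right action on `M ⊗ V^{⊗ n}`,
`(m ⊗ v¹ ⊗ ⋯ ⊗ vⁿ) h = m h₍₁₎ ⊗ S(h₍₂₎) (v¹ ⊗ ⋯ ⊗ vⁿ)`. -/
def rightDiag (V : Type u) [AddCommGroup V] [Module ℂ V] [Module H V] [IsScalarTower ℂ H V]
    (n : ℕ) : H →ₗ[ℂ] Module.End ℂ (M ⊗[ℂ] TP V n) :=
  TensorProduct.homTensorHomMap (RingHom.id ℂ) M (TP V n) M (TP V n) ∘ₗ
    TensorProduct.map (rAct H M) ((diagAct H V n).toLinearMap ∘ₗ antipode ℂ) ∘ₗ comul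

/-- `Hom_H(M ⊗ V^{⊗ n}, ℂ)`, where `H` acts on `ℂ` through the counit. -/
def invForms (V : Type u) [AddCommGroup V] [Module ℂ V] [Module H V] [IsScalarTower ℂ H V]
    (n : ℕ) : Submodule ℂ (Module.Dual ℂ (M ⊗[ℂ] TP V n)) where
  carrier := {φ | ∀ (h : H) (z : M ⊗[ℂ] TP V n),
    φ (rightDiag H M V n h z) = counit (R := ℂ) h * φ z}
  add_mem' := fun ha hb h z => by simp [ha h z, hb h z, mul_add]
  zero_mem' := by simp
  smul_mem' := fun r φ hφ h z => by simp [hφ h z, mul_left_comm]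

variable {H M} in
lemma rightDiag_tmul {V : Type u} [AddCommGroup V] [Module ℂ V] [Module H V] [IsScalarTower ℂ H V]
    {n : ℕ} (h : H) (m : M) (x : TP V n) {ι : Type*} (s : Finset ι) (l r : ι → H)
    (hs : comul (R := ℂ) h = ∑ i ∈ s, l i ⊗ₜ r i) :
    rightDiag H M V n h (m ⊗ₜ x) =
      ∑ i ∈ s, (MulOpposite.op (l i) • m) ⊗ₜ[ℂ] diagAct H V n (antipode ℂ (r i)) x := by
  simp [rightDiag, hs]

variable {H M} in
lemma mem_invForms_iff {V : Type u} [AddCommGroup V] [Module ℂ V] [Module H V]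
    [IsScalarTower ℂ H V] {n : ℕ} (φ : Module.Dual ℂ (M ⊗[ℂ] TP V n)) :
    φ ∈ invForms H M V n ↔ relSub H V M n ≤ LinearMap.ker φ := by
  constructor
  · intro hφ
    rw [relSub, Submodule.span_le]
    rintro _ ⟨h, m, x, rfl⟩
    rw [SetLike.mem_coe, LinearMap.mem_ker, map_sub, sub_eq_zero]
    let F : H ⊗[ℂ] (H ⊗[ℂ] H) →ₗ[ℂ] ℂ := φ ∘ₗ TensorProduct.map ((rAct H M).flip m)
      ((diagAct H V n).toLinearMap.flip x ∘ₗ LinearMap.mul' ℂ H ∘ₗ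
        (antipode ℂ (A := H)).rTensor H)
    have h1 : F ((comul (R := ℂ)).lTensor H (comul h)) = φ ((MulOpposite.op h • m) ⊗ₜ x) := by
      have e : F ∘ₗ (comul (R := ℂ)).lTensor H = φ ∘ₗ TensorProduct.map ((rAct H M).flip m)
          ((diagAct H V n).toLinearMap.flip x ∘ₗ Algebra.linearMap ℂ H ∘ₗ
            counit (R := ℂ) (A := H)) := by
        rw [← HopfAlgebra.mul_antipode_rTensor_comul]
        ext a b
        rfl
      have e2 : ∀ t : H ⊗[ℂ] H, (φ ∘ₗ TensorProduct.map ((rAct H M).flip m)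
          ((diagAct H V n).toLinearMap.flip x ∘ₗ Algebra.linearMap ℂ H ∘ₗ
            counit (R := ℂ) (A := H))) t =
          φ ((MulOpposite.op (TensorProduct.rid ℂ H ((counit (R := ℂ)).lTensor H t)) • m) ⊗ₜ x) := by
        intro t
        induction t with
        | zero => simp
        | add s t hs ht =>
          rw [map_add, hs, ht, map_add, map_add, MulOpposite.op_add, add_smul,
            TensorProduct.add_tmul, map_add]
        | tmul a b =>
          simp [Algebra.algebraMap_eq_smul_one, smul_assoc, ← TensorProduct.smul_tmul']
      have := LinearMap.congr_fun e (comul (R := ℂ) h)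
      rw [LinearMap.comp_apply] at this
      rw [this, e2, Coalgebra.lTensor_counit_comul]
      simp
    have h2 : ∀ t : H ⊗[ℂ] H, F (TensorProduct.assoc ℂ H H H ((comul (R := ℂ)).rTensor H t)) =
        φ (m ⊗ₜ diagAct H V n (TensorProduct.lid ℂ H ((counit (R := ℂ)).rTensor H t)) x) := by
      intro t
      induction t with
      | zero => simp
      | add s t hs ht => simp only [map_add, hs, ht, LinearMap.add_apply, TensorProduct.tmul_add]
      | tmul a b =>
        have h3 := hφ a (m ⊗ₜ diagAct H V n b x)
        obtain ⟨s, hs⟩ := TensorProduct.exists_finset (comul (R := ℂ) a)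
        rw [rightDiag_tmul a m _ s (fun i => i.1) (fun i => i.2) hs] at h3
        rw [LinearMap.rTensor_tmul, LinearMap.rTensor_tmul, TensorProduct.lid_tmul, map_smul,
          LinearMap.smul_apply, TensorProduct.tmul_smul, map_smul, smul_eq_mul, ← h3, hs]
        simp [F, TensorProduct.sum_tmul]
    rw [← h1, ← Coalgebra.coassoc_apply, h2, Coalgebra.rTensor_counit_comul]
    simp
  · intro hφ h z
    induction z with
    | zero => simp
    | add s t hs ht => simp only [map_add, hs, ht, mul_add]
    | tmul m x =>
      obtain ⟨s, hs⟩ := TensorProduct.exists_finset (comul (R := ℂ) h)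
      rw [rightDiag_tmul h m x s (fun i => i.1) (fun i => i.2) hs, map_sum]
      have h1 : ∀ i ∈ s, φ ((MulOpposite.op i.1 • m) ⊗ₜ[ℂ] diagAct H V n (antipode ℂ i.2) x) =
          φ (m ⊗ₜ diagAct H V n (i.1 * antipode ℂ i.2) x) := by
        intro i _
        have h2 := hφ (Submodule.subset_span ⟨i.1, m, diagAct H V n (antipode ℂ i.2) x, rfl⟩)
        rw [LinearMap.mem_ker, map_sub, sub_eq_zero] at h2
        rw [h2, map_mul]
        rfl
      rw [Finset.sum_congr rfl h1, ← map_sum, ← TensorProduct.tmul_sum]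
      have h3 : ∑ i ∈ s, i.1 * antipode ℂ i.2 = counit (R := ℂ) h • (1 : H) := by
        rw [← Algebra.algebraMap_eq_smul_one, ← HopfAlgebra.mul_antipode_lTensor_comul_apply, hs]
        simp
      have h4 : ∑ i ∈ s, diagAct H V n (i.1 * antipode ℂ i.2) x = counit (R := ℂ) h • x := by
        rw [← LinearMap.sum_apply, ← map_sum, h3, map_smul, map_one]
        rfl
      rw [h4, TensorProduct.tmul_smul, map_smul, smul_eq_mul]

/-- The transpose `φ ↦ φ ∘ F`. -/
def invFormsMap {V : Type u} [AddCommGroup V] [Module ℂ V] [Module H V] [IsScalarTower ℂ H V]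
    {n k : ℕ} (F : M ⊗[ℂ] TP V n →ₗ[ℂ] M ⊗[ℂ] TP V k)
    (hF : relSub H V M n ≤ (relSub H V M k).comap F) :
    invForms H M V k →ₗ[ℂ] invForms H M V n :=
  F.dualMap.restrict fun φ hφ => by
    rw [mem_invForms_iff] at hφ ⊢
    exact fun z hz => hφ (hF hz)

variable (A : Type u) [Ring A] [Algebra ℂ A] [Module H A] [IsScalarTower ℂ H A] [ModuleAlgebra H A]
variable [SAYD H M] [BijectiveAntipode H]

/-- The cocyclic module `Cⁿ_H(A, M) = Hom_H(M ⊗ A^{⊗ (n + 1)}, ℂ)` of a module algebra: `δᵢ`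
multiplies `aⁱ` and `aⁱ⁺¹` for `i ≤ n`,
`(δₙ₊₁ φ)(m ⊗ a⁰ ⊗ ⋯ ⊗ aⁿ⁺¹) = φ(m₍₀₎ ⊗ (S⁻¹(m₍₋₁₎) aⁿ⁺¹) a⁰ ⊗ a¹ ⊗ ⋯ ⊗ aⁿ)`, `σⱼ` inserts `1`
behind `aʲ`, and `(τ φ)(m ⊗ a⁰ ⊗ ⋯ ⊗ aⁿ) = φ(m₍₀₎ ⊗ S⁻¹(m₍₋₁₎) aⁿ ⊗ a⁰ ⊗ ⋯ ⊗ aⁿ⁻¹)`. -/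
abbrev algData : CocyclicData.{max u v} where
  obj n := invForms H M A (n + 1)
  δ n i :=
    if i ≤ n then invFormsMap H M ((mulAt n i).lTensor M) (lTensor_relSub (mulAt_equivariant n i))
    else invFormsMap H M ((mulAt n 0).lTensor M ∘ₗ cycInv H M A (n + 1)) (by
      rw [Submodule.comap_comp]
      exact (cycInv_relSub (n + 1)).trans
        (Submodule.comap_mono (lTensor_relSub (mulAt_equivariant n 0))))
  σ n j := invFormsMap H M ((oneAt (n + 1) (j + 1)).lTensor M)
    (lTensor_relSub (oneAt_equivariant (n + 1) (j + 1)))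
  τ n := invFormsMap H M (cycInv H M A n) (cycInv_relSub n)

end Algebras

section Plain
variable (B : Type u) [Ring B] [Algebra ℂ B]

/-- `b⁰ ⊗ ⋯ ⊗ bⁿ ↦ bⁿ ⊗ b⁰ ⊗ ⋯ ⊗ bⁿ⁻¹`. -/
def rotate (n : ℕ) : TP B (n + 1) →ₗ[ℂ] TP B (n + 1) :=
  (consE B n).toLinearMap ∘ₗ (TensorProduct.comm ℂ (TP B n) B).toLinearMap ∘ₗ
    (snocE B n).symm.toLinearMap

/-- The cocyclic module `Cⁿ(B) = Hom(B^{⊗ (n + 1)}, ℂ)` of an algebra. -/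
abbrev plainData : CocyclicData.{u} where
  obj n := Module.Dual ℂ (TP B (n + 1))
  δ n i := if i ≤ n then (mulAt n i).dualMap else (mulAt n 0 ∘ₗ rotate B (n + 1)).dualMap
  σ n j := (oneAt (n + 1) (j + 1)).dualMap
  τ n := (rotate B n).dualMap

end Plain

section Convolution
variable (H : Type u) [Ring H] [HopfAlgebra ℂ H]
variable (C : Type u) [AddCommGroup C] [Module ℂ C] [Coalgebra ℂ C] [Module H C]
  [IsScalarTower ℂ H C]
variable (A : Type u) [Ring A] [Algebra ℂ A] [Module H A] [IsScalarTower ℂ H A]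

/-- An action of an `H`-module coalgebra `C` on an `H`-module algebra `A`:
`(h c) a = h (c a)`, `c (a b) = (c₍₁₎ a) (c₍₂₎ b)` and `c 1 = ε(c) 1`. -/
structure CoalgebraAction where
  act : C →ₗ[ℂ] A →ₗ[ℂ] A
  smul_act : ∀ (h : H) (c : C) (a : A), act (h • c) a = h • act c a
  act_mul : ∀ (c : C) (a b : A),
    act c (a * b) = LinearMap.mul' ℂ A (TensorProduct.map₂ act act (comul c) (a ⊗ₜ b))
  act_one : ∀ c : C, act c 1 = counit (R := ℂ) c • (1 : A)

variable [ModuleCoalgebra H C] [ModuleAlgebra H A]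

/-- The convolution algebra `Hom_H(C, A)`, with `(f * g)(c) = f(c₍₁₎) g(c₍₂₎)` and unit `η ε`. -/
def convAlg : Subalgebra ℂ (WithConv (C →ₗ[ℂ] A)) where
  carrier := {f | ∀ (h : H) (c : C), f.ofConv (h • c) = h • f.ofConv c}
  mul_mem' := by
    intro f g hf hg h c
    change LinearMap.mul' ℂ A (TensorProduct.map f.ofConv g.ofConv (comul (h • c))) =
      h • LinearMap.mul' ℂ A (TensorProduct.map f.ofConv g.ofConv (comul c))
    rw [ModuleCoalgebra.comul_smul]
    generalize comul (R := ℂ) c = t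
    induction t with
    | zero => simp
    | add s t hs ht => simp only [map_add, hs, ht, smul_add]
    | tmul c d =>
      rw [TensorProduct.map_tmul, LinearMap.mul'_apply, ModuleAlgebra.smul_mul]
      generalize comul (R := ℂ) h = t
      induction t with
      | zero => simp
      | add s t hs ht => simp only [map_add, LinearMap.add_apply, hs, ht]
      | tmul a b => simp [hf a c, hg b d]
  add_mem' := by
    intro f g hf hg h c
    change f.ofConv (h • c) + g.ofConv (h • c) = h • (f.ofConv c + g.ofConv c)
    rw [hf, hg, smul_add]
  algebraMap_mem' := by
    intro r h c
    change r • algebraMap ℂ A (counit (R := ℂ) (h • c)) =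
      h • (r • algebraMap ℂ A (counit (R := ℂ) c))
    rw [ModuleCoalgebra.counit_smul, Algebra.algebraMap_eq_smul_one,
      Algebra.algebraMap_eq_smul_one, smul_comm h r, smul_comm h, ModuleAlgebra.smul_one,
      smul_smul (counit (R := ℂ) c), mul_comm]

variable {H C A}

/-- The algebra map `A → Hom_H(C, A)`, `a ↦ (c ↦ c(a))`. -/
def CoalgebraAction.natural (α : CoalgebraAction H C A) : A →ₐ[ℂ] convAlg H C A :=
  AlgHom.ofLinearMap
    { toFun := fun a => ⟨WithConv.toConv (α.act.flip a), fun h c => α.smul_act h c a⟩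
      map_add' := fun a b => by
        apply Subtype.ext
        apply WithConv.ofConv_injective
        exact map_add α.act.flip a b
      map_smul' := fun r a => by
        apply Subtype.ext
        apply WithConv.ofConv_injective
        exact map_smul α.act.flip r a }
    (by
      apply Subtype.ext
      apply WithConv.ofConv_injective
      refine LinearMap.ext fun c => ?_
      change α.act c 1 = algebraMap ℂ A (counit (R := ℂ) c)
      rw [α.act_one, Algebra.algebraMap_eq_smul_one])
    (by
      intro a b
      apply Subtype.ext
      apply WithConv.ofConv_injective
      refine LinearMap.ext fun c => ?_
      change α.act c (a * b) =
        LinearMap.mul' ℂ A (TensorProduct.map (α.act.flip a) (α.act.flip b) (comul c))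
      rw [α.act_mul]
      congr 1
      generalize comul (R := ℂ) c = t
      induction t with
      | zero => simp
      | add s t hs ht => simp only [map_add, LinearMap.add_apply, hs, ht]
      | tmul c d => rfl)

end Convolution

section SelfAction
variable (H : Type u) [Ring H] [HopfAlgebra ℂ H]

/-- A Hopf algebra is a module coalgebra over itself by left multiplication. -/
instance : ModuleCoalgebra H H where
  comul_smul h c := by
    rw [smul_eq_mul, Bialgebra.comul_mul]
    generalize comul (R := ℂ) h = s
    generalize comul (R := ℂ) c = t
    induction s with
    | zero => simp
    | add s s' hs hs' => simp only [map_add, LinearMap.add_apply, add_mul, hs, hs']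
    | tmul a b =>
      induction t with
      | zero => simp
      | add t t' ht ht' => simp only [map_add, mul_add, ht, ht']
      | tmul c d => simp
  counit_smul h c := by rw [smul_eq_mul, Bialgebra.counit_mul]

variable (A : Type u) [Ring A] [Algebra ℂ A] [Module H A] [IsScalarTower ℂ H A] [ModuleAlgebra H A]

/-- The action of the module coalgebra `H` on an `H`-module algebra. -/
def selfAction : CoalgebraAction H H A where
  act := (lAct H A).toLinearMap
  smul_act h c a := mul_smul h c a
  act_mul c a b := ModuleAlgebra.smul_mul c a b
  act_one c := ModuleAlgebra.smul_one c

end SelfAction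

section Relative
variable (H : Type u) [Ring H] [HopfAlgebra ℂ H]

/-- A sub-Hopf algebra. -/
structure SubHopf extends Subalgebra ℂ H where
  comul_mem : ∀ k ∈ toSubalgebra, comul (R := ℂ) k ∈ LinearMap.range
    (TensorProduct.map toSubalgebra.val.toLinearMap toSubalgebra.val.toLinearMap)
  antipode_mem : ∀ k ∈ toSubalgebra, antipode ℂ k ∈ toSubalgebra

variable {H}

/-- The left ideal `H K⁺`, generated by the elements `k - ε(k) 1` with `k` in `K`. -/
def SubHopf.relIdeal (K : SubHopf H) : Submodule H H :=
  Submodule.span H {x | ∃ k ∈ K.toSubalgebra, x = k - counit (R := ℂ) k • (1 : H)}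

/-- The coalgebra `H ⊗_K ℂ = H / H K⁺`. -/
abbrev SubHopf.Rel (K : SubHopf H) : Type u := H ⧸ K.relIdeal

lemma SubHopf.mk_mul (K : SubHopf H) (h k : H) (hk : k ∈ K.toSubalgebra) :
    (Submodule.Quotient.mk (h * k) : K.Rel) =
      Submodule.Quotient.mk (counit (R := ℂ) k • h) := by
  rw [Submodule.Quotient.eq]
  have : h * k - counit (R := ℂ) k • h = h • (k - counit (R := ℂ) k • (1 : H)) := by
    rw [smul_eq_mul, mul_sub, mul_smul_comm, mul_one]
  rw [this]
  exact Submodule.smul_mem _ _ (Submodule.subset_span ⟨k, hk, rfl⟩)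

/-- The projection `H → H ⊗_K ℂ`. -/
def SubHopf.proj (K : SubHopf H) : H →ₗ[ℂ] K.Rel := K.relIdeal.mkQ.restrictScalars ℂ

lemma SubHopf.map_proj_mul (K : SubHopf H) (s t : H ⊗[ℂ] H) :
    TensorProduct.map K.proj K.proj (s * t) =
      TensorProduct.map₂ (lAct H K.Rel).toLinearMap (lAct H K.Rel).toLinearMap s
        (TensorProduct.map K.proj K.proj t) := by
  induction s with
  | zero => simp
  | add s s' hs hs' => simp only [map_add, LinearMap.add_apply, add_mul, hs, hs']
  | tmul a b =>
    induction t with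
    | zero => simp
    | add t t' ht ht' => simp only [map_add, mul_add, ht, ht']
    | tmul c d =>
      simp [SubHopf.proj]
      rfl

lemma SubHopf.map_proj_comul (K : SubHopf H) (k : H) (hk : k ∈ K.toSubalgebra) :
    TensorProduct.map K.proj K.proj (comul k) =
      counit (R := ℂ) k • TensorProduct.map K.proj K.proj (1 ⊗ₜ 1) := by
  obtain ⟨t, ht⟩ := K.comul_mem k hk
  have h1 : ∀ t : K.toSubalgebra ⊗[ℂ] K.toSubalgebra, TensorProduct.map K.proj K.proj
      (TensorProduct.map K.toSubalgebra.val.toLinearMap K.toSubalgebra.val.toLinearMap t) =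
      counit (R := ℂ) (TensorProduct.lid ℂ H ((counit (R := ℂ)).rTensor H
        (TensorProduct.map K.toSubalgebra.val.toLinearMap K.toSubalgebra.val.toLinearMap t))) •
          TensorProduct.map K.proj K.proj (1 ⊗ₜ 1) := by
    intro t
    induction t with
    | zero => simp
    | add s t hs ht => simp only [map_add, hs, ht, add_smul]
    | tmul a b =>
      have e : ∀ a : K.toSubalgebra, K.proj a = counit (R := ℂ) (a : H) • K.proj 1 := by
        intro a
        have := K.mk_mul 1 a a.2
        rw [one_mul] at this
        rw [← map_smul]
        exact this
      simp [e a, e b, TensorProduct.smul_tmul', TensorProduct.tmul_smul, smul_smul, mul_comm]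
  rw [← ht, h1, ht, Coalgebra.rTensor_counit_comul]
  simp

lemma SubHopf.map_proj_comul_eq_zero (K : SubHopf H) (x : H) (hx : x ∈ K.relIdeal) :
    TensorProduct.map K.proj K.proj (comul (R := ℂ) x) = 0 := by
  induction hx using Submodule.span_induction with
  | mem x h =>
    obtain ⟨k, hk, rfl⟩ := h
    rw [map_sub, map_sub, K.map_proj_comul k hk, map_smul, map_smul, Bialgebra.comul_one]
    exact sub_self _
  | zero => simp
  | add x y _ _ h1 h2 => rw [map_add, map_add, h1, h2, add_zero]
  | smul a x _ h1 => rw [smul_eq_mul, Bialgebra.comul_mul, K.map_proj_mul, h1, map_zero]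

instance (K : SubHopf H) : (K.relIdeal.restrictScalars ℂ).IsCoideal where
  counit_eq_zero x hx := by
    replace hx : x ∈ K.relIdeal := hx
    induction hx using Submodule.span_induction with
    | mem x h => obtain ⟨k, hk, rfl⟩ := h; simp
    | zero => simp
    | add x y _ _ h1 h2 => rw [map_add, h1, h2, add_zero]
    | smul a x _ h1 => rw [smul_eq_mul, Bialgebra.counit_mul, h1, mul_zero]
  map_mkQ_comul_eq_zero x hx := K.map_proj_comul_eq_zero x hx

/-- The coalgebra structure of `H ⊗_K ℂ`, the quotient of the one of `H`. -/
instance (K : SubHopf H) : Coalgebra ℂ K.Rel :=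
  inferInstanceAs (Coalgebra ℂ (H ⧸ K.relIdeal.restrictScalars ℂ))

instance (K : SubHopf H) : ModuleCoalgebra H K.Rel where
  comul_smul h c := by
    induction c using Submodule.Quotient.induction_on with
    | H c =>
      change TensorProduct.map K.proj K.proj (comul (R := ℂ) (h * c)) = 
        TensorProduct.map₂ _ _ _ (TensorProduct.map K.proj K.proj (comul (R := ℂ) c))
      rw [Bialgebra.comul_mul, K.map_proj_mul]
  counit_smul h c := by
    induction c using Submodule.Quotient.induction_on with
    | H c => exact Bialgebra.counit_mul h c

variable (A : Type u) [Ring A] [Algebra ℂ A] [Module H A] [IsScalarTower ℂ H A] [ModuleAlgebra H A]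

/-- The subalgebra `A^K = {a | k a = ε(k) a for all k in K}`. -/
def SubHopf.invAlg (K : SubHopf H) : Subalgebra ℂ A where
  carrier := {a | ∀ k ∈ K.toSubalgebra, k • a = counit (R := ℂ) k • a}
  mul_mem' := by
    intro a b ha hb k hk
    obtain ⟨t, ht⟩ := K.comul_mem k hk
    have h1 : ∀ t : K.toSubalgebra ⊗[ℂ] K.toSubalgebra, LinearMap.mul' ℂ A
        (TensorProduct.map₂ (lAct H A).toLinearMap (lAct H A).toLinearMap
          (TensorProduct.map K.toSubalgebra.val.toLinearMap K.toSubalgebra.val.toLinearMap t)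
          (a ⊗ₜ b)) =
        counit (R := ℂ) (TensorProduct.lid ℂ H ((counit (R := ℂ)).rTensor H
          (TensorProduct.map K.toSubalgebra.val.toLinearMap K.toSubalgebra.val.toLinearMap t))) •
            (a * b) := by
      intro t
      induction t with
      | zero => simp
      | add s t hs ht => simp only [map_add, LinearMap.add_apply, hs, ht, add_smul]
      | tmul k k' => simp [ha k.1 k.2, hb k'.1 k'.2, smul_smul, mul_comm]
    rw [ModuleAlgebra.smul_mul, ← ht, h1, ht, Coalgebra.rTensor_counit_comul]
    simp
  add_mem' := fun ha hb k hk => by rw [smul_add, smul_add, ha k hk, hb k hk]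
  algebraMap_mem' := fun r k hk => by
    rw [Algebra.algebraMap_eq_smul_one, smul_comm k r, ModuleAlgebra.smul_one, smul_comm]

end Relative

section ConnesMoscovici
variable (H : Type u) [Ring H] [HopfAlgebra ℂ H]

/-- The twisted antipode `S_δ(h) = δ(h₍₁₎) S(h₍₂₎)`. -/
def twistedAntipode (δ : H →ₐ[ℂ] ℂ) : H →ₗ[ℂ] H :=
  LinearMap.mul' ℂ H ∘ₗ
    TensorProduct.map (Algebra.linearMap ℂ H ∘ₗ δ.toLinearMap) (antipode ℂ) ∘ₗ comul

/-- A modular pair in involution: a character `δ` and a group-like element `σ` with `δ(σ) = 1` and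
`S_δ² = Ad σ`. -/
structure ModularPair where
  δ : H →ₐ[ℂ] ℂ
  σ : H
  groupLike : IsGroupLikeElem ℂ σ
  δ_σ : δ σ = 1
  involution : ∀ h, twistedAntipode H δ (twistedAntipode H δ h) = σ * h * antipode ℂ σ

variable {H}

lemma twistedAntipode_mul (δ : H →ₐ[ℂ] ℂ) (a b : H) :
    twistedAntipode H δ (a * b) = twistedAntipode H δ b * twistedAntipode H δ a := by
  simp only [twistedAntipode, LinearMap.comp_apply, Bialgebra.comul_mul]
  generalize comul (R := ℂ) a = s
  generalize comul (R := ℂ) b = t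
  induction s with
  | zero => simp
  | add s s' hs hs' => simp only [add_mul, map_add, mul_add, hs, hs']
  | tmul a a' =>
    induction t with
    | zero => simp
    | add t t' ht ht' => simp only [add_mul, map_add, mul_add, ht, ht']
    | tmul b b' =>
      simp [antipode_mul_antidistrib, Algebra.algebraMap_eq_smul_one, smul_smul]

lemma mul_twistedAntipode (δ : H →ₐ[ℂ] ℂ) (h : H) :
    LinearMap.mul' ℂ H ((twistedAntipode H δ).rTensor H (comul h)) = algebraMap ℂ H (δ h) := by
  let F : H ⊗[ℂ] (H ⊗[ℂ] H) →ₗ[ℂ] H := LinearMap.mul' ℂ H ∘ₗ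
    TensorProduct.map (Algebra.linearMap ℂ H ∘ₗ δ.toLinearMap)
      (LinearMap.mul' ℂ H ∘ₗ (antipode ℂ).rTensor H)
  have h1 : ∀ t : H ⊗[ℂ] H, LinearMap.mul' ℂ H ((twistedAntipode H δ).rTensor H t) =
      F (TensorProduct.assoc ℂ H H H ((comul (R := ℂ)).rTensor H t)) := by
    intro t
    induction t with
    | zero => simp
    | add s t hs ht => simp only [map_add, hs, ht]
    | tmul a b =>
      simp only [LinearMap.rTensor_tmul, twistedAntipode, LinearMap.comp_apply]
      generalize comul (R := ℂ) a = s
      induction s with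
      | zero => simp
      | add s t hs ht => simp only [map_add, TensorProduct.add_tmul, hs, ht]
      | tmul a a' => simp [F, mul_assoc]
  have h2 : F ∘ₗ (comul (R := ℂ)).lTensor H = LinearMap.mul' ℂ H ∘ₗ
      TensorProduct.map (Algebra.linearMap ℂ H ∘ₗ δ.toLinearMap) (Algebra.linearMap ℂ H) ∘ₗ
        (counit (R := ℂ) (A := H)).lTensor H := by
    ext a b
    simp [F, HopfAlgebra.mul_antipode_rTensor_comul_apply]
  rw [h1, Coalgebra.coassoc_apply, ← LinearMap.comp_apply, h2,
    LinearMap.comp_apply, LinearMap.comp_apply, Coalgebra.lTensor_counit_comul]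
  simp

/-- The ground field as a right-left module-comodule `^σℂ_δ`. -/
@[nolint unusedArguments]
def ModularPair.Coeff (_ : ModularPair H) : Type := ℂ

instance (p : ModularPair H) : AddCommGroup p.Coeff := inferInstanceAs (AddCommGroup ℂ)

instance (p : ModularPair H) : Module ℂ p.Coeff := inferInstanceAs (Module ℂ ℂ)

/-- `z h = δ(h) z`. -/
instance (p : ModularPair H) : Module Hᵐᵒᵖ p.Coeff where
  smul h z := p.δ h.unop • z
  one_smul z := by
    change p.δ 1 • z = z
    rw [map_one, one_smul]
  mul_smul g h z := by
    change p.δ (h.unop * g.unop) • z = p.δ g.unop • p.δ h.unop • z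
    rw [map_mul, mul_comm, mul_smul]
  smul_zero h := smul_zero (p.δ h.unop)
  smul_add h z z' := smul_add (p.δ h.unop) z z'
  add_smul g h z := by
    change p.δ (g.unop + h.unop) • z = p.δ g.unop • z + p.δ h.unop • z
    rw [map_add, add_smul]
  zero_smul z := by
    change p.δ 0 • z = 0
    rw [map_zero, zero_smul]

instance (p : ModularPair H) : IsScalarTower ℂ Hᵐᵒᵖ p.Coeff where
  smul_assoc r h z := by
    change p.δ (r • h.unop) • z = r • p.δ h.unop • z
    rw [map_smul, smul_eq_mul, mul_smul]

lemma ModularPair.op_smul (p : ModularPair H) (h : H) (z : p.Coeff) :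
    MulOpposite.op h • z = p.δ h • z := rfl

lemma ModularPair.antiYD_aux (p : ModularPair H) (h : H) (z : p.Coeff) :
    antiYDMap H p.Coeff ((comul (R := ℂ)).lTensor H (comul h)) (p.σ ⊗ₜ z) =
      (p.δ h • p.σ) ⊗ₜ z := by
  let T := twistedAntipode H p.δ
  have h1 : ∀ t : H ⊗[ℂ] H, antiYDMap H p.Coeff ((comul (R := ℂ)).lTensor H t) (p.σ ⊗ₜ z) =
      (T (LinearMap.mul' ℂ H (T.rTensor H t)) * p.σ) ⊗ₜ z := by
    intro t
    induction t with
    | zero => simp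
    | add s t hs ht =>
      simp only [map_add, LinearMap.add_apply, hs, ht, add_mul, TensorProduct.add_tmul]
    | tmul a b =>
      have e : T (LinearMap.mul' ℂ H (T.rTensor H (a ⊗ₜ b))) * p.σ = T b * (p.σ * a) := by
        rw [LinearMap.rTensor_tmul, LinearMap.mul'_apply, twistedAntipode_mul, p.involution,
          mul_assoc, mul_assoc, p.groupLike.antipode_mul_cancel, mul_one]
      rw [e, LinearMap.lTensor_tmul]
      simp only [T, twistedAntipode, LinearMap.comp_apply]
      generalize comul (R := ℂ) b = s
      induction s with
      | zero => simp
      | add s t hs ht =>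
        simp only [map_add, LinearMap.add_apply, TensorProduct.tmul_add, add_mul,
          TensorProduct.add_tmul, hs, ht]
      | tmul b c =>
        rw [antiYDMap_tmul, p.op_smul, TensorProduct.tmul_smul, TensorProduct.smul_tmul']
        simp [Algebra.algebraMap_eq_smul_one]
  have hT1 : T 1 = 1 := by simp [T, twistedAntipode, Algebra.TensorProduct.one_def]
  rw [h1, mul_twistedAntipode, Algebra.algebraMap_eq_smul_one, map_smul, hT1, smul_mul_assoc,
    one_mul]

/-- The identity, as a map from `ℂ` to the coefficients. -/
def ModularPair.coeff (p : ModularPair H) : ℂ ≃ₗ[ℂ] p.Coeff := LinearEquiv.refl ℂ ℂ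

/-- The left coaction is `z ↦ σ ⊗ z`. -/
instance (p : ModularPair H) : SAYD H p.Coeff where
  coact := TensorProduct.mk ℂ H p.Coeff p.σ
  coassoc z := by simp [p.groupLike.comul_eq_tmul_self]
  counit_coact z := by simp [p.groupLike.counit_eq_one]
  stable z := by
    rw [TensorProduct.mk_apply, TensorProduct.lift.tmul, rAct_apply, p.op_smul, p.δ_σ, one_smul]
  antiYD z h := by
    rw [TensorProduct.mk_apply, TensorProduct.mk_apply, rAct_apply, p.op_smul, p.antiYD_aux,
      TensorProduct.smul_tmul]

/-- `x ↦ x ⊗ v`. -/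
def snocR {V : Type u} [AddCommGroup V] [Module ℂ V] (v : V) (n : ℕ) :
    TP V n →ₗ[ℂ] TP V (n + 1) where
  toFun x := snoc x v
  map_add' x y := add_snoc x y v
  map_smul' r x := smul_snoc r x v

/-- `Δ` at the `i`-th factor, `1 ≤ i ≤ n`. -/
def cmInner : (n i : ℕ) → TP H n →ₗ[ℂ] TP H (n + 1)
  | 0, _ => 0
  | n + 1, i => comulAt n (i - 1)

/-- `τₙ(h¹ ⊗ ⋯ ⊗ hⁿ) = S_δ(h¹) (h² ⊗ ⋯ ⊗ hⁿ ⊗ σ)`, and `τ₀ = id`. -/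
def ModularPair.cmCyc (p : ModularPair H) : (n : ℕ) → TP H n →ₗ[ℂ] TP H n
  | 0 => LinearMap.id
  | n + 1 => TensorProduct.lift
      (((diagAct H H (n + 1)).toLinearMap ∘ₗ twistedAntipode H p.δ).compl₂ (snocR p.σ n)) ∘ₗ
        (consE H n).symm.toLinearMap

/-- The Connes-Moscovici cocyclic module of `(H, δ, σ)`, with `H^{⊗ n}` in degree `n`. -/
abbrev ModularPair.cmData (p : ModularPair H) : CocyclicData.{u} where
  obj n := TP H n
  δ n i := if i = 0 then oneAt n 0 else if i ≤ n then cmInner n i else snocR p.σ n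
  σ n j := counitAt n j
  τ n := p.cmCyc n

/-- A `δ`-invariant `σ`-trace: `tr(h a) = δ(h) tr(a)` and `tr(a b) = tr(b (σ a))`. -/
structure ModularPair.InvTrace (p : ModularPair H) (A : Type u) [Ring A] [Algebra ℂ A]
    [Module H A] [IsScalarTower ℂ H A] where
  tr : A →ₗ[ℂ] ℂ
  tr_smul : ∀ (h : H) (a : A), tr (h • a) = p.δ h * tr a
  tr_mul : ∀ a b : A, tr (a * b) = tr (b * (p.σ • a))

end ConnesMoscovici
end HopfCocyclic

end HopfCyclic
end

/-!
The theorem has three ingredients: the calculus of natural operations, which gives the cyclic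
Alexander-Whitney maps and their uniqueness up to what cohomology sees; the verification that the
Hopf-cyclic objects are cocyclic modules and that the pairings respect the structure; and the
comparison with the characteristic map of Connes and Moscovici.

**Natural operations.** A natural linear map `Xᵖ → Xʳ` between the terms of cocyclic modules is an
element of degree `r` of the free cocyclic module on a generator of degree `p` (`free`, `NatOp`),
and a natural map `Xᵖ ⊗ Y^q → Xʳ ⊗ Yʳ` is an element of the tensor product of two such spaces. For
fixed `r`, composition with `B` and with `b` on the source makes `NatOp p r` into a mixed complex
with the roles of `b` and `B` exchanged (`opData`). Composition with `b` is exact, except for one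
class in each of the source degrees `0` and `1`: the vertex operation `δᵣ ⋯ δ₁`, and its composite
with `B` (`decompose_zero`, `exact_one`, `exact_succ`). To see this, move all cyclic operators of an
operation next to its argument, so that it becomes a combination `θ` of cosimplicial operations
modulo `1 - λ` (`mem_simplicialPart`). If the operation kills `b`, then so does `θ` on all
cosimplicial modules, because every cosimplicial module is a quotient of a cocyclic one, the cofree
one, along which cochains have `λ`-invariant lifts (`evalC_b_eq_zero`). A cosimplicial operation
that kills boundaries factors through `b` by the contraction `σ₀ θ` on the décalage (`exists_cone`),
and a chase in the bicomplex with the differentials `b`, `b'`, `1 - λ`, `N` removes the part with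
`1 - λ` (`chase`). The two exceptional classes are detected by the values on two test cocycles (`test`)
in one cocyclic module.

**Alexander-Whitney maps.** A cyclic Alexander-Whitney map is a solution, in operations of two
variables, of a linear equation whose leading term is prescribed (`IsCyclicAW`). The homotopy of the
preceding paragraph solves such equations step by step (`perturb_spec`), provided that the harmonic
part of each right-hand side is zero. Only the source degrees `(p, q)` with `p, q ≤ 1` can have a
harmonic part, and there it is a number that the test cocycles compute. For the defect of the
classical map all these numbers vanish (`harmonic_awCorrection`), which gives existence
(`nonempty_cyclicAW`). For the difference of two solutions there is one obstruction, in bidegree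
`(1, 1)` with values in degree `0`; it is removed by subtracting a multiple of the solution composed
with `B ⊗ B` (`IsCyclicAW.exists_homotopy`). On exterior products of cocycles this last term is a
coboundary, since `uB` is homotopic to zero on the total complex (`restr_famB_mem_bdry`). Hence the
cup products do not depend on the choice (`CyclicAW.cup_eq`). The same argument in one variable
shows that the cup product with a cocycle of degree zero is the naive product
(`CyclicAW.cup_ofZero`).

**Hopf-cyclic cochains.** For cocyclic modules it is enough to check the identities that do not
involve the last coface, together with the rules for `τ` (`IsCocyclic.of_reduced`). The rule
`τⁿ⁺¹ = 1` expresses stability: the power of the rotation multiplies by the coaction on all factors at once,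
which modulo the action of `H` is the identity (`mkQ_cyc_pow`). The maps `Ψ_c`, `Ψ` and `Ψ_r` are
instances of one construction, for a coalgebra `C` that acts on an algebra `F` with values in `A`
(`ActionInto.pairingHom`). It commutes with `τ` because the twist by `S⁻¹(m₍₋₁₎)` on the side of the
algebra undoes the twist by `m₍₋₁₎` on the side of the coalgebra (`coeffPow_cyc`).

**The characteristic map.** The map `𝓘` has the inverse `x ↦ 1 ⊗ 1 ⊗ x` (`coinvInv`), so the
identities of the Connes-Moscovici module follow from those of `C*_H(H, ^σℂ_δ)`
(`IsCocyclic.of_surjective`). The iterated cofaces of the cocycle `φ` are the forms `z tr(a⁰ ⋯ aⁿ)`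
(`vertex_cochain`), so that `χ` is the composite of `𝓘⁻¹`, the product with `φ` and `Ψ` (`charHom`).
It is therefore a map of cocyclic modules, and it computes the cup product with `[φ]`
(`cup_cochain`).
-/

noncomputable section
namespace HopfCyclic

/-! ### The mixed complex of a cocyclic module -/

/-- The identities `b² = 0`, `B² = 0` and `b B + B b = 0` of a mixed complex. -/
structure MixedData.IsMixed (X : MixedData.{w}) : Prop where
  b_b : ∀ n x, X.b (n + 1) (X.b n x) = 0
  B_B : ∀ n x, X.B n (X.B (n + 1) x) = 0
  b_B : ∀ n x, X.b n (X.B n x) + X.B (n + 1) (X.b (n + 1) x) = 0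
  B_b_zero : ∀ x, X.B 0 (X.b 0 x) = 0

namespace CocyclicData

section Operators
variable (X : CocyclicData.{w})

/-- The signed cyclic operator `λ = (-1)ⁿ τ` on `Xⁿ`. -/
def lam (n : ℕ) : X.obj n →ₗ[ℂ] X.obj n := (-1 : ℂ) ^ n • X.τ n

/-- The norm operator `1 + λ + ⋯ + λⁿ` on `Xⁿ`. -/
def norm (n : ℕ) : X.obj n →ₗ[ℂ] X.obj n := ∑ i ∈ Finset.range (n + 1), X.lam n ^ i

/-- The differential `b' = ∑_{i ≤ n} (-1)ⁱ δᵢ`, which omits the last coface. -/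
def bPrime (n : ℕ) : X.obj n →ₗ[ℂ] X.obj (n + 1) :=
  ∑ i ∈ Finset.range (n + 1), (-1 : ℂ) ^ i • X.δ n i

/-- The extra codegeneracy `σₙ τₙ₊₁`. -/
def extra (n : ℕ) : X.obj (n + 1) →ₗ[ℂ] X.obj n := X.σ n n ∘ₗ X.τ (n + 1)

lemma mixed_B_apply (n : ℕ) (x : X.obj (n + 1)) :
    X.mixed.B n x = X.norm n (X.extra n (x - X.lam (n + 1) x)) := rfl

lemma mixed_b_apply (n : ℕ) (x : X.obj n) :
    X.mixed.b n x = ∑ i ∈ Finset.range (n + 2), (-1 : ℂ) ^ i • X.δ n i x := by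
  simp [LinearMap.sum_apply]

lemma bPrime_apply (n : ℕ) (x : X.obj n) :
    X.bPrime n x = ∑ i ∈ Finset.range (n + 1), (-1 : ℂ) ^ i • X.δ n i x := by
  simp [bPrime, LinearMap.sum_apply]

lemma norm_apply (n : ℕ) (x : X.obj n) :
    X.norm n x = ∑ i ∈ Finset.range (n + 1), (X.lam n ^ i) x := by
  simp [norm, LinearMap.sum_apply]

end Operators

section Laws
variable {X : CocyclicData.{w}} (hX : X.IsCocyclic)
include hX

lemma IsCocyclic.lam_pow (n : ℕ) : X.lam n ^ (n + 1) = 1 := by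
  rw [lam, smul_pow, hX.τ_pow, ← pow_mul, Even.neg_one_pow (Nat.even_mul_succ_self n), one_smul]

lemma IsCocyclic.norm_mul (n : ℕ) : X.norm n * (1 - X.lam n) = 0 := by
  rw [norm, geom_sum_mul_neg, hX.lam_pow, sub_self]

lemma IsCocyclic.mul_norm (n : ℕ) : (1 - X.lam n) * X.norm n = 0 := by
  rw [norm, mul_neg_geom_sum, hX.lam_pow, sub_self]

lemma IsCocyclic.norm_sub_lam (n : ℕ) (x : X.obj n) : X.norm n (x - X.lam n x) = 0 :=
  LinearMap.congr_fun (hX.norm_mul n) x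

lemma IsCocyclic.norm_lam (n : ℕ) (x : X.obj n) : X.norm n (X.lam n x) = X.norm n x := by
  have := hX.norm_sub_lam n x
  rw [map_sub, sub_eq_zero] at this
  exact this.symm

lemma IsCocyclic.lam_norm (n : ℕ) (x : X.obj n) : X.lam n (X.norm n x) = X.norm n x :=
  (sub_eq_zero.1 (LinearMap.congr_fun (hX.mul_norm n) x)).symm

lemma IsCocyclic.lam_δ (n i : ℕ) (hi : i ≤ n) (x : X.obj n) :
    X.lam (n + 1) (X.δ n (i + 1) x) = -X.δ n i (X.lam n x) := by
  have := LinearMap.congr_fun (hX.τ_δ n (i + 1) (by omega) (by omega)) x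
  simp only [LinearMap.comp_apply, Nat.add_sub_cancel] at this
  simp [lam, this, pow_succ]

lemma IsCocyclic.lam_δ_zero (n : ℕ) (x : X.obj n) :
    X.lam (n + 1) (X.δ n 0 x) = (-1 : ℂ) ^ (n + 1) • X.δ n (n + 1) x := by
  rw [← hX.τ_δ_zero]; rfl

lemma IsCocyclic.b_sub_lam (n : ℕ) (x : X.obj n) :
    X.mixed.b n x - X.lam (n + 1) (X.mixed.b n x) = X.bPrime n (x - X.lam n x) := by
  have h1 : X.lam (n + 1) (X.mixed.b n x) =
      (-1 : ℂ) ^ (n + 1) • X.δ n (n + 1) x + X.bPrime n (X.lam n x) := by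
    rw [mixed_b_apply, Finset.sum_range_succ', map_add, map_sum, bPrime_apply, pow_zero, one_smul,
      hX.lam_δ_zero]
    refine (add_comm _ _).trans (congrArg₂ (· + ·) rfl ?_)
    refine Finset.sum_congr rfl fun i hi => ?_
    rw [map_smul, hX.lam_δ n i (by simp at hi; omega), smul_neg, pow_succ]
    simp
  rw [h1, mixed_b_apply, Finset.sum_range_succ, ← bPrime_apply, map_sub]
  abel

omit hX in
lemma norm_of_lam_eq (n : ℕ) (x : X.obj n) (h : X.lam n x = x) :
    X.norm n x = ((n + 1 : ℕ) : ℂ) • x := by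
  have : ∀ i, (X.lam n ^ i) x = x := by
    intro i
    induction i with
    | zero => rfl
    | succ i ih => rw [pow_succ', Module.End.mul_apply, ih, h]
  rw [norm_apply, Finset.sum_congr rfl fun i _ => this i]
  simp only [Finset.sum_const, Finset.card_range, ← Nat.cast_smul_eq_nsmul ℂ]

/-- `b N = N b'`. Both sides agree with `N δ₀ N`, because `N δᵢ = -N δᵢ₋₁` on the image of `N`. -/
lemma IsCocyclic.b_norm (n : ℕ) (x : X.obj n) :
    X.mixed.b n (X.norm n x) = X.norm (n + 1) (X.bPrime n x) := by
  set y := X.norm n x with hy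
  have hly : X.lam n y = y := hX.lam_norm n x
  have h1 : ∀ i, i ≤ n + 1 → X.norm (n + 1) ((-1 : ℂ) ^ i • X.δ n i y) =
      X.norm (n + 1) (X.δ n 0 y) := by
    intro i
    induction i with
    | zero => intro _; simp
    | succ i ih =>
      intro hi
      rw [← ih (by omega), ← hX.norm_lam (n + 1) ((-1 : ℂ) ^ (i + 1) • X.δ n (i + 1) y), map_smul,
        hX.lam_δ n i (by omega), hly, pow_succ]
      simp
  have h2 : X.norm (n + 1) (X.mixed.b n y) = ((n + 2 : ℕ) : ℂ) • X.norm (n + 1) (X.δ n 0 y) := by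
    rw [mixed_b_apply, map_sum, Finset.sum_congr rfl fun i hi => h1 i (by simp at hi; omega)]
    simp only [Finset.sum_const, Finset.card_range, ← Nat.cast_smul_eq_nsmul ℂ]
  have h3 : X.norm (n + 1) (X.bPrime n y) = ((n + 1 : ℕ) : ℂ) • X.norm (n + 1) (X.δ n 0 y) := by
    rw [bPrime_apply, map_sum, Finset.sum_congr rfl fun i hi => h1 i (by simp at hi; omega)]
    simp only [Finset.sum_const, Finset.card_range, ← Nat.cast_smul_eq_nsmul ℂ]
  have h4 : ∀ z, X.norm (n + 1) (X.bPrime n (X.lam n z)) = X.norm (n + 1) (X.bPrime n z) := by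
    intro z
    have := hX.norm_sub_lam (n + 1) (X.mixed.b n z)
    rw [hX.b_sub_lam, map_sub, map_sub, sub_eq_zero] at this
    exact this.symm
  have h5 : X.norm (n + 1) (X.bPrime n y) = ((n + 1 : ℕ) : ℂ) • X.norm (n + 1) (X.bPrime n x) := by
    have : ∀ i, X.norm (n + 1) (X.bPrime n ((X.lam n ^ i) x)) = X.norm (n + 1) (X.bPrime n x) := by
      intro i
      induction i with
      | zero => rfl
      | succ i ih => rw [pow_succ', Module.End.mul_apply, h4, ih]
    rw [hy, norm_apply X n, map_sum, map_sum, Finset.sum_congr rfl fun i _ => this i]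
    simp only [Finset.sum_const, Finset.card_range, ← Nat.cast_smul_eq_nsmul ℂ]
  have h6 : X.norm (n + 1) (X.mixed.b n y) = ((n + 2 : ℕ) : ℂ) • X.mixed.b n y := by
    apply norm_of_lam_eq
    have := hX.b_sub_lam n y
    rw [hly, sub_self, map_zero, sub_eq_zero] at this
    exact this.symm
  have e1 : X.mixed.b n y = X.norm (n + 1) (X.δ n 0 y) :=
    smul_right_injective _ (by exact_mod_cast (n + 1).succ_ne_zero : ((n + 2 : ℕ) : ℂ) ≠ 0)
      (h6.symm.trans h2)
  have e2 : X.norm (n + 1) (X.bPrime n x) = X.norm (n + 1) (X.δ n 0 y) :=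
    smul_right_injective _ (by exact_mod_cast n.succ_ne_zero : ((n + 1 : ℕ) : ℂ) ≠ 0)
      (h5.symm.trans h3)
  rw [e1, e2]

lemma IsCocyclic.extra_δ_zero (n : ℕ) (x : X.obj n) : X.extra n (X.δ n 0 x) = x := by
  have h1 := LinearMap.congr_fun (hX.τ_δ_zero n) x
  have h2 := LinearMap.congr_fun (hX.σ_δ_succ n n le_rfl) x
  simp only [LinearMap.comp_apply] at h1 h2
  rw [extra, LinearMap.comp_apply, h1, h2]; rfl

lemma IsCocyclic.extra_δ_succ (n i : ℕ) (hi : i ≤ n) (x : X.obj (n + 1)) :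
    X.extra (n + 1) (X.δ (n + 1) (i + 1) x) = X.δ n i (X.extra n x) := by
  have h1 := LinearMap.congr_fun (hX.τ_δ (n + 1) (i + 1) (by omega) (by omega)) x
  have h2 := LinearMap.congr_fun (hX.σ_δ_lt n i (n + 1) (by omega) (by omega)) (X.τ (n + 1) x)
  simp only [LinearMap.comp_apply, Nat.add_sub_cancel] at h1 h2
  rw [extra, LinearMap.comp_apply, h1, h2]; rfl

lemma IsCocyclic.extra_bPrime_zero (x : X.obj 0) : X.extra 0 (X.bPrime 0 x) = x := by
  simp [bPrime, hX.extra_δ_zero]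

lemma IsCocyclic.extra_bPrime (n : ℕ) (x : X.obj (n + 1)) :
    X.extra (n + 1) (X.bPrime (n + 1) x) + X.bPrime n (X.extra n x) = x := by
  rw [bPrime_apply, Finset.sum_range_succ', bPrime_apply, map_add, map_sum]
  have : ∀ i ∈ Finset.range (n + 1), X.extra (n + 1) ((-1 : ℂ) ^ (i + 1) • X.δ (n + 1) (i + 1) x) =
      -((-1 : ℂ) ^ i • X.δ n i (X.extra n x)) := by
    intro i hi
    rw [map_smul, hX.extra_δ_succ n i (by simp at hi; omega), pow_succ]
    simp
  rw [Finset.sum_congr rfl this, Finset.sum_neg_distrib, pow_zero, one_smul, hX.extra_δ_zero]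
  abel

/-- The cancellation behind `b² = 0` and `b'² = 0`. -/
lemma IsCocyclic.alternating_sum (n N : ℕ) (hN : N ≤ n + 2) (x : X.obj n) :
    ∑ j ∈ Finset.range (N + 1), (-1 : ℂ) ^ j • X.δ (n + 1) j
      (∑ i ∈ Finset.range N, (-1 : ℂ) ^ i • X.δ n i x) = 0 := by
  simp only [map_sum, map_smul, Finset.smul_sum, smul_smul, ← pow_add]
  rw [← Finset.sum_product', ← Finset.sum_filter_add_sum_filter_not _
    (fun p : ℕ × ℕ => p.2 < p.1), add_eq_zero_iff_eq_neg, ← Finset.sum_neg_distrib]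
  refine Finset.sum_bij' (fun p _ => (p.2, p.1 - 1)) (fun p _ => (p.2 + 1, p.1)) ?_ ?_ ?_ ?_ ?_
  · rintro ⟨j, i⟩ h
    simp at h ⊢; omega
  · rintro ⟨j, i⟩ h
    simp at h ⊢; omega
  · rintro ⟨j, i⟩ h
    simp at h ⊢; omega
  · rintro ⟨j, i⟩ h
    simp
  · rintro ⟨j, i⟩ h
    simp at h
    have h1 := LinearMap.congr_fun (hX.δ_δ n i j h.2 (by omega)) x
    simp only [LinearMap.comp_apply] at h1
    rw [h1, ← neg_smul]
    congr 1
    obtain ⟨j, rfl⟩ : ∃ k, j = k + 1 := ⟨j - 1, by omega⟩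
    simp only [Nat.add_sub_cancel]
    ring

lemma IsCocyclic.b_b (n : ℕ) (x : X.obj n) : X.mixed.b (n + 1) (X.mixed.b n x) = 0 := by
  rw [mixed_b_apply X n x, mixed_b_apply]
  exact hX.alternating_sum n (n + 2) le_rfl x

lemma IsCocyclic.bPrime_bPrime (n : ℕ) (x : X.obj n) :
    X.bPrime (n + 1) (X.bPrime n x) = 0 := by
  rw [bPrime_apply X n x, bPrime_apply]
  exact hX.alternating_sum n (n + 1) (by omega) x

/-- The mixed complex of a cocyclic module: `b B + B b = N (b' s + s b') (1 - λ) = 0`, where `s` is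
the extra codegeneracy. -/
lemma IsCocyclic.isMixed : X.mixed.IsMixed where
  b_b := hX.b_b
  B_B n x := by
    rw [mixed_B_apply, mixed_B_apply, hX.lam_norm, sub_self, map_zero, map_zero]
  b_B n x := by
    rw [mixed_B_apply, mixed_B_apply, hX.b_sub_lam, hX.b_norm, ← map_add,
      add_comm (X.bPrime n _), hX.extra_bPrime, hX.norm_sub_lam]
  B_b_zero x := by
    rw [mixed_B_apply, hX.b_sub_lam, hX.extra_bPrime_zero, hX.norm_sub_lam]

end Laws

/-- The cocyclic identities follow from those which do not involve the last cofaces: the last coface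
is `τ δ₀`, and `τ` is invertible. -/
lemma IsCocyclic.of_reduced (X : CocyclicData.{w})
    (δ_δ : ∀ n i j x, i < j → j ≤ n + 1 →
      X.δ (n + 1) j (X.δ n i x) = X.δ (n + 1) i (X.δ n (j - 1) x))
    (σ_σ : ∀ n i j x, i ≤ j → j ≤ n →
      X.σ n j (X.σ (n + 1) i x) = X.σ n i (X.σ (n + 1) (j + 1) x))
    (σ_δ_lt : ∀ n i j x, i < j → j ≤ n + 1 →
      X.σ (n + 1) j (X.δ (n + 1) i x) = X.δ n i (X.σ n (j - 1) x))
    (σ_δ_self : ∀ n j x, j ≤ n → X.σ n j (X.δ n j x) = x)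
    (σ_δ_succ : ∀ n j x, j + 1 ≤ n → X.σ n j (X.δ n (j + 1) x) = x)
    (σ_δ_gt : ∀ n i j x, j + 1 < i → i ≤ n + 1 →
      X.σ (n + 1) j (X.δ (n + 1) i x) = X.δ n (i - 1) (X.σ n j x))
    (τ_δ : ∀ n i x, i + 1 ≤ n → X.τ (n + 1) (X.δ n (i + 1) x) = X.δ n i (X.τ n x))
    (τ_δ_zero : ∀ n x, X.τ (n + 1) (X.δ n 0 x) = X.δ n (n + 1) x)
    (τ_σ : ∀ n i x, i + 1 ≤ n → X.τ n (X.σ n (i + 1) x) = X.σ n i (X.τ (n + 1) x))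
    (τ_pow : ∀ n, X.τ n ^ (n + 1) = 1)
    (σ_δ_zero : ∀ x, X.σ 0 0 (X.δ 0 1 x) = x) : X.IsCocyclic := by
  have inv : ∀ n x, X.τ n ((X.τ n ^ n) x) = x := fun n x => by
    rw [← Module.End.mul_apply, ← pow_succ', τ_pow]; rfl
  have inv' : ∀ n x, (X.τ n ^ n) (X.τ n x) = x := fun n x => by
    rw [← Module.End.mul_apply, ← pow_succ, τ_pow]; rfl
  have surj : ∀ n x, ∃ y, x = X.τ n y := fun n x => ⟨_, (inv n x).symm⟩
  have inj : ∀ n x y, X.τ n x = X.τ n y → x = y := fun n x y h => by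
    rw [← inv' n x, h, inv']
  have powδ : ∀ n i x, i ≤ n → (X.τ (n + 1) ^ i) (X.δ n i x) = X.δ n 0 ((X.τ n ^ i) x) := by
    intro n i
    induction i with
    | zero => intro x _; rfl
    | succ i ih =>
      intro x hi
      rw [pow_succ, Module.End.mul_apply, τ_δ n i x hi, ih _ (by omega), pow_succ]; rfl
  have powσ : ∀ n i x, i ≤ n → (X.τ n ^ i) (X.σ n i x) = X.σ n 0 ((X.τ (n + 1) ^ i) x) := by
    intro n i
    induction i with
    | zero => intro x _; rfl
    | succ i ih =>
      intro x hi
      rw [pow_succ, Module.End.mul_apply, τ_σ n i x hi, ih _ (by omega), pow_succ]; rfl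
  -- `τ² δ₀ = δₙ τ`
  have τ_last : ∀ n x, X.τ (n + 1) (X.δ n (n + 1) x) = X.δ n n (X.τ n x) := by
    intro n x
    rw [← τ_δ_zero]
    have h := powδ n n (X.τ n x) le_rfl
    rw [inv'] at h
    rw [← h, ← Module.End.mul_apply, ← Module.End.mul_apply, mul_assoc, ← pow_succ', ← pow_succ',
      τ_pow (n + 1)]
    rfl
  have τ_δ' : ∀ n i x, i ≤ n → X.τ (n + 1) (X.δ n (i + 1) x) = X.δ n i (X.τ n x) := by
    intro n i x hi
    rcases hi.lt_or_eq with h | rfl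
    · exact τ_δ n i x h
    · exact τ_last i x
  have τ_σ_zero : ∀ n x, X.τ n (X.σ n 0 x) = X.σ n n (X.τ (n + 1) (X.τ (n + 1) x)) := by
    intro n x
    have h := powσ n n (X.τ (n + 1) (X.τ (n + 1) x)) le_rfl
    have e : (X.τ (n + 1) ^ n) (X.τ (n + 1) (X.τ (n + 1) x)) = x := by
      rw [← Module.End.mul_apply, ← Module.End.mul_apply, ← pow_succ, ← pow_succ, τ_pow]; rfl
    rw [e] at h
    rw [← h, inv]
  have σ_δ_last : ∀ n x, X.σ n n (X.δ n (n + 1) x) = x := by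
    intro n x
    rcases n with _ | n
    · exact σ_δ_zero x
    · obtain ⟨y, rfl⟩ := surj _ x
      rw [← τ_δ_zero, ← τ_δ' _ _ _ (Nat.zero_le _), ← τ_σ_zero, σ_δ_succ _ _ _ (by omega)]
  refine ⟨?_, ?_, ?_, ?_, ?_, ?_, ?_, ?_, ?_, ?_, ?_⟩
  · intro n i j hij hj
    refine LinearMap.ext fun x => ?_
    simp only [LinearMap.comp_apply]
    rcases hj.lt_or_eq with h | rfl
    · exact δ_δ n i j x hij (by omega)
    · rw [← τ_δ_zero (n + 1) (X.δ n i x)]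
      rcases (show i ≤ n + 1 by omega).lt_or_eq with h | rfl
      · have := δ_δ n 0 (i + 1) x (by omega) (by omega)
        rw [Nat.add_sub_cancel] at this
        rw [← this, τ_δ' _ _ _ (by omega), τ_δ_zero]
        rfl
      · rw [show n + 2 - 1 = n + 1 from rfl, ← τ_δ_zero n x, ← τ_δ' _ _ _ le_rfl,
          ← τ_δ_zero (n + 1), ← τ_δ' (n + 1) 0 _ (Nat.zero_le _),
          δ_δ n 0 1 x (by omega) (by omega)]
  · intro n i j hij hj
    exact LinearMap.ext fun x => σ_σ n i j x hij hj
  · intro n i j hij hj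
    exact LinearMap.ext fun x => σ_δ_lt n i j x hij hj
  · intro n j hj
    exact LinearMap.ext fun x => σ_δ_self n j x hj
  · intro n j hj
    refine LinearMap.ext fun x => ?_
    rcases hj.lt_or_eq with h | rfl
    · exact σ_δ_succ n j x h
    · exact σ_δ_last j x
  · intro n i j hij hi
    refine LinearMap.ext fun x => ?_
    simp only [LinearMap.comp_apply]
    rcases hi.lt_or_eq with h | rfl
    · exact σ_δ_gt n i j x hij (by omega)
    · rw [← τ_δ_zero (n + 1), ← τ_σ _ _ _ (by omega), σ_δ_lt _ _ _ _ (by omega) (by omega),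
        τ_δ_zero]
      rfl
  · intro n i h1 hi
    obtain ⟨i, rfl⟩ : ∃ k, i = k + 1 := ⟨i - 1, by omega⟩
    exact LinearMap.ext fun x => τ_δ' n i x (by omega)
  · intro n
    exact LinearMap.ext fun x => τ_δ_zero n x
  · intro n i h1 hi
    obtain ⟨i, rfl⟩ : ∃ k, i = k + 1 := ⟨i - 1, by omega⟩
    exact LinearMap.ext fun x => τ_σ n i x (by omega)
  · intro n
    exact LinearMap.ext fun x => τ_σ_zero n x
  · exact τ_pow

lemma IsCocyclic.diag {X : CocyclicData.{w}} {Y : CocyclicData.{w'}} (hX : X.IsCocyclic)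
    (hY : Y.IsCocyclic) : (X.diag Y).IsCocyclic where
  δ_δ n i j h h' := by simp only [← TensorProduct.map_comp, hX.δ_δ n i j h h', hY.δ_δ n i j h h']
  σ_σ n i j h h' := by simp only [← TensorProduct.map_comp, hX.σ_σ n i j h h', hY.σ_σ n i j h h']
  σ_δ_lt n i j h h' := by
    simp only [← TensorProduct.map_comp, hX.σ_δ_lt n i j h h', hY.σ_δ_lt n i j h h']
  σ_δ_self n j h := by
    simp only [← TensorProduct.map_comp, hX.σ_δ_self n j h, hY.σ_δ_self n j h,
      TensorProduct.map_id]
  σ_δ_succ n j h := by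
    simp only [← TensorProduct.map_comp, hX.σ_δ_succ n j h, hY.σ_δ_succ n j h,
      TensorProduct.map_id]
  σ_δ_gt n i j h h' := by
    simp only [← TensorProduct.map_comp, hX.σ_δ_gt n i j h h', hY.σ_δ_gt n i j h h']
  τ_δ n i h h' := by simp only [← TensorProduct.map_comp, hX.τ_δ n i h h', hY.τ_δ n i h h']
  τ_δ_zero n := by simp only [← TensorProduct.map_comp, hX.τ_δ_zero n, hY.τ_δ_zero n]
  τ_σ n i h h' := by simp only [← TensorProduct.map_comp, hX.τ_σ n i h h', hY.τ_σ n i h h']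
  τ_σ_zero n := by simp only [← TensorProduct.map_comp, hX.τ_σ_zero n, hY.τ_σ_zero n]
  τ_pow n := by
    rw [TensorProduct.map_pow, hX.τ_pow, hY.τ_pow]
    exact TensorProduct.map_id

namespace Hom
variable {X X' X'' : CocyclicData.{w}} {Y Y' : CocyclicData.{w'}}

/-- The tensor product of two maps of cocyclic modules, on the diagonal. -/
def diag (f : X.Hom X') (g : Y.Hom Y') : (X.diag Y).Hom (X'.diag Y') where
  app n := TensorProduct.map (f.app n) (g.app n)
  app_δ n i h := by simp only [← TensorProduct.map_comp, f.app_δ n i h, g.app_δ n i h]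
  app_σ n i h := by simp only [← TensorProduct.map_comp, f.app_σ n i h, g.app_σ n i h]
  app_τ n := by simp only [← TensorProduct.map_comp, f.app_τ n, g.app_τ n]

lemma app_lam {X : CocyclicData.{w}} {Y : CocyclicData.{w'}} (f : X.Hom Y) (n : ℕ) (x : X.obj n) :
    f.app n (X.lam n x) = Y.lam n (f.app n x) := by
  simpa [lam] using congrArg ((-1 : ℂ) ^ n • ·) (LinearMap.congr_fun (f.app_τ n) x)

end Hom
end CocyclicData

namespace MixedData
variable {X : MixedData.{w}} {Y : MixedData.{w'}}

section TensorAux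
variable {V₁ V₂ V₃ V₄ W W₁ W₂ : Type*} [AddCommGroup V₁] [Module ℂ V₁] [AddCommGroup V₂] [Module ℂ V₂]
  [AddCommGroup V₃] [Module ℂ V₃] [AddCommGroup V₄] [Module ℂ V₄] [AddCommGroup W] [Module ℂ W]
  [AddCommGroup W₁] [Module ℂ W₁] [AddCommGroup W₂] [Module ℂ W₂]

lemma rTensor_rTensor_eq_zero {f : V₂ →ₗ[ℂ] V₃} {g : V₁ →ₗ[ℂ] V₂} (h : ∀ x, f (g x) = 0)
    (t : V₁ ⊗[ℂ] W) : f.rTensor W (g.rTensor W t) = 0 := by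
  rw [← LinearMap.rTensor_comp_apply, show f ∘ₗ g = 0 from LinearMap.ext h, LinearMap.rTensor_zero]
  rfl

lemma lTensor_lTensor_eq_zero {f : V₂ →ₗ[ℂ] V₃} {g : V₁ →ₗ[ℂ] V₂} (h : ∀ x, f (g x) = 0)
    (t : W ⊗[ℂ] V₁) : f.lTensor W (g.lTensor W t) = 0 := by
  rw [← LinearMap.lTensor_comp_apply, show f ∘ₗ g = 0 from LinearMap.ext h, LinearMap.lTensor_zero]
  rfl

lemma rTensor_add_rTensor_eq_zero {f : V₂ →ₗ[ℂ] V₃} {g : V₁ →ₗ[ℂ] V₂} {f' : V₄ →ₗ[ℂ] V₃}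
    {g' : V₁ →ₗ[ℂ] V₄} (h : ∀ x, f (g x) + f' (g' x) = 0)
    (t : V₁ ⊗[ℂ] W) : f.rTensor W (g.rTensor W t) + f'.rTensor W (g'.rTensor W t) = 0 := by
  rw [← LinearMap.rTensor_comp_apply, ← LinearMap.rTensor_comp_apply, ← LinearMap.add_apply,
    ← LinearMap.rTensor_add, show f ∘ₗ g + f' ∘ₗ g' = 0 from LinearMap.ext h,
    LinearMap.rTensor_zero]
  rfl

lemma lTensor_add_lTensor_eq_zero {f : V₂ →ₗ[ℂ] V₃} {g : V₁ →ₗ[ℂ] V₂} {f' : V₄ →ₗ[ℂ] V₃}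
    {g' : V₁ →ₗ[ℂ] V₄} (h : ∀ x, f (g x) + f' (g' x) = 0)
    (t : W ⊗[ℂ] V₁) : f.lTensor W (g.lTensor W t) + f'.lTensor W (g'.lTensor W t) = 0 := by
  rw [← LinearMap.lTensor_comp_apply, ← LinearMap.lTensor_comp_apply, ← LinearMap.add_apply,
    ← LinearMap.lTensor_add, show f ∘ₗ g + f' ∘ₗ g' = 0 from LinearMap.ext h,
    LinearMap.lTensor_zero]
  rfl

lemma rTensor_lTensor (f : V₁ →ₗ[ℂ] V₂) (g : W₁ →ₗ[ℂ] W₂) (t : V₁ ⊗[ℂ] W₁) :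
    f.rTensor W₂ (g.lTensor V₁ t) = g.lTensor V₂ (f.rTensor W₁ t) := by
  rw [← LinearMap.comp_apply, LinearMap.rTensor_comp_lTensor, ← LinearMap.comp_apply,
    LinearMap.lTensor_comp_rTensor]

end TensorAux

variable (X Y) in
/-- The component `(p, q)` of an element of the tensor product. -/
abbrev tensorAt {n : ℕ} (z : (X.tensor Y).obj n) (p q : ℕ) (h : p + q = n) :
    X.obj p ⊗[ℂ] Y.obj q := z ⟨(p, q), h⟩

lemma tensor_obj_ext {n : ℕ} {z z' : (X.tensor Y).obj n}
    (h : ∀ p q h, X.tensorAt Y z p q h = X.tensorAt Y z' p q h) : z = z' := by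
  funext ⟨⟨p, q⟩, hs⟩
  exact h p q hs

lemma tensorAt_b {n : ℕ} (z : (X.tensor Y).obj n) (p q : ℕ) (h : p + q = n + 1) :
    X.tensorAt Y ((X.tensor Y).b n z) p q h = X.bLeft Y z p q h + X.bRight Y z p q h := rfl

lemma tensorAt_B {n : ℕ} (z : (X.tensor Y).obj (n + 1)) (p q : ℕ) (h : p + q = n) :
    X.tensorAt Y ((X.tensor Y).B n z) p q h =
      (-1 : ℂ) ^ q • (X.B p).rTensor (Y.obj q) (X.tensorAt Y z (p + 1) q (by omega)) +
        (Y.B q).lTensor (X.obj p) (X.tensorAt Y z p (q + 1) (by omega)) := rfl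

lemma bLeft_zero {n : ℕ} (z : (X.tensor Y).obj n) (q : ℕ) (h : 0 + q = n + 1) :
    X.bLeft Y z 0 q h = 0 := rfl

lemma bLeft_succ {n : ℕ} (z : (X.tensor Y).obj n) (p q : ℕ) (h : p + 1 + q = n + 1) :
    X.bLeft Y z (p + 1) q h = (-1 : ℂ) ^ q • (X.b p).rTensor (Y.obj q)
      (X.tensorAt Y z p q (by omega)) := rfl

lemma bRight_zero {n : ℕ} (z : (X.tensor Y).obj n) (p : ℕ) (h : p + 0 = n + 1) :
    X.bRight Y z p 0 h = 0 := rfl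

lemma bRight_succ {n : ℕ} (z : (X.tensor Y).obj n) (p q : ℕ) (h : p + (q + 1) = n + 1) :
    X.bRight Y z p (q + 1) h = (Y.b q).lTensor (X.obj p) (X.tensorAt Y z p q (by omega)) := rfl

lemma tensorAt_zero {n p q : ℕ} (h : p + q = n) :
    X.tensorAt Y (0 : (X.tensor Y).obj n) p q h = 0 := rfl

lemma tensorAt_add {n p q : ℕ} (z z' : (X.tensor Y).obj n) (h : p + q = n) :
    X.tensorAt Y (z + z') p q h = X.tensorAt Y z p q h + X.tensorAt Y z' p q h := rfl

lemma neg_one_pow_smul_smul {V : Type*} [AddCommGroup V] [Module ℂ V] (n : ℕ) (x : V) :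
    (-1 : ℂ) ^ n • (-1 : ℂ) ^ n • x = x := by
  rw [smul_smul, ← mul_pow]; simp

/-- The tensor product of mixed complexes is a mixed complex. -/
lemma IsMixed.tensor (hX : X.IsMixed) (hY : Y.IsMixed) : (X.tensor Y).IsMixed where
  b_b n z := by
    refine tensor_obj_ext fun p q h => ?_
    rw [tensorAt_b, tensorAt_zero]
    rcases p with _ | p <;> rcases q with _ | q
    · omega
    · rw [bLeft_zero, bRight_succ, tensorAt_b]
      rcases q with _ | q
      · omega
      · rw [bLeft_zero, bRight_succ, zero_add, zero_add, lTensor_lTensor_eq_zero (hY.b_b q)]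
    · rw [bRight_zero, bLeft_succ, tensorAt_b]
      rcases p with _ | p
      · omega
      · rw [bRight_zero, bLeft_succ, add_zero, add_zero, map_smul,
          rTensor_rTensor_eq_zero (hX.b_b p), smul_zero, smul_zero]
    · rw [bLeft_succ, bRight_succ, tensorAt_b, tensorAt_b, map_add, map_add, smul_add, bRight_succ,
        bLeft_succ, map_smul, rTensor_lTensor, pow_succ]
      have e1 : (X.b p).rTensor (Y.obj (q + 1)) (X.bLeft Y z p (q + 1) (by omega)) = 0 := by
        rcases p with _ | p
        · rw [bLeft_zero, map_zero]
        · rw [bLeft_succ, map_smul, rTensor_rTensor_eq_zero (hX.b_b p), smul_zero]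
      have e2 : (Y.b q).lTensor (X.obj (p + 1)) (X.bRight Y z (p + 1) q (by omega)) = 0 := by
        rcases q with _ | q
        · rw [bRight_zero, map_zero]
        · rw [bRight_succ, lTensor_lTensor_eq_zero (hY.b_b q)]
      rw [e1, e2]
      simp
  B_B n z := by
    refine tensor_obj_ext fun p q h => ?_
    rw [tensorAt_B, tensorAt_zero, tensorAt_B, tensorAt_B, map_add, map_add, map_smul, map_smul,
      rTensor_rTensor_eq_zero (hX.B_B p), lTensor_lTensor_eq_zero (hY.B_B q), rTensor_lTensor,
      pow_succ]
    simp
  b_B n z := by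
    refine tensor_obj_ext fun p q h => ?_
    rw [tensorAt_add, tensorAt_zero, tensorAt_b, tensorAt_B, tensorAt_b, tensorAt_b, map_add,
      map_add, smul_add, bLeft_succ, bRight_succ, map_smul, neg_one_pow_smul_smul]
    have e1 : X.bLeft Y ((X.tensor Y).B n z) p q h + ((X.B p).rTensor (Y.obj q)
        ((X.b p).rTensor (Y.obj q) (X.tensorAt Y z p q (by omega))) +
        (Y.B q).lTensor (X.obj p) (X.bLeft Y z p (q + 1) (by omega))) = 0 := by
      rcases p with _ | p
      · rw [bLeft_zero, bLeft_zero, map_zero, rTensor_rTensor_eq_zero hX.B_b_zero]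
        simp
      · rw [bLeft_succ, bLeft_succ, tensorAt_B, map_add, smul_add, map_smul, map_smul,
          neg_one_pow_smul_smul, rTensor_lTensor, pow_succ]
        rw [← rTensor_add_rTensor_eq_zero (hX.b_B p) (X.tensorAt Y z (p + 1) q (by omega))]
        simp only [mul_neg, mul_one, neg_smul]
        abel
    have e2 : X.bRight Y ((X.tensor Y).B n z) p q h + ((-1 : ℂ) ^ q • (X.B p).rTensor (Y.obj q)
        (X.bRight Y z (p + 1) q (by omega)) + (Y.B q).lTensor (X.obj p)
        ((Y.b q).lTensor (X.obj p) (X.tensorAt Y z p q (by omega)))) = 0 := by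
      rcases q with _ | q
      · rw [bRight_zero, bRight_zero, map_zero, lTensor_lTensor_eq_zero hY.B_b_zero]
        simp
      · rw [bRight_succ, bRight_succ, tensorAt_B, map_add, map_smul, rTensor_lTensor, pow_succ]
        rw [← lTensor_add_lTensor_eq_zero (hY.b_B q) (X.tensorAt Y z p (q + 1) (by omega))]
        simp only [mul_neg, mul_one, neg_smul]
        abel
    rw [← add_zero (0 : X.obj p ⊗[ℂ] Y.obj q)]
    refine Eq.trans ?_ (congrArg₂ (· + ·) e1 e2)
    abel
  B_b_zero z := by
    refine tensor_obj_ext fun p q h => ?_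
    obtain ⟨rfl, rfl⟩ : p = 0 ∧ q = 0 := by omega
    rw [tensorAt_B, tensorAt_b, tensorAt_b, bLeft_zero, bRight_zero, bLeft_succ, bRight_succ,
      map_add, map_add, map_smul, rTensor_rTensor_eq_zero hX.B_b_zero,
      lTensor_lTensor_eq_zero hY.B_b_zero, map_zero, map_zero, add_zero, zero_add, smul_zero,
      add_zero]
    rfl

section Homotopy

/-- A homotopy `h` between the identity of the complex `(X, B)` and a map `P`. -/
structure Homotopy (X : MixedData.{w}) where
  h : ∀ p, X.obj p →ₗ[ℂ] X.obj (p + 1)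
  P : ∀ p, X.obj p →ₗ[ℂ] X.obj p
  B_h_zero : ∀ x, X.B 0 (h 0 x) = x - P 0 x
  B_h : ∀ p x, X.B (p + 1) (h (p + 1) x) + h p (X.B p x) = x - P (p + 1) x

/-- A homotopy between the identity of the complex `(X, B)` and a map `P` that vanishes on
boundaries and has values in the cycles. -/
structure Contraction (X : MixedData.{w}) extends Homotopy X where
  P_B : ∀ p x, P p (X.B p x) = 0
  B_P : ∀ p x, X.B p (P (p + 1) x) = 0

/-- The product of a sequence of mixed complexes. -/
abbrev pi (V : ℕ → MixedData.{w}) : MixedData.{w} where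
  obj n := ∀ r, (V r).obj n
  b n := LinearMap.pi fun r => (V r).b n ∘ₗ LinearMap.proj r
  B n := LinearMap.pi fun r => (V r).B n ∘ₗ LinearMap.proj r

lemma IsMixed.pi {V : ℕ → MixedData.{w}} (hV : ∀ r, (V r).IsMixed) :
    (MixedData.pi V).IsMixed where
  b_b n x := funext fun r => (hV r).b_b n (x r)
  B_B n x := funext fun r => (hV r).B_B n (x r)
  b_B n x := funext fun r => (hV r).b_B n (x r)
  B_b_zero x := funext fun r => (hV r).B_b_zero (x r)

/-- The product of homotopies. -/
abbrev Homotopy.pi {V : ℕ → MixedData.{w}} (c : ∀ r, (V r).Homotopy) :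
    (MixedData.pi V).Homotopy where
  h n := LinearMap.pi fun r => (c r).h n ∘ₗ LinearMap.proj r
  P n := LinearMap.pi fun r => (c r).P n ∘ₗ LinearMap.proj r
  B_h_zero x := funext fun r => (c r).B_h_zero (x r)
  B_h n x := funext fun r => (c r).B_h n (x r)

namespace Contraction
variable (c : X.Contraction)

/-- The homotopy of a contraction, as the raising operator of a mixed complex. -/
abbrev hData : MixedData.{w} := { X with b := c.h, B := fun _ => 0 }

/-- `(-1)^q h ⊗ 1`. -/
def hLeft (n : ℕ) : (X.tensor X).obj n →ₗ[ℂ] (X.tensor X).obj (n + 1) :=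
  (c.hData.tensor { X with b := fun _ => 0, B := fun _ => 0 }).b n

/-- `1 ⊗ h`. -/
def hRight (n : ℕ) : (X.tensor X).obj n →ₗ[ℂ] (X.tensor X).obj (n + 1) :=
  (tensor { X with b := fun _ => 0, B := fun _ => 0 } c.hData).b n

/-- `P ⊗ 1`. -/
def pLeft (n : ℕ) : (X.tensor X).obj n →ₗ[ℂ] (X.tensor X).obj n :=
  LinearMap.pi fun s => (c.P s.1.1).rTensor _ ∘ₗ LinearMap.proj s

/-- `P ⊗ P`. -/
def pBoth (n : ℕ) : (X.tensor X).obj n →ₗ[ℂ] (X.tensor X).obj n :=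
  LinearMap.pi fun s => TensorProduct.map (c.P s.1.1) (c.P s.1.2) ∘ₗ LinearMap.proj s

/-- The homotopy `(-1)^q h ⊗ 1 + P ⊗ h` between the identity and `P ⊗ P` on the tensor square. -/
def tensorH (n : ℕ) : (X.tensor X).obj n →ₗ[ℂ] (X.tensor X).obj (n + 1) :=
  c.hLeft n + c.pLeft (n + 1) ∘ₗ c.hRight n

lemma hLeft_zero {n : ℕ} (z : (X.tensor X).obj n) (q : ℕ) (h : 0 + q = n + 1) :
    X.tensorAt X (c.hLeft n z) 0 q h = 0 := by
  rcases q with _ | q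
  · omega
  · change 0 + (0 : X.obj q →ₗ[ℂ] X.obj (q + 1)).lTensor (X.obj 0) _ = _
    simp

lemma hLeft_succ {n : ℕ} (z : (X.tensor X).obj n) (p q : ℕ) (h : p + 1 + q = n + 1) :
    X.tensorAt X (c.hLeft n z) (p + 1) q h = (-1 : ℂ) ^ q • (c.h p).rTensor (X.obj q)
      (X.tensorAt X z p q (by omega)) := by
  rcases q with _ | q
  · exact add_zero _
  · change _ + (0 : X.obj q →ₗ[ℂ] X.obj (q + 1)).lTensor (X.obj (p + 1)) _ = _
    rw [LinearMap.lTensor_zero]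
    exact add_zero _

lemma hRight_zero {n : ℕ} (z : (X.tensor X).obj n) (p : ℕ) (h : p + 0 = n + 1) :
    X.tensorAt X (c.hRight n z) p 0 h = 0 := by
  rcases p with _ | p
  · omega
  · change (-1 : ℂ) ^ 0 • (0 : X.obj p →ₗ[ℂ] X.obj (p + 1)).rTensor (X.obj 0) _ + 0 = _
    simp

lemma hRight_succ {n : ℕ} (z : (X.tensor X).obj n) (p q : ℕ) (h : p + (q + 1) = n + 1) :
    X.tensorAt X (c.hRight n z) p (q + 1) h = (c.h q).lTensor (X.obj p)
      (X.tensorAt X z p q (by omega)) := by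
  rcases p with _ | p
  · exact zero_add _
  · change (-1 : ℂ) ^ (q + 1) • (0 : X.obj p →ₗ[ℂ] X.obj (p + 1)).rTensor (X.obj (q + 1)) _ + _ = _
    rw [LinearMap.rTensor_zero, LinearMap.zero_apply, smul_zero]
    exact zero_add _

lemma pLeft_apply {n : ℕ} (z : (X.tensor X).obj n) (p q : ℕ) (h : p + q = n) :
    X.tensorAt X (c.pLeft n z) p q h = (c.P p).rTensor _ (X.tensorAt X z p q h) := rfl

lemma pBoth_apply {n : ℕ} (z : (X.tensor X).obj n) (p q : ℕ) (h : p + q = n) :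
    X.tensorAt X (c.pBoth n z) p q h =
      TensorProduct.map (c.P p) (c.P q) (X.tensorAt X z p q h) := rfl

lemma tensorAt_tensorH {n : ℕ} (z : (X.tensor X).obj n) (p q : ℕ) (h : p + q = n + 1) :
    X.tensorAt X (c.tensorH n z) p q h = X.tensorAt X (c.hLeft n z) p q h +
      (c.P p).rTensor _ (X.tensorAt X (c.hRight n z) p q h) := rfl

lemma pBoth_eq {p q : ℕ} (t : X.obj p ⊗[ℂ] X.obj q) :
    TensorProduct.map (c.P p) (c.P q) t = (c.P p).rTensor _ ((c.P q).lTensor _ t) := by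
  rw [← LinearMap.comp_apply, LinearMap.rTensor_comp_lTensor]

lemma B_hLeft (n : ℕ) (z : (X.tensor X).obj n) (p q : ℕ) (h : p + q = n) :
    X.tensorAt X ((X.tensor X).B n (c.hLeft n z)) p q h =
      (X.B p).rTensor _ ((c.h p).rTensor _ (X.tensorAt X z p q h)) +
        (X.B q).lTensor _ (X.tensorAt X (c.hLeft n z) p (q + 1) (by omega)) := by
  rw [tensorAt_B, hLeft_succ, map_smul, neg_one_pow_smul_smul]

lemma B_tensorH_zero (z : (X.tensor X).obj 0) :
    (X.tensor X).B 0 (c.tensorH 0 z) = z - c.pBoth 0 z := by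
  refine tensor_obj_ext fun p q h => ?_
  obtain ⟨rfl, rfl⟩ : p = 0 ∧ q = 0 := by omega
  have h1 : ∀ {W : Type w} [AddCommGroup W] [Module ℂ W] (t : X.obj 0 ⊗[ℂ] W),
      (X.B 0).rTensor _ ((c.h 0).rTensor _ t) = t - (c.P 0).rTensor _ t := by
    intro W _ _ t
    rw [← LinearMap.rTensor_comp_apply,
      show X.B 0 ∘ₗ c.h 0 = LinearMap.id - c.P 0 from LinearMap.ext c.B_h_zero,
      LinearMap.rTensor_sub]
    simp
  have h2 : ∀ {W : Type w} [AddCommGroup W] [Module ℂ W] (t : W ⊗[ℂ] X.obj 0),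
      (X.B 0).lTensor _ ((c.h 0).lTensor _ t) = t - (c.P 0).lTensor _ t := by
    intro W _ _ t
    rw [← LinearMap.lTensor_comp_apply,
      show X.B 0 ∘ₗ c.h 0 = LinearMap.id - c.P 0 from LinearMap.ext c.B_h_zero,
      LinearMap.lTensor_sub]
    simp
  rw [tensorAt_B, tensorAt_tensorH, tensorAt_tensorH, hLeft_zero, hRight_zero, hLeft_succ,
    hRight_succ, map_zero, add_zero, zero_add ((c.P 0).rTensor _ _), ← rTensor_lTensor, h2, map_smul,
    neg_one_pow_smul_smul, h1,
    map_sub]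
  change _ = X.tensorAt X z 0 0 h - X.tensorAt X (c.pBoth 0 z) 0 0 h
  rw [pBoth_apply, pBoth_eq]
  simp

lemma B_tensorH (n : ℕ) (z : (X.tensor X).obj (n + 1)) :
    (X.tensor X).B (n + 1) (c.tensorH (n + 1) z) + c.tensorH n ((X.tensor X).B n z) =
      z - c.pBoth (n + 1) z := by
  refine tensor_obj_ext fun p q h => ?_
  have h1 : ∀ {W : Type w} [AddCommGroup W] [Module ℂ W] (t : X.obj 0 ⊗[ℂ] W),
      (X.B 0).rTensor _ ((c.h 0).rTensor _ t) = t - (c.P 0).rTensor _ t := by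
    intro W _ _ t
    rw [← LinearMap.rTensor_comp_apply,
      show X.B 0 ∘ₗ c.h 0 = LinearMap.id - c.P 0 from LinearMap.ext c.B_h_zero,
      LinearMap.rTensor_sub]
    simp
  have h2 : ∀ {W : Type w} [AddCommGroup W] [Module ℂ W] (t : W ⊗[ℂ] X.obj 0),
      (X.B 0).lTensor _ ((c.h 0).lTensor _ t) = t - (c.P 0).lTensor _ t := by
    intro W _ _ t
    rw [← LinearMap.lTensor_comp_apply,
      show X.B 0 ∘ₗ c.h 0 = LinearMap.id - c.P 0 from LinearMap.ext c.B_h_zero,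
      LinearMap.lTensor_sub]
    simp
  have h3 : ∀ (p : ℕ) {W : Type w} [AddCommGroup W] [Module ℂ W] (t : X.obj (p + 1) ⊗[ℂ] W),
      (X.B (p + 1)).rTensor _ ((c.h (p + 1)).rTensor _ t) +
        (c.h p).rTensor _ ((X.B p).rTensor _ t) = t - (c.P (p + 1)).rTensor _ t := by
    intro p W _ _ t
    rw [← LinearMap.rTensor_comp_apply, ← LinearMap.rTensor_comp_apply, ← LinearMap.add_apply,
      ← LinearMap.rTensor_add,
      show X.B (p + 1) ∘ₗ c.h (p + 1) + c.h p ∘ₗ X.B p = LinearMap.id - c.P (p + 1) from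
        LinearMap.ext (c.B_h p), LinearMap.rTensor_sub]
    simp
  have h4 : ∀ (p : ℕ) {W : Type w} [AddCommGroup W] [Module ℂ W] (t : W ⊗[ℂ] X.obj (p + 1)),
      (X.B (p + 1)).lTensor _ ((c.h (p + 1)).lTensor _ t) +
        (c.h p).lTensor _ ((X.B p).lTensor _ t) = t - (c.P (p + 1)).lTensor _ t := by
    intro p W _ _ t
    rw [← LinearMap.lTensor_comp_apply, ← LinearMap.lTensor_comp_apply, ← LinearMap.add_apply,
      ← LinearMap.lTensor_add,
      show X.B (p + 1) ∘ₗ c.h (p + 1) + c.h p ∘ₗ X.B p = LinearMap.id - c.P (p + 1) from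
        LinearMap.ext (c.B_h p), LinearMap.lTensor_sub]
    simp
  -- the part of `h ⊗ 1`
  have L : X.tensorAt X ((X.tensor X).B (n + 1) (c.hLeft (n + 1) z)) p q h +
      X.tensorAt X (c.hLeft n ((X.tensor X).B n z)) p q h =
        X.tensorAt X z p q h - (c.P p).rTensor _ (X.tensorAt X z p q h) := by
    rw [B_hLeft]
    rcases p with _ | p
    · rw [hLeft_zero, hLeft_zero, map_zero, h1]
      simp
    · rw [hLeft_succ, hLeft_succ, tensorAt_B, map_add, map_smul, map_smul, smul_add,
        neg_one_pow_smul_smul, ← h3, rTensor_lTensor, pow_succ]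
      simp only [mul_neg, mul_one, neg_smul]
      abel
  -- the part of `P ⊗ h`
  have R : X.tensorAt X ((X.tensor X).B (n + 1) (c.pLeft (n + 2) (c.hRight (n + 1) z))) p q h +
      X.tensorAt X (c.pLeft (n + 1) (c.hRight n ((X.tensor X).B n z))) p q h =
        (c.P p).rTensor _ (X.tensorAt X z p q h) -
          (c.P p).rTensor _ ((c.P q).lTensor _ (X.tensorAt X z p q h)) := by
    rw [tensorAt_B, pLeft_apply, pLeft_apply, pLeft_apply, rTensor_rTensor_eq_zero (c.B_P p),
      smul_zero, zero_add, hRight_succ, ← rTensor_lTensor, ← map_add, ← map_sub]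
    rcases q with _ | q
    · rw [hRight_zero, add_zero, h2]
    · rw [hRight_succ, tensorAt_B, ← h4, map_add, map_add, map_add, map_smul, map_smul,
        ← rTensor_lTensor, rTensor_rTensor_eq_zero (c.P_B p), smul_zero, zero_add]
      exact (map_add _ _ _).symm
  change X.tensorAt X ((X.tensor X).B (n + 1) (c.hLeft (n + 1) z +
    c.pLeft (n + 2) (c.hRight (n + 1) z))) p q h + (X.tensorAt X (c.hLeft n ((X.tensor X).B n z)) p q h +
      X.tensorAt X (c.pLeft (n + 1) (c.hRight n ((X.tensor X).B n z))) p q h) =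
    X.tensorAt X z p q h - X.tensorAt X (c.pBoth (n + 1) z) p q h
  rw [map_add, tensorAt_add, pBoth_apply, pBoth_eq]
  refine Eq.trans ?_ ((congrArg₂ (· + ·) L R).trans ?_) <;> abel

/-- The homotopy between the identity and `P ⊗ P` on the tensor square. -/
abbrev tensor : (X.tensor X).Homotopy := ⟨c.tensorH, c.pBoth, c.B_tensorH_zero, c.B_tensorH⟩

end Contraction

/-- An exact complex, up to a map `P`, of vector spaces has a contraction. -/
lemma exists_contraction (hX : X.IsMixed) (P : ∀ p, X.obj p →ₗ[ℂ] X.obj p)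
    (P_B : ∀ p x, P p (X.B p x) = 0) (B_P : ∀ p x, X.B p (P (p + 1) x) = 0)
    (P_P : ∀ p x, P p (P p x) = P p x) (exact_zero : ∀ x, ∃ y, x = X.B 0 y + P 0 x)
    (exact_succ : ∀ p x, X.B p x = 0 → ∃ y, x = X.B (p + 1) y + P (p + 1) x) :
    ∃ c : X.Contraction, c.P = P := by
  have hs : ∀ p, ∃ s : X.obj p →ₗ[ℂ] X.obj (p + 1), ∀ y, X.B p (s (X.B p y)) = X.B p y := by
    intro p
    obtain ⟨g, hg⟩ := (X.B p).rangeRestrict.exists_rightInverse_of_surjective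
      (X.B p).range_rangeRestrict
    obtain ⟨s, hs⟩ := g.exists_extend
    refine ⟨s, fun y => ?_⟩
    have h1 := LinearMap.congr_fun hs ((X.B p).rangeRestrict y)
    have h2 := LinearMap.congr_fun hg ((X.B p).rangeRestrict y)
    simp only [LinearMap.comp_apply] at h1 h2
    have h3 := congrArg Subtype.val h2
    simp only [LinearMap.id_apply, LinearMap.codRestrict_apply] at h3
    change s (X.B p y) = _ at h1
    rw [h1]
    exact h3
  choose s hs using hs
  -- normalized so that `P s' = 0`
  let s' : ∀ p, X.obj p →ₗ[ℂ] X.obj (p + 1) := fun p => s p - P (p + 1) ∘ₗ s p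
  have hs' : ∀ p y, X.B p (s' p (X.B p y)) = X.B p y := fun p y => by
    simp only [s', LinearMap.sub_apply, LinearMap.comp_apply, map_sub, B_P, hs, sub_zero]
  have hP : ∀ p y, P (p + 1) (s' p y) = 0 := fun p y => by
    simp only [s', LinearMap.sub_apply, LinearMap.comp_apply, map_sub, P_P, sub_self]
  let h : ∀ p, X.obj p →ₗ[ℂ] X.obj (p + 1) := fun p => match p with
    | 0 => s' 0 ∘ₗ (LinearMap.id - P 0)
    | p + 1 => s' (p + 1) ∘ₗ (LinearMap.id - P (p + 1) - s' p ∘ₗ X.B p)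
  have hB : ∀ p y, h p (X.B p y) = s' p (X.B p y) := by
    intro p y
    rcases p with _ | p
    · simp [h, P_B]
    · simp [h, P_B, hX.B_B]
  refine ⟨⟨⟨h, P, fun x => ?_, fun p x => ?_⟩, P_B, B_P⟩, rfl⟩
  · obtain ⟨y, hy⟩ := exact_zero x
    have e : x - P 0 x = X.B 0 y := sub_eq_iff_eq_add.2 hy
    change X.B 0 (s' 0 (x - P 0 x)) = _
    rw [e, hs']
  · rw [hB]
    have h1 : X.B p (x - P (p + 1) x - s' p (X.B p x)) = 0 := by
      rw [map_sub, map_sub, B_P, hs', sub_zero, sub_self]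
    obtain ⟨y, hy⟩ := exact_succ p _ h1
    rw [map_sub, map_sub, P_P, hP, sub_self, sub_zero, add_zero] at hy
    change X.B (p + 1) (s' (p + 1) (x - P (p + 1) x - s' p (X.B p x))) + _ = _
    rw [hy, hs', ← hy, sub_add_cancel]


end Homotopy

end MixedData

/-! ### Free cocyclic modules -/

/-- The formal composites `[p] → [n]` of cofaces, codegeneracies and, if `c` holds, cyclic
operators. -/
inductive Word (c : Prop) (p : ℕ) : ℕ → Type w
  | nil : Word c p p
  | δ {n : ℕ} (i : ℕ) (h : i ≤ n + 1) (a : Word c p n) : Word c p (n + 1)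
  | σ {n : ℕ} (j : ℕ) (h : j ≤ n) (a : Word c p (n + 1)) : Word c p n
  | τ {n : ℕ} (h : c) (a : Word c p n) : Word c p n

namespace Word
variable {c : Prop} {p : ℕ}

/-- The value of a formal composite. -/
def eval (X : CocyclicData.{w'}) : ∀ {n : ℕ}, Word.{w} c p n → (X.obj p →ₗ[ℂ] X.obj n)
  | _, nil => LinearMap.id
  | _, δ i _ a => X.δ _ i ∘ₗ a.eval X
  | _, σ j _ a => X.σ _ j ∘ₗ a.eval X
  | _, τ _ a => X.τ _ ∘ₗ a.eval X

/-- The value of a linear combination of formal composites. -/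
def evalC (X : CocyclicData.{w'}) {n : ℕ} :
    (Word.{w} c p n →₀ ℂ) →ₗ[ℂ] (X.obj p →ₗ[ℂ] X.obj n) :=
  Finsupp.linearCombination ℂ (fun a : Word.{w} c p n => a.eval X)

lemma evalC_single (X : CocyclicData.{w'}) {n : ℕ} (a : Word.{w} c p n) (r : ℂ) :
    evalC X (Finsupp.single a r) = r • a.eval X := by
  simp [evalC]

lemma evalC_mapDomain (X : CocyclicData.{w'}) {n m : ℕ} (f : Word.{w} c p n → Word.{w} c p m)
    (g : X.obj n →ₗ[ℂ] X.obj m) (hg : ∀ a, (f a).eval X = g ∘ₗ a.eval X)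
    (a : Word.{w} c p n →₀ ℂ) :
    evalC X (Finsupp.lmapDomain ℂ ℂ f a) = g ∘ₗ evalC X a := by
  induction a using Finsupp.induction_linear with
  | zero => simp
  | add a b ha hb => rw [map_add, map_add, ha, hb, map_add, LinearMap.comp_add]
  | single a r =>
    rw [Finsupp.lmapDomain_apply, Finsupp.mapDomain_single, evalC_single, hg, evalC_single,
      LinearMap.comp_smul]

lemma eval_natural {X : CocyclicData.{w'}} {Y : CocyclicData.{v}}
    (f : ∀ n, X.obj n →ₗ[ℂ] Y.obj n)
    (hδ : ∀ n i x, i ≤ n + 1 → f (n + 1) (X.δ n i x) = Y.δ n i (f n x))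
    (hσ : ∀ n j x, j ≤ n → f n (X.σ n j x) = Y.σ n j (f (n + 1) x))
    (hτ : c → ∀ n x, f n (X.τ n x) = Y.τ n (f n x)) {n : ℕ} (a : Word.{w} c p n) (x : X.obj p) :
    f n (a.eval X x) = a.eval Y (f p x) := by
  induction a with
  | nil => rfl
  | δ i h a ih => simp only [eval, LinearMap.comp_apply, hδ _ _ _ h, ih]
  | σ j h a ih => simp only [eval, LinearMap.comp_apply, hσ _ _ _ h, ih]
  | τ h a ih => simp only [eval, LinearMap.comp_apply, hτ h, ih]

lemma evalC_natural {X : CocyclicData.{w'}} {Y : CocyclicData.{v}}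
    (f : ∀ n, X.obj n →ₗ[ℂ] Y.obj n)
    (hδ : ∀ n i x, i ≤ n + 1 → f (n + 1) (X.δ n i x) = Y.δ n i (f n x))
    (hσ : ∀ n j x, j ≤ n → f n (X.σ n j x) = Y.σ n j (f (n + 1) x))
    (hτ : c → ∀ n x, f n (X.τ n x) = Y.τ n (f n x)) {n : ℕ} (a : Word.{w} c p n →₀ ℂ)
    (x : X.obj p) : f n (evalC X a x) = evalC Y a (f p x) := by
  induction a using Finsupp.induction_linear with
  | zero => simp
  | add a b ha hb => simp [ha, hb]
  | single a r => simp [evalC_single, eval_natural f hδ hσ hτ]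

lemma evalC_hom {X : CocyclicData.{w'}} {Y : CocyclicData.{v}} (f : X.Hom Y) {n : ℕ}
    (a : Word.{w} c p n →₀ ℂ) (x : X.obj p) : f.app n (evalC X a x) = evalC Y a (f.app p x) :=
  evalC_natural f.app (fun n i x h => LinearMap.congr_fun (f.app_δ n i h) x)
    (fun n j x h => LinearMap.congr_fun (f.app_σ n j h) x)
    (fun _ n x => LinearMap.congr_fun (f.app_τ n) x) a x

end Word

/-- The formal linear combinations that vanish in all cocyclic modules. -/
def freeRel (p n : ℕ) : Submodule ℂ (Word.{w} True p n →₀ ℂ) :=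
  ⨅ X : CocyclicModule.{w}, LinearMap.ker (Word.evalC X.toCocyclicData)

/-- The natural operations `X^p → X^n` on cocyclic modules. -/
abbrev NatOp (p n : ℕ) : Type w := (Word.{w} True p n →₀ ℂ) ⧸ freeRel.{w} p n

namespace NatOp
variable {p q n : ℕ}

/-- The value of a natural operation on a cocyclic module. -/
def ev (X : CocyclicModule.{w}) : NatOp.{w} p n →ₗ[ℂ] (X.obj p →ₗ[ℂ] X.obj n) :=
  Submodule.liftQ _ (Word.evalC X.toCocyclicData) (iInf_le _ X)

lemma ev_mk (X : CocyclicModule.{w}) (a : Word.{w} True p n →₀ ℂ) :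
    ev X (Submodule.Quotient.mk a : NatOp p n) = Word.evalC X.toCocyclicData a := rfl

lemma ext {a b : NatOp.{w} p n} (h : ∀ X x, ev X a x = ev X b x) : a = b := by
  induction a using Submodule.Quotient.induction_on with
  | H a =>
    induction b using Submodule.Quotient.induction_on with
    | H b =>
      rw [Submodule.Quotient.eq, freeRel, Submodule.mem_iInf]
      intro X
      rw [LinearMap.mem_ker, map_sub, sub_eq_zero]
      exact LinearMap.ext (h X)

/-- Adding a letter to all words of a linear combination. -/
def push {m : ℕ} (f : Word.{w} True p n → Word.{w} True p m)
    (g : ∀ X : CocyclicModule.{w}, X.obj n →ₗ[ℂ] X.obj m)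
    (hg : ∀ X a, (f a).eval X.toCocyclicData = g X ∘ₗ a.eval X.toCocyclicData) :
    NatOp.{w} p n →ₗ[ℂ] NatOp.{w} p m :=
  Submodule.mapQ _ _ (Finsupp.lmapDomain ℂ ℂ f) (by
    intro a ha
    rw [Submodule.mem_comap, freeRel, Submodule.mem_iInf] at *
    intro X
    have h2 := ha X
    rw [LinearMap.mem_ker] at h2 ⊢
    rw [Word.evalC_mapDomain _ f (g X) (hg X), h2, LinearMap.comp_zero])

lemma ev_push {m : ℕ} (f : Word.{w} True p n → Word.{w} True p m)
    (g : ∀ X : CocyclicModule.{w}, X.obj n →ₗ[ℂ] X.obj m)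
    (hg : ∀ X a, (f a).eval X.toCocyclicData = g X ∘ₗ a.eval X.toCocyclicData)
    (X : CocyclicModule.{w}) (a : NatOp.{w} p n) : ev X (push f g hg a) = g X ∘ₗ ev X a := by
  induction a using Submodule.Quotient.induction_on with
  | H a =>
    exact Word.evalC_mapDomain _ f (g X) (hg X) a

/-- The free cocyclic module on a generator in degree `p`. -/
abbrev freeData (p : ℕ) : CocyclicData.{w} where
  obj n := NatOp.{w} p n
  δ n i := if h : i ≤ n + 1 then push (Word.δ i h) (fun X => X.δ n i) (fun _ _ => rfl) else 0
  σ n j := if h : j ≤ n then push (Word.σ j h) (fun X => X.σ n j) (fun _ _ => rfl) else 0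
  τ n := push (Word.τ trivial) (fun X => X.τ n) (fun _ _ => rfl)

lemma ev_δ (X : CocyclicModule.{w}) (i : ℕ) (h : i ≤ n + 1) (a : NatOp.{w} p n) (x : X.obj p) :
    ev X ((freeData p).δ n i a : NatOp p (n + 1)) x = X.δ n i (ev X a x) := by
  simp only [freeData, dif_pos h]
  exact LinearMap.congr_fun (ev_push _ _ _ X a) x

lemma ev_σ (X : CocyclicModule.{w}) (j : ℕ) (h : j ≤ n) (a : NatOp.{w} p (n + 1)) (x : X.obj p) :
    ev X ((freeData p).σ n j a : NatOp p n) x = X.σ n j (ev X a x) := by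
  simp only [freeData, dif_pos h]
  exact LinearMap.congr_fun (ev_push _ _ _ X a) x

lemma ev_τ (X : CocyclicModule.{w}) (a : NatOp.{w} p n) (x : X.obj p) :
    ev X ((freeData p).τ n a : NatOp p n) x = X.τ n (ev X a x) := by
  simp only [freeData]
  exact LinearMap.congr_fun (ev_push _ _ _ X a) x

lemma ev_τ_pow (X : CocyclicModule.{w}) (k : ℕ) (a : NatOp.{w} p n) (x : X.obj p) :
    ev X (((freeData p).τ n ^ k) a : NatOp p n) x = (X.τ n ^ k) (ev X a x) := by
  induction k with
  | zero => rfl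
  | succ k ih => rw [pow_succ', Module.End.mul_apply, ev_τ, ih, pow_succ']; rfl

/-- The free cocyclic module on a generator in degree `p`. -/
abbrev free (p : ℕ) : CocyclicModule.{w} where
  toCocyclicData := freeData p
  laws :=
    { δ_δ := fun n i j h h' => LinearMap.ext fun a => ext fun X x => by
        simp only [LinearMap.comp_apply]
        rw [ev_δ X j h', ev_δ X i (by omega), ev_δ X i (by omega), ev_δ X (j - 1) (by omega)]
        exact LinearMap.congr_fun (X.laws.δ_δ n i j h h') _
      σ_σ := fun n i j h h' => LinearMap.ext fun a => ext fun X x => by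
        simp only [LinearMap.comp_apply]
        rw [ev_σ X j h', ev_σ X i (by omega), ev_σ X i (by omega), ev_σ X (j + 1) (by omega)]
        exact LinearMap.congr_fun (X.laws.σ_σ n i j h h') _
      σ_δ_lt := fun n i j h h' => LinearMap.ext fun a => ext fun X x => by
        simp only [LinearMap.comp_apply]
        rw [ev_σ X j h', ev_δ X i (by omega), ev_δ X i (by omega), ev_σ X (j - 1) (by omega)]
        exact LinearMap.congr_fun (X.laws.σ_δ_lt n i j h h') _
      σ_δ_self := fun n j h => LinearMap.ext fun a => ext fun X x => by
        simp only [LinearMap.comp_apply]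
        rw [ev_σ X j h, ev_δ X j (by omega)]
        exact LinearMap.congr_fun (X.laws.σ_δ_self n j h) _
      σ_δ_succ := fun n j h => LinearMap.ext fun a => ext fun X x => by
        simp only [LinearMap.comp_apply]
        rw [ev_σ X j h, ev_δ X (j + 1) (by omega)]
        exact LinearMap.congr_fun (X.laws.σ_δ_succ n j h) _
      σ_δ_gt := fun n i j h h' => LinearMap.ext fun a => ext fun X x => by
        simp only [LinearMap.comp_apply]
        rw [ev_σ X j (by omega), ev_δ X i (by omega), ev_δ X (i - 1) (by omega),
          ev_σ X j (by omega)]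
        exact LinearMap.congr_fun (X.laws.σ_δ_gt n i j h h') _
      τ_δ := fun n i h h' => LinearMap.ext fun a => ext fun X x => by
        simp only [LinearMap.comp_apply]
        rw [ev_τ, ev_δ X i (by omega), ev_δ X (i - 1) (by omega), ev_τ]
        exact LinearMap.congr_fun (X.laws.τ_δ n i h h') _
      τ_δ_zero := fun n => LinearMap.ext fun a => ext fun X x => by
        simp only [LinearMap.comp_apply]
        rw [ev_τ, ev_δ X 0 (by omega), ev_δ X (n + 1) (by omega)]
        exact LinearMap.congr_fun (X.laws.τ_δ_zero n) _
      τ_σ := fun n i h h' => LinearMap.ext fun a => ext fun X x => by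
        simp only [LinearMap.comp_apply]
        rw [ev_τ, ev_σ X i (by omega), ev_σ X (i - 1) (by omega), ev_τ]
        exact LinearMap.congr_fun (X.laws.τ_σ n i h h') _
      τ_σ_zero := fun n => LinearMap.ext fun a => ext fun X x => by
        simp only [LinearMap.comp_apply]
        rw [ev_τ, ev_σ X 0 (by omega), ev_σ X n (by omega), ev_τ, ev_τ]
        exact LinearMap.congr_fun (X.laws.τ_σ_zero n) _
      τ_pow := fun n => LinearMap.ext fun a => ext fun X x => by
        rw [ev_τ_pow, X.laws.τ_pow]; rfl }

/-- The generator of the free cocyclic module: the identity operation. -/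
def gen (p : ℕ) : (free.{w} p).obj p :=
  (Submodule.Quotient.mk (Finsupp.single Word.nil 1) : NatOp.{w} p p)

lemma ev_gen (X : CocyclicModule.{w}) (x : X.obj p) : ev X (gen p : NatOp p p) x = x := by
  rw [gen, ev_mk, Word.evalC_single]
  simp [Word.eval]

/-- The map out of a free cocyclic module determined by the image of the generator. -/
def evHom (X : CocyclicModule.{w}) (x : X.obj p) : (free.{w} p).Hom X.toCocyclicData where
  app _ := (ev X).flip x
  app_δ _ i h := LinearMap.ext fun a => ev_δ X i h a x
  app_σ _ j h := LinearMap.ext fun a => ev_σ X j h a x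
  app_τ _ := LinearMap.ext fun a => ev_τ X a x

lemma evHom_gen (X : CocyclicModule.{w}) (x : X.obj p) : (evHom X x).app p (gen p) = x :=
  ev_gen X x

lemma ev_hom {X Y : CocyclicModule.{w}} (f : X.Hom Y.toCocyclicData) (a : NatOp.{w} p n)
    (x : X.obj p) : f.app n (ev X a x) = ev Y a (f.app p x) := by
  induction a using Submodule.Quotient.induction_on with
  | H a => exact Word.evalC_hom f a x

/-- Composition of natural operations, `φ ↦ φ ∘ ℓ`. -/
def precomp (l : NatOp.{w} p q) (n : ℕ) : NatOp.{w} q n →ₗ[ℂ] NatOp.{w} p n :=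
  (evHom (free p) l).app n

lemma ev_precomp (X : CocyclicModule.{w}) (l : NatOp.{w} p q) (a : NatOp.{w} q n) (x : X.obj p) :
    ev X (precomp l n a) x = ev X a (ev X l x) :=
  ev_hom (evHom X x) a l

@[elab_as_elim]
lemma induction {P : ∀ n, NatOp.{w} p n → Prop} (zero : ∀ n, P n 0)
    (add : ∀ n a b, P n a → P n b → P n (a + b)) (smul : ∀ n (r : ℂ) a, P n a → P n (r • a))
    (gen : P p (gen p)) (δ : ∀ n i a, i ≤ n + 1 → P n a → P (n + 1) ((free p).δ n i a))
    (σ : ∀ n j a, j ≤ n → P (n + 1) a → P n ((free p).σ n j a))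
    (τ : ∀ n a, P n a → P n ((free p).τ n a)) (a : NatOp.{w} p n) : P n a := by
  have key : ∀ {n} (a : Word.{w} True p n),
      P n (Submodule.Quotient.mk (Finsupp.single a 1) : NatOp p n) := by
    intro n a
    induction a with
    | nil => exact gen
    | δ i h a ih =>
      have := δ _ i _ h ih
      simp only [free, freeData, dif_pos h] at this
      convert this using 1
      change _ = Submodule.Quotient.mk (Finsupp.lmapDomain ℂ ℂ _ _)
      rw [Finsupp.lmapDomain_apply, Finsupp.mapDomain_single]
    | σ j h a ih =>
      have := σ _ j _ h ih
      simp only [free, freeData, dif_pos h] at this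
      convert this using 1
      change _ = Submodule.Quotient.mk (Finsupp.lmapDomain ℂ ℂ _ _)
      rw [Finsupp.lmapDomain_apply, Finsupp.mapDomain_single]
    | τ h a ih =>
      have := τ _ _ ih
      simp only [free, freeData] at this
      convert this using 1
      change _ = Submodule.Quotient.mk (Finsupp.lmapDomain ℂ ℂ _ _)
      rw [Finsupp.lmapDomain_apply, Finsupp.mapDomain_single]
  induction a using Submodule.Quotient.induction_on with
  | H a =>
    induction a using Finsupp.induction_linear with
    | zero => exact zero n
    | add a b ha hb => exact add n _ _ ha hb
    | single a r =>
      have := smul n r _ (key a)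
      rw [← Submodule.Quotient.mk_smul, Finsupp.smul_single, smul_eq_mul, mul_one] at this
      exact this

end NatOp

namespace CocyclicData

/-! ### Cofree cocyclic modules -/

/-- The cosimplicial identities. -/
structure IsCosimplicial (Z : CocyclicData.{w}) : Prop where
  δ_δ : ∀ n i j x, i < j → j ≤ n + 2 →
    Z.δ (n + 1) j (Z.δ n i x) = Z.δ (n + 1) i (Z.δ n (j - 1) x)
  σ_σ : ∀ n i j x, i ≤ j → j ≤ n →
    Z.σ n j (Z.σ (n + 1) i x) = Z.σ n i (Z.σ (n + 1) (j + 1) x)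
  σ_δ_lt : ∀ n i j x, i < j → j ≤ n + 1 →
    Z.σ (n + 1) j (Z.δ (n + 1) i x) = Z.δ n i (Z.σ n (j - 1) x)
  σ_δ_self : ∀ n j x, j ≤ n → Z.σ n j (Z.δ n j x) = x
  σ_δ_succ : ∀ n j x, j ≤ n → Z.σ n j (Z.δ n (j + 1) x) = x
  σ_δ_gt : ∀ n i j x, j + 1 < i → i ≤ n + 2 →
    Z.σ (n + 1) j (Z.δ (n + 1) i x) = Z.δ n (i - 1) (Z.σ n j x)

lemma IsCocyclic.isCosimplicial {X : CocyclicData.{w}} (hX : X.IsCocyclic) :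
    X.IsCosimplicial where
  δ_δ n i j x h h' := LinearMap.congr_fun (hX.δ_δ n i j h h') x
  σ_σ n i j x h h' := LinearMap.congr_fun (hX.σ_σ n i j h h') x
  σ_δ_lt n i j x h h' := LinearMap.congr_fun (hX.σ_δ_lt n i j h h') x
  σ_δ_self n j x h := LinearMap.congr_fun (hX.σ_δ_self n j h) x
  σ_δ_succ n j x h := LinearMap.congr_fun (hX.σ_δ_succ n j h) x
  σ_δ_gt n i j x h h' := LinearMap.congr_fun (hX.σ_δ_gt n i j h h') x

section Cofree
variable (Z : CocyclicData.{w})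

/-- The component of a sequence of length `n + 1`, with indices modulo `n + 1`. -/
def cofreeAt {n : ℕ} (a : ℕ) : (Fin (n + 1) → Z.obj n) →ₗ[ℂ] Z.obj n :=
  LinearMap.proj ⟨a % (n + 1), Nat.mod_lt _ n.succ_pos⟩

/-- The cofree cocyclic module on a cosimplicial module `Z`. A cochain `x` in degree `n` is the
sequence of the components `xₐ = π(τᵃ x)` in `Zⁿ`, where `π` is the projection to `Z`; the
identities between `τᵃ` and the cofaces and codegeneracies force the formulas. -/
abbrev cofree : CocyclicData.{w} where
  obj n := Fin (n + 1) → Z.obj n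
  δ n i := LinearMap.pi fun a : Fin (n + 2) =>
    if a.1 ≤ i then Z.δ n (i - a.1) ∘ₗ Z.cofreeAt a.1
    else Z.δ n (n + 2 + i - a.1) ∘ₗ Z.cofreeAt (a.1 - 1)
  σ n j := LinearMap.pi fun a : Fin (n + 1) =>
    if a.1 ≤ j then Z.σ n (j - a.1) ∘ₗ Z.cofreeAt a.1
    else Z.σ n (n + 1 + j - a.1) ∘ₗ Z.cofreeAt (a.1 + 1)
  τ n := LinearMap.pi fun a : Fin (n + 1) => Z.cofreeAt (a.1 + 1)

variable {Z}

lemma cofreeAt_of_le {n : ℕ} (a : ℕ) (h : a ≤ n) (x : Fin (n + 1) → Z.obj n) :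
    Z.cofreeAt a x = x ⟨a, by omega⟩ := by
  change x _ = x _
  congr 2
  exact Nat.mod_eq_of_lt (by omega)

lemma cofreeAt_period {n : ℕ} (a : ℕ) (x : Fin (n + 1) → Z.obj n) :
    Z.cofreeAt (n + 1 + a) x = Z.cofreeAt a x := by
  change x _ = x _
  congr 2
  exact Nat.add_mod_left _ _

lemma cofree_ext {n : ℕ} {x y : Fin (n + 1) → Z.obj n}
    (h : ∀ a ≤ n, Z.cofreeAt a x = Z.cofreeAt a y) : x = y := by
  funext a
  have := h a.1 (by omega)
  rwa [cofreeAt_of_le _ (by omega), cofreeAt_of_le _ (by omega)] at this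

lemma cofreeAt_τ {n : ℕ} (a : ℕ) (x : Fin (n + 1) → Z.obj n) :
    Z.cofreeAt a (Z.cofree.τ n x) = Z.cofreeAt (a + 1) x := by
  change x _ = x _
  congr 2
  simp

lemma cofreeAt_τ_pow {n : ℕ} (k a : ℕ) (x : Fin (n + 1) → Z.obj n) :
    Z.cofreeAt a ((Z.cofree.τ n ^ k) x) = Z.cofreeAt (a + k) x := by
  induction k generalizing a with
  | zero => rfl
  | succ k ih =>
    rw [pow_succ', Module.End.mul_apply, cofreeAt_τ, ih, add_assoc, Nat.add_comm 1]

lemma cofreeAt_δ_le {n i a : ℕ} (h : a ≤ i) (ha : a ≤ n + 1) (x : Fin (n + 1) → Z.obj n) :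
    Z.cofreeAt a (Z.cofree.δ n i x) = Z.δ n (i - a) (Z.cofreeAt a x) := by
  rw [cofreeAt_of_le _ ha]
  simp [h]

lemma cofreeAt_δ_gt {n i a : ℕ} (h : i < a) (ha : a ≤ n + 1) (x : Fin (n + 1) → Z.obj n) :
    Z.cofreeAt a (Z.cofree.δ n i x) = Z.δ n (n + 2 + i - a) (Z.cofreeAt (a - 1) x) := by
  rw [cofreeAt_of_le _ ha]
  simp [h.not_ge]

lemma cofreeAt_σ_le {n j a : ℕ} (h : a ≤ j) (ha : a ≤ n) (x : Fin (n + 2) → Z.obj (n + 1)) :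
    Z.cofreeAt a (Z.cofree.σ n j x) = Z.σ n (j - a) (Z.cofreeAt a x) := by
  rw [cofreeAt_of_le _ ha]
  simp [h]

lemma cofreeAt_σ_gt {n j a : ℕ} (h : j < a) (ha : a ≤ n) (x : Fin (n + 2) → Z.obj (n + 1)) :
    Z.cofreeAt a (Z.cofree.σ n j x) = Z.σ n (n + 1 + j - a) (Z.cofreeAt (a + 1) x) := by
  rw [cofreeAt_of_le _ ha]
  simp [h.not_ge]

lemma congr_index {α : Type*} (f : ℕ → ℕ → ℕ → α) {i i' j j' a a' : ℕ} (hi : i = i') (hj : j = j')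
    (ha : a = a') : f i j a = f i' j' a' := by rw [hi, hj, ha]

lemma IsCosimplicial.cofree (hZ : Z.IsCosimplicial) : Z.cofree.IsCocyclic := by
  refine IsCocyclic.of_reduced _ ?_ ?_ ?_ ?_ ?_ ?_ ?_ ?_ ?_ ?_ ?_
  · intro n i j x hij hj
    refine cofree_ext fun a ha => ?_
    rcases le_or_gt a i with h | h
    · rw [cofreeAt_δ_le (by omega) ha, cofreeAt_δ_le h (by omega), cofreeAt_δ_le h ha,
        cofreeAt_δ_le (by omega) (by omega), hZ.δ_δ _ _ _ _ (by omega) (by omega)]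
      exact congr_index (fun i j a => Z.δ (n + 1) i (Z.δ n j (Z.cofreeAt a x))) (by omega) (by omega) (by omega)
    · rcases le_or_gt a j with h' | h'
      · rw [cofreeAt_δ_le h' ha, cofreeAt_δ_gt h (by omega), cofreeAt_δ_gt h ha,
          cofreeAt_δ_le (by omega) (by omega), hZ.δ_δ _ _ (n + 1 + 2 + i - a) _ (by omega) (by omega)]
        exact congr_index (fun i j a => Z.δ (n + 1) i (Z.δ n j (Z.cofreeAt a x))) (by omega) (by omega) (by omega)
      · rw [cofreeAt_δ_gt h' ha, cofreeAt_δ_gt (by omega) (by omega), cofreeAt_δ_gt h ha,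
          cofreeAt_δ_gt (by omega) (by omega), hZ.δ_δ _ _ _ _ (by omega) (by omega)]
        exact congr_index (fun i j a => Z.δ (n + 1) i (Z.δ n j (Z.cofreeAt a x))) (by omega) (by omega) (by omega)
  · intro n i j x hij hj
    refine cofree_ext fun a ha => ?_
    rcases le_or_gt a i with h | h
    · rw [cofreeAt_σ_le (by omega) ha, cofreeAt_σ_le h (by omega), cofreeAt_σ_le h ha,
        cofreeAt_σ_le (by omega) (by omega), hZ.σ_σ _ _ _ _ (by omega) (by omega)]
      exact congr_index (fun i j a => Z.σ n i (Z.σ (n + 1) j (Z.cofreeAt a x))) (by omega) (by omega) (by omega)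
    · rcases le_or_gt a j with h' | h'
      · rw [cofreeAt_σ_le h' ha, cofreeAt_σ_gt h (by omega), cofreeAt_σ_gt h ha,
          cofreeAt_σ_le (by omega) (by omega), show n + 1 + 1 + i - a = (n + 1 + i - a) + 1 by omega,
          ← hZ.σ_σ _ _ (n + 1 + i - a) _ (by omega) (by omega)]
        congr 3; omega
      · rw [cofreeAt_σ_gt h' ha, cofreeAt_σ_gt (by omega) (by omega), cofreeAt_σ_gt h ha,
          cofreeAt_σ_gt (by omega) (by omega), hZ.σ_σ _ _ _ _ (by omega) (by omega)]
        exact congr_index (fun i j a => Z.σ n i (Z.σ (n + 1) j (Z.cofreeAt a x))) (by omega) (by omega) (by omega)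
  · intro n i j x hij hj
    refine cofree_ext fun a ha => ?_
    rcases le_or_gt a i with h | h
    · rw [cofreeAt_σ_le (by omega) ha, cofreeAt_δ_le h (by omega), cofreeAt_δ_le h ha,
        cofreeAt_σ_le (by omega) (by omega), hZ.σ_δ_lt _ _ _ _ (by omega) (by omega)]
      exact congr_index (fun i j a => Z.δ n i (Z.σ n j (Z.cofreeAt a x))) (by omega) (by omega) (by omega)
    · rcases le_or_gt a j with h' | h'
      · rw [cofreeAt_σ_le h' ha, cofreeAt_δ_gt h (by omega), cofreeAt_δ_gt h ha,
          cofreeAt_σ_le (by omega) (by omega), hZ.σ_δ_gt _ _ _ _ (by omega) (by omega)]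
        exact congr_index (fun i j a => Z.δ n i (Z.σ n j (Z.cofreeAt a x))) (by omega) (by omega) (by omega)
      · rw [cofreeAt_σ_gt h' ha, cofreeAt_δ_gt (by omega) (by omega), cofreeAt_δ_gt h ha,
          cofreeAt_σ_gt (by omega) (by omega), hZ.σ_δ_lt _ _ _ _ (by omega) (by omega)]
        exact congr_index (fun i j a => Z.δ n i (Z.σ n j (Z.cofreeAt a x))) (by omega) (by omega) (by omega)
  · intro n j x hj
    refine cofree_ext fun a ha => ?_
    rcases le_or_gt a j with h | h
    · rw [cofreeAt_σ_le h ha, cofreeAt_δ_le h (by omega), hZ.σ_δ_self _ _ _ (by omega)]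
    · rw [cofreeAt_σ_gt h ha, cofreeAt_δ_gt (by omega) (by omega),
        show n + 2 + j - (a + 1) = n + 1 + j - a by omega, hZ.σ_δ_self _ _ _ (by omega)]
      rfl
  · intro n j x hj
    refine cofree_ext fun a ha => ?_
    rcases le_or_gt a j with h | h
    · rw [cofreeAt_σ_le h ha, cofreeAt_δ_le (by omega) (by omega),
        show j + 1 - a = (j - a) + 1 by omega, hZ.σ_δ_succ _ _ _ (by omega)]
    · rcases (Nat.succ_le_of_lt h).lt_or_eq with h' | rfl
      · rw [cofreeAt_σ_gt h ha, cofreeAt_δ_gt (by omega) (by omega),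
          show n + 2 + (j + 1) - (a + 1) = (n + 1 + j - a) + 1 by omega,
          hZ.σ_δ_succ _ _ _ (by omega)]
        rfl
      · rw [cofreeAt_σ_gt h ha, cofreeAt_δ_gt (by omega) (by omega),
          show n + 2 + (j + 1) - (j.succ + 1) = (n + 1 + j - j.succ) + 1 by omega,
          hZ.σ_δ_succ _ _ _ (by omega)]
        rfl
  · intro n i j x hij hi
    refine cofree_ext fun a ha => ?_
    rcases le_or_gt a j with h | h
    · rw [cofreeAt_σ_le h ha, cofreeAt_δ_le (by omega) (by omega),
        cofreeAt_δ_le (by omega) (by omega), cofreeAt_σ_le h (by omega),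
        hZ.σ_δ_gt _ _ _ _ (by omega) (by omega)]
      exact congr_index (fun i j a => Z.δ n i (Z.σ n j (Z.cofreeAt a x))) (by omega) (by omega) (by omega)
    · rcases lt_or_ge a i with h' | h'
      · rw [cofreeAt_σ_gt h ha, cofreeAt_δ_le (by omega) (by omega),
          cofreeAt_δ_le (by omega) (by omega), cofreeAt_σ_gt h (by omega),
          hZ.σ_δ_lt _ _ _ _ (by omega) (by omega)]
        exact congr_index (fun i j a => Z.δ n i (Z.σ n j (Z.cofreeAt a x))) (by omega) (by omega) (by omega)
      · rw [cofreeAt_σ_gt h ha, cofreeAt_δ_gt (by omega) (by omega),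
          cofreeAt_δ_gt (by omega) (by omega), cofreeAt_σ_gt (by omega) (by omega),
          hZ.σ_δ_gt _ _ _ _ (by omega) (by omega)]
        exact congr_index (fun i j a => Z.δ n i (Z.σ n j (Z.cofreeAt a x))) (by omega) (by omega) (by omega)
  · intro n i x hi
    refine cofree_ext fun a ha => ?_
    rw [cofreeAt_τ]
    rcases ha.lt_or_eq with h | rfl
    · rcases le_or_gt a i with h' | h'
      · rw [cofreeAt_δ_le (by omega) (by omega), cofreeAt_δ_le (by omega) (by omega), cofreeAt_τ]
        exact congr_index (fun i _ a => Z.δ n i (Z.cofreeAt a x)) (j := 0) (j' := 0) (by omega) (by omega) (by omega)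
      · rw [cofreeAt_δ_gt (by omega) (by omega), cofreeAt_δ_gt (by omega) (by omega), cofreeAt_τ]
        exact congr_index (fun i _ a => Z.δ n i (Z.cofreeAt a x)) (j := 0) (j' := 0) (by omega) (by omega) (by omega)
    · have h0 : ∀ y : Fin (n + 2) → Z.obj (n + 1), Z.cofreeAt (n + 1 + 1) y = Z.cofreeAt 0 y :=
        fun y => cofreeAt_period 0 y
      have h1 : Z.cofreeAt (n + 1) x = Z.cofreeAt 0 x := cofreeAt_period 0 x
      rw [h0, cofreeAt_δ_le (by omega) (by omega), cofreeAt_δ_gt (by omega) (by omega), cofreeAt_τ,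
        show n + 1 - 1 + 1 = n + 1 by omega, h1]
      exact congr_index (fun i _ a => Z.δ n i (Z.cofreeAt a x)) (j := 0) (j' := 0) (by omega) (by omega) (by omega)
  · intro n x
    refine cofree_ext fun a ha => ?_
    rw [cofreeAt_τ]
    rcases ha.lt_or_eq with h | rfl
    · rw [cofreeAt_δ_gt (by omega) (by omega), cofreeAt_δ_le (by omega) (by omega)]
      exact congr_index (fun i _ a => Z.δ n i (Z.cofreeAt a x)) (j := 0) (j' := 0) (by omega) rfl (by omega)
    · have h0 : ∀ y : Fin (n + 2) → Z.obj (n + 1), Z.cofreeAt (n + 1 + 1) y = Z.cofreeAt 0 y :=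
        fun y => cofreeAt_period 0 y
      have h1 : Z.cofreeAt (n + 1) x = Z.cofreeAt 0 x := cofreeAt_period 0 x
      rw [h0, cofreeAt_δ_le le_rfl (by omega), cofreeAt_δ_le le_rfl (by omega), h1]
      exact congr_index (fun i _ a => Z.δ n i (Z.cofreeAt a x)) (j := 0) (j' := 0) (by omega) rfl rfl
  · intro n i x hi
    refine cofree_ext fun a ha => ?_
    rw [cofreeAt_τ]
    rcases ha.lt_or_eq with h | rfl
    · rcases le_or_gt a i with h' | h'
      · rw [cofreeAt_σ_le (by omega) (by omega), cofreeAt_σ_le (by omega) (by omega), cofreeAt_τ]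
        exact congr_index (fun i _ a => Z.σ _ i (Z.cofreeAt a x)) (j := 0) (j' := 0) (by omega) (by omega) (by omega)
      · rw [cofreeAt_σ_gt (by omega) (by omega), cofreeAt_σ_gt (by omega) (by omega), cofreeAt_τ]
        exact congr_index (fun i _ a => Z.σ _ i (Z.cofreeAt a x)) (j := 0) (j' := 0) (by omega) (by omega) (by omega)
    · have h0 : ∀ y : Fin (a + 1) → Z.obj a, Z.cofreeAt (a + 1) y = Z.cofreeAt 0 y :=
        fun y => cofreeAt_period 0 y
      have h1 : Z.cofreeAt (a + 1 + 1) x = Z.cofreeAt 0 x := cofreeAt_period 0 x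
      rw [h0, cofreeAt_σ_le (by omega) (by omega), cofreeAt_σ_gt (by omega) (by omega), cofreeAt_τ,
        h1]
      exact congr_index (fun i _ a => Z.σ _ i (Z.cofreeAt a x)) (j := 0) (j' := 0) (by omega) (by omega) (by omega)
  · intro n
    refine LinearMap.ext fun x => cofree_ext fun a ha => ?_
    exact (cofreeAt_τ_pow _ _ _).trans ((congrArg (fun k => Z.cofreeAt k x) (Nat.add_comm a _)).trans
      (cofreeAt_period a x))
  · intro x
    refine cofree_ext fun a ha => ?_
    obtain rfl : a = 0 := by omega
    rw [cofreeAt_σ_le le_rfl le_rfl, cofreeAt_δ_le (by omega) (by omega)]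
    exact hZ.σ_δ_succ 0 0 _ le_rfl

/-- The lift of `z` to a `λ`-invariant cochain. -/
def cofreeLift {n : ℕ} (z : Z.obj n) : Z.cofree.obj n := fun a => (-1 : ℂ) ^ (n * a.1) • z

lemma cofreeAt_lift_zero {n : ℕ} (z : Z.obj n) : Z.cofreeAt 0 (cofreeLift z) = z := by
  rw [cofreeAt_of_le _ n.zero_le]
  simp [cofreeLift]

/-- The signs of the lift match across the period `n + 1`, since `n(n + 1)` is even. -/
lemma lam_cofreeLift {n : ℕ} (z : Z.obj n) : Z.cofree.lam n (cofreeLift z) = cofreeLift z := by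
  refine cofree_ext fun a ha => ?_
  rw [lam, LinearMap.smul_apply, map_smul, cofreeAt_τ, cofreeAt_of_le a ha]
  rcases ha.lt_or_eq with h | rfl
  · rw [cofreeAt_of_le _ (Nat.succ_le_of_lt h)]
    simp only [cofreeLift]
    rw [smul_smul, ← pow_add, show n + n * (a + 1) = 2 * n + n * a by ring, pow_add, pow_mul]
    simp
  · have h1 : Z.cofreeAt (a + 1) (cofreeLift z) = Z.cofreeAt 0 (cofreeLift z) :=
      cofreeAt_period 0 _
    rw [h1, cofreeAt_lift_zero]
    simp only [cofreeLift]
    congr 1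
    rcases Nat.even_or_odd a with h | h
    · rw [h.neg_one_pow, (h.mul_right a).neg_one_pow]
    · rw [h.neg_one_pow, (h.mul h).neg_one_pow]

/-- A combination of cosimplicial operations which vanishes on the boundaries of `λ`-invariant
cochains in cocyclic modules vanishes on boundaries in all cosimplicial modules. -/
lemma evalC_b_eq_zero {p r : ℕ} (θ : Word.{w} False (p + 1) r →₀ ℂ)
    (hθ : ∀ (X : CocyclicModule.{w}) (x : X.obj p), X.lam p x = x →
      Word.evalC X.toCocyclicData θ (X.mixed.b p x) = 0) (hZ : Z.IsCosimplicial) (z : Z.obj p) :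
    Word.evalC Z θ (Z.mixed.b p z) = 0 := by
  have h1 := hθ ⟨Z.cofree, hZ.cofree⟩ (cofreeLift z) (lam_cofreeLift z)
  have h2 := Word.evalC_natural (X := Z.cofree) (Y := Z) (fun n => Z.cofreeAt 0)
    (fun n i x _ => cofreeAt_δ_le i.zero_le (Nat.zero_le _) x)
    (fun n j x _ => cofreeAt_σ_le j.zero_le (Nat.zero_le _) x) (fun h => h.elim) θ
    (Z.cofree.mixed.b p (cofreeLift z))
  rw [h1, map_zero] at h2
  rw [h2]
  congr 1
  rw [mixed_b_apply, mixed_b_apply, map_sum]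
  refine Finset.sum_congr rfl fun i _ => ?_
  rw [map_smul, cofreeAt_δ_le i.zero_le (Nat.zero_le _), cofreeAt_lift_zero]
  rfl

end Cofree

section Dec
variable (X : CocyclicData.{w})

/-- The décalage of a cosimplicial module: `Xⁿ⁺¹` in degree `n`, without `δ₀` and `σ₀`. -/
abbrev dec : CocyclicData.{w} where
  obj n := X.obj (n + 1)
  δ n i := X.δ (n + 1) (i + 1)
  σ n j := X.σ (n + 1) (j + 1)
  τ _ := 0

variable {X}

lemma IsCosimplicial.dec (hX : X.IsCosimplicial) : X.dec.IsCosimplicial where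
  δ_δ n i j x h h' := by
    have := hX.δ_δ (n + 1) (i + 1) (j + 1) x (by omega) (by omega)
    rw [this, show j + 1 - 1 = j - 1 + 1 by omega]
  σ_σ n i j x h h' := hX.σ_σ (n + 1) (i + 1) (j + 1) x (by omega) (by omega)
  σ_δ_lt n i j x h h' := by
    have := hX.σ_δ_lt (n + 1) (i + 1) (j + 1) x (by omega) (by omega)
    rw [this, show j + 1 - 1 = j - 1 + 1 by omega]
  σ_δ_self n j x h := hX.σ_δ_self (n + 1) (j + 1) x (by omega)
  σ_δ_succ n j x h := hX.σ_δ_succ (n + 1) (j + 1) x (by omega)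
  σ_δ_gt n i j x h h' := by
    have := hX.σ_δ_gt (n + 1) (i + 1) (j + 1) x (by omega) (by omega)
    rw [this, show i + 1 - 1 = i - 1 + 1 by omega]

lemma mixed_b_eq_dec (p : ℕ) (x : X.obj (p + 1)) :
    X.mixed.b (p + 1) x = X.δ (p + 1) 0 x - X.dec.mixed.b p x := by
  rw [mixed_b_apply, mixed_b_apply, Finset.sum_range_succ', pow_zero, one_smul, sub_eq_neg_add,
    ← Finset.sum_neg_distrib]
  congr 1
  refine Finset.sum_congr rfl fun i _ => ?_
  rw [pow_succ]
  simp

/-- The coface `δ₀` is a cosimplicial map from a cosimplicial module to its décalage. -/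
lemma evalC_dec_δ_zero (hX : X.IsCosimplicial) {p r : ℕ} (θ : Word.{w'} False p r →₀ ℂ)
    (x : X.obj p) : Word.evalC X.dec θ (X.δ p 0 x) = X.δ r 0 (Word.evalC X θ x) :=
  (Word.evalC_natural (X := X) (Y := X.dec) (fun n => X.δ n 0)
    (fun n i x h => (hX.δ_δ n 0 (i + 1) x (by omega) (by omega)).symm)
    (fun n j x h => (hX.σ_δ_lt n 0 (j + 1) x (by omega) (by omega)).symm) (fun h => h.elim) θ x).symm

/-- The vertex operation `δₙ ⋯ δ₁ : X⁰ → Xⁿ`. -/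
def vertex (X : CocyclicData.{w}) : ∀ n, X.obj 0 →ₗ[ℂ] X.obj n
  | 0 => LinearMap.id
  | n + 1 => X.δ n (n + 1) ∘ₗ X.vertex n

lemma vertex_succ (n : ℕ) (x : X.obj 0) : X.vertex (n + 1) x = X.δ n (n + 1) (X.vertex n x) := rfl

lemma IsCosimplicial.δ_vertex (hX : X.IsCosimplicial) {n i : ℕ} (hi : i ≤ n) (x : X.obj 0) :
    X.δ n (i + 1) (X.vertex n x) = X.vertex (n + 1) x := by
  induction n with
  | zero => obtain rfl : i = 0 := by omega
            rfl
  | succ n ih =>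
    rcases hi.lt_or_eq with h | rfl
    · have h2 := hX.δ_δ n (i + 1) (n + 2) (X.vertex n x) (by omega) (by omega)
      rw [ih (by omega)] at h2
      exact h2.symm
    · rfl

lemma IsCosimplicial.σ_vertex (hX : X.IsCosimplicial) {n j : ℕ} (hj : j ≤ n) (x : X.obj 0) :
    X.σ n j (X.vertex (n + 1) x) = X.vertex n x := by
  rw [← hX.δ_vertex hj, hX.σ_δ_succ _ _ _ hj]

lemma eval_dec_vertex (hX : X.IsCosimplicial) {r : ℕ} (a : Word.{w'} False 0 r) (x : X.obj 0) :
    a.eval X.dec (X.δ 0 1 x) = X.vertex (r + 1) x := by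
  induction a with
  | nil => rfl
  | δ i h a ih =>
    simp only [Word.eval, LinearMap.comp_apply, ih]
    exact hX.δ_vertex h x
  | σ j h a ih =>
    simp only [Word.eval, LinearMap.comp_apply, ih]
    exact hX.σ_vertex (by omega) x
  | τ h => exact h.elim

/-- On a vertex, every cosimplicial operation of the décalage acts as the vertex operation. -/
lemma evalC_dec_vertex (hX : X.IsCosimplicial) {r : ℕ} (θ : Word.{w'} False 0 r →₀ ℂ)
    (x : X.obj 0) :
    Word.evalC X.dec θ (X.δ 0 1 x) = (θ.sum fun _ c => c) • X.vertex (r + 1) x := by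
  rw [Word.evalC, Finsupp.linearCombination_apply, Finsupp.sum, LinearMap.sum_apply, Finsupp.sum,
    Finset.sum_smul]
  refine Finset.sum_congr rfl fun a _ => ?_
  rw [LinearMap.smul_apply, eval_dec_vertex hX]

end Dec
end CocyclicData

/-! ### Exactness of the complexes of natural operations -/

lemma CocyclicModule.τ_pow_δ (n k i : ℕ) (hi : i ≤ n + 1) :
    ∃ j m, j ≤ n + 1 ∧ ∀ (X : CocyclicModule.{w}) (x : X.obj n),
      (X.τ (n + 1) ^ k) (X.δ n i x) = X.δ n j ((X.τ n ^ m) x) := by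
  induction k with
  | zero => exact ⟨i, 0, hi, fun _ _ => rfl⟩
  | succ k ih =>
    obtain ⟨j, m, hj, h⟩ := ih
    rcases j with _ | j
    · refine ⟨n + 1, m, le_rfl, fun X x => ?_⟩
      rw [pow_succ', Module.End.mul_apply, h, ← X.laws.τ_δ_zero]
      rfl
    · refine ⟨j, m + 1, by omega, fun X x => ?_⟩
      rw [pow_succ', Module.End.mul_apply, h, pow_succ']
      exact LinearMap.congr_fun (X.laws.τ_δ n (j + 1) (by omega) hj) _

lemma CocyclicModule.τ_pow_σ (n k i : ℕ) (hi : i ≤ n) :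
    ∃ j m, j ≤ n ∧ ∀ (X : CocyclicModule.{w}) (x : X.obj (n + 1)),
      (X.τ n ^ k) (X.σ n i x) = X.σ n j ((X.τ (n + 1) ^ m) x) := by
  induction k with
  | zero => exact ⟨i, 0, hi, fun _ _ => rfl⟩
  | succ k ih =>
    obtain ⟨j, m, hj, h⟩ := ih
    rcases j with _ | j
    · refine ⟨n, m + 2, le_rfl, fun X x => ?_⟩
      rw [pow_succ', Module.End.mul_apply, h, add_comm m 2, pow_add]
      exact LinearMap.congr_fun (X.laws.τ_σ_zero n) _
    · refine ⟨j, m + 1, by omega, fun X x => ?_⟩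
      rw [pow_succ', Module.End.mul_apply, h, pow_succ']
      exact LinearMap.congr_fun (X.laws.τ_σ n (j + 1) (by omega) hj) _

namespace NatOp
variable {p q r n : ℕ}

lemma ev_lam (X : CocyclicModule.{w}) (a : NatOp.{w} p n) (x : X.obj p) :
    ev X ((free p).lam n a : NatOp p n) x = X.lam n (ev X a x) :=
  (evHom X x).app_lam n a

lemma ev_norm (X : CocyclicModule.{w}) (a : NatOp.{w} p n) (x : X.obj p) :
    ev X ((free p).norm n a : NatOp p n) x = X.norm n (ev X a x) := by
  have h : ∀ i, ev X (((free p).lam n ^ i) a : NatOp p n) x = (X.lam n ^ i) (ev X a x) := by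
    intro i
    induction i with
    | zero => rfl
    | succ i ih => rw [pow_succ', Module.End.mul_apply, ev_lam, ih, pow_succ']; rfl
  rw [CocyclicData.norm_apply, CocyclicData.norm_apply, map_sum, LinearMap.sum_apply]
  exact Finset.sum_congr rfl fun i _ => h i

lemma ev_bPrime (X : CocyclicModule.{w}) (a : NatOp.{w} p n) (x : X.obj p) :
    ev X ((free p).bPrime n a : NatOp p (n + 1)) x = X.bPrime n (ev X a x) := by
  rw [CocyclicData.bPrime_apply, CocyclicData.bPrime_apply, map_sum, LinearMap.sum_apply]
  refine Finset.sum_congr rfl fun i hi => ?_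
  rw [map_smul, LinearMap.smul_apply, ev_δ X i (by simp at hi; omega)]

lemma ev_extra (X : CocyclicModule.{w}) (a : NatOp.{w} p (n + 1)) (x : X.obj p) :
    ev X ((free p).extra n a : NatOp p n) x = X.extra n (ev X a x) := by
  rw [CocyclicData.extra, LinearMap.comp_apply, ev_σ X n le_rfl, ev_τ]
  rfl

lemma ev_b (X : CocyclicModule.{w}) (a : NatOp.{w} p n) (x : X.obj p) :
    ev X ((free p).mixed.b n a : NatOp p (n + 1)) x = X.mixed.b n (ev X a x) :=
  ((evHom X x).app_b n a).symm

lemma ev_B (X : CocyclicModule.{w}) (a : NatOp.{w} p (n + 1)) (x : X.obj p) :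
    ev X ((free p).mixed.B n a : NatOp p n) x = X.mixed.B n (ev X a x) :=
  ((evHom X x).app_B n a).symm

/-- Precomposition with a natural operation that is given by its values. -/
lemma exists_precomp (l : NatOp.{w} p q) (a : NatOp.{w} q r)
    {t : ∀ X : CocyclicModule.{w}, X.obj p → X.obj q} (ht : ∀ X x, ev X l x = t X x) :
    ∃ c : NatOp.{w} p r, ∀ X x, ev X c x = ev X a (t X x) :=
  ⟨precomp l r a, fun X x => by rw [ev_precomp, ht]⟩

lemma exists_extra (a : NatOp.{w} p r) :
    ∃ c : NatOp.{w} (p + 1) r, ∀ X x, ev X c x = ev X a (X.extra p x) :=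
  exists_precomp ((free (p + 1)).extra p (gen (p + 1))) a fun X x => by rw [ev_extra, ev_gen]

lemma exists_norm (a : NatOp.{w} p r) :
    ∃ c : NatOp.{w} p r, ∀ X x, ev X c x = ev X a (X.norm p x) :=
  exists_precomp ((free p).norm p (gen p)) a fun X x => by rw [ev_norm, ev_gen]

lemma exists_sub_lam (a : NatOp.{w} p r) :
    ∃ c : NatOp.{w} p r, ∀ X x, ev X c x = ev X a (x - X.lam p x) :=
  exists_precomp (gen p - (free p).lam p (gen p) : NatOp p p) a fun X x => by
    rw [map_sub, LinearMap.sub_apply, ev_lam, ev_gen]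

lemma exists_bPrime (a : NatOp.{w} (p + 1) r) :
    ∃ c : NatOp.{w} p r, ∀ X x, ev X c x = ev X a (X.bPrime p x) :=
  exists_precomp ((free p).bPrime p (gen p)) a fun X x => by rw [ev_bPrime, ev_gen]

/-- The operations that agree with combinations of cosimplicial operations modulo operations of the
form `η (1 - λ)`. -/
def simplicialPart (p n : ℕ) : Submodule ℂ (NatOp.{w} p n) where
  carrier := {a | ∃ (θ : Word.{w} False p n →₀ ℂ) (η : NatOp.{w} p n),
    ∀ X x, ev X a x = Word.evalC X.toCocyclicData θ x + ev X η (x - X.lam p x)}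
  zero_mem' := ⟨0, 0, fun X x => by simp⟩
  add_mem' := by
    rintro a a' ⟨θ, η, h⟩ ⟨θ', η', h'⟩
    refine ⟨θ + θ', η + η', fun X x => ?_⟩
    rw [map_add, map_add, map_add, LinearMap.add_apply, LinearMap.add_apply, LinearMap.add_apply,
      h, h']
    abel
  smul_mem' := by
    rintro c a ⟨θ, η, h⟩
    refine ⟨c • θ, c • η, fun X x => ?_⟩
    rw [map_smul, map_smul, map_smul, LinearMap.smul_apply, LinearMap.smul_apply,
      LinearMap.smul_apply, h, smul_add]

lemma δ_mem_simplicialPart {i : ℕ} (hi : i ≤ n + 1) {a : NatOp.{w} p n}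
    (ha : a ∈ simplicialPart p n) : (free p).δ n i a ∈ simplicialPart p (n + 1) := by
  obtain ⟨θ, η, h⟩ := ha
  refine ⟨Finsupp.lmapDomain ℂ ℂ (Word.δ i hi) θ, (free p).δ n i η, fun X x => ?_⟩
  rw [ev_δ X i hi, ev_δ X i hi, h, map_add,
    Word.evalC_mapDomain X.toCocyclicData (Word.δ i hi) (X.δ n i) fun _ => rfl]
  rfl

lemma σ_mem_simplicialPart {j : ℕ} (hj : j ≤ n) {a : NatOp.{w} p (n + 1)}
    (ha : a ∈ simplicialPart p (n + 1)) : (free p).σ n j a ∈ simplicialPart p n := by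
  obtain ⟨θ, η, h⟩ := ha
  refine ⟨Finsupp.lmapDomain ℂ ℂ (Word.σ j hj) θ, (free p).σ n j η, fun X x => ?_⟩
  rw [ev_σ X j hj, ev_σ X j hj, h, map_add,
    Word.evalC_mapDomain X.toCocyclicData (Word.σ j hj) (X.σ n j) fun _ => rfl]
  rfl

lemma lam_pow_gen_mem (p k : ℕ) :
    (((free.{w} p).lam p ^ k) (gen p) : NatOp p p) ∈ simplicialPart p p := by
  induction k with
  | zero =>
    refine ⟨Finsupp.single Word.nil 1, 0, fun X x => ?_⟩
    rw [pow_zero, Module.End.one_apply, ev_gen, Word.evalC_single]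
    simp [Word.eval]
  | succ k ih =>
    obtain ⟨θ, η, h⟩ := ih
    refine ⟨θ, η - ((free p).lam p ^ k) (gen p), fun X x => ?_⟩
    have e : ∀ k y, ev X (((free p).lam p ^ k) (gen p) : NatOp p p) y = (X.lam p ^ k) y := by
      intro k y
      induction k with
      | zero => exact ev_gen X y
      | succ k ih => rw [pow_succ', Module.End.mul_apply, ev_lam, ih, pow_succ']; rfl
    have e' : (X.lam p ^ k) (X.lam p x) = (X.lam p ^ (k + 1)) x := by rw [pow_succ]; rfl
    have h1 := h X x
    rw [e] at h1 ⊢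
    rw [map_sub (ev X) η, LinearMap.sub_apply, map_sub (ev X (((free p).lam p ^ k) (gen p) :
      NatOp p p)), e, e, e', add_sub, ← h1]
    abel

/-- Every natural operation is a combination of cosimplicial operations modulo `1 - λ`, since cyclic
operators can be moved to the right. -/
lemma mem_simplicialPart (a : NatOp.{w} p n) : a ∈ simplicialPart p n := by
  have key : ∀ k, ((free p).τ n ^ k) a ∈ simplicialPart p n := by
    induction a using NatOp.induction with
    | zero n => intro k; rw [map_zero]; exact zero_mem _
    | add n a b ha hb => intro k; rw [map_add]; exact add_mem (ha k) (hb k)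
    | smul n c a ha => intro k; rw [map_smul]; exact Submodule.smul_mem _ _ (ha k)
    | gen =>
      intro k
      have : (free.{w} p).τ p = (-1 : ℂ) ^ p • (free p).lam p := by
        rw [CocyclicData.lam, smul_smul, ← mul_pow]; simp
      rw [this, smul_pow, LinearMap.smul_apply]
      exact Submodule.smul_mem _ _ (lam_pow_gen_mem p k)
    | δ n i a hi ha =>
      intro k
      obtain ⟨j, m, hj, h⟩ := CocyclicModule.τ_pow_δ.{w} n k i hi
      rw [h]
      exact δ_mem_simplicialPart hj (ha m)
    | σ n i a hi ha =>
      intro k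
      obtain ⟨j, m, hj, h⟩ := CocyclicModule.τ_pow_σ.{w} n k i hi
      rw [h]
      exact σ_mem_simplicialPart hj (ha m)
    | τ n a ha =>
      intro k
      rw [← Module.End.mul_apply, ← pow_succ]
      exact ha (k + 1)
  exact key 0

/-- The cone operation `ψ = σ₀ θ` on the décalage. -/
lemma exists_cone (θ : Word.{w} False p r →₀ ℂ) :
    ∃ ψ : NatOp.{w} (p + 1) r, ∀ X x, ev X ψ x = X.σ r 0 (Word.evalC X.dec θ x) := by
  refine ⟨(free (p + 1)).σ r 0 (Word.evalC (free (p + 1)).dec θ (gen (p + 1))), fun X x => ?_⟩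
  rw [ev_σ X 0 r.zero_le]
  congr 1
  have := Word.evalC_natural (X := (free.{w} (p + 1)).dec) (Y := X.dec)
    (fun n => (evHom X x).app (n + 1))
    (fun n i y h => LinearMap.congr_fun ((evHom X x).app_δ (n + 1) (i + 1) (by omega)) y)
    (fun n j y h => LinearMap.congr_fun ((evHom X x).app_σ (n + 1) (j + 1) (by omega)) y)
    (fun h => h.elim) θ (gen (p + 1))
  refine this.trans ?_
  rw [evHom_gen]

end NatOp

namespace NatOp
variable {p q r n : ℕ}

/-- Up to an operation `η (1 - λ)`, an operation of positive source degree that kills the boundaries of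
`λ`-invariant cochains factors through `b`: its cosimplicial part `θ` kills all boundaries, also on
the décalage, and `b = δ₀ - b_dec`, so that `σ₀ θ_dec b = σ₀ θ_dec δ₀ = θ`. -/
lemma decompose_succ (a : NatOp.{w} (p + 1) r)
    (h : ∀ (X : CocyclicModule.{w}) (x : X.obj p), X.lam p x = x → ev X a (X.mixed.b p x) = 0) :
    ∃ (ψ : NatOp.{w} (p + 2) r) (η : NatOp.{w} (p + 1) r), ∀ X x,
      ev X a x = ev X ψ (X.mixed.b (p + 1) x) + ev X η (x - X.lam (p + 1) x) := by
  obtain ⟨θ, η, hθ⟩ := mem_simplicialPart a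
  obtain ⟨ψ, hψ⟩ := exists_cone θ
  refine ⟨ψ, η, fun X x => ?_⟩
  have h0 : Word.evalC X.dec θ (X.dec.mixed.b p x) = 0 := by
    refine CocyclicData.evalC_b_eq_zero θ (fun X x hx => ?_) X.laws.isCosimplicial.dec x
    have := hθ X (X.mixed.b p x)
    rw [h X x hx, X.laws.b_sub_lam, hx, sub_self, map_zero, map_zero, add_zero] at this
    exact this.symm
  rw [hθ, hψ]
  congr 1
  rw [CocyclicData.mixed_b_eq_dec, map_sub, h0, sub_zero,
    CocyclicData.evalC_dec_δ_zero X.laws.isCosimplicial,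
    X.laws.isCosimplicial.σ_δ_self r 0 _ r.zero_le]

/-- In source degree zero there is no boundary to kill, and the term `δ₁` of `b = δ₀ - δ₁` contributes
a multiple of the vertex operation. -/
lemma decompose_zero (a : NatOp.{w} 0 r) :
    ∃ (ψ : NatOp.{w} 1 r) (c : ℂ), ∀ X x,
      ev X a x = ev X ψ (X.mixed.b 0 x) + c • X.vertex r x := by
  obtain ⟨θ, η, hθ⟩ := mem_simplicialPart a
  obtain ⟨ψ, hψ⟩ := exists_cone θ
  refine ⟨ψ, θ.sum fun _ c => c, fun X x => ?_⟩
  have h0 : x - X.lam 0 x = 0 := by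
    have := LinearMap.congr_fun (X.laws.lam_pow 0) x
    rw [pow_one] at this
    rw [this]; exact sub_self x
  have h1 : X.mixed.b 0 x = X.δ 0 0 x - X.δ 0 1 x := by
    rw [CocyclicData.mixed_b_apply]
    simp [Finset.sum_range_succ, sub_eq_add_neg]
  rw [hθ, h0, map_zero, add_zero, hψ, h1, map_sub,
    CocyclicData.evalC_dec_δ_zero X.laws.isCosimplicial,
    CocyclicData.evalC_dec_vertex X.laws.isCosimplicial, map_sub,
    X.laws.isCosimplicial.σ_δ_self r 0 _ r.zero_le, map_smul,
    X.laws.isCosimplicial.σ_vertex r.zero_le, sub_add_cancel]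

/-- The diagram chase in the bicomplex with rows `1 - λ`, `N` and columns `b`, `b'`. -/
lemma chase (φ : NatOp.{w} (p + 1) r)
    (ψ : NatOp.{w} (p + 2) r) (η : NatOp.{w} (p + 1) r)
    (hφ : ∀ X x, ev X φ x = ev X ψ (X.mixed.b (p + 1) x) + ev X η (x - X.lam (p + 1) x))
    (κ : NatOp.{w} p r) (hκ : ∀ X x, ev X η (X.bPrime p x) = ev X κ (X.norm p x))
    (ψ' : NatOp.{w} (p + 1) r) (η' μ : NatOp.{w} p r)
    (h' : ∀ X x, ev X κ x = ev X ψ' (X.mixed.b p x) + ev X η' (x - X.lam p x) + ev X μ x)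
    (hμ : ∀ X x, ev X μ (X.norm p x) = ev X μ (X.norm p (X.extra p (X.bPrime p x)))) :
    ∃ ψ'' : NatOp.{w} (p + 2) r, ∀ X x,
      ev X φ x = ev X ψ'' (X.mixed.b (p + 1) x) + ev X μ (X.mixed.B p x) := by
  obtain ⟨α, hα⟩ := exists_norm ψ'
  obtain ⟨β, hβ⟩ := exists_norm μ
  obtain ⟨γ, hγ⟩ := exists_extra β
  -- `ξ = η - ψ' N - μ N s` satisfies `ξ b' = 0`, hence `ξ = (ξ s) b'`
  have hξ : ∀ X x, ev X (η - α - γ) (X.bPrime p x) = 0 := by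
    intro X x
    rw [map_sub, map_sub, LinearMap.sub_apply, LinearMap.sub_apply, hα, hγ, hβ, hκ, ← hμ, h',
      ← X.laws.b_norm, X.laws.lam_norm, sub_self, map_zero]
    abel
  obtain ⟨ξ, hξ'⟩ := exists_extra (η - α - γ)
  obtain ⟨ζ, hζ⟩ := exists_sub_lam ξ
  refine ⟨ψ + ζ, fun X x => ?_⟩
  have e1 : ∀ y, ev X (η - α - γ) y = ev X ξ (X.bPrime (p + 1) y) := by
    intro y
    rw [hξ']
    conv_lhs => rw [← X.laws.extra_bPrime p y]
    rw [map_add, hξ, add_zero]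
  have e2 := e1 (x - X.lam (p + 1) x)
  have e3 : ∀ y, ev X (η - α - γ) y = ev X η y - ev X α y - ev X γ y := fun y => by
    rw [map_sub, map_sub, LinearMap.sub_apply, LinearMap.sub_apply]
  rw [← X.laws.b_sub_lam, ← hζ, e3, hα, hγ, hβ, X.laws.norm_sub_lam, map_zero, sub_zero, sub_eq_iff_eq_add] at e2
  rw [hφ, e2, map_add, LinearMap.add_apply, CocyclicData.mixed_B_apply]
  abel

/-- If `η b'` kills the image of `1 - λ`, then it factors through the norm operator, by averaging. -/
lemma exists_norm_factor (η : NatOp.{w} (p + 1) r)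
    (h : ∀ X x, ev X η (X.bPrime p (x - X.lam p x)) = 0) :
    ∃ κ : NatOp.{w} p r, (∀ X x, ev X η (X.bPrime p x) = ev X κ (X.norm p x)) ∧
      ∀ X x, ev X κ x = (((p + 1 : ℕ) : ℂ)⁻¹) • ev X η (X.bPrime p x) := by
  obtain ⟨κ, hκ⟩ := exists_bPrime η
  have e : ∀ X x, ev X (((p + 1 : ℕ) : ℂ)⁻¹ • κ) x =
      (((p + 1 : ℕ) : ℂ)⁻¹) • ev X η (X.bPrime p x) := by
    intro X x
    rw [map_smul, LinearMap.smul_apply, hκ]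
  refine ⟨((p + 1 : ℕ) : ℂ)⁻¹ • κ, fun X x => ?_, e⟩
  have e1 : ∀ i, ev X η (X.bPrime p ((X.lam p ^ i) x)) = ev X η (X.bPrime p x) := by
    intro i
    induction i with
    | zero => rfl
    | succ i ih =>
      rw [← ih, eq_comm, ← sub_eq_zero, ← map_sub, ← map_sub, pow_succ']
      exact h X _
  rw [e, CocyclicData.norm_apply, map_sum, map_sum, Finset.sum_congr rfl fun i _ => e1 i]
  simp only [Finset.sum_const, Finset.card_range, ← Nat.cast_smul_eq_nsmul ℂ]
  rw [smul_smul, inv_mul_cancel₀ (by exact_mod_cast p.succ_ne_zero), one_smul]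

/-- Exactness of the complex of operations in source degrees at least two. -/
lemma exact_succ (φ : NatOp.{w} (p + 2) r) (h : ∀ X x, ev X φ (X.mixed.b (p + 1) x) = 0) :
    ∃ ψ : NatOp.{w} (p + 3) r, ∀ X x, ev X φ x = ev X ψ (X.mixed.b (p + 2) x) := by
  obtain ⟨ψ, η, hφ⟩ := decompose_succ φ fun X x _ => h X x
  obtain ⟨κ, hκ, hκ'⟩ := exists_norm_factor η fun X x => by
    have := h X x
    rwa [hφ, X.laws.b_b, map_zero, zero_add, X.laws.b_sub_lam] at this
  obtain ⟨ψ', η', h'⟩ := decompose_succ κ fun X x hx => by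
    have e := CocyclicData.norm_of_lam_eq p x hx
    have : ev X κ (X.mixed.b p (X.norm p x)) = 0 := by
      rw [X.laws.b_norm, ← hκ, X.laws.bPrime_bPrime, map_zero]
    rw [e, map_smul, map_smul] at this
    exact (smul_eq_zero.1 this).resolve_left (by exact_mod_cast p.succ_ne_zero)
  obtain ⟨ψ'', h''⟩ := chase φ ψ η hφ κ hκ ψ' η' 0 (fun X x => by rw [h']; simp)
    (fun X x => by simp)
  exact ⟨ψ'', fun X x => by rw [h'']; simp⟩

/-- The vertex operation as a natural operation. -/
def vertexOp (r : ℕ) : NatOp.{w} 0 r := (free 0).vertex r (gen 0)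

lemma ev_vertexOp (X : CocyclicModule.{w}) (x : X.obj 0) :
    ev X (vertexOp r) x = X.vertex r x := by
  induction r with
  | zero => exact ev_gen X x
  | succ r ih =>
    rw [CocyclicData.vertex_succ, ← ih]
    exact ev_δ X (r + 1) le_rfl _ x

/-- Exactness in source degree one, up to the composite of the vertex operation with `B`. -/
lemma exact_one (φ : NatOp.{w} 1 r) (h : ∀ X x, ev X φ (X.mixed.b 0 x) = 0) :
    ∃ (ψ : NatOp.{w} 2 r) (c : ℂ), ∀ X x,
      ev X φ x = ev X ψ (X.mixed.b 1 x) + c • X.vertex r (X.mixed.B 0 x) := by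
  obtain ⟨ψ, η, hφ⟩ := decompose_succ φ fun X x _ => h X x
  obtain ⟨κ, hκ, hκ'⟩ := exists_norm_factor η fun X x => by
    have := h X x
    rwa [hφ, X.laws.b_b, map_zero, zero_add, X.laws.b_sub_lam] at this
  obtain ⟨ψ', c, h'⟩ := decompose_zero κ
  obtain ⟨ψ'', h''⟩ := chase φ ψ η hφ κ hκ ψ' 0 (c • vertexOp r)
    (fun X x => by rw [h', map_smul, LinearMap.smul_apply, ev_vertexOp]; simp)
    (fun X x => by rw [X.laws.extra_bPrime_zero])
  exact ⟨ψ'', c, fun X x => by rw [h'', map_smul, LinearMap.smul_apply, ev_vertexOp]⟩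

end NatOp

/-! ### Test cocycles -/

/-- The constant cosimplicial module with value `ℂ`. -/
abbrev constData : CocyclicData.{w} where
  obj _ := ULift.{w} ℂ
  δ _ _ := LinearMap.id
  σ _ _ := LinearMap.id
  τ _ := LinearMap.id

lemma constData_isCosimplicial : constData.{w}.IsCosimplicial := by
  constructor <;> intros <;> rfl

/-- The cofree cocyclic module on the constant cosimplicial module. -/
abbrev testModule : CocyclicModule.{w} := ⟨constData.cofree, constData_isCosimplicial.cofree⟩

/-- The cochain `(1)` in degree zero and `(0, 1, …, n)` in positive degrees `n`; those of degree zero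
and one are cocycles. -/
def testCochain : ∀ n, testModule.{w}.obj n
  | 0 => fun _ => ⟨1⟩
  | _ + 1 => fun a => ⟨a.1⟩

lemma b_testCochain_zero : testModule.{w}.mixed.b 0 (testCochain 0) = 0 := by
  rw [CocyclicData.mixed_b_apply]
  refine funext fun a => ULift.ext _ _ ?_
  fin_cases a <;> simp [Finset.sum_range_succ, CocyclicData.cofreeAt, testCochain] <;> rfl

lemma b_testCochain_one : testModule.{w}.mixed.b 1 (testCochain 1) = 0 := by
  rw [CocyclicData.mixed_b_apply]
  refine funext fun a => ULift.ext _ _ ?_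
  fin_cases a <;> simp [Finset.sum_range_succ, CocyclicData.cofreeAt, testCochain] <;> rfl

lemma B_testCochain_one : testModule.{w}.mixed.B 0 (testCochain 1) = testCochain 0 := by
  rw [CocyclicData.mixed_B_apply, CocyclicData.norm_apply]
  refine funext fun a => ULift.ext _ _ ?_
  fin_cases a
  simp [CocyclicData.cofreeAt, testCochain, CocyclicData.extra, CocyclicData.lam]

lemma vertex_testCochain (r : ℕ) (a : Fin (r + 1)) :
    testModule.{w}.vertex r (testCochain 0) a = ⟨1⟩ := by
  induction r with
  | zero => rfl
  | succ r ih =>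
    rw [CocyclicData.vertex_succ]
    simp only [LinearMap.pi_apply]
    split_ifs
    · exact ih _
    · exact ih _

namespace NatOp

/-- The value of a natural operation on a test cocycle, at the first vertex. -/
def test (p r : ℕ) : NatOp.{w} p r →ₗ[ℂ] ℂ :=
  ULift.moduleEquiv.toLinearMap ∘ₗ LinearMap.proj (0 : Fin (r + 1)) ∘ₗ
    (ev testModule).flip (testCochain p)

lemma test_apply {p r : ℕ} (a : NatOp.{w} p r) :
    test p r a = (ev testModule a (testCochain p) 0).down := rfl

end NatOp

/-! ### The mixed complexes of natural operations -/

namespace NatOp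
variable {p q r n : ℕ}

/-- The operations with values in degree `r`, as a mixed complex: composition with Connes' operator
raises the degree, and composition with Hochschild's differential lowers it. -/
abbrev opData (r : ℕ) : MixedData.{w} where
  obj p := NatOp.{w} p r
  b p := precomp ((free (p + 1)).mixed.B p (gen (p + 1))) r
  B p := precomp ((free p).mixed.b p (gen p)) r

lemma ev_opData_b (X : CocyclicModule.{w}) (a : NatOp.{w} p r) (x : X.obj (p + 1)) :
    ev X ((opData r).b p a : NatOp (p + 1) r) x = ev X a (X.mixed.B p x) := by
  rw [ev_precomp, ev_B, ev_gen]

lemma ev_opData_B (X : CocyclicModule.{w}) (a : NatOp.{w} (p + 1) r) (x : X.obj p) :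
    ev X ((opData r).B p a : NatOp p r) x = ev X a (X.mixed.b p x) := by
  rw [ev_precomp, ev_b, ev_gen]

lemma opData_isMixed (r : ℕ) : (opData.{w} r).IsMixed where
  b_b p a := ext fun X x => by
    rw [ev_opData_b, ev_opData_b, X.laws.isMixed.B_B]; simp
  B_B p a := ext fun X x => by
    rw [ev_opData_B, ev_opData_B, X.laws.isMixed.b_b]; simp
  b_B p a := ext fun X x => by
    rw [map_add, LinearMap.add_apply, ev_opData_b, ev_opData_B, ev_opData_B, ev_opData_b,
      ← map_add, X.laws.isMixed.b_B]
    simp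
  B_b_zero a := ext fun X x => by
    rw [ev_opData_B, ev_opData_b, X.laws.isMixed.B_b_zero]; simp

/-- The projection to the harmonic operations, which are the multiples of the vertex operation in
degree zero and of its composite with `B` in degree one. -/
def harmonic (r : ℕ) : ∀ p, NatOp.{w} p r →ₗ[ℂ] NatOp.{w} p r
  | 0 => (test 0 r).smulRight (vertexOp r)
  | 1 => (test 1 r).smulRight ((opData r).b 0 (vertexOp r))
  | _ + 2 => 0

lemma test_vertexOp (r : ℕ) : test.{w} 0 r (vertexOp r) = 1 := by
  rw [test_apply, ev_vertexOp, vertex_testCochain]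

lemma test_b_vertexOp (r : ℕ) : test.{w} 1 r ((opData r).b 0 (vertexOp r)) = 1 := by
  rw [test_apply, ev_opData_b, B_testCochain_one, ev_vertexOp, vertex_testCochain]

lemma test_B_zero (r : ℕ) (a : NatOp.{w} 1 r) : test 0 r ((opData r).B 0 a) = 0 := by
  rw [test_apply, ev_opData_B, b_testCochain_zero, map_zero]; rfl

lemma test_B_one (r : ℕ) (a : NatOp.{w} 2 r) : test 1 r ((opData r).B 1 a) = 0 := by
  rw [test_apply, ev_opData_B, b_testCochain_one, map_zero]; rfl

/-- The complex of operations is exact up to `harmonic`. Evaluation on the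
test cocycles kills composites with `b` and reads off the coefficients of the harmonic operations. -/
lemma exists_opContraction (r : ℕ) : ∃ c : (opData.{w} r).Contraction, c.P = harmonic r := by
  refine MixedData.exists_contraction (opData_isMixed r) (harmonic r) ?_ ?_ ?_ ?_ ?_
  · intro p a
    match p with
    | 0 =>
      rw [harmonic, LinearMap.smulRight_apply, test_B_zero, zero_smul]
    | 1 =>
      rw [harmonic, LinearMap.smulRight_apply, test_B_one, zero_smul]
    | _ + 2 => rfl
  · intro p a
    match p with
    | 0 =>
      rw [harmonic, LinearMap.smulRight_apply, map_smul, (opData_isMixed r).B_b_zero, smul_zero]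
    | p + 1 => exact map_zero _
  · intro p a
    match p with
    | 0 => simp [harmonic, test_vertexOp]
    | 1 =>
      change test 1 r (test 1 r a • (opData r).b 0 (vertexOp r)) • (opData r).b 0 (vertexOp r) =
        test 1 r a • (opData r).b 0 (vertexOp r)
      rw [map_smul, test_b_vertexOp, smul_eq_mul, mul_one]
    | _ + 2 => rfl
  · intro a
    obtain ⟨ψ, c, h⟩ := decompose_zero a
    have e : a = (opData r).B 0 ψ + c • vertexOp r := ext fun X x => by
      rw [h, map_add, map_smul, LinearMap.add_apply, LinearMap.smul_apply, ev_opData_B,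
        ev_vertexOp]
    have h1 : test 0 r a = c := by
      rw [e, map_add, test_B_zero, map_smul, test_vertexOp, smul_eq_mul, mul_one, zero_add]
    refine ⟨ψ, ?_⟩
    rw [harmonic, LinearMap.smulRight_apply, h1]
    exact e
  · intro p a ha
    have ha' : ∀ (X : CocyclicModule.{w}) x, ev X a (X.mixed.b p x) = 0 := fun X x => by
      rw [← ev_opData_B]
      exact (congrArg (fun t => ev X t x) ha).trans (by simp)
    match p, a, ha, ha' with
    | 0, a, ha, ha' =>
      obtain ⟨ψ, c, h⟩ := exact_one a ha'
      have e : a = (opData r).B 1 ψ + c • (opData r).b 0 (vertexOp r) := ext fun X x => by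
        rw [h, map_add, map_smul, LinearMap.add_apply, LinearMap.smul_apply, ev_opData_B,
          ev_opData_b, ev_vertexOp]
      have h1 : test 1 r a = c := by
        rw [e, map_add, test_B_one, map_smul, test_b_vertexOp, smul_eq_mul, mul_one, zero_add]
      refine ⟨ψ, ?_⟩
      rw [harmonic, LinearMap.smulRight_apply, h1]
      exact e
    | p + 1, a, ha, ha' =>
      obtain ⟨ψ, h⟩ := exact_succ a ha'
      refine ⟨ψ, ext fun X x => ?_⟩
      rw [h, harmonic, LinearMap.zero_apply, add_zero, ev_opData_B]

/-- A contraction of the complex of natural operations to the harmonic operations. -/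
def opContraction (r : ℕ) : (opData.{w} r).Contraction := (exists_opContraction r).choose

lemma opContraction_P (r : ℕ) : (opContraction.{w} r).P = harmonic r :=
  (exists_opContraction r).choose_spec

end NatOp

namespace MixedData

/-! ### Sequences of cochains -/

section Families
variable (T : MixedData.{w})

/-- The differential `b + B` on sequences of cochains. -/
def famD : (∀ r, T.obj r) →ₗ[ℂ] (∀ r, T.obj r) where
  toFun y r := match r with
    | 0 => T.B 0 (y 1)
    | r + 1 => T.b r (y r) + T.B (r + 1) (y (r + 2))
  map_add' x y := by
    funext r
    cases r with
    | zero => exact map_add _ _ _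
    | succ r => simp only [Pi.add_apply, map_add]; abel
  map_smul' c y := by
    funext r
    cases r with
    | zero => exact map_smul _ _ _
    | succ r => simp

lemma famD_zero (y : ∀ r, T.obj r) : T.famD y 0 = T.B 0 (y 1) := rfl

lemma famD_succ (y : ∀ r, T.obj r) (r : ℕ) :
    T.famD y (r + 1) = T.b r (y r) + T.B (r + 1) (y (r + 2)) := rfl

variable {T}

lemma famD_famD (hT : T.IsMixed) (y : ∀ r, T.obj r) : T.famD (T.famD y) = 0 := by
  funext r
  match r with
  | 0 => rw [famD_zero, famD_succ, map_add, hT.B_b_zero, hT.B_B, add_zero]; rfl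
  | 1 =>
    rw [famD_succ, famD_zero, famD_succ, map_add, hT.B_B, add_zero, hT.b_B]; rfl
  | r + 2 =>
    rw [famD_succ, famD_succ, famD_succ, map_add, map_add, hT.b_b, hT.B_B, zero_add, add_zero,
      hT.b_B]
    rfl

/-- The restriction of a sequence to the total complex in degree `n`. -/
def restr (n : ℕ) : (∀ r, T.obj r) →ₗ[ℂ] T.TC n where
  toFun y s := y s.1.1
  map_add' _ _ := rfl
  map_smul' _ _ := rfl

lemma d_restr (n : ℕ) (y : ∀ r, T.obj r) (hy : y (n + 2) = 0) :
    T.d n (restr n y) = restr (n + 1) (T.famD y) := by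
  funext ⟨⟨m, k⟩, h⟩
  change T.bPart (restr n y) m k h + T.BPart (restr n y) m k h = T.famD y m
  rcases m with _ | m <;> rcases k with _ | k
  · omega
  · exact zero_add _
  · obtain rfl : m = n := by omega
    rw [famD_succ, hy, map_zero]
    rfl
  · rfl

/-- The sequence of the components of a cochain of the total complex. -/
def fam {n : ℕ} (x : T.TC n) (m : ℕ) : T.obj m := ext x m ((n - m) / 2)

lemma fam_of_eq {n m k : ℕ} (x : T.TC n) (h : m + 2 * k = n) : fam x m = x ⟨(m, k), h⟩ := by
  obtain rfl : k = (n - m) / 2 := by omega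
  rw [fam, ext, dif_pos h]

lemma fam_of_ne {n m : ℕ} (x : T.TC n) (h : ∀ k, m + 2 * k ≠ n) : fam x m = 0 := by
  rw [fam, ext, dif_neg (h _)]

lemma restr_fam {n : ℕ} (x : T.TC n) : restr n (fam x) = x :=
  funext fun ⟨⟨_, _⟩, h⟩ => fam_of_eq x h

lemma fam_d {n : ℕ} (x : T.TC n) : fam (T.d n x) = T.famD (fam x) := by
  funext m
  by_cases h : ∃ k, m + 2 * k = n + 1
  · obtain ⟨k, h⟩ := h
    rw [fam_of_eq _ h]
    have := congrFun (d_restr n (fam x) (fam_of_ne _ (by omega))) ⟨(m, k), h⟩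
    rwa [restr_fam] at this
  · rw [fam_of_ne _ (by simpa using h)]
    rcases m with _ | m
    · rw [famD_zero, fam_of_ne, map_zero]
      intro k hk
      exact h ⟨k + 1, by omega⟩
    · rw [famD_succ, fam_of_ne, fam_of_ne, map_zero, map_zero, add_zero]
      · intro k hk
        exact h ⟨k + 1, by omega⟩
      · intro k hk
        exact h ⟨k, by omega⟩

end Families

/-! ### Perturbation of a homotopy -/

section Perturbation
variable {S : MixedData.{w}} (c : S.Homotopy) (A : ∀ n, S.obj n →ₗ[ℂ] S.obj n) (ε : ℂ)
  (g : ∀ n, S.obj n)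

/-- The successive solutions `k` of `B kₙ₊₁ = ε (gₙ - A kₙ) - b kₙ₋₁`. -/
def perturb : ∀ n, S.obj n
  | 0 => 0
  | 1 => c.h 0 (ε • g 0)
  | n + 2 => c.h (n + 1) (ε • (g (n + 1) - A (n + 1) (perturb (n + 1))) - S.b n (perturb n))

/-- The right-hand sides of the equations for `perturb`. -/
def perturbRhs : ∀ n, S.obj n
  | 0 => ε • g 0
  | n + 1 => ε • (g (n + 1) - A (n + 1) (perturb c A ε g (n + 1))) - S.b n (perturb c A ε g n)

lemma perturb_succ (n : ℕ) : perturb c A ε g (n + 1) = c.h n (perturbRhs c A ε g n) := by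
  cases n <;> simp only [perturb, perturbRhs]

variable {c A ε g}

/-- The equations for `perturb` have a solution as soon as the right-hand sides have no harmonic
part: if `g` is a cocycle, then the right-hand sides are cycles, by induction. -/
lemma B_perturb (hS : S.IsMixed) (hε : ε * ε = 1)
    (hAB : ∀ n x, A n (S.B n x) = S.B n (A (n + 1) x))
    (hAb : ∀ n x, A (n + 1) (S.b n x) = S.b n (A n x)) (hA : ∀ n x, A n (A n x) = 0)
    (hg : ∀ n, A n (g n) = ε • S.famD g n)
    (hP : ∀ n, c.P n (perturbRhs c A ε g n) = 0) (n : ℕ) :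
    S.B n (perturb c A ε g (n + 1)) = perturbRhs c A ε g n := by
  have step : ∀ n, S.B n (perturbRhs c A ε g (n + 1)) = 0 →
      S.B (n + 1) (perturb c A ε g (n + 2)) = perturbRhs c A ε g (n + 1) := by
    intro n h
    have := c.B_h n (perturbRhs c A ε g (n + 1))
    rwa [h, map_zero, add_zero, hP, sub_zero, ← perturb_succ] at this
  have hsm : ∀ {n} (x : S.obj n), ε • ε • x = x := fun x => by rw [smul_smul, hε, one_smul]
  induction n using Nat.strong_induction_on with
  | _ n ih =>
    match n, ih with
    | 0, ih =>
      have := c.B_h_zero (perturbRhs c A ε g 0)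
      rwa [hP, sub_zero, ← perturb_succ] at this
    | 1, ih =>
      refine step 0 ?_
      have e0 := ih 0 (by omega)
      simp only [perturbRhs] at e0 ⊢
      have e1 : S.b 0 (perturb c A ε g 0) = 0 := map_zero _
      rw [e1, sub_zero, map_smul, map_sub, ← hAB, e0, map_smul, hg,
        famD_zero, smul_sub, hsm, sub_self]
    | n + 2, ih =>
      refine step (n + 1) ?_
      have e0 := ih (n + 1) (by omega)
      have e1 := ih n (by omega)
      simp only [perturbRhs] at e0 ⊢
      have e2 : S.B (n + 1) (S.b (n + 1) (perturb c A ε g (n + 1))) =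
          -S.b n (perturbRhs c A ε g n) := by
        rw [← e1]
        exact eq_neg_of_add_eq_zero_right (hS.b_B n _)
      have e3 : S.b n (perturbRhs c A ε g n) = ε • (S.b n (g n) - A (n + 1) (S.b n (perturb c A ε g n))) := by
        match n with
        | 0 =>
          have e1 : S.b 0 (perturb c A ε g 0) = 0 := map_zero _
          rw [e1, map_zero, sub_zero, perturbRhs, map_smul]
        | n + 1 =>
          rw [perturbRhs, map_sub, hS.b_b, sub_zero, map_smul, map_sub, hAb]
      rw [map_sub, map_smul, map_sub, e2, ← hAB, e0, e3, map_sub, map_smul, map_sub, hA, sub_zero,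
        hg, famD_succ, smul_sub, smul_sub, smul_sub, hsm]
      simp only [smul_add]
      abel

/-- The equation `(A + ε (b + B)) k = g` for `k = perturb c A ε g`. -/
lemma perturb_spec (hS : S.IsMixed) (hε : ε * ε = 1)
    (hAB : ∀ n x, A n (S.B n x) = S.B n (A (n + 1) x))
    (hAb : ∀ n x, A (n + 1) (S.b n x) = S.b n (A n x)) (hA : ∀ n x, A n (A n x) = 0)
    (hg : ∀ n, A n (g n) = ε • S.famD g n)
    (hP : ∀ n, c.P n (perturbRhs c A ε g n) = 0) (n : ℕ) :
    A n (perturb c A ε g n) + ε • S.famD (perturb c A ε g) n = g n := by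
  have h := B_perturb hS hε hAB hAb hA hg hP n
  rcases n with _ | n
  · have e1 : A 0 (perturb c A ε g 0) = 0 := map_zero _
    rw [famD_zero, h, perturbRhs, smul_smul, hε, one_smul, e1, zero_add]
  · rw [famD_succ, h, perturbRhs, add_sub_cancel, smul_smul, hε, one_smul, add_sub_cancel]

end Perturbation

section Support
variable {V : ℕ → MixedData.{w}}

/-- The sequence `x` is concentrated in the degrees `n - d - 2 i` with `i ≥ 0`. -/
def SuppLE (d : ℕ) {n : ℕ} (x : (MixedData.pi V).obj n) : Prop :=
  ∀ r, (∀ i, r + d + 2 * i ≠ n) → x r = 0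

variable {c : ∀ r, (V r).Homotopy} {A : ∀ n, (MixedData.pi V).obj n →ₗ[ℂ] (MixedData.pi V).obj n}
  {ε : ℂ} {g : ∀ n, (MixedData.pi V).obj n} {d n : ℕ}

lemma SuppLE.sub {x y : (MixedData.pi V).obj n} (hx : SuppLE d x) (hy : SuppLE d y) :
    SuppLE d (x - y) := fun r h => by
  rw [Pi.sub_apply, hx r h, hy r h, sub_zero]

lemma SuppLE.add {x y : (MixedData.pi V).obj n} (hx : SuppLE d x) (hy : SuppLE d y) :
    SuppLE d (x + y) := fun r h => by
  rw [Pi.add_apply, hx r h, hy r h, add_zero]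

lemma SuppLE.smul {x : (MixedData.pi V).obj n} (hx : SuppLE d x) (a : ℂ) :
    SuppLE d (a • x) := fun r h => by
  rw [Pi.smul_apply, hx r h, smul_zero]

lemma SuppLE.of_add_two {x : (MixedData.pi V).obj n} (hx : SuppLE (d + 2) x) : SuppLE d x :=
  fun r h => hx r fun i hi => h (i + 1) (by omega)

lemma SuppLE.b {x : (MixedData.pi V).obj n} (hx : SuppLE d x) :
    SuppLE (d + 1) ((MixedData.pi V).b n x) := fun r h => by
  change (V r).b n (x r) = 0
  rw [hx r fun i hi => h i (by omega), map_zero]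

lemma SuppLE.h {x : (MixedData.pi V).obj n} (hx : SuppLE d x) :
    SuppLE (d + 1) ((Homotopy.pi c).h n x) := fun r h => by
  change (c r).h n (x r) = 0
  rw [hx r fun i hi => h i (by omega), map_zero]

/-- The value in degree `r` depends only on the values in degrees `r - 1` and `r + 1`. -/
def IsLocal (A : ∀ n, (MixedData.pi V).obj n →ₗ[ℂ] (MixedData.pi V).obj n) : Prop :=
  ∀ n x r, x (r + 1) = 0 → (∀ s, r = s + 1 → x s = 0) → A n x r = 0

lemma SuppLE.op (hA : IsLocal A) {x : (MixedData.pi V).obj n} (hx : SuppLE (d + 1) x) :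
    SuppLE d (A n x) := fun r h =>
  hA n x r (hx _ fun i hi => h (i + 1) (by omega))
    fun s hs => hx _ fun i hi => h i (by omega)

lemma SuppLE.perturb (hA : IsLocal A) (hg : ∀ n, SuppLE d (g n)) (n : ℕ) :
    SuppLE (d + 1) (perturb (Homotopy.pi c) A ε g n) := by
  induction n using Nat.strong_induction_on with
  | _ n ih =>
    match n, ih with
    | 0, _ => exact fun _ _ => rfl
    | 1, _ => exact ((hg 0).smul ε).h
    | n + 2, ih =>
      exact ((((hg (n + 1)).sub ((ih (n + 1) (by omega)).op hA)).smul ε).sub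
        ((ih n (by omega)).b).of_add_two).h

end Support

end MixedData

/-! ### Natural operations in two variables -/

namespace CocyclicData

/-- The identity map of a cocyclic module. -/
def Hom.refl (X : CocyclicData.{w}) : X.Hom X where
  app _ := LinearMap.id
  app_δ _ _ _ := rfl
  app_σ _ _ _ := rfl
  app_τ _ := rfl

lemma Hom.app_famD {X : CocyclicData.{w}} {Y : CocyclicData.{w'}} (f : X.Hom Y)
    (y : ∀ r, X.obj r) (r : ℕ) :
    Y.mixed.famD (fun r => f.app r (y r)) r = f.app r (X.mixed.famD y r) := by
  rcases r with _ | r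
  · exact f.app_B 0 _
  · rw [MixedData.famD_succ, MixedData.famD_succ, map_add, f.app_b, f.app_B]

end CocyclicData

namespace NatOp
variable {p q r n : ℕ}

/-- The sums of products `X^p ⊗ Y^q → X^r ⊗ Y^r`, `p + q = n`, of natural operations. -/
abbrev biData (r : ℕ) : MixedData.{w} := (opData.{w} r).tensor (opData.{w} r)

lemma biData_isMixed (r : ℕ) : (biData.{w} r).IsMixed := (opData_isMixed r).tensor (opData_isMixed r)

/-- The diagonal of two free cocyclic modules. -/
abbrev bi (p q : ℕ) : CocyclicData.{w} := (free.{w} p).diag (free.{w} q).toCocyclicData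

lemma bi_isMixed (p q : ℕ) : (bi.{w} p q).mixed.IsMixed := ((free p).laws.diag (free q).laws).isMixed

/-- Composition of operations in two variables with `b + B` of the diagonal. -/
def postD (n : ℕ) : (MixedData.pi biData.{w}).obj n →ₗ[ℂ] (MixedData.pi biData.{w}).obj n where
  toFun x r s := (bi s.1.1 s.1.2).mixed.famD (fun r' => x r' s) r
  map_add' x y := by
    funext r s
    exact congrFun (map_add (bi s.1.1 s.1.2).mixed.famD (fun r' => x r' s) fun r' => y r' s) r
  map_smul' c x := by
    funext r s
    exact congrFun (map_smul (bi s.1.1 s.1.2).mixed.famD c fun r' => x r' s) r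

lemma postD_apply (x : (MixedData.pi biData.{w}).obj n) (r p q : ℕ) (h : p + q = n) :
    (opData r).tensorAt (opData r) (postD n x r) p q h =
      (bi p q).mixed.famD (fun r' => (opData r').tensorAt (opData r') (x r') p q h) r := rfl

lemma postD_postD (x : (MixedData.pi biData.{w}).obj n) : postD n (postD n x) = 0 := by
  funext r s
  exact congrFun (MixedData.famD_famD (bi_isMixed s.1.1 s.1.2) fun r' => x r' s) r

lemma postD_isLocal : MixedData.IsLocal (postD.{w}) := by
  intro n x r h1 h2
  refine MixedData.tensor_obj_ext fun p q h => ?_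
  have e : ∀ r, x r = 0 → (opData r).tensorAt (opData r) (x r) p q h = 0 := by
    intro r hr; rw [hr]; rfl
  rw [postD_apply]
  rcases r with _ | r
  · rw [MixedData.famD_zero]
    simp only [e _ h1]
    exact map_zero _
  · rw [MixedData.famD_succ]
    simp only [e _ h1, e _ (h2 r rfl)]
    rw [map_zero, map_zero, add_zero]
    rfl

lemma famD_bi_left {p p' q : ℕ} (l : NatOp.{w} p p') (y : ∀ r, (bi p' q).obj r) (r : ℕ) :
    (bi p q).mixed.famD (fun r => (precomp l r).rTensor (NatOp q r) (y r)) r =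
      (precomp l r).rTensor (NatOp q r) ((bi p' q).mixed.famD y r) :=
  ((evHom (free p) l).diag (CocyclicData.Hom.refl (freeData q))).app_famD y r

lemma famD_bi_right {p q q' : ℕ} (l : NatOp.{w} q q') (y : ∀ r, (bi p q').obj r) (r : ℕ) :
    (bi p q).mixed.famD (fun r => (precomp l r).lTensor (NatOp p r) (y r)) r =
      (precomp l r).lTensor (NatOp p r) ((bi p q').mixed.famD y r) :=
  ((CocyclicData.Hom.refl (freeData p)).diag (evHom (free q) l)).app_famD y r

lemma famD_smul_add (c : ℂ) (y y' : ∀ r, (bi.{w} p q).obj r) (r : ℕ) :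
    (bi p q).mixed.famD (fun r => c • y r + y' r) r =
      c • (bi p q).mixed.famD y r + (bi p q).mixed.famD y' r := by
  have := congrFun (map_add (bi p q).mixed.famD (c • y) y') r
  rw [map_smul] at this
  exact this

lemma postD_B (x : (MixedData.pi biData.{w}).obj (n + 1)) :
    postD n ((MixedData.pi biData).B n x) = (MixedData.pi biData).B n (postD (n + 1) x) := by
  funext r
  refine MixedData.tensor_obj_ext fun p q h => ?_
  have h1 := famD_smul_add ((-1 : ℂ) ^ q)
    (fun r' => ((opData r').B p).rTensor (NatOp q r')
      ((opData r').tensorAt (opData r') (x r') (p + 1) q (by omega)))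
    (fun r' => ((opData r').B q).lTensor (NatOp p r')
      ((opData r').tensorAt (opData r') (x r') p (q + 1) (by omega))) r
  rw [famD_bi_left ((free p).mixed.b p (gen p)), famD_bi_right ((free q).mixed.b q (gen q))] at h1
  exact h1

lemma postD_b (x : (MixedData.pi biData.{w}).obj n) :
    postD (n + 1) ((MixedData.pi biData).b n x) = (MixedData.pi biData).b n (postD n x) := by
  funext r
  refine MixedData.tensor_obj_ext fun p q h => ?_
  rw [postD_apply]
  have e : ∀ r', (opData r').tensorAt (opData r') ((MixedData.pi biData).b n x r') p q h =
    (1 : ℂ) • (opData r').bLeft (opData r') (x r') p q h +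
      (opData r').bRight (opData r') (x r') p q h := fun r' => by rw [one_smul]; rfl
  simp only [e]
  refine (famD_smul_add 1 _ _ r).trans ?_
  have h0 : ∀ p q, (bi.{w} p q).mixed.famD (fun r => (0 : (bi p q).obj r)) = 0 :=
    fun p q => map_zero _
  have hL : (bi p q).mixed.famD (fun r' => (opData r').bLeft (opData r') (x r') p q h) r =
      (opData r).bLeft (opData r) (postD n x r) p q h := by
    rcases p with _ | p
    · exact congrFun (h0 0 q) r
    · simp only [MixedData.bLeft_succ]
      rw [postD_apply, ← famD_bi_left]
      exact congrFun (map_smul (bi (p + 1) q).mixed.famD ((-1 : ℂ) ^ q) _) r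
  have hR : (bi p q).mixed.famD (fun r' => (opData r').bRight (opData r') (x r') p q h) r =
      (opData r).bRight (opData r) (postD n x r) p q h := by
    rcases q with _ | q
    · exact congrFun (h0 p 0) r
    · simp only [MixedData.bRight_succ]
      rw [postD_apply, ← famD_bi_right]
  rw [hL, hR, one_smul]
  rfl

section Act
variable (X Y : CocyclicModule.{w})

/-- The value of an operation in two variables. -/
def act (p q r : ℕ) : NatOp.{w} p r ⊗[ℂ] NatOp.{w} q r →ₗ[ℂ]
    (X.obj p ⊗[ℂ] Y.obj q →ₗ[ℂ] X.obj r ⊗[ℂ] Y.obj r) :=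
  TensorProduct.homTensorHomMap (RingHom.id ℂ) _ _ _ _ ∘ₗ TensorProduct.map (ev X) (ev Y)

variable {X Y}

lemma act_tmul_tmul (a : NatOp.{w} p r) (b : NatOp.{w} q r) (x : X.obj p) (y : Y.obj q) :
    act X Y p q r (a ⊗ₜ b) (x ⊗ₜ y) = ev X a x ⊗ₜ ev Y b y := rfl

lemma act_tmul (t : NatOp.{w} p r ⊗[ℂ] NatOp.{w} q r) (x : X.obj p) (y : Y.obj q) :
    act X Y p q r t (x ⊗ₜ y) = ((evHom X x).diag (evHom Y y)).app r t := by
  induction t with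
  | zero => simp
  | add a b ha hb => rw [map_add, map_add, LinearMap.add_apply, ha, hb]
  | tmul a b => rfl

lemma act_gen (t : NatOp.{w} p r ⊗[ℂ] NatOp.{w} q r) :
    act (free p) (free q) p q r t (gen p ⊗ₜ gen q) = t := by
  rw [act_tmul]
  have h : ∀ {p} (a : NatOp.{w} p r), ev (free p) a (gen p) = a := fun {p} a => ext fun X x => by
    have := ev_precomp X (gen p) a x
    rw [ev_gen] at this
    exact this
  induction t with
  | zero => simp
  | add a b ha hb => rw [map_add, ha, hb]
  | tmul a b => exact congrArg₂ (· ⊗ₜ[ℂ] ·) (h a) (h b)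

lemma act_natural {X' Y' : CocyclicModule.{w}} (f : X.Hom X'.toCocyclicData)
    (g : Y.Hom Y'.toCocyclicData) (t : NatOp.{w} p r ⊗[ℂ] NatOp.{w} q r)
    (z : X.obj p ⊗[ℂ] Y.obj q) :
    (f.diag g).app r (act X Y p q r t z) =
      act X' Y' p q r t (TensorProduct.map (f.app p) (g.app q) z) := by
  induction t with
  | zero => simp
  | add a b ha hb => simp only [map_add, LinearMap.add_apply, ha, hb]
  | tmul a b =>
    induction z with
    | zero => simp
    | add a b ha hb => simp only [map_add, ha, hb]
    | tmul x y => exact congrArg₂ (· ⊗ₜ[ℂ] ·) (ev_hom f a x) (ev_hom g b y)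

lemma act_famD (t : ∀ r, NatOp.{w} p r ⊗[ℂ] NatOp.{w} q r) (z : X.obj p ⊗[ℂ] Y.obj q) (r : ℕ) :
    act X Y p q r ((bi p q).mixed.famD t r) z =
      (X.diag Y.toCocyclicData).mixed.famD (fun r => act X Y p q r (t r) z) r := by
  induction z with
  | zero =>
    simp only [map_zero]
    exact (congrFun (map_zero (X.diag Y.toCocyclicData).mixed.famD) r).symm
  | add a b ha hb =>
    simp only [map_add, ha, hb]
    exact (congrFun (map_add (X.diag Y.toCocyclicData).mixed.famD
      (fun r => act X Y p q r (t r) a) fun r => act X Y p q r (t r) b) r).symm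
  | tmul x y =>
    simp only [act_tmul]
    have h := CocyclicData.Hom.app_famD (X := bi p q) (Y := X.diag Y.toCocyclicData)
      ((evHom X x).diag (evHom Y y)) t r
    exact h.symm

lemma act_left {p p' : ℕ} (l : NatOp.{w} p p') (t : NatOp.{w} p' r ⊗[ℂ] NatOp.{w} q r)
    (z : X.obj p ⊗[ℂ] Y.obj q) :
    act X Y p q r ((precomp l r).rTensor _ t) z = act X Y p' q r t ((ev X l).rTensor _ z) := by
  induction t with
  | zero => simp
  | add a b ha hb => simp only [map_add, LinearMap.add_apply, ha, hb]
  | tmul a b =>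
    induction z with
    | zero => simp
    | add a b ha hb => simp only [map_add, ha, hb]
    | tmul x y =>
      rw [LinearMap.rTensor_tmul, LinearMap.rTensor_tmul, act_tmul_tmul, act_tmul_tmul, ev_precomp]

lemma act_right {q q' : ℕ} (l : NatOp.{w} q q') (t : NatOp.{w} p r ⊗[ℂ] NatOp.{w} q' r)
    (z : X.obj p ⊗[ℂ] Y.obj q) :
    act X Y p q r ((precomp l r).lTensor _ t) z = act X Y p q' r t ((ev Y l).lTensor _ z) := by
  induction t with
  | zero => simp
  | add a b ha hb => simp only [map_add, LinearMap.add_apply, ha, hb]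
  | tmul a b =>
    induction z with
    | zero => simp
    | add a b ha hb => simp only [map_add, ha, hb]
    | tmul x y =>
      rw [LinearMap.lTensor_tmul, LinearMap.lTensor_tmul, act_tmul_tmul, act_tmul_tmul, ev_precomp]

lemma ev_mixed_B (X : CocyclicModule.{w}) (p : ℕ) :
    ev X ((free (p + 1)).mixed.B p (gen (p + 1)) : NatOp (p + 1) p) = X.mixed.B p :=
  LinearMap.ext fun x => by rw [ev_B, ev_gen]

lemma ev_mixed_b (X : CocyclicModule.{w}) (p : ℕ) :
    ev X ((free p).mixed.b p (gen p) : NatOp p (p + 1)) = X.mixed.b p :=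
  LinearMap.ext fun x => by rw [ev_b, ev_gen]

end Act

/-! ### Sums over the components of a tensor product -/

/-- The sum of `F p q` over `p + q = n`. -/
def sumAnti {M : Type*} [AddCommMonoid M] (n : ℕ) (F : ∀ p q, p + q = n → M) : M :=
  ∑ t ∈ (Finset.HasAntidiagonal.antidiagonal n).attach,
    F t.1.1 t.1.2 (Finset.HasAntidiagonal.mem_antidiagonal.1 t.2)

section SumAnti
variable {M : Type*} [AddCommMonoid M]

lemma sumAnti_eq (n : ℕ) (F : ∀ p q, p + q = n → M) :
    sumAnti n F = ∑ t ∈ Finset.HasAntidiagonal.antidiagonal n,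
      if h : t.1 + t.2 = n then F t.1 t.2 h else 0 := by
  rw [← Finset.sum_attach]
  refine Finset.sum_congr rfl fun t _ => ?_
  rw [dif_pos]

lemma sumAnti_congr {n : ℕ} {F G : ∀ p q, p + q = n → M} (h : ∀ p q h, F p q h = G p q h) :
    sumAnti n F = sumAnti n G :=
  Finset.sum_congr rfl fun _ _ => h _ _ _

lemma sumAnti_add (n : ℕ) (F G : ∀ p q, p + q = n → M) :
    sumAnti n (fun p q h => F p q h + G p q h) = sumAnti n F + sumAnti n G :=
  Finset.sum_add_distrib

lemma sumAnti_left (n : ℕ) (F : ∀ p q, p + q = n + 1 → M) (h0 : ∀ q h, F 0 q h = 0) :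
    sumAnti (n + 1) F = sumAnti n fun p q h => F (p + 1) q (by omega) := by
  rw [sumAnti_eq, sumAnti_eq, Finset.Nat.sum_antidiagonal_succ]
  simp only [h0, dite_eq_ite, ite_self, zero_add]
  refine Finset.sum_congr rfl fun t ht => ?_
  have := Finset.HasAntidiagonal.mem_antidiagonal.1 ht
  rw [dif_pos (by omega), dif_pos this]

lemma sumAnti_right (n : ℕ) (F : ∀ p q, p + q = n + 1 → M) (h0 : ∀ p h, F p 0 h = 0) :
    sumAnti (n + 1) F = sumAnti n fun p q h => F p (q + 1) (by omega) := by
  rw [sumAnti_eq, sumAnti_eq, Finset.Nat.sum_antidiagonal_succ']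
  simp only [h0, dite_eq_ite, ite_self, add_zero, zero_add]
  refine Finset.sum_congr rfl fun t ht => ?_
  have := Finset.HasAntidiagonal.mem_antidiagonal.1 ht
  rw [dif_pos (by omega), dif_pos this]

lemma sumAnti_single {n : ℕ} (F : ∀ p q, p + q = n → M) (p q : ℕ) (h : p + q = n)
    (h0 : ∀ p' q' h', p' ≠ p → F p' q' h' = 0) : sumAnti n F = F p q h := by
  rw [sumAnti_eq, Finset.sum_eq_single (p, q)]
  · rw [dif_pos h]
  · rintro ⟨p', q'⟩ ht hne
    have := Finset.HasAntidiagonal.mem_antidiagonal.1 ht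
    rw [dif_pos this]
    refine h0 _ _ _ fun e => hne ?_
    dsimp only at this e
    rw [Prod.mk.injEq]
    omega
  · intro h'
    exact absurd (Finset.HasAntidiagonal.mem_antidiagonal.2 h) h'

end SumAnti
end NatOp

namespace NatOp
variable {p q r n : ℕ}

/-! ### The action of two-variable operations on cochains -/

section Star
variable (X Y : CocyclicModule.{w})

/-- The total value of an operation on `⨁ X^p ⊗ Y^q`, `p + q = n`. -/
def pair (n r : ℕ) (x : (biData.{w} r).obj n) (z : (X.mixed.tensor Y.mixed).obj n) :
    X.obj r ⊗[ℂ] Y.obj r :=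
  sumAnti n fun p q h =>
    act X Y p q r ((opData r).tensorAt (opData r) x p q h) (X.mixed.tensorAt Y.mixed z p q h)

variable {X Y}

lemma pair_add_left (x x' : (biData.{w} r).obj n) (z : (X.mixed.tensor Y.mixed).obj n) :
    pair X Y n r (x + x') z = pair X Y n r x z + pair X Y n r x' z := by
  rw [pair, pair, pair, ← sumAnti_add]
  exact sumAnti_congr fun p q h => by rw [MixedData.tensorAt_add, map_add, LinearMap.add_apply]

lemma pair_add_right (x : (biData.{w} r).obj n) (z z' : (X.mixed.tensor Y.mixed).obj n) :
    pair X Y n r x (z + z') = pair X Y n r x z + pair X Y n r x z' := by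
  rw [pair, pair, pair, ← sumAnti_add]
  exact sumAnti_congr fun p q h => by rw [MixedData.tensorAt_add, map_add]

lemma pair_zero_left (z : (X.mixed.tensor Y.mixed).obj n) :
    pair X Y n r (0 : (biData.{w} r).obj n) z = 0 := by
  rw [pair, sumAnti]
  refine Finset.sum_eq_zero fun t _ => ?_
  change act X Y _ _ r 0 _ = 0
  rw [map_zero, LinearMap.zero_apply]

lemma pair_zero_right (x : (biData.{w} r).obj n) :
    pair X Y n r x (0 : (X.mixed.tensor Y.mixed).obj n) = 0 := by
  rw [pair, sumAnti]
  refine Finset.sum_eq_zero fun t _ => ?_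
  change act X Y _ _ r _ 0 = 0
  rw [map_zero]

lemma pair_smul_left (c : ℂ) (x : (biData.{w} r).obj n) (z : (X.mixed.tensor Y.mixed).obj n) :
    pair X Y n r (c • x) z = c • pair X Y n r x z := by
  rw [pair, pair, sumAnti, sumAnti, Finset.smul_sum]
  refine Finset.sum_congr rfl fun t _ => ?_
  change act X Y _ _ r (c • _) _ = _
  rw [map_smul, LinearMap.smul_apply]

lemma pair_smul_right (c : ℂ) (x : (biData.{w} r).obj n) (z : (X.mixed.tensor Y.mixed).obj n) :
    pair X Y n r x (c • z) = c • pair X Y n r x z := by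
  rw [pair, pair, sumAnti, sumAnti, Finset.smul_sum]
  refine Finset.sum_congr rfl fun t _ => ?_
  change act X Y _ _ r _ (c • _) = _
  rw [map_smul]

/-- Composition with `B` is adjoint to `b` on cochains. -/
lemma pair_b (x : (biData.{w} r).obj (n + 1)) (z : (X.mixed.tensor Y.mixed).obj n) :
    pair X Y (n + 1) r x ((X.mixed.tensor Y.mixed).b n z) = pair X Y n r ((biData r).B n x) z := by
  rw [pair, pair]
  have hL : ∀ p q h, act X Y p q r ((opData r).tensorAt (opData r) x p q h)
      (X.mixed.tensorAt Y.mixed ((X.mixed.tensor Y.mixed).b n z) p q h) =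
      act X Y p q r ((opData r).tensorAt (opData r) x p q h) (X.mixed.bLeft Y.mixed z p q h) +
      act X Y p q r ((opData r).tensorAt (opData r) x p q h) (X.mixed.bRight Y.mixed z p q h) :=
    fun p q h => by rw [MixedData.tensorAt_b, map_add]
  have hR : ∀ p q h, act X Y p q r ((opData r).tensorAt (opData r) ((biData r).B n x) p q h)
      (X.mixed.tensorAt Y.mixed z p q h) =
      act X Y p q r ((-1 : ℂ) ^ q • ((opData r).B p).rTensor (NatOp q r)
        ((opData r).tensorAt (opData r) x (p + 1) q (by omega))) (X.mixed.tensorAt Y.mixed z p q h) +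
      act X Y p q r (((opData r).B q).lTensor (NatOp p r)
        ((opData r).tensorAt (opData r) x p (q + 1) (by omega)))
        (X.mixed.tensorAt Y.mixed z p q h) :=
    fun p q h => by rw [MixedData.tensorAt_B, map_add, LinearMap.add_apply]
  rw [sumAnti_congr hL, sumAnti_congr hR, sumAnti_add, sumAnti_add,
    sumAnti_left n (fun p q h => act X Y p q r ((opData r).tensorAt (opData r) x p q h)
      (X.mixed.bLeft Y.mixed z p q h)) fun q h => by rw [MixedData.bLeft_zero, map_zero],
    sumAnti_right n (fun p q h => act X Y p q r ((opData r).tensorAt (opData r) x p q h)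
      (X.mixed.bRight Y.mixed z p q h)) fun p h => by rw [MixedData.bRight_zero, map_zero]]
  congr 1
  · refine sumAnti_congr fun p q h => ?_
    rw [MixedData.bLeft_succ, map_smul, map_smul, LinearMap.smul_apply, act_left, ev_mixed_b]
  · refine sumAnti_congr fun p q h => ?_
    rw [MixedData.bRight_succ, act_right, ev_mixed_b]

/-- Composition with `b` is adjoint to `B` on cochains. -/
lemma pair_B (x : (biData.{w} r).obj n) (z : (X.mixed.tensor Y.mixed).obj (n + 1)) :
    pair X Y n r x ((X.mixed.tensor Y.mixed).B n z) = pair X Y (n + 1) r ((biData r).b n x) z := by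
  rw [pair, pair]
  have hL : ∀ p q h, act X Y p q r ((opData r).tensorAt (opData r) x p q h)
      (X.mixed.tensorAt Y.mixed ((X.mixed.tensor Y.mixed).B n z) p q h) =
      act X Y p q r ((opData r).tensorAt (opData r) x p q h)
        ((-1 : ℂ) ^ q • (X.mixed.B p).rTensor (Y.obj q)
          (X.mixed.tensorAt Y.mixed z (p + 1) q (by omega))) +
      act X Y p q r ((opData r).tensorAt (opData r) x p q h)
        ((Y.mixed.B q).lTensor (X.obj p) (X.mixed.tensorAt Y.mixed z p (q + 1) (by omega))) :=
    fun p q h => by rw [MixedData.tensorAt_B, map_add]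
  have hR : ∀ p q h, act X Y p q r ((opData r).tensorAt (opData r) ((biData r).b n x) p q h)
      (X.mixed.tensorAt Y.mixed z p q h) =
      act X Y p q r ((opData r).bLeft (opData r) x p q h) (X.mixed.tensorAt Y.mixed z p q h) +
      act X Y p q r ((opData r).bRight (opData r) x p q h) (X.mixed.tensorAt Y.mixed z p q h) :=
    fun p q h => by rw [MixedData.tensorAt_b, map_add, LinearMap.add_apply]
  rw [sumAnti_congr hL, sumAnti_congr hR, sumAnti_add, sumAnti_add,
    sumAnti_left n (fun p q h => act X Y p q r ((opData r).bLeft (opData r) x p q h)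
      (X.mixed.tensorAt Y.mixed z p q h))
      fun q h => by rw [MixedData.bLeft_zero, map_zero, LinearMap.zero_apply],
    sumAnti_right n (fun p q h => act X Y p q r ((opData r).bRight (opData r) x p q h)
      (X.mixed.tensorAt Y.mixed z p q h))
      fun q h => by rw [MixedData.bRight_zero, map_zero, LinearMap.zero_apply]]
  congr 1
  · refine sumAnti_congr fun p q h => ?_
    rw [MixedData.bLeft_succ, map_smul, map_smul, LinearMap.smul_apply, act_left, ev_mixed_B]
  · refine sumAnti_congr fun p q h => ?_
    rw [MixedData.bRight_succ, act_right, ev_mixed_B]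

variable (X Y) in
/-- The value of a sequence of operations on the sequence `z`, of which only the terms before `N`
are considered. -/
def star (N : ℕ) (x : ∀ n, (MixedData.pi biData.{w}).obj n)
    (z : ∀ n, (X.mixed.tensor Y.mixed).obj n) (r : ℕ) : X.obj r ⊗[ℂ] Y.obj r :=
  ∑ n ∈ Finset.range N, pair X Y n r (x n r) (z n)

lemma star_add_left (N : ℕ) (x x' : ∀ n, (MixedData.pi biData.{w}).obj n)
    (z : ∀ n, (X.mixed.tensor Y.mixed).obj n) (r : ℕ) :
    star X Y N (fun n => x n + x' n) z r = star X Y N x z r + star X Y N x' z r := by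
  rw [star, star, star, ← Finset.sum_add_distrib]
  exact Finset.sum_congr rfl fun n _ => pair_add_left _ _ _

lemma star_smul_left (N : ℕ) (c : ℂ) (x : ∀ n, (MixedData.pi biData.{w}).obj n)
    (z : ∀ n, (X.mixed.tensor Y.mixed).obj n) (r : ℕ) :
    star X Y N (fun n => c • x n) z r = c • star X Y N x z r := by
  rw [star, star, Finset.smul_sum]
  exact Finset.sum_congr rfl fun n _ => pair_smul_left _ _ _

lemma star_smul_right (N : ℕ) (c : ℂ) (x : ∀ n, (MixedData.pi biData.{w}).obj n)
    (z : ∀ n, (X.mixed.tensor Y.mixed).obj n) (r : ℕ) :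
    star X Y N x (fun n => c • z n) r = c • star X Y N x z r := by
  rw [star, star, Finset.smul_sum]
  exact Finset.sum_congr rfl fun n _ => pair_smul_right _ _ _

lemma pair_famD (x : (MixedData.pi biData.{w}).obj n) (z : (X.mixed.tensor Y.mixed).obj n) :
    (X.diag Y.toCocyclicData).mixed.famD (fun r => pair X Y n r (x r) z) r =
      pair X Y n r (postD n x r) z := by
  have e : (fun r => pair X Y n r (x r) z) =
      ∑ t ∈ (Finset.HasAntidiagonal.antidiagonal n).attach, fun r =>
        act X Y t.1.1 t.1.2 r ((opData r).tensorAt (opData r) (x r) t.1.1 t.1.2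
          (Finset.HasAntidiagonal.mem_antidiagonal.1 t.2)) (X.mixed.tensorAt Y.mixed z t.1.1 t.1.2
          (Finset.HasAntidiagonal.mem_antidiagonal.1 t.2)) := by
    funext r
    rw [Finset.sum_apply]
    rfl
  rw [e, map_sum, Finset.sum_apply, pair, sumAnti]
  exact Finset.sum_congr rfl fun t _ => (act_famD (X := X) (Y := Y) (p := t.1.1) (q := t.1.2)
    (fun r' => (opData r').tensorAt (opData r') (x r') t.1.1 t.1.2
      (Finset.HasAntidiagonal.mem_antidiagonal.1 t.2)) _ r).symm

lemma famD_star (N : ℕ) (x : ∀ n, (MixedData.pi biData.{w}).obj n)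
    (z : ∀ n, (X.mixed.tensor Y.mixed).obj n) (r : ℕ) :
    (X.diag Y.toCocyclicData).mixed.famD (star X Y N x z) r =
      star X Y N (fun n => postD n (x n)) z r := by
  have e : star X Y N x z = ∑ n ∈ Finset.range N, fun r => pair X Y n r (x n r) (z n) := by
    funext r
    rw [Finset.sum_apply]
    rfl
  rw [e, map_sum, Finset.sum_apply, star]
  exact Finset.sum_congr rfl fun n _ => pair_famD _ _

lemma star_famD (N : ℕ) (x : ∀ n, (MixedData.pi biData.{w}).obj n)
    (z : ∀ n, (X.mixed.tensor Y.mixed).obj n) (hz : ∀ n, N ≤ n → z n = 0) (r : ℕ) :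
    star X Y (N + 1) x ((X.mixed.tensor Y.mixed).famD z) r =
      star X Y (N + 1) ((MixedData.pi biData).famD x) z r := by
  have h1 : star X Y (N + 1) x ((X.mixed.tensor Y.mixed).famD z) r =
      (∑ n ∈ Finset.range N, pair X Y (n + 1) r (x (n + 1) r)
        ((X.mixed.tensor Y.mixed).b n (z n))) +
      ∑ n ∈ Finset.range (N + 1), pair X Y n r (x n r)
        ((X.mixed.tensor Y.mixed).B n (z (n + 1))) := by
    rw [star, Finset.sum_range_succ', Finset.sum_range_succ' _ N, ← add_assoc,
      ← Finset.sum_add_distrib, MixedData.famD_zero]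
    congr 1
    exact Finset.sum_congr rfl fun n _ => pair_add_right _ _ _
  have h2 : star X Y (N + 1) ((MixedData.pi biData).famD x) z r =
      (∑ n ∈ Finset.range N, pair X Y (n + 1) r ((biData r).b n (x n r)) (z (n + 1))) +
      ∑ n ∈ Finset.range (N + 1), pair X Y n r ((biData r).B n (x (n + 1) r)) (z n) := by
    rw [star, Finset.sum_range_succ', Finset.sum_range_succ' _ N, ← add_assoc,
      ← Finset.sum_add_distrib, MixedData.famD_zero]
    congr 1
    exact Finset.sum_congr rfl fun n _ => pair_add_left _ _ _
  rw [h1, h2, Finset.sum_congr rfl fun n _ => pair_b (x (n + 1) r) (z n),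
    Finset.sum_congr rfl fun n _ => pair_B (x n r) (z (n + 1)), Finset.sum_range_succ,
      Finset.sum_range_succ _ N, hz N le_rfl, hz (N + 1) (by omega),
    pair_zero_right, pair_zero_right, add_zero, add_zero, add_comm]

lemma fam_eq_zero {T : MixedData.{w}} {n m : ℕ} (z : T.TC n) (h : n < m) :
    MixedData.fam z m = 0 :=
  MixedData.fam_of_ne _ fun k hk => by omega

/-- The map on total complexes given by the values of a sequence of operations. -/
lemma uMap_eq_restr {x : ∀ n, (MixedData.pi biData.{w}).obj n}
    (hx : ∀ n, MixedData.SuppLE 0 (x n))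
    {f : ∀ p q r, X.obj p ⊗[ℂ] Y.obj q →ₗ[ℂ] X.obj r ⊗[ℂ] Y.obj r}
    (hf : ∀ p q r i, p + q = r + 2 * i →
      f p q r = act X Y p q r ((opData r).tensorAt (opData r) (x (p + q) r) p q rfl))
    {n N : ℕ} (hN : n < N) (z : (X.mixed.tensor Y.mixed).TC n) :
    X.uMap Y.toCocyclicData f n z = MixedData.restr n (star X Y N x (MixedData.fam z)) := by
  funext ⟨⟨r, k⟩, h⟩
  have e : ∀ i : Fin (k + 1), pair X Y (r + 2 * i.1) r (x (r + 2 * i.1) r)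
      (MixedData.fam z (r + 2 * i.1)) =
      ∑ t ∈ (Finset.HasAntidiagonal.antidiagonal (r + 2 * i.1)).attach,
      f t.1.1 t.1.2 r ((z ⟨(r + 2 * i.1, k - i.1), by
        have := h; have := i.2; dsimp only at *; omega⟩ :
          ∀ t : {t : ℕ × ℕ // t.1 + t.2 = r + 2 * i.1}, X.obj t.1.1 ⊗[ℂ] Y.obj t.1.2)
        ⟨t.1, Finset.HasAntidiagonal.mem_antidiagonal.1 t.2⟩) := by
    intro i
    rw [pair, sumAnti]
    refine Finset.sum_congr rfl fun t _ => ?_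
    have ht := Finset.HasAntidiagonal.mem_antidiagonal.1 t.2
    rw [hf _ _ _ i.1 ht, MixedData.fam_of_eq z (k := k - i.1)
      (by have := i.2; dsimp only at h; omega)]
    congr 1
    have : ∀ m (hm : t.1.1 + t.1.2 = m), (opData r).tensorAt (opData r) (x m r) t.1.1 t.1.2 hm =
        (opData r).tensorAt (opData r) (x (t.1.1 + t.1.2) r) t.1.1 t.1.2 rfl := by
      rintro _ rfl; rfl
    rw [this]
  have e' : X.uMap Y.toCocyclicData f n z ⟨(r, k), h⟩ = ∑ i : Fin (k + 1),
      pair X Y (r + 2 * i.1) r (x (r + 2 * i.1) r) (MixedData.fam z (r + 2 * i.1)) :=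
    Eq.symm (Finset.sum_congr (s₁ := Finset.univ) rfl fun i _ => e i)
  change _ = star X Y N x (MixedData.fam z) r
  rw [e']
  rw [star]
  refine Finset.sum_bij_ne_zero (fun i _ _ => r + 2 * i.1) ?_ ?_ ?_ ?_
  · intro i _ _
    have := i.2
    dsimp only at h
    simp; omega
  · intro i _ _ j _ _ hij
    have : r + 2 * i.1 = r + 2 * j.1 := hij
    ext; omega
  · intro m hm hne
    have h1 : ∃ i, r + 0 + 2 * i = m := by
      by_contra h1
      refine hne ?_
      rw [hx m r (by simpa using h1), pair_zero_left]
    have h2 : ∃ l, m + 2 * l = n := by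
      by_contra h2
      refine hne ?_
      rw [MixedData.fam_of_ne z (by simpa using h2), pair_zero_right]
    obtain ⟨i, rfl⟩ := h1
    obtain ⟨l, hl⟩ := h2
    dsimp only at h
    exact ⟨⟨i, by omega⟩, Finset.mem_univ _, hne, by simp⟩
  · intro i _ _
    rfl

end Star

/-! ### Chain maps given by natural operations -/

/-- A sequence of two-variable operations that commutes with the differentials, and starts with the
Alexander-Whitney map. -/
structure IsCyclicAW (x : ∀ n, (MixedData.pi biData.{w}).obj n) : Prop where
  supp : ∀ n, MixedData.SuppLE 0 (x n)
  chain : ∀ n, postD n (x n) = (MixedData.pi biData).famD x n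
  leading : ∀ p q, (opData (p + q)).tensorAt (opData (p + q)) (x (p + q) (p + q)) p q rfl =
    (free p).zeroFaces q p (p + q) rfl (gen p) ⊗ₜ[ℂ] (free q).lastFaces p q (p + q) rfl (gen q)

lemma hom_zeroFaces {X : CocyclicData.{w}} {Y : CocyclicData.{w'}} (f : X.Hom Y) (q p n : ℕ)
    (h : p + q = n) (x : X.obj p) :
    f.app n (X.zeroFaces q p n h x) = Y.zeroFaces q p n h (f.app p x) := by
  induction q generalizing p with
  | zero => subst h; rfl
  | succ q ih =>
    simp only [CocyclicData.zeroFaces, LinearMap.comp_apply]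
    rw [ih]
    congr 1
    exact LinearMap.congr_fun (f.app_δ p 0 (by omega)) x

lemma hom_lastFaces {X : CocyclicData.{w}} {Y : CocyclicData.{w'}} (f : X.Hom Y) (p q n : ℕ)
    (h : p + q = n) (x : X.obj q) :
    f.app n (X.lastFaces p q n h x) = Y.lastFaces p q n h (f.app q x) := by
  induction p generalizing q with
  | zero =>
    obtain rfl : q = n := by omega
    rfl
  | succ p ih =>
    simp only [CocyclicData.lastFaces, LinearMap.comp_apply]
    rw [ih]
    congr 1
    exact LinearMap.congr_fun (f.app_δ q (q + 1) le_rfl) x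

lemma ev_zeroFaces (X : CocyclicModule.{w}) (p q n : ℕ) (h : p + q = n) (x : X.obj p) :
    ev X ((free p).zeroFaces q p n h (gen p) : NatOp p n) x = X.zeroFaces q p n h x := by
  have := hom_zeroFaces (evHom X x) q p n h (gen p)
  rwa [evHom_gen] at this

lemma ev_lastFaces (X : CocyclicModule.{w}) (p q n : ℕ) (h : p + q = n) (x : X.obj q) :
    ev X ((free q).lastFaces p q n h (gen q) : NatOp q n) x = X.lastFaces p q n h x := by
  have := hom_lastFaces (evHom X x) p q n h (gen q)
  rwa [evHom_gen] at this

/-- The cyclic Alexander-Whitney map given by a sequence of operations. -/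
def IsCyclicAW.toCyclicAW {x : ∀ n, (MixedData.pi biData.{w}).obj n} (hx : IsCyclicAW x) :
    CyclicAW.{w} where
  comp X Y p q r := act X Y p q r ((opData r).tensorAt (opData r) (x (p + q) r) p q rfl)
  natural f g p q r := LinearMap.ext fun z => act_natural f g _ z
  leading X Y p q n h := by
    subst h
    refine TensorProduct.ext' fun a b => ?_
    rw [hx.leading, act_tmul_tmul, ev_zeroFaces, ev_lastFaces]
    rfl
  chain X Y n z := by
    rw [uMap_eq_restr hx.supp (fun _ _ _ _ _ => rfl) (show n < n + 2 by omega),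
      uMap_eq_restr hx.supp (fun _ _ _ _ _ => rfl) (show n + 1 < n + 2 by omega),
      MixedData.d_restr, MixedData.fam_d]
    · congr 1
      funext r
      rw [famD_star, star_famD _ _ _ fun m hm => fam_eq_zero z (by omega)]
      rw [show (fun n => postD n (x n)) = (MixedData.pi biData).famD x from funext hx.chain]
    · refine Finset.sum_eq_zero fun m hm => ?_
      have := Finset.mem_range.1 hm
      rcases Nat.lt_or_ge n m with h | h
      · rw [fam_eq_zero z h, pair_zero_right]
      · rw [hx.supp m _ fun i hi => by omega, pair_zero_left]

end NatOp

/-! ### The Alexander-Whitney map -/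

namespace CocyclicData
variable {X : CocyclicData.{w}} {Y : CocyclicData.{w'}}

lemma zeroFaces_succ (q p n : ℕ) (h : p + (q + 1) = n) (x : X.obj p) :
    X.zeroFaces (q + 1) p n h x = X.zeroFaces q (p + 1) n (by omega) (X.δ p 0 x) := rfl

lemma lastFaces_succ (p q n : ℕ) (h : p + 1 + q = n) (y : Y.obj q) :
    Y.lastFaces (p + 1) q n h y = Y.lastFaces p (q + 1) n (by omega) (Y.δ q (q + 1) y) := rfl

lemma IsCocyclic.δ_zeroFaces_add (hX : X.IsCocyclic) (q p n j : ℕ) (h : p + q = n) (hj : j ≤ p + 1)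
    (x : X.obj p) :
    X.δ n (q + j) (X.zeroFaces q p n h x) = X.zeroFaces q (p + 1) (n + 1) (by omega) (X.δ p j x) := by
  induction q generalizing p j with
  | zero => subst h; rw [Nat.zero_add]; rfl
  | succ q ih =>
    rw [zeroFaces_succ, zeroFaces_succ, show q + 1 + j = q + (j + 1) by omega, ih _ _ _ (by omega)]
    have := LinearMap.congr_fun (hX.δ_δ p 0 (j + 1) (by omega) (by omega)) x
    simp only [LinearMap.comp_apply, Nat.add_sub_cancel] at this
    rw [this]

lemma IsCocyclic.δ_zeroFaces (hX : X.IsCocyclic) (q p n i : ℕ) (h : p + q = n) (hi : i ≤ q)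
    (x : X.obj p) :
    X.δ n i (X.zeroFaces q p n h x) = X.zeroFaces (q + 1) p (n + 1) (by omega) x := by
  induction q generalizing p with
  | zero => subst h; obtain rfl : i = 0 := by omega
            rfl
  | succ q ih =>
    rcases hi.lt_or_eq with h' | rfl
    · rw [zeroFaces_succ, ih _ _ (by omega)]
      rfl
    · rw [zeroFaces_succ, hX.δ_zeroFaces_add q (p + 1) n 1 _ (by omega)]
      have := LinearMap.congr_fun (hX.δ_δ p 0 1 (by omega) (by omega)) x
      simp only [LinearMap.comp_apply] at this
      rw [this]
      rfl

lemma IsCocyclic.δ_lastFaces_le (hY : Y.IsCocyclic) (p q n i : ℕ) (h : p + q = n) (hi : i ≤ q + 1)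
    (y : Y.obj q) :
    Y.δ n i (Y.lastFaces p q n h y) = Y.lastFaces p (q + 1) (n + 1) (by omega) (Y.δ q i y) := by
  induction p generalizing q with
  | zero =>
    obtain rfl : q = n := by omega
    rfl
  | succ p ih =>
    rw [lastFaces_succ, lastFaces_succ, ih _ _ (by omega)]
    have := LinearMap.congr_fun (hY.δ_δ q i (q + 2) (by omega) (by omega)) y
    simp only [LinearMap.comp_apply] at this
    exact congrArg (Y.lastFaces p (q + 2) (n + 1) (by omega)) this.symm

lemma IsCocyclic.δ_lastFaces (hY : Y.IsCocyclic) (p q n i : ℕ) (h : p + q = n) (hi : q + 1 ≤ i)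
    (hi' : i ≤ n + 1) (y : Y.obj q) :
    Y.δ n i (Y.lastFaces p q n h y) = Y.lastFaces (p + 1) q (n + 1) (by omega) y := by
  induction p generalizing q with
  | zero =>
    obtain rfl : q = n := by omega
    obtain rfl : i = q + 1 := by omega
    rfl
  | succ p ih =>
    rcases hi.lt_or_eq with h' | rfl
    · rw [lastFaces_succ, ih _ _ h']
      rfl
    · rw [lastFaces_succ, hY.δ_lastFaces_le p (q + 1) n _ _ (by omega)]
      have := LinearMap.congr_fun (hY.δ_δ q (q + 1) (q + 2) (by omega) (by omega)) y
      simp only [LinearMap.comp_apply] at this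
      exact congrArg _ this.symm

/-- The Alexander-Whitney map is compatible with the Hochschild differentials. -/
lemma IsCocyclic.b_zeroFaces_lastFaces (hX : X.IsCocyclic) (hY : Y.IsCocyclic) {p q n : ℕ}
    (h : p + q = n) (x : X.obj p) (y : Y.obj q) :
    (X.diag Y).mixed.b n (X.zeroFaces q p n h x ⊗ₜ[ℂ] Y.lastFaces p q n h y) =
      (-1 : ℂ) ^ q • (X.zeroFaces q (p + 1) (n + 1) (by omega) (X.mixed.b p x) ⊗ₜ[ℂ]
        Y.lastFaces (p + 1) q (n + 1) (by omega) y) +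
      X.zeroFaces (q + 1) p (n + 1) (by omega) x ⊗ₜ[ℂ]
        Y.lastFaces p (q + 1) (n + 1) (by omega) (Y.mixed.b q y) := by
  rw [mixed_b_apply, mixed_b_apply X, mixed_b_apply Y, show n + 2 = (q + 1) + (p + 1) by omega,
    Finset.sum_range_add, Finset.sum_range_succ' _ (p + 1), Finset.sum_range_succ _ (q + 1), map_add,
    map_add, TensorProduct.add_tmul, TensorProduct.tmul_add, map_sum, map_sum,
    TensorProduct.sum_tmul, TensorProduct.tmul_sum, smul_add, Finset.smul_sum]
  have e1 : ∀ i ∈ Finset.range (q + 1), (-1 : ℂ) ^ i • (X.diag Y).δ n i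
      (X.zeroFaces q p n h x ⊗ₜ[ℂ] Y.lastFaces p q n h y) =
      X.zeroFaces (q + 1) p (n + 1) (by omega) x ⊗ₜ[ℂ]
        Y.lastFaces p (q + 1) (n + 1) (by omega) ((-1 : ℂ) ^ i • Y.δ q i y) := by
    intro i hi
    have := Finset.mem_range.1 hi
    rw [map_smul, TensorProduct.tmul_smul, TensorProduct.map_tmul, hX.δ_zeroFaces _ _ _ _ _ (by omega),
      hY.δ_lastFaces_le _ _ _ _ _ (by omega)]
  have e2 : ∀ j ∈ Finset.range (p + 1), (-1 : ℂ) ^ (q + 1 + j) • (X.diag Y).δ n (q + 1 + j)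
      (X.zeroFaces q p n h x ⊗ₜ[ℂ] Y.lastFaces p q n h y) =
      (-1 : ℂ) ^ q • (X.zeroFaces q (p + 1) (n + 1) (by omega)
        ((-1 : ℂ) ^ (j + 1) • X.δ p (j + 1) x) ⊗ₜ[ℂ] Y.lastFaces (p + 1) q (n + 1) (by omega) y) := by
    intro j hj
    have := Finset.mem_range.1 hj
    rw [map_smul, TensorProduct.smul_tmul', smul_smul, TensorProduct.map_tmul, ← pow_add,
      hY.δ_lastFaces _ _ _ _ _ (by omega) (by omega), show q + 1 + j = q + (j + 1) by omega,
      hX.δ_zeroFaces_add _ _ _ _ _ (by omega), ← TensorProduct.smul_tmul']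
  rw [Finset.sum_congr rfl e1, Finset.sum_congr rfl e2]
  have e3 : (-1 : ℂ) ^ q • (X.zeroFaces q (p + 1) (n + 1) (by omega) ((-1 : ℂ) ^ 0 • X.δ p 0 x) ⊗ₜ[ℂ]
      Y.lastFaces (p + 1) q (n + 1) (by omega) y) = -(X.zeroFaces (q + 1) p (n + 1) (by omega) x ⊗ₜ[ℂ]
        Y.lastFaces p (q + 1) (n + 1) (by omega) ((-1 : ℂ) ^ (q + 1) • Y.δ q (q + 1) y)) := by
    rw [pow_zero, one_smul, map_smul, TensorProduct.tmul_smul, pow_succ, mul_neg, mul_one, neg_smul,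
      neg_neg]
    rfl
  rw [e3]
  abel

end CocyclicData

namespace NatOp
variable {p q r n : ℕ}

/-- The Alexander-Whitney map as a sequence of operations. -/
def awOp (n : ℕ) : (MixedData.pi biData.{w}).obj n := fun r s =>
  if h : s.1.1 + s.1.2 = r then
    ((free s.1.1).zeroFaces s.1.2 s.1.1 r h (gen s.1.1) : NatOp s.1.1 r) ⊗ₜ[ℂ]
      ((free s.1.2).lastFaces s.1.1 s.1.2 r h (gen s.1.2) : NatOp s.1.2 r)
  else 0

lemma awOp_of_eq {n p q : ℕ} (h : p + q = n) :
    (opData n).tensorAt (opData n) (awOp.{w} n n) p q h =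
      ((free p).zeroFaces q p n h (gen p) : NatOp p n) ⊗ₜ[ℂ]
        ((free q).lastFaces p q n h (gen q) : NatOp q n) :=
  dif_pos h

lemma awOp_of_ne {n r : ℕ} (h : n ≠ r) : awOp.{w} n r = 0 := by
  funext s
  exact dif_neg fun hs => h (s.2.symm.trans hs)

lemma awOp_supp (n : ℕ) : MixedData.SuppLE 0 (awOp.{w} n) := fun r h =>
  awOp_of_ne fun e => h 0 (by omega)

lemma postD_awOp_top (n : ℕ) :
    postD n (awOp.{w} n) (n + 1) = (MixedData.pi biData).famD awOp n (n + 1) := by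
  have e : (MixedData.pi biData).famD awOp n (n + 1) =
      (biData.{w} (n + 1)).B n (awOp (n + 1) (n + 1)) := by
    rcases n with _ | n
    · rfl
    · rw [MixedData.famD_succ]
      change (biData (n + 2)).b n (awOp n (n + 2)) + _ = _
      rw [awOp_of_ne (by omega), map_zero, zero_add]
      rfl
  rw [e]
  refine MixedData.tensor_obj_ext fun p q h => ?_
  have e2 : (opData (n + 2)).tensorAt (opData (n + 2)) (awOp.{w} n (n + 2)) p q h = 0 := by
    rw [awOp_of_ne (by omega)]
    rfl
  rw [postD_apply, MixedData.famD_succ, e2, map_zero, add_zero, awOp_of_eq, MixedData.tensorAt_B,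
    awOp_of_eq, awOp_of_eq]
  rw [CocyclicData.IsCocyclic.b_zeroFaces_lastFaces (free p).laws (free q).laws]
  rw [LinearMap.rTensor_tmul, LinearMap.lTensor_tmul]
  have e3 := hom_zeroFaces (evHom (free p) ((free p).mixed.b p (gen p))) q (p + 1) (n + 1) (by omega)
    (gen (p + 1))
  have e4 := hom_lastFaces (evHom (free q) ((free q).mixed.b q (gen q))) p (q + 1) (n + 1) (by omega)
    (gen (q + 1))
  rw [evHom_gen] at e3 e4
  rw [← e3, ← e4]
  rfl

/-- The failure of the Alexander-Whitney map to commute with the differentials `b + B`. -/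
def awDefect (n : ℕ) : (MixedData.pi biData.{w}).obj n :=
  (MixedData.pi biData).famD awOp n - postD n (awOp n)

lemma awDefect_supp (n : ℕ) : MixedData.SuppLE 1 (awDefect.{w} n) := by
  intro r h
  rw [awDefect, Pi.sub_apply]
  by_cases hr : r = n + 1
  · subst hr
    rw [postD_awOp_top, sub_self]
  · have h1 : r + 1 ≠ n := fun e => h 0 (by omega)
    rw [postD_isLocal n _ r (awOp_of_ne (by omega)) fun s hs => awOp_of_ne (by omega), sub_zero]
    rcases n with _ | n
    · rw [MixedData.famD_zero]
      change (biData r).B 0 (awOp 1 r) = 0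
      rw [awOp_of_ne (by omega), map_zero]
    · rw [MixedData.famD_succ]
      change (biData r).b n (awOp n r) + (biData r).B (n + 1) (awOp (n + 2) r) = 0
      rw [awOp_of_ne (by omega), awOp_of_ne (by omega), map_zero, map_zero, add_zero]

lemma postD_famD (x : ∀ n, (MixedData.pi biData.{w}).obj n) (n : ℕ) :
    postD n ((MixedData.pi biData).famD x n) =
      (MixedData.pi biData).famD (fun n => postD n (x n)) n := by
  rcases n with _ | n
  · rw [MixedData.famD_zero, MixedData.famD_zero, postD_B]
  · rw [MixedData.famD_succ, MixedData.famD_succ, map_add, postD_B, postD_b]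

/-! ### Harmonic parts of operations in two variables -/

/-- Pointwise multiplication of test cochains. -/
def testMul : (testModule.{w}.diag testModule.toCocyclicData).Hom testModule.toCocyclicData where
  app n := LinearMap.mul' ℂ (Fin (n + 1) → ULift.{w} ℂ)
  app_δ n i h := TensorProduct.ext' fun f g => funext fun a => by
    simp only [LinearMap.comp_apply, TensorProduct.map_tmul, LinearMap.mul'_apply, Pi.mul_apply,
      LinearMap.pi_apply]
    split_ifs <;> rfl
  app_σ n i h := TensorProduct.ext' fun f g => funext fun a => by
    simp only [LinearMap.comp_apply, TensorProduct.map_tmul, LinearMap.mul'_apply, Pi.mul_apply,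
      LinearMap.pi_apply]
    split_ifs <;> rfl
  app_τ n := TensorProduct.ext' fun f g => rfl

/-- The product of the values of two operations on test cocycles. -/
def test₂ (p q r : ℕ) : NatOp.{w} p r ⊗[ℂ] NatOp.{w} q r →ₗ[ℂ] ℂ :=
  LinearMap.mul' ℂ ℂ ∘ₗ TensorProduct.map (test p r) (test q r)

lemma test₂_eq (t : NatOp.{w} p r ⊗[ℂ] NatOp.{w} q r) :
    test₂ p q r t = (testMul.app r
      (((evHom testModule (testCochain p)).diag (evHom testModule (testCochain q))).app r t) 0).down := by
  induction t with
  | zero => rw [map_zero, map_zero, map_zero]; rfl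
  | add a b ha hb => rw [map_add, ha, hb, map_add, map_add]; rfl
  | tmul a b => rfl

lemma test_b (f : testModule.{w}.obj 0) : testModule.{w}.mixed.b 0 f 0 = 0 := by
  rw [CocyclicData.mixed_b_apply]
  simp [Finset.sum_range_succ, CocyclicData.cofreeAt]

lemma test₂_b (t : (bi.{w} p q).obj 0) : test₂ p q 1 ((bi p q).mixed.b 0 t) = 0 := by
  rw [test₂_eq, ← CocyclicData.Hom.app_b, ← CocyclicData.Hom.app_b, test_b]
  rfl

lemma test₂_B (r : ℕ) (t : (bi.{w} p q).obj (r + 1)) : test₂ p q r ((bi p q).mixed.B r t) =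
    (testModule.{w}.mixed.B r (testMul.app (r + 1)
      (((evHom testModule (testCochain p)).diag (evHom testModule (testCochain q))).app (r + 1) t))
        0).down := by
  rw [test₂_eq, ← CocyclicData.Hom.app_B, ← CocyclicData.Hom.app_B]

/-- The harmonic operations of each source degree are the multiples of one operation. -/
lemma exists_harmonic (r p : ℕ) :
    ∃ v, harmonic.{w} r p = (test p r).smulRight v ∧ (2 ≤ p → v = 0) := by
  match p with
  | 0 => exact ⟨vertexOp r, rfl, by omega⟩
  | 1 => exact ⟨(opData r).b 0 (vertexOp r), rfl, by omega⟩
  | p + 2 => exact ⟨0, by rw [LinearMap.smulRight_zero]; rfl, fun _ => rfl⟩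

/-- The harmonic part of an operation in two variables is a multiple of one operation, with the value
on the test cocycles as the coefficient. -/
lemma map_harmonic_eq_zero {t : NatOp.{w} p r ⊗[ℂ] NatOp.{w} q r}
    (h : p ≤ 1 → q ≤ 1 → test₂ p q r t = 0) :
    TensorProduct.map (harmonic r p) (harmonic r q) t = 0 := by
  obtain ⟨v, hv, hv'⟩ := exists_harmonic.{w} r p
  obtain ⟨v', hw, hw'⟩ := exists_harmonic.{w} r q
  have e : ∀ t, TensorProduct.map (harmonic r p) (harmonic r q) t = test₂ p q r t • v ⊗ₜ[ℂ] v' := by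
    intro t
    induction t with
    | zero => rw [map_zero, map_zero, zero_smul]
    | add a b ha hb => rw [map_add, map_add, ha, hb, add_smul]
    | tmul a b =>
      rw [TensorProduct.map_tmul, hv, hw, LinearMap.smulRight_apply, LinearMap.smulRight_apply,
        TensorProduct.smul_tmul_smul]
      rfl
  rw [e]
  by_cases hp : p ≤ 1
  · by_cases hq : q ≤ 1
    · rw [h hp hq, zero_smul]
    · rw [hw' (by omega), TensorProduct.tmul_zero, smul_zero]
  · rw [hv' (by omega), TensorProduct.zero_tmul, smul_zero]

/-- The homotopy on sequences of operations in two variables. -/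
abbrev biHomotopy : (MixedData.pi biData.{w}).Homotopy :=
  MixedData.Homotopy.pi fun r => (opContraction r).tensor

/-- A sequence has no harmonic part if its components of source degree `(p, q)` with `p, q ≤ 1` vanish
on the test cocycles. -/
lemma biHomotopy_P {x : (MixedData.pi biData.{w}).obj n}
    (h : ∀ r p q (hpq : p + q = n), p ≤ 1 → q ≤ 1 →
      test₂ p q r ((opData r).tensorAt (opData r) (x r) p q hpq) = 0) : biHomotopy.P n x = 0 := by
  funext r
  refine MixedData.tensor_obj_ext fun p q hpq => ?_
  change (opData r).tensorAt (opData r) ((opContraction r).pBoth n (x r)) p q hpq = 0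
  rw [MixedData.Contraction.pBoth_apply, opContraction_P]
  exact map_harmonic_eq_zero (h r p q hpq)

/-! ### Existence of cyclic Alexander-Whitney maps -/

lemma tensorAt_awDefect (n r p q : ℕ) (h : p + q = n) :
    (opData r).tensorAt (opData r) (awDefect.{w} n r) p q h =
      (opData r).tensorAt (opData r) ((MixedData.pi biData).famD awOp n r) p q h -
        (bi p q).mixed.famD (fun r' => (opData r').tensorAt (opData r') (awOp n r') p q h) r := rfl

lemma test₂_b_left (t : NatOp.{w} p r ⊗[ℂ] NatOp.{w} q r) (hp : p = 0) :
    test₂ (p + 1) q r (((opData r).b p).rTensor _ t) = test₂ p q r t := by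
  subst hp
  have h : ∀ a : NatOp.{w} 0 r, test 1 r ((opData r).b 0 a) = test 0 r a := fun a => by
    rw [test_apply, ev_opData_b, B_testCochain_one, test_apply]
  induction t with
  | zero => rw [map_zero, map_zero, map_zero]
  | add a b ha hb => rw [map_add, map_add, map_add, ha, hb]
  | tmul a b => exact congrArg (· * test q r b) (h a)

lemma test₂_b_right (t : NatOp.{w} p r ⊗[ℂ] NatOp.{w} q r) (hq : q = 0) :
    test₂ p (q + 1) r (((opData r).b q).lTensor _ t) = test₂ p q r t := by
  subst hq
  have h : ∀ a : NatOp.{w} 0 r, test 1 r ((opData r).b 0 a) = test 0 r a := fun a => by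
    rw [test_apply, ev_opData_b, B_testCochain_one, test_apply]
  induction t with
  | zero => rw [map_zero, map_zero, map_zero]
  | add a b ha hb => rw [map_add, map_add, map_add, ha, hb]
  | tmul a b => exact congrArg (test p r a * ·) (h b)

lemma test₂_awOp (p q n : ℕ) (h : p + q = n) :
    test₂ p q n ((opData n).tensorAt (opData n) (awOp.{w} n n) p q h) =
      (testModule.{w}.zeroFaces q p n h (testCochain p) 0).down *
        (testModule.{w}.lastFaces p q n h (testCochain q) 0).down := by
  rw [awOp_of_eq]
  change test p _ _ * test q _ _ = _
  rw [test_apply, test_apply, ev_zeroFaces, ev_lastFaces]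

lemma test₂_B_awOp (p q r : ℕ) (h : p + q = r + 1) : test₂ p q r ((bi p q).mixed.B r
    ((opData (r + 1)).tensorAt (opData (r + 1)) (awOp.{w} (r + 1) (r + 1)) p q h)) =
      (testModule.{w}.mixed.B r (testMul.app (r + 1)
        (testModule.{w}.zeroFaces q p (r + 1) h (testCochain p) ⊗ₜ
          testModule.{w}.lastFaces p q (r + 1) h (testCochain q))) 0).down := by
  rw [test₂_B, awOp_of_eq]
  have e : ((evHom testModule (testCochain p)).diag (evHom testModule (testCochain q))).app (r + 1)
      ((free.{w} p).zeroFaces q p (r + 1) h (gen p) ⊗ₜ[ℂ]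
        (free q).lastFaces p q (r + 1) h (gen q)) =
      ev testModule ((free.{w} p).zeroFaces q p (r + 1) h (gen p) : NatOp p (r + 1)) (testCochain p) ⊗ₜ
      ev testModule ((free q).lastFaces p q (r + 1) h (gen q) : NatOp q (r + 1)) (testCochain q) :=
    rfl
  rw [e, ev_zeroFaces, ev_lastFaces]

lemma testMul_one_zero : testMul.{w}.app 1 (testModule.{w}.zeroFaces 0 1 1 rfl (testCochain 1) ⊗ₜ
    testModule.{w}.lastFaces 1 0 1 rfl (testCochain 0)) = testCochain 1 := by
  refine funext fun a => ULift.ext _ _ ?_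
  fin_cases a
  · exact mul_one ((0 : ℕ) : ℂ)
  · exact mul_one ((1 : ℕ) : ℂ)

lemma testMul_zero_one : testMul.{w}.app 1 (testModule.{w}.zeroFaces 1 0 1 rfl (testCochain 0) ⊗ₜ
    testModule.{w}.lastFaces 0 1 1 rfl (testCochain 1)) = testCochain 1 := by
  refine funext fun a => ULift.ext _ _ ?_
  fin_cases a
  · exact one_mul ((0 : ℕ) : ℂ)
  · exact one_mul ((1 : ℕ) : ℂ)

lemma testMul_one_one : testMul.{w}.app 2 (testModule.{w}.zeroFaces 1 1 2 rfl (testCochain 1) ⊗ₜ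
    testModule.{w}.lastFaces 1 1 2 rfl (testCochain 1)) = 0 := by
  refine funext fun a => ULift.ext _ _ ?_
  fin_cases a
  · exact (congrArg (· * ((0 : ℕ) : ℂ)) Nat.cast_zero).trans (zero_mul _)
  · exact (congrArg (· * ((1 : ℕ) : ℂ)) Nat.cast_zero).trans (zero_mul _)
  · exact (congrArg (((1 : ℕ) : ℂ) * ·) Nat.cast_zero).trans (mul_zero _)

lemma test₂_awDefect_one (r p q : ℕ) (h : p + q = 1) :
    test₂ p q r ((opData r).tensorAt (opData r) (awDefect.{w} 1 r) p q h) = 0 := by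
  by_cases hr : r = 0
  · subst hr
    have e : (MixedData.pi biData).famD awOp 1 0 = (biData.{w} 0).b 0 (awOp 0 0) := by
      rw [MixedData.famD_succ]
      change _ + (biData 0).B 1 (awOp 2 0) = _
      rw [awOp_of_ne (by omega), map_zero, add_zero]
      rfl
    rw [tensorAt_awDefect, e, MixedData.famD_zero, map_sub, test₂_B_awOp, MixedData.tensorAt_b]
    obtain ⟨rfl, rfl⟩ | ⟨rfl, rfl⟩ : p = 1 ∧ q = 0 ∨ p = 0 ∧ q = 1 := by omega
    · rw [MixedData.bLeft_succ, MixedData.bRight_zero, add_zero, pow_zero, one_smul,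
        test₂_b_left _ rfl, test₂_awOp, testMul_one_zero, B_testCochain_one]
      exact sub_eq_zero.2 (mul_one _)
    · rw [MixedData.bRight_succ, MixedData.bLeft_zero, zero_add,
        test₂_b_right _ rfl, test₂_awOp, testMul_zero_one, B_testCochain_one]
      exact sub_eq_zero.2 (mul_one _)
  · have : awDefect.{w} 1 r = 0 := awDefect_supp 1 r fun i hi => hr (by omega)
    rw [this]
    exact map_zero _

lemma test₂_awDefect_two :
    test₂ 1 1 1 ((opData 1).tensorAt (opData 1) (awDefect.{w} 2 1) 1 1 rfl) = 0 := by
  have e : (MixedData.pi biData).famD awOp 2 1 = (biData.{w} 1).b 1 (awOp 1 1) := by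
    rw [MixedData.famD_succ]
    change _ + (biData 1).B 2 (awOp 3 1) = _
    rw [awOp_of_ne (by omega), map_zero, add_zero]
    rfl
  have e' : (opData 0).tensorAt (opData 0) (awOp.{w} 2 0) 1 1 rfl = 0 := by
    rw [awOp_of_ne (by omega)]
    rfl
  rw [tensorAt_awDefect, e, MixedData.famD_succ, e', map_zero, zero_add, map_sub, test₂_B_awOp,
    MixedData.tensorAt_b, MixedData.bLeft_succ, MixedData.bRight_succ, map_add, map_smul,
    test₂_b_left _ rfl, test₂_b_right _ rfl, test₂_awOp, test₂_awOp, testMul_one_one, map_zero]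
  have h0 : (testModule.{w}.lastFaces 0 1 1 rfl (testCochain 1) 0).down = 0 := Nat.cast_zero
  have h1 : (testModule.{w}.zeroFaces 0 1 1 rfl (testCochain 1) 0).down = 0 := Nat.cast_zero
  rw [h0, h1, mul_zero, zero_mul, smul_zero, add_zero, zero_sub]
  exact neg_zero

/-- A natural sequence of operations that corrects the Alexander-Whitney map to a chain map. -/
def awCorrection (n : ℕ) : (MixedData.pi biData.{w}).obj n :=
  MixedData.perturb biHomotopy postD (-1) awDefect n

lemma awCorrection_supp (n : ℕ) : MixedData.SuppLE 2 (awCorrection.{w} n) :=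
  MixedData.SuppLE.perturb postD_isLocal awDefect_supp n

/-- The equations for the correction are solvable: only operations of total source degree at most two
can have a harmonic part. In degrees one and two the defect of the Alexander-Whitney map vanishes on
the test cocycles, and so does every `b f` with `f` in target degree zero. -/
lemma harmonic_awCorrection (n : ℕ) :
    biHomotopy.P n (MixedData.perturbRhs biHomotopy.{w} postD (-1) awDefect n) = 0 := by
  have k1 : MixedData.perturb biHomotopy.{w} postD (-1) awDefect 1 = 0 :=
    funext fun r => awCorrection_supp 1 r fun i hi => by omega
  match n with
  | 0 =>
    have : awDefect.{w} 0 = 0 := funext fun r => awDefect_supp 0 r fun i hi => by omega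
    rw [MixedData.perturbRhs, this, smul_zero, map_zero]
  | 1 =>
    have k0 : MixedData.perturb biHomotopy.{w} postD (-1) awDefect 0 = 0 := rfl
    rw [MixedData.perturbRhs, k0, k1, map_zero, map_zero, sub_zero, sub_zero, map_smul,
      biHomotopy_P, smul_zero]
    exact fun r p q h _ _ => test₂_awDefect_one r p q h
  | 2 =>
    rw [MixedData.perturbRhs, k1, map_zero, sub_zero, map_smul, map_sub, biHomotopy_P, biHomotopy_P,
      sub_zero, smul_zero]
    · intro r p q h hp hq
      by_cases hr : r = 1
      · subst hr
        have e : (opData 2).tensorAt (opData 2)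
            (MixedData.perturb biHomotopy.{w} postD (-1) awDefect 2 2) p q h = 0 := by
          have : MixedData.perturb biHomotopy.{w} postD (-1) awDefect 2 2 = 0 :=
            awCorrection_supp 2 2 fun i hi => by omega
          rw [this]
          rfl
        rw [postD_apply, MixedData.famD_succ, e, map_zero, add_zero]
        exact test₂_b _
      · have : postD 2 (MixedData.perturb biHomotopy.{w} postD (-1) awDefect 2) r = 0 :=
          ((awCorrection_supp 2).op (d := 1) postD_isLocal) r fun i hi => hr (by omega)
        rw [this]
        exact map_zero _
    · intro r p q h hp hq
      obtain ⟨rfl, rfl⟩ : p = 1 ∧ q = 1 := by omega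
      by_cases hr : r = 1
      · subst hr
        exact test₂_awDefect_two
      · have : awDefect.{w} 2 r = 0 := awDefect_supp 2 r fun i hi => hr (by omega)
        rw [this]
        exact map_zero _
  | n + 3 => exact biHomotopy_P fun r p q h hp hq => by omega

/-- The Alexander-Whitney map has an extension to a cyclic Alexander-Whitney map. -/
lemma isCyclicAW : IsCyclicAW fun n => awOp.{w} n + awCorrection n where
  supp n := (awOp_supp n).add (awCorrection_supp n).of_add_two
  chain n := by
    have h := MixedData.perturb_spec (c := biHomotopy.{w}) (A := postD) (ε := -1) (g := awDefect)
      (MixedData.IsMixed.pi biData_isMixed) (by norm_num) (fun n x => postD_B x)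
      (fun n x => postD_b x) (fun n x => postD_postD x) ?_ harmonic_awCorrection n
    · have e : (MixedData.pi biData).famD (fun n => awOp.{w} n + awCorrection n) n =
          (MixedData.pi biData).famD awOp n + (MixedData.pi biData).famD awCorrection n :=
        congrFun (map_add (MixedData.pi biData).famD awOp awCorrection) n
      rw [e, map_add]
      change postD n (awCorrection n) + (-1 : ℂ) • (MixedData.pi biData).famD awCorrection n =
        (MixedData.pi biData).famD awOp n - postD n (awOp n) at h
      rw [neg_smul, one_smul, ← sub_eq_add_neg, sub_eq_sub_iff_add_eq_add] at h
      rw [add_comm, h]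
    · intro n
      have h1 : (MixedData.pi biData).famD awDefect.{w} n =
          (MixedData.pi biData).famD ((MixedData.pi biData).famD awOp) n -
            (MixedData.pi biData).famD (fun n => postD n (awOp n)) n :=
        congrFun (map_sub (MixedData.pi biData).famD ((MixedData.pi biData).famD awOp)
          fun n => postD n (awOp n)) n
      rw [h1, MixedData.famD_famD (MixedData.IsMixed.pi biData_isMixed), awDefect, map_sub,
        postD_postD, postD_famD, sub_zero, Pi.zero_apply, zero_sub, neg_smul, one_smul, neg_neg]
  leading p q := by
    have : awCorrection.{w} (p + q) (p + q) = 0 := awCorrection_supp _ _ fun i hi => by omega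
    rw [Pi.add_apply, this, add_zero]
    exact awOp_of_eq rfl

/-- Cyclic Alexander-Whitney maps exist. -/
lemma nonempty_cyclicAW : Nonempty CyclicAW.{w} := ⟨isCyclicAW.toCyclicAW⟩

end NatOp

namespace MixedData

lemma fam_restr {T : MixedData.{w}} {n : ℕ} (y : ∀ r, T.obj r)
    (hy : ∀ m, (∀ k, m + 2 * k ≠ n) → y m = 0) : fam (restr n y) = y := by
  funext m
  by_cases h : ∃ k, m + 2 * k = n
  · obtain ⟨k, h⟩ := h
    exact fam_of_eq _ h
  · rw [fam_of_ne _ (by simpa using h), hy _ (by simpa using h)]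

end MixedData

namespace NatOp
variable {p q r n : ℕ}

section Converse
variable {X Y : CocyclicModule.{w}}

/-- The cochain `x ⊗ y`, as a sequence that vanishes in all other degrees. -/
def single (X Y : CocyclicModule.{w}) (p q : ℕ) (t : X.obj p ⊗[ℂ] Y.obj q) :
    ∀ n, (X.mixed.tensor Y.mixed).obj n := fun _ =>
  Pi.single (M := fun s : ℕ × ℕ => X.obj s.1 ⊗[ℂ] Y.obj s.2) (p, q) t ∘' Subtype.val

lemma single_of_eq (t : X.obj p ⊗[ℂ] Y.obj q) (h : p + q = n) :
    X.mixed.tensorAt Y.mixed (single X Y p q t n) p q h = t :=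
  Pi.single_eq_same (M := fun s : ℕ × ℕ => X.obj s.1 ⊗[ℂ] Y.obj s.2) (p, q) t

lemma single_of_ne (t : X.obj p ⊗[ℂ] Y.obj q) {p' q' : ℕ} (h : p' + q' = n)
    (hne : (p', q') ≠ (p, q)) :
    X.mixed.tensorAt Y.mixed (single X Y p q t n) p' q' h = 0 :=
  Pi.single_eq_of_ne (M := fun s : ℕ × ℕ => X.obj s.1 ⊗[ℂ] Y.obj s.2) hne t

lemma single_degree_ne (t : X.obj p ⊗[ℂ] Y.obj q) (h : p + q ≠ n) :
    single X Y p q t n = 0 :=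
  MixedData.tensor_obj_ext fun p' q' h' => single_of_ne t h' fun e => h (by
    rw [Prod.mk.injEq] at e
    omega)

lemma pair_single (t : X.obj p ⊗[ℂ] Y.obj q) (h : p + q = n) (x : (biData.{w} r).obj n) :
    pair X Y n r x (single X Y p q t n) = act X Y p q r ((opData r).tensorAt (opData r) x p q h) t := by
  rw [pair, sumAnti_single _ p q h, single_of_eq]
  intro p' q' h' hne
  rw [single_of_ne t h' fun e => hne (Prod.mk.inj e).1, map_zero]

lemma star_single (t : X.obj p ⊗[ℂ] Y.obj q) (h : p + q = n) {N : ℕ} (hN : n < N)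
    (x : ∀ n, (MixedData.pi biData.{w}).obj n) (r : ℕ) :
    star X Y N x (single X Y p q t) r =
      act X Y p q r ((opData r).tensorAt (opData r) (x n r) p q h) t := by
  rw [star, Finset.sum_eq_single n, pair_single t h]
  · intro m _ hm
    rw [single_degree_ne t (by omega), pair_zero_right]
  · intro h'
    exact absurd (Finset.mem_range.2 hN) h'

end Converse
end NatOp

namespace CyclicAW
open NatOp
variable (F : CyclicAW.{w}) {X Y : CocyclicModule.{w}} {p q r n : ℕ}

/-- The operations that define a cyclic Alexander-Whitney map: its values on the generators of free
cocyclic modules. -/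
def ops (n : ℕ) : (MixedData.pi biData.{w}).obj n := fun r s =>
  open Classical in
  if ∃ i, r + 2 * i = n then
    F.comp (free s.1.1) (free s.1.2) s.1.1 s.1.2 r (gen s.1.1 ⊗ₜ gen s.1.2)
  else 0

lemma ops_supp (n : ℕ) : MixedData.SuppLE 0 (F.ops n) := fun r h => by
  funext s
  exact if_neg (by simpa using h)

lemma comp_eq_act (p q r i : ℕ) (h : p + q = r + 2 * i) : F.comp X Y p q r =
    act X Y p q r ((opData r).tensorAt (opData r) (F.ops (p + q) r) p q rfl) := by
  have e : (opData r).tensorAt (opData r) (F.ops (p + q) r) p q rfl =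
      F.comp (free p) (free q) p q r (gen p ⊗ₜ gen q) := if_pos ⟨i, h.symm⟩
  refine TensorProduct.ext' fun x y => ?_
  rw [act_tmul, e]
  have := LinearMap.congr_fun (F.natural (evHom X x) (evHom Y y) p q r) (gen p ⊗ₜ gen q)
  rw [LinearMap.comp_apply, LinearMap.comp_apply, TensorProduct.map_tmul, evHom_gen, evHom_gen] at this
  exact this.symm

lemma uMap_eq {N : ℕ} (hN : n < N) (z : (X.mixed.tensor Y.mixed).TC n) :
    X.uMap Y.toCocyclicData (F.comp X Y) n z =
      MixedData.restr n (star X Y N F.ops (MixedData.fam z)) :=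
  uMap_eq_restr F.ops_supp (fun p q r i h => F.comp_eq_act p q r i h) hN z

lemma star_eq_zero {x : ∀ n, (MixedData.pi biData.{w}).obj n}
    (hx : ∀ n, MixedData.SuppLE 0 (x n)) (N : ℕ) (z : (X.mixed.tensor Y.mixed).TC n)
    (h : ∀ i, r + 2 * i ≠ n) : star X Y N x (MixedData.fam z) r = 0 := by
  refine Finset.sum_eq_zero fun m hm => ?_
  by_cases h' : ∃ k, m + 2 * k = n
  · obtain ⟨k, hk⟩ := h'
    rw [hx m _ fun i hi => h (i + k) (by omega), pair_zero_left]
  · rw [MixedData.fam_of_ne _ (by simpa using h'), pair_zero_right]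

lemma isCyclicAW : IsCyclicAW F.ops where
  supp := F.ops_supp
  chain n := by
    funext r
    refine MixedData.tensor_obj_ext fun p q h => ?_
    by_cases hr : ∃ k, r + 2 * k = n + 1
    · obtain ⟨k, hr⟩ := hr
      let z := single (free.{w} p) (free q) p q (gen p ⊗ₜ gen q)
      have hz : ∀ m, n < m → z m = 0 := fun m hm => single_degree_ne _ (by omega)
      have hz' : MixedData.fam (MixedData.restr n z) = z :=
        MixedData.fam_restr z fun m hm => single_degree_ne _ fun e => hm 0 (by omega)
      have h1 := F.chain (free p) (free q) n (MixedData.restr n z)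
      rw [F.uMap_eq (show n < n + 2 by omega), F.uMap_eq (show n + 1 < n + 2 by omega),
        MixedData.d_restr _ _ (star_eq_zero F.ops_supp _ _ fun i => by omega), MixedData.fam_d,
        hz'] at h1
      have h2 : ((free p).diag (free q).toCocyclicData).mixed.famD (star (free p) (free q) (n + 2)
          F.ops z) r = star (free p) (free q) (n + 2) F.ops
            (((free p).mixed.tensor (free q).mixed).famD z) r := congrFun h1 ⟨(r, k), hr⟩
      rw [famD_star, star_famD _ _ _ fun m hm => hz m (by omega),
        star_single _ h (by omega), star_single _ h (by omega), act_gen, act_gen] at h2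
      exact h2
    · have hr' : ∀ i, r + 2 * i ≠ n + 1 := by simpa using hr
      have e1 : postD n (F.ops n) r = 0 := postD_isLocal n _ r
        (F.ops_supp n _ fun i hi => hr' (i + 1) (by omega))
        fun s hs => F.ops_supp n _ fun i hi => hr' i (by omega)
      have e2 : (MixedData.pi biData).famD F.ops n r = 0 := by
        rcases n with _ | n
        · rw [MixedData.famD_zero]
          change (biData r).B 0 (F.ops 1 r) = 0
          rw [F.ops_supp 1 r fun i hi => hr' i (by omega), map_zero]
        · rw [MixedData.famD_succ]
          change (biData r).b n (F.ops n r) + (biData r).B (n + 1) (F.ops (n + 2) r) = 0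
          rw [F.ops_supp n r fun i hi => hr' (i + 1) (by omega),
            F.ops_supp (n + 2) r fun i hi => hr' i (by omega), map_zero, map_zero, add_zero]
      rw [e1, e2]
  leading p q := by
    have e : (opData (p + q)).tensorAt (opData (p + q)) (F.ops (p + q) (p + q)) p q rfl =
      F.comp (free p) (free q) p q (p + q) (gen p ⊗ₜ gen q) := if_pos ⟨0, rfl⟩
    rw [e, F.leading _ _ rfl]
    rfl

end CyclicAW

namespace MixedData
variable {X : MixedData.{w}} {Y : MixedData.{w'}}

/-! ### The operator `B ⊗ B` -/

section Square

/-- `(-1)^q b ⊗ b`, on the component `X^p ⊗ Y^q`. -/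
def bSquareAt {n : ℕ} (z : (X.tensor Y).obj n) :
    ∀ p q : ℕ, p + q = n + 2 → X.obj p ⊗[ℂ] Y.obj q
  | 0, _, _ => 0
  | _ + 1, 0, _ => 0
  | p + 1, q + 1, h => (-1 : ℂ) ^ q • TensorProduct.map (X.b p) (Y.b q)
      (X.tensorAt Y z p q (by omega))

/-- `(-1)^q b ⊗ b`. -/
def bSquare {n : ℕ} (z : (X.tensor Y).obj n) : (X.tensor Y).obj (n + 2) :=
  fun s => bSquareAt z s.1.1 s.1.2 s.2

/-- `(-1)^q B ⊗ B`. -/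
def BSquare {n : ℕ} (z : (X.tensor Y).obj (n + 2)) : (X.tensor Y).obj n := fun s =>
  (-1 : ℂ) ^ s.1.2 • TensorProduct.map (X.B s.1.1) (Y.B s.1.2)
    (X.tensorAt Y z (s.1.1 + 1) (s.1.2 + 1) (by have := s.2; omega))

lemma bSquare_zero {n : ℕ} (z : (X.tensor Y).obj n) (q : ℕ) (h : 0 + q = n + 2) :
    X.tensorAt Y (bSquare z) 0 q h = 0 := rfl

lemma bSquare_right_zero {n : ℕ} (z : (X.tensor Y).obj n) (p : ℕ) (h : p + 0 = n + 2) :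
    X.tensorAt Y (bSquare z) p 0 h = 0 := by
  rcases p with _ | p <;> rfl

lemma bSquare_succ {n : ℕ} (z : (X.tensor Y).obj n) (p q : ℕ) (h : p + 1 + (q + 1) = n + 2) :
    X.tensorAt Y (bSquare z) (p + 1) (q + 1) h =
      (-1 : ℂ) ^ q • (X.b p).rTensor _ ((Y.b q).lTensor _ (X.tensorAt Y z p q (by omega))) := by
  rw [← LinearMap.comp_apply (LinearMap.rTensor _ _), LinearMap.rTensor_comp_lTensor]
  rfl

lemma BSquare_apply {n : ℕ} (z : (X.tensor Y).obj (n + 2)) (p q : ℕ) (h : p + q = n) :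
    X.tensorAt Y (BSquare z) p q h = (-1 : ℂ) ^ q • TensorProduct.map (X.B p) (Y.B q)
      (X.tensorAt Y z (p + 1) (q + 1) (by omega)) := rfl

lemma bSquare_zero_right (n : ℕ) : bSquare (0 : (X.tensor Y).obj n) = 0 := by
  refine tensor_obj_ext fun p q h => ?_
  rcases p with _ | p
  · rfl
  · rcases q with _ | q
    · rfl
    · rw [bSquare_succ]
      change (-1 : ℂ) ^ q • (X.b p).rTensor _ ((Y.b q).lTensor _ 0) = 0
      rw [map_zero, map_zero, smul_zero]

lemma b_bSquare (hX : X.IsMixed) (hY : Y.IsMixed) {n : ℕ} (z : (X.tensor Y).obj n) :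
    (X.tensor Y).b (n + 2) (bSquare z) = 0 := by
  refine tensor_obj_ext fun p q h => ?_
  rw [tensorAt_b]
  have h1 : X.bLeft Y (bSquare z) p q h = 0 := by
    rcases p with _ | p
    · rfl
    · rw [bLeft_succ]
      rcases p with _ | p
      · rw [bSquare_zero, map_zero, smul_zero]
      · rcases q with _ | q
        · rw [bSquare_right_zero, map_zero, smul_zero]
        · rw [bSquare_succ, map_smul, rTensor_rTensor_eq_zero (hX.b_b p), smul_zero, smul_zero]
  have h2 : X.bRight Y (bSquare z) p q h = 0 := by
    rcases q with _ | q
    · rfl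
    · rw [bRight_succ]
      rcases p with _ | p
      · rw [bSquare_zero, map_zero]
      · rcases q with _ | q
        · rw [bSquare_right_zero, map_zero]
        · rw [bSquare_succ, map_smul, rTensor_lTensor, lTensor_lTensor_eq_zero (hY.b_b q), smul_zero]
  rw [h1, h2, add_zero]
  rfl

lemma bSquare_b (hX : X.IsMixed) (hY : Y.IsMixed) {n : ℕ} (z : (X.tensor Y).obj n) :
    bSquare ((X.tensor Y).b n z) = 0 := by
  refine tensor_obj_ext fun p q h => ?_
  rcases p with _ | p
  · rfl
  · rcases q with _ | q
    · rfl
    · rw [bSquare_succ, tensorAt_b, map_add, map_add]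
      have h1 : (X.b p).rTensor _ ((Y.b q).lTensor _ (X.bLeft Y z p q (by omega))) = 0 := by
        rcases p with _ | p
        · rw [bLeft_zero, map_zero, map_zero]
        · rw [bLeft_succ, map_smul, map_smul, rTensor_lTensor, rTensor_rTensor_eq_zero (hX.b_b p),
            map_zero, smul_zero]
      have h2 : (X.b p).rTensor _ ((Y.b q).lTensor _ (X.bRight Y z p q (by omega))) = 0 := by
        rcases q with _ | q
        · rw [bRight_zero, map_zero, map_zero]
        · rw [bRight_succ, lTensor_lTensor_eq_zero (hY.b_b q), map_zero]
      rw [h1, h2, add_zero, smul_zero]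
      rfl

lemma B_bSquare_zero (hX : X.IsMixed) (hY : Y.IsMixed) (z : (X.tensor Y).obj 0) :
    (X.tensor Y).B 1 (bSquare z) = 0 := by
  refine tensor_obj_ext fun p q h => ?_
  rw [tensorAt_B]
  obtain ⟨rfl, rfl⟩ | ⟨rfl, rfl⟩ : p = 1 ∧ q = 0 ∨ p = 0 ∧ q = 1 := by omega
  · rw [bSquare_right_zero, map_zero, smul_zero, zero_add, bSquare_succ, map_smul, rTensor_lTensor,
      lTensor_lTensor_eq_zero hY.B_b_zero, smul_zero]
    rfl
  · rw [bSquare_zero, map_zero, add_zero, bSquare_succ, map_smul,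
      rTensor_rTensor_eq_zero hX.B_b_zero, smul_zero, smul_zero]
    rfl

lemma B_bSquare (hX : X.IsMixed) (hY : Y.IsMixed) {n : ℕ} (z : (X.tensor Y).obj (n + 1)) :
    (X.tensor Y).B (n + 2) (bSquare z) = bSquare ((X.tensor Y).B n z) := by
  have hl : ∀ {W : Type w'} [AddCommGroup W] [Module ℂ W] p (t : X.obj (p + 1) ⊗[ℂ] W),
      (X.B (p + 1)).rTensor _ ((X.b (p + 1)).rTensor _ t) =
        -(X.b p).rTensor _ ((X.B p).rTensor _ t) := fun p t =>
    eq_neg_of_add_eq_zero_right (rTensor_add_rTensor_eq_zero (hX.b_B p) t)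
  have hr : ∀ {W : Type w} [AddCommGroup W] [Module ℂ W] q (t : W ⊗[ℂ] Y.obj (q + 1)),
      (Y.B (q + 1)).lTensor _ ((Y.b (q + 1)).lTensor _ t) =
        -(Y.b q).lTensor _ ((Y.B q).lTensor _ t) := fun q t =>
    eq_neg_of_add_eq_zero_right (lTensor_add_lTensor_eq_zero (hY.b_B q) t)
  refine tensor_obj_ext fun p q h => ?_
  rw [tensorAt_B]
  rcases p with _ | p
  · rw [bSquare_zero, bSquare_zero, map_zero, add_zero]
    rcases q with _ | q
    · omega
    · rw [bSquare_succ, map_smul, rTensor_rTensor_eq_zero hX.B_b_zero, smul_zero, smul_zero]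
  · rcases q with _ | q
    · rw [bSquare_right_zero, bSquare_right_zero, map_zero, smul_zero, zero_add, bSquare_succ,
        map_smul, rTensor_lTensor, lTensor_lTensor_eq_zero hY.B_b_zero, smul_zero]
    · rw [bSquare_succ, bSquare_succ, bSquare_succ, tensorAt_B, map_smul, map_smul, hl,
        rTensor_lTensor, ← rTensor_lTensor (X.b p) (Y.B (q + 1)), hr, map_neg, map_add, map_add,
        map_smul, map_smul, smul_add, pow_succ, mul_neg, mul_one]
      simp only [neg_smul, smul_neg, neg_neg]

lemma famD_bSquare (hX : X.IsMixed) (hY : Y.IsMixed) {x y : ∀ n, (X.tensor Y).obj n}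
    (h0 : y 0 = 0) (h1 : y 1 = 0) (h : ∀ n, y (n + 2) = bSquare (x n)) :
    (X.tensor Y).famD y 0 = 0 ∧ (X.tensor Y).famD y 1 = 0 ∧
      ∀ n, (X.tensor Y).famD y (n + 2) = bSquare ((X.tensor Y).famD x n) := by
  refine ⟨?_, ?_, fun n => ?_⟩
  · rw [famD_zero, h1, map_zero]
  · rw [famD_succ, h0, map_zero, zero_add, h, B_bSquare_zero hX hY]
  · rw [famD_succ, h]
    have e : (X.tensor Y).b (n + 1) (y (n + 1)) = 0 := by
      rcases n with _ | n
      · rw [h1, map_zero]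
      · rw [h, b_bSquare hX hY]
    rw [e, zero_add, B_bSquare hX hY]
    rcases n with _ | n
    · rw [famD_zero]
    · rw [famD_succ]
      have e' : ∀ a b : (X.tensor Y).obj (n + 1), bSquare (a + b) = bSquare a + bSquare b := by
        intro a b
        refine tensor_obj_ext fun p q hpq => ?_
        rcases p with _ | p
        · exact (add_zero _).symm
        · rcases q with _ | q
          · exact (add_zero _).symm
          · rw [tensorAt_add, bSquare_succ, bSquare_succ, bSquare_succ, tensorAt_add, map_add,
              map_add, smul_add]
      rw [e', bSquare_b hX hY, zero_add]

end Square

/-! ### Exterior products as sequences -/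

section Products
variable {P Q n : ℕ}

lemma tensorAt_fam_prodTC (h : P + Q = n) (x : X.TC P) (y : Y.TC Q) (m p q : ℕ) (hpq : p + q = m) :
    X.tensorAt Y (fam (prodTC (n := n) x y) m) p q hpq = fam x p ⊗ₜ[ℂ] fam y q := by
  by_cases hp : ∃ a, p + 2 * a = P
  · by_cases hq : ∃ b, q + 2 * b = Q
    · obtain ⟨a, hp⟩ := hp
      obtain ⟨b, hq⟩ := hq
      rw [fam_of_eq _ (show m + 2 * (a + b) = n by omega), fam_of_eq x hp, fam_of_eq y hq]
      refine (prodTC_apply x y _ _).trans ?_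
      rw [Finset.sum_eq_single (a, b)]
      · rw [ext, ext, dif_pos hp, dif_pos hq]
      · rintro ⟨i, j⟩ hij hne
        have := Finset.HasAntidiagonal.mem_antidiagonal.1 hij
        dsimp only at this
        rw [ext, dif_neg, TensorProduct.zero_tmul]
        intro e
        dsimp only at e
        exact hne (by rw [Prod.mk.injEq]; omega)
      · intro h'
        exact absurd (Finset.HasAntidiagonal.mem_antidiagonal.2 (by rfl)) h'
    · rw [fam_of_ne y (by simpa using hq), TensorProduct.tmul_zero]
      by_cases hm : ∃ k, m + 2 * k = n
      · obtain ⟨k, hk⟩ := hm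
        rw [fam_of_eq _ hk]
        refine (prodTC_apply x y _ _).trans (Finset.sum_eq_zero fun ij _ => ?_)
        rw [ext, ext, dif_neg (fun e => hq ⟨_, e⟩), TensorProduct.tmul_zero]
      · rw [fam_of_ne _ (by simpa using hm)]
        rfl
  · rw [fam_of_ne x (by simpa using hp), TensorProduct.zero_tmul]
    by_cases hm : ∃ k, m + 2 * k = n
    · obtain ⟨k, hk⟩ := hm
      rw [fam_of_eq _ hk]
      refine (prodTC_apply x y _ _).trans (Finset.sum_eq_zero fun ij _ => ?_)
      rw [ext, ext, dif_neg (fun e => hp ⟨_, e⟩), TensorProduct.zero_tmul]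
    · rw [fam_of_ne _ (by simpa using hm)]
      rfl

/-- The sequence of the cochains `B zₘ₊₁`. -/
def famB (z : ∀ m, X.obj m) (m : ℕ) : X.obj m := X.B m (z (m + 1))

lemma famD_famB (hX : X.IsMixed) {z : ∀ m, X.obj m} (hz : X.famD z = 0) : X.famD (famB z) = 0 := by
  funext m
  rcases m with _ | m
  · rw [famD_zero, famB, hX.B_B]
    rfl
  · rw [famD_succ, famB, famB, hX.B_B, add_zero]
    have h1 := congrFun hz (m + 2)
    rw [famD_succ] at h1
    have h2 := hX.b_B m (z (m + 1))
    rw [eq_neg_of_add_eq_zero_left h1, map_neg, hX.B_B, neg_zero, add_zero] at h2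
    exact h2

/-- For a cocycle `z` of the total complex, `u B z` is the coboundary of `-D z`, where `D` is the
derivation `u d/du`. -/
lemma restr_famB_mem_bdry (z : X.TC n) (hz : X.d n z = 0) :
    (restr (n + 1) (famB (fam z)) : X.TC (n + 1)) ∈ X.bdry (n + 1) := by
  refine ⟨-fun s => (s.1.2 : ℂ) • z s, ?_⟩
  rw [map_neg]
  funext ⟨⟨m, k⟩, h⟩
  have h1 := congrFun hz ⟨(m, k), h⟩
  change X.bPart z m k h + X.BPart z m k h = 0 at h1
  change -(X.bPart (fun s => (s.1.2 : ℂ) • z s) m k h + X.BPart (fun s => (s.1.2 : ℂ) • z s) m k h) =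
    X.B m (fam z (m + 1))
  have hb : X.bPart (fun s => (s.1.2 : ℂ) • z s) m k h = (k : ℂ) • X.bPart z m k h := by
    rcases m with _ | m
    · exact (smul_zero _).symm
    · exact map_smul _ _ _
  have hB : X.BPart (fun s => (s.1.2 : ℂ) • z s) m k h = (k : ℂ) • X.BPart z m k h -
      X.BPart z m k h := by
    rcases k with _ | k
    · simp [BPart]
    · change X.B m ((k : ℂ) • _) = ((k + 1 : ℕ) : ℂ) • X.B m _ - X.B m _
      rw [map_smul, Nat.cast_succ, add_smul, one_smul, add_sub_cancel_right]
  have hf : X.B m (fam z (m + 1)) = X.BPart z m k h := by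
    rcases k with _ | k
    · rw [fam_of_ne _ fun i => by omega, map_zero]
      rfl
    · rw [fam_of_eq z (k := k) (by omega)]
      rfl
  rw [hb, hB, hf, ← add_sub_assoc, ← smul_add, h1, smul_zero, zero_sub, neg_neg]

end Products
end MixedData

lemma MixedData.fam_zero {T : MixedData.{w}} {n : ℕ} : fam (0 : T.TC n) = fun _ => 0 := by
  funext m
  rw [fam, ext]
  split <;> rfl

namespace NatOp
variable {p q r n : ℕ}

/-- Composition of operations in two variables with `(-1)^q B ⊗ B`. -/
def sq (x : ∀ n, (MixedData.pi biData.{w}).obj n) : ∀ n, (MixedData.pi biData.{w}).obj n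
  | 0 => 0
  | 1 => 0
  | n + 2 => fun r => MixedData.bSquare (x n r)

/-- `b + B` on the source commutes with composition with `B ⊗ B`, as both `B b + b B` and `B²` vanish. -/
lemma famD_sq (x : ∀ n, (MixedData.pi biData.{w}).obj n) :
    (MixedData.pi biData).famD (sq x) = sq ((MixedData.pi biData).famD x) := by
  have e : ∀ (y : ∀ n, (MixedData.pi biData.{w}).obj n) n r,
      (MixedData.pi biData).famD y n r = (biData r).famD (fun n => y n r) n := by
    intro y n r
    rcases n with _ | n <;> rfl
  have h := fun r => MixedData.famD_bSquare (opData_isMixed.{w} r) (opData_isMixed r)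
    (x := fun n => x n r) (y := fun n => sq x n r) rfl rfl fun n => rfl
  funext n r
  rw [e]
  match n with
  | 0 => exact (h r).1
  | 1 => exact (h r).2.1
  | n + 2 => exact ((h r).2.2 n).trans (congrArg _ (e x n r).symm)

lemma postD_sq (x : ∀ n, (MixedData.pi biData.{w}).obj n) (n : ℕ) :
    postD n (sq x n) = sq (fun n => postD n (x n)) n := by
  match n with
  | 0 => exact map_zero _
  | 1 => exact map_zero _
  | n + 2 =>
    funext r
    refine MixedData.tensor_obj_ext fun p q h => ?_
    have h0 : ∀ p q, (bi.{w} p q).mixed.famD (fun r => (0 : (bi p q).obj r)) = 0 :=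
      fun p q => map_zero _
    rw [postD_apply]
    rcases p with _ | p
    · exact congrFun (h0 0 q) r
    · rcases q with _ | q
      · exact congrFun (h0 (p + 1) 0) r
      · have e : ∀ r', (opData r').tensorAt (opData r') (sq x (n + 2) r') (p + 1) (q + 1) h =
            (-1 : ℂ) ^ q • ((opData r').b p).rTensor _ (((opData r').b q).lTensor _
              ((opData r').tensorAt (opData r') (x n r') p q (by omega))) := fun r' =>
          MixedData.bSquare_succ (x n r') p q h
        have e' : (opData r).tensorAt (opData r) (sq (fun n => postD n (x n)) (n + 2) r)
            (p + 1) (q + 1) h = (-1 : ℂ) ^ q • ((opData r).b p).rTensor _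
              (((opData r).b q).lTensor _ ((opData r).tensorAt (opData r) (postD n (x n) r) p q
                (by omega))) := MixedData.bSquare_succ (postD n (x n) r) p q h
        rw [e', postD_apply, ← famD_bi_right, ← famD_bi_left, funext e]
        exact congrFun (map_smul (bi (p + 1) (q + 1)).mixed.famD ((-1 : ℂ) ^ q) _) r

lemma sq_supp {x : ∀ n, (MixedData.pi biData.{w}).obj n} (hx : ∀ n, MixedData.SuppLE 0 (x n))
    (n : ℕ) : MixedData.SuppLE 2 (sq x n) := fun r h => by
  match n with
  | 0 => rfl
  | 1 => rfl
  | n + 2 =>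
    change MixedData.bSquare (x n r) = 0
    rw [hx n r fun i hi => h i (by omega), MixedData.bSquare_zero_right]

section
variable {X Y : CocyclicModule.{w}}

lemma pair_bSquare (x : (biData.{w} r).obj n) (z : (X.mixed.tensor Y.mixed).obj (n + 2)) :
    pair X Y (n + 2) r (MixedData.bSquare x) z = pair X Y n r x (MixedData.BSquare z) := by
  rw [pair, sumAnti_left (n + 1) _ fun q h => ?_, sumAnti_right n _ fun p h => ?_, pair]
  · refine sumAnti_congr fun p q h => ?_
    rw [MixedData.bSquare_succ, map_smul, LinearMap.smul_apply, act_left, act_right,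
      MixedData.BSquare_apply, map_smul, ev_mixed_B, ev_mixed_B, ← LinearMap.comp_apply
      (LinearMap.lTensor _ _), LinearMap.lTensor_comp_rTensor]
  · rw [MixedData.bSquare_right_zero, map_zero, LinearMap.zero_apply]
  · rw [MixedData.bSquare_zero, map_zero, LinearMap.zero_apply]

lemma star_sq (N : ℕ) (x : ∀ n, (MixedData.pi biData.{w}).obj n)
    (z : ∀ n, (X.mixed.tensor Y.mixed).obj n) (r : ℕ) :
    star X Y (N + 2) (sq x) z r = star X Y N x (fun n => MixedData.BSquare (z (n + 2))) r := by
  have e : ∀ n (z : (X.mixed.tensor Y.mixed).obj n),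
      pair X Y n r ((0 : (MixedData.pi biData.{w}).obj n) r) z = 0 := fun n z => pair_zero_left z
  rw [star, Finset.sum_range_succ', Finset.sum_range_succ', star]
  change _ + pair X Y 1 r ((0 : (MixedData.pi biData.{w}).obj 1) r) _ +
    pair X Y 0 r ((0 : (MixedData.pi biData.{w}).obj 0) r) _ = _
  rw [e, e, add_zero, add_zero]
  exact Finset.sum_congr rfl fun n _ => pair_bSquare _ _

/-- On exterior products, `(-1)^q B ⊗ B` is the product of the operators `B`, up to a sign. -/
lemma BSquare_fam_prodTC {P Q n : ℕ} (h : P + (Q + 1) = n) (x : X.mixed.TC P)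
    (y : Y.mixed.TC (Q + 1)) (m : ℕ) :
    MixedData.BSquare (MixedData.fam (MixedData.prodTC (n := n) x y) (m + 2)) =
      (-1 : ℂ) ^ Q • MixedData.fam (MixedData.prodTC (n := n)
        (MixedData.restr (P + 1) (MixedData.famB (MixedData.fam x)))
        (MixedData.restr Q (MixedData.famB (MixedData.fam y)))) m := by
  have hx : MixedData.fam (MixedData.restr (P + 1) (MixedData.famB (MixedData.fam x))) =
      MixedData.famB (MixedData.fam x) := MixedData.fam_restr _ fun m hm => by
    rw [MixedData.famB, MixedData.fam_of_ne x fun k hk => hm (k + 1) (by omega), map_zero]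
  have hy : MixedData.fam (MixedData.restr Q (MixedData.famB (MixedData.fam y))) =
      MixedData.famB (MixedData.fam y) := MixedData.fam_restr _ fun m hm => by
    rw [MixedData.famB, MixedData.fam_of_ne y fun k hk => hm k (by omega), map_zero]
  refine MixedData.tensor_obj_ext fun p q hpq => ?_
  rw [MixedData.BSquare_apply, MixedData.tensorAt_fam_prodTC h, TensorProduct.map_tmul]
  refine Eq.trans ?_ (congrArg ((-1 : ℂ) ^ Q • ·) (MixedData.tensorAt_fam_prodTC
    (show P + 1 + Q = n by omega) _ _ m p q hpq)).symm
  rw [hx, hy]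
  by_cases hq : ∃ b, q + 2 * b = Q
  · obtain ⟨b, rfl⟩ := hq
    rw [pow_add, pow_mul, neg_one_sq, one_pow, mul_one]
    rfl
  · have e : MixedData.famB (MixedData.fam y) q = 0 := by
      rw [MixedData.famB, MixedData.fam_of_ne y fun k hk => hq ⟨k, by omega⟩, map_zero]
    rw [e]
    change (-1 : ℂ) ^ q • (_ ⊗ₜ[ℂ] MixedData.famB (MixedData.fam y) q) = _
    rw [e, TensorProduct.tmul_zero, smul_zero, TensorProduct.tmul_zero]
    exact (smul_zero _).symm

end

/-! ### Uniqueness of cyclic Alexander-Whitney maps -/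

section Uniqueness
variable {f f' : ∀ n, (MixedData.pi biData.{w}).obj n}

lemma IsCyclicAW.top_eq (hf : IsCyclicAW f) (hf' : IsCyclicAW f') (n : ℕ) : f n n = f' n n := by
  refine MixedData.tensor_obj_ext fun p q h => ?_
  subst h
  exact (hf.leading p q).trans (hf'.leading p q).symm

/-- The composite of a cyclic Alexander-Whitney map with `B ⊗ B` has a non-trivial harmonic part. -/
lemma IsCyclicAW.test₂_sq (hf : IsCyclicAW f) :
    test₂ 1 1 0 ((opData 0).tensorAt (opData 0) (sq f 2 0) 1 1 rfl) = 1 := by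
  have e : (opData 0).tensorAt (opData 0) (sq f 2 0) 1 1 rfl = (-1 : ℂ) ^ 0 •
      ((opData 0).b 0).rTensor _ (((opData 0).b 0).lTensor _
        ((opData 0).tensorAt (opData 0) (f 0 0) 0 0 rfl)) := MixedData.bSquare_succ (f 0 0) 0 0 rfl
  have e' : (opData 0).tensorAt (opData 0) (f 0 0) 0 0 rfl =
      (opData 0).tensorAt (opData 0) (awOp 0 0) 0 0 rfl :=
    (hf.leading 0 0).trans (awOp_of_eq rfl).symm
  rw [e, pow_zero, one_smul, test₂_b_left _ rfl, test₂_b_right _ rfl, e', test₂_awOp]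
  exact mul_one _

/-- The difference of two sequences, minus the multiple of `sq f'` that makes it null-homotopic. -/
def reduced (f f' : ∀ n, (MixedData.pi biData.{w}).obj n) (n : ℕ) :
    (MixedData.pi biData.{w}).obj n :=
  f n - f' n - test₂ 1 1 0 ((opData 0).tensorAt (opData 0) (f 2 0 - f' 2 0) 1 1 rfl) • sq f' n

lemma IsCyclicAW.reduced_supp (hf : IsCyclicAW f) (hf' : IsCyclicAW f') (n : ℕ) :
    MixedData.SuppLE 2 (reduced f f' n) := by
  refine MixedData.SuppLE.sub (fun r h => ?_) ((sq_supp hf'.supp n).smul _)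
  rw [Pi.sub_apply]
  by_cases hr : r = n
  · subst hr
    rw [hf.top_eq hf', sub_self]
  · have h' : ∀ i, r + 0 + 2 * i ≠ n := by
      rintro (_ | i) hi
      · exact hr (by omega)
      · exact h i (by omega)
    rw [hf.supp n r h', hf'.supp n r h', sub_self]

lemma IsCyclicAW.postD_reduced (hf : IsCyclicAW f) (hf' : IsCyclicAW f') (n : ℕ) :
    postD n (reduced f f' n) = (1 : ℂ) • (MixedData.pi biData).famD (reduced f f') n := by
  have e : (MixedData.pi biData).famD (reduced f f') = (MixedData.pi biData).famD f -
      (MixedData.pi biData).famD f' -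
        test₂ 1 1 0 ((opData 0).tensorAt (opData 0) (f 2 0 - f' 2 0) 1 1 rfl) •
          (MixedData.pi biData).famD (sq f') := by
    rw [← map_smul, ← map_sub, ← map_sub]
    rfl
  rw [one_smul, e, reduced, map_sub, map_sub, map_smul, hf.chain, hf'.chain, postD_sq, famD_sq,
    funext hf'.chain]
  rfl

/-- The difference of two cyclic Alexander-Whitney maps has harmonic part only in source degree `(1, 1)`
and target degree zero, where the multiple of `sq f'` in `reduced` cancels it. -/
lemma IsCyclicAW.harmonic_reduced (hf : IsCyclicAW f) (hf' : IsCyclicAW f') (n : ℕ) :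
    biHomotopy.P n (MixedData.perturbRhs biHomotopy.{w} postD 1 (reduced f f') n) = 0 := by
  have hs : ∀ n, MixedData.SuppLE 3 (MixedData.perturb biHomotopy.{w} postD 1 (reduced f f') n) :=
    MixedData.SuppLE.perturb postD_isLocal (hf.reduced_supp hf')
  have k1 : MixedData.perturb biHomotopy.{w} postD 1 (reduced f f') 1 = 0 :=
    funext fun r => hs 1 r fun i hi => by omega
  match n with
  | 0 =>
    have : reduced f f' 0 = 0 := funext fun r => hf.reduced_supp hf' 0 r fun i hi => by omega
    rw [MixedData.perturbRhs, this, smul_zero, map_zero]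
  | 1 =>
    have k0 : MixedData.perturb biHomotopy.{w} postD 1 (reduced f f') 0 = 0 := rfl
    have : reduced f f' 1 = 0 := funext fun r => hf.reduced_supp hf' 1 r fun i hi => by omega
    rw [MixedData.perturbRhs, k0, k1, this, map_zero, map_zero, sub_zero, sub_zero, smul_zero,
      map_zero]
  | 2 =>
    have k2 : MixedData.perturb biHomotopy.{w} postD 1 (reduced f f') 2 = 0 :=
      funext fun r => hs 2 r fun i hi => by omega
    rw [MixedData.perturbRhs, k1, k2, map_zero, map_zero, sub_zero, sub_zero, one_smul, biHomotopy_P]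
    intro r p q h hp hq
    obtain ⟨rfl, rfl⟩ : p = 1 ∧ q = 1 := by omega
    by_cases hr : r = 0
    · subst hr
      change test₂ 1 1 0 ((opData 0).tensorAt (opData 0) (f 2 0 - f' 2 0) 1 1 rfl -
        test₂ 1 1 0 ((opData 0).tensorAt (opData 0) (f 2 0 - f' 2 0) 1 1 rfl) •
          (opData 0).tensorAt (opData 0) (sq f' 2 0) 1 1 rfl) = 0
      rw [map_sub, map_smul, hf'.test₂_sq, smul_eq_mul, mul_one, sub_self]
    · have : reduced f f' 2 r = 0 := hf.reduced_supp hf' 2 r fun i hi => hr (by omega)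
      rw [this]
      exact map_zero _
  | n + 3 => exact biHomotopy_P fun r p q h hp hq => by omega

/-- Two cyclic Alexander-Whitney maps are homotopic, up to a multiple of `B ⊗ B`. -/
lemma IsCyclicAW.exists_homotopy (hf : IsCyclicAW f) (hf' : IsCyclicAW f') :
    ∃ (c : ℂ) (k : ∀ n, (MixedData.pi biData.{w}).obj n), (∀ n, MixedData.SuppLE 3 (k n)) ∧
      ∀ n, f n = f' n + c • sq f' n + (postD n (k n) + (MixedData.pi biData).famD k n) := by
  refine ⟨test₂ 1 1 0 ((opData 0).tensorAt (opData 0) (f 2 0 - f' 2 0) 1 1 rfl),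
    MixedData.perturb biHomotopy postD 1 (reduced f f'),
    MixedData.SuppLE.perturb postD_isLocal (hf.reduced_supp hf'), fun n => ?_⟩
  have h := MixedData.perturb_spec (c := biHomotopy.{w}) (A := postD) (ε := 1) (g := reduced f f')
    (MixedData.IsMixed.pi biData_isMixed) (one_mul 1) (fun n x => postD_B x)
    (fun n x => postD_b x) (fun n x => postD_postD x) (hf.postD_reduced hf')
    (hf.harmonic_reduced hf') n
  rw [one_smul] at h
  rw [h, reduced]
  abel

end Uniqueness
end NatOp

namespace CyclicAW
open NatOp
variable (F F' : CyclicAW.{w}) {X Y : CocyclicModule.{w}} {P Q n : ℕ}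

/-- The term of a cyclic Alexander-Whitney map that is composed with `B ⊗ B` is zero in cohomology
on exterior products: `uB` is null-homotopic. -/
lemma star_sq_mem_bdry (h : P + Q = n) {x : X.mixed.TC P} {y : Y.mixed.TC Q}
    (hx : X.mixed.d P x = 0) (hy : Y.mixed.d Q y = 0) :
    (MixedData.restr n (star X Y (n + 3) (sq F.ops) (MixedData.fam (MixedData.prodTC (n := n) x y))) :
      (X.diag Y.toCocyclicData).mixed.TC n) ∈ (X.diag Y.toCocyclicData).mixed.bdry n := by
  have e : star X Y (n + 3) (sq F.ops) (MixedData.fam (MixedData.prodTC (n := n) x y)) =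
      star X Y (n + 1) F.ops (fun m => MixedData.BSquare
        (MixedData.fam (MixedData.prodTC (n := n) x y) (m + 2))) :=
    funext fun r => star_sq (n + 1) F.ops _ r
  rw [e]
  rcases Q with _ | Q
  · have e2 : (fun m => MixedData.BSquare
        (MixedData.fam (MixedData.prodTC (n := n) x y) (m + 2))) = fun m => 0 := by
      refine funext fun m => MixedData.tensor_obj_ext fun p q hpq => ?_
      rw [MixedData.BSquare_apply, MixedData.tensorAt_fam_prodTC h,
        MixedData.fam_of_ne y fun k => by omega, TensorProduct.tmul_zero, map_zero, smul_zero]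
      rfl
    have e3 : star X Y (n + 1) F.ops (fun m => 0) = 0 :=
      funext fun r => Finset.sum_eq_zero fun m _ => pair_zero_right _
    rw [e2, e3, map_zero]
    exact zero_mem _
  · have e2 : star X Y (n + 1) F.ops (fun m => MixedData.BSquare
        (MixedData.fam (MixedData.prodTC (n := n) x y) (m + 2))) =
        (-1 : ℂ) ^ Q • star X Y (n + 1) F.ops (MixedData.fam (MixedData.prodTC (n := n)
        (MixedData.restr (P + 1) (MixedData.famB (MixedData.fam x)))
        (MixedData.restr Q (MixedData.famB (MixedData.fam y))))) := by
      rw [funext (BSquare_fam_prodTC h x y)]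
      exact funext fun r => star_smul_right _ _ _ _ _
    rw [e2, map_smul, ← F.uMap_eq (Nat.lt_succ_self n)]
    refine Submodule.smul_mem _ _ ?_
    have hy' : Y.mixed.d Q (MixedData.restr Q (MixedData.famB (MixedData.fam y))) = 0 := by
      rw [MixedData.d_restr, MixedData.famD_famB Y.laws.isMixed, map_zero]
      · rw [← MixedData.fam_d, hy]
        exact MixedData.fam_zero
      · rw [MixedData.famB, MixedData.fam_of_ne y fun k => by omega, map_zero]
    obtain ⟨n, rfl⟩ : ∃ m, n = m + 1 := ⟨n - 1, by omega⟩
    obtain ⟨w, hw⟩ := MixedData.prodTC_mem_bdry_left (n := n + 1) (show P + 1 + Q = n + 1 by omega)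
      (MixedData.restr_famB_mem_bdry x hx) hy'
    rw [← hw, ← F.chain]
    exact ⟨_, rfl⟩

lemma star_eq_zero_of_lt {k : ∀ n, (MixedData.pi biData.{w}).obj n}
    (hk : ∀ n, MixedData.SuppLE 3 (k n)) (N : ℕ) (z : (X.mixed.tensor Y.mixed).TC n) {r : ℕ}
    (h : n < r + 3) : star X Y N k (MixedData.fam z) r = 0 := by
  refine Finset.sum_eq_zero fun m hm => ?_
  rcases Nat.lt_or_ge n m with h' | h'
  · rw [fam_eq_zero z h', pair_zero_right]
  · rw [hk m _ fun i hi => by omega, pair_zero_left]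

/-- On exterior products of cocycles, two cyclic Alexander-Whitney maps are cohomologous. -/
lemma uMap_sub_mem_bdry (h : P + Q = n) {x : X.mixed.TC P} {y : Y.mixed.TC Q}
    (hx : X.mixed.d P x = 0) (hy : Y.mixed.d Q y = 0) :
    X.uMap Y.toCocyclicData (F.comp X Y) n (MixedData.prodTC x y) -
      X.uMap Y.toCocyclicData (F'.comp X Y) n (MixedData.prodTC x y) ∈
        (X.diag Y.toCocyclicData).mixed.bdry n := by
  obtain ⟨c, k, hk, hF⟩ := F.isCyclicAW.exists_homotopy F'.isCyclicAW
  have hz : (X.mixed.tensor Y.mixed).d n (MixedData.prodTC x y) = 0 :=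
    (MixedData.prodZ (n := n) ⟨x, hx⟩ ⟨y, hy⟩).2
  have hsq := F'.star_sq_mem_bdry h hx hy
  generalize (MixedData.prodTC x y : (X.mixed.tensor Y.mixed).TC n) = z at hz hsq ⊢
  have hz' : (X.mixed.tensor Y.mixed).famD (MixedData.fam z) = fun _ => 0 := by
    rw [← MixedData.fam_d, hz]
    exact MixedData.fam_zero
  have e : star X Y (n + 3) F.ops (MixedData.fam z) = star X Y (n + 3) F'.ops (MixedData.fam z) +
      c • star X Y (n + 3) (sq F'.ops) (MixedData.fam z) +
        (X.diag Y.toCocyclicData).mixed.famD (star X Y (n + 3) k (MixedData.fam z)) := by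
    funext r
    rw [funext hF, star_add_left, star_add_left, star_smul_left, star_add_left, ← famD_star,
      ← star_famD (n + 2) k _ fun m hm => fam_eq_zero z (by omega), hz']
    have e0 : star X Y (n + 3) k (fun _ => 0) r = 0 :=
      Finset.sum_eq_zero fun m _ => pair_zero_right _
    rw [e0, add_zero]
    rfl
  rw [F.uMap_eq (show n < n + 3 by omega), F'.uMap_eq (show n < n + 3 by omega), e, map_add, map_add,
    map_smul, add_assoc, add_sub_cancel_left]
  refine add_mem (Submodule.smul_mem _ _ hsq) ?_
  rcases n with _ | n
  · have : MixedData.restr 0 ((X.diag Y.toCocyclicData).mixed.famD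
        (star X Y (0 + 3) k (MixedData.fam z))) = 0 := by
      funext ⟨⟨m, l⟩, h⟩
      obtain ⟨rfl, rfl⟩ : m = 0 ∧ l = 0 := by omega
      change (X.diag Y.toCocyclicData).mixed.famD (star X Y (0 + 3) k (MixedData.fam z)) 0 = 0
      rw [MixedData.famD_zero, star_eq_zero_of_lt hk _ z (by omega), map_zero]
    rw [this]
    exact zero_mem _
  · rw [← MixedData.d_restr n _ (star_eq_zero_of_lt hk _ z (by omega))]
    exact ⟨_, rfl⟩

/-- The cup product does not depend on the choice of the cyclic Alexander-Whitney map. -/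
lemma cup_eq {Z : CocyclicData.{w'}} (Ψ : (X.diag Y.toCocyclicData).Hom Z) (h : P + Q = n) :
    cup F Ψ h = cup F' Ψ h := by
  refine LinearMap.ext fun x => LinearMap.ext fun y => ?_
  induction x using Submodule.Quotient.induction_on with
  | H x =>
    induction y using Submodule.Quotient.induction_on with
    | H y =>
      refine congrArg (Ψ.hc n) ((Submodule.Quotient.eq _).2 ?_)
      exact F.uMap_sub_mem_bdry F' h x.2 y.2

end CyclicAW

/-! ### Natural operations in one variable on sequences -/

namespace MixedData
variable {T : MixedData.{w}}

lemma famD_single_zero (x : T.obj 0) : T.famD (Pi.single 0 x) = Pi.single 1 (T.b 0 x) := by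
  funext r
  match r with
  | 0 => rw [famD_zero, Pi.single_eq_of_ne (by omega), Pi.single_eq_of_ne (by omega), map_zero]
  | 1 => rw [famD_succ, Pi.single_eq_same, Pi.single_eq_same, Pi.single_eq_of_ne (by omega),
      map_zero, add_zero]
  | r + 2 => rw [famD_succ, Pi.single_eq_of_ne (by omega), Pi.single_eq_of_ne (by omega),
      Pi.single_eq_of_ne (by omega), map_zero, map_zero, add_zero]

lemma famD_single_succ {n : ℕ} (x : T.obj (n + 1)) : T.famD (Pi.single (n + 1) x) =
    Pi.single n (T.B n x) + Pi.single (n + 2) (T.b (n + 1) x) := by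
  funext r
  have h0 : T.famD (Pi.single (n + 1) x) r =
      (match r with | 0 => 0 | r + 1 => T.b r ((Pi.single (n + 1) x : ∀ r, T.obj r) r)) +
        T.B r ((Pi.single (n + 1) x : ∀ r, T.obj r) (r + 1)) := by
    rcases r with _ | r
    · exact (zero_add _).symm
    · rfl
  rw [h0, Pi.add_apply, add_comm]
  congr 1
  · by_cases h : r = n
    · subst h
      rw [Pi.single_eq_same, Pi.single_eq_same]
    · rw [Pi.single_eq_of_ne (by omega), Pi.single_eq_of_ne h, map_zero]
  · rcases r with _ | r
    · rw [Pi.single_eq_of_ne (by omega)]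
    · by_cases h : r = n + 1
      · subst h
        simp only [Pi.single_eq_same]
      · rw [Pi.single_eq_of_ne (show r + 1 ≠ n + 2 by omega)]
        simp only [Pi.single_eq_of_ne h, map_zero]

lemma perturbRhs_one {c : T.Homotopy} {A : ∀ n, T.obj n →ₗ[ℂ] T.obj n} {ε : ℂ} {g : ∀ n, T.obj n}
    (hg : g 1 = 0) (hk : perturb c A ε g 1 = 0) : perturbRhs c A ε g 1 = 0 := by
  have k0 : perturb c A ε g 0 = 0 := rfl
  rw [perturbRhs, k0, hk, hg, map_zero, map_zero, sub_zero, sub_zero, smul_zero]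

end MixedData

namespace NatOp
variable {p q r n : ℕ}

/-- Composition of operations with `b + B`. -/
def postD₁ (n : ℕ) : (MixedData.pi opData.{w}).obj n →ₗ[ℂ] (MixedData.pi opData.{w}).obj n :=
  (free n).mixed.famD

lemma postD₁_precomp {m : ℕ} (l : NatOp.{w} m n) (x : ∀ r, NatOp.{w} n r) (r : ℕ) :
    postD₁ m (fun r => precomp l r (x r)) r = precomp l r (postD₁ n x r) :=
  (evHom (free m) l).app_famD x r

lemma postD₁_B (x : (MixedData.pi opData.{w}).obj (n + 1)) :
    postD₁ n ((MixedData.pi opData).B n x) = (MixedData.pi opData).B n (postD₁ (n + 1) x) :=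
  funext fun r => postD₁_precomp ((free n).mixed.b n (gen n)) x r

lemma postD₁_b (x : (MixedData.pi opData.{w}).obj n) :
    postD₁ (n + 1) ((MixedData.pi opData).b n x) = (MixedData.pi opData).b n (postD₁ n x) :=
  funext fun r => postD₁_precomp ((free (n + 1)).mixed.B n (gen (n + 1))) x r

lemma postD₁_postD₁ (x : (MixedData.pi opData.{w}).obj n) : postD₁ n (postD₁ n x) = 0 :=
  MixedData.famD_famD (free n).laws.isMixed x

lemma postD₁_isLocal : MixedData.IsLocal (postD₁.{w}) := by
  intro n x r h1 h2
  rcases r with _ | r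
  · change (free n).mixed.B 0 (x 1) = 0
    rw [h1]
    exact map_zero _
  · change (free n).mixed.b r (x r) + (free n).mixed.B (r + 1) (x (r + 2)) = 0
    rw [h1, h2 r rfl]
    refine (congrArg₂ (· + ·) (map_zero _) (map_zero _)).trans (add_zero _)

lemma ev_postD₁ (X : CocyclicModule.{w}) (x : ∀ r, NatOp.{w} n r) (y : X.obj n) (r : ℕ) :
    ev X (postD₁ n x r) y = X.mixed.famD (fun r => ev X (x r) y) r :=
  ((evHom X y).app_famD x r).symm

/-- The identity, as a sequence of operations. -/
def idOp (n : ℕ) : (MixedData.pi opData.{w}).obj n :=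
  Pi.single (M := fun r => NatOp.{w} n r) n (gen n)

lemma ev_idOp (X : CocyclicModule.{w}) (y : X.obj n) (r : ℕ) :
    ev X (idOp n r : NatOp n r) y = (Pi.single n y : ∀ r, X.obj r) r := by
  by_cases h : r = n
  · subst h
    rw [idOp, Pi.single_eq_same, Pi.single_eq_same, ev_gen]
  · rw [idOp, Pi.single_eq_of_ne h, Pi.single_eq_of_ne h, map_zero, LinearMap.zero_apply]

lemma postD₁_idOp (n : ℕ) : postD₁ n (idOp.{w} n) = (MixedData.pi opData).famD idOp n := by
  funext r
  refine ext fun X y => ?_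
  rw [ev_postD₁, funext (ev_idOp X y)]
  rcases n with _ | n
  · rw [MixedData.famD_single_zero, MixedData.famD_zero]
    exact ((ev_opData_B X (idOp 1 r) y).trans (ev_idOp X _ r)).symm
  · rw [MixedData.famD_single_succ, MixedData.famD_succ, Pi.add_apply, Pi.add_apply, map_add,
      LinearMap.add_apply]
    exact congrArg₂ (· + ·) ((ev_opData_b X (idOp n r) y).trans (ev_idOp X _ r)).symm
      ((ev_opData_B X (idOp (n + 2) r) y).trans (ev_idOp X _ r)).symm

section Star
variable {Y : CocyclicModule.{w}}

variable (Y) in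
/-- The value of a sequence of operations on the sequence `y`, of which only the terms before `N`
are considered. -/
def star₁ (N : ℕ) (x : ∀ n, (MixedData.pi opData.{w}).obj n) (y : ∀ n, Y.obj n) (r : ℕ) : Y.obj r :=
  ∑ n ∈ Finset.range N, ev Y (x n r) (y n)

lemma star₁_add_left (N : ℕ) (x x' : ∀ n, (MixedData.pi opData.{w}).obj n)
    (y : ∀ n, Y.obj n) (r : ℕ) :
    star₁ Y N (fun n => x n + x' n) y r = star₁ Y N x y r + star₁ Y N x' y r := by
  rw [star₁, star₁, star₁, ← Finset.sum_add_distrib]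
  exact Finset.sum_congr rfl fun n _ => by rw [Pi.add_apply, map_add, LinearMap.add_apply]

lemma star₁_idOp (N : ℕ) (y : ∀ n, Y.obj n) {r : ℕ} (hr : r < N) : star₁ Y N idOp y r = y r := by
  rw [star₁, Finset.sum_eq_single r, ev_idOp, Pi.single_eq_same]
  · intro n _ hn
    rw [ev_idOp, Pi.single_eq_of_ne hn.symm]
  · intro h
    exact absurd (Finset.mem_range.2 hr) h

lemma famD_star₁ (N : ℕ) (x : ∀ n, (MixedData.pi opData.{w}).obj n) (y : ∀ n, Y.obj n) (r : ℕ) :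
    Y.mixed.famD (star₁ Y N x y) r = star₁ Y N (fun n => postD₁ n (x n)) y r := by
  have e : star₁ Y N x y = ∑ n ∈ Finset.range N, fun r => ev Y (x n r) (y n) := by
    funext r
    rw [Finset.sum_apply]
    rfl
  rw [e, map_sum, Finset.sum_apply, star₁]
  exact Finset.sum_congr rfl fun n _ => (ev_postD₁ Y (x n) (y n) r).symm

lemma star₁_famD (N : ℕ) (x : ∀ n, (MixedData.pi opData.{w}).obj n) (y : ∀ n, Y.obj n)
    (hy : ∀ n, N ≤ n → y n = 0) (r : ℕ) :
    star₁ Y (N + 1) x (Y.mixed.famD y) r =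
      star₁ Y (N + 1) ((MixedData.pi opData).famD x) y r := by
  have h1 : star₁ Y (N + 1) x (Y.mixed.famD y) r =
      (∑ n ∈ Finset.range N, ev Y (x (n + 1) r) (Y.mixed.b n (y n))) +
      ∑ n ∈ Finset.range (N + 1), ev Y (x n r) (Y.mixed.B n (y (n + 1))) := by
    rw [star₁, Finset.sum_range_succ', Finset.sum_range_succ' _ N, ← add_assoc,
      ← Finset.sum_add_distrib, MixedData.famD_zero]
    congr 1
    exact Finset.sum_congr rfl fun n _ => map_add _ _ _
  have h2 : star₁ Y (N + 1) ((MixedData.pi opData).famD x) y r =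
      (∑ n ∈ Finset.range N, ev Y ((opData r).b n (x n r) : NatOp (n + 1) r) (y (n + 1))) +
      ∑ n ∈ Finset.range (N + 1), ev Y ((opData r).B n (x (n + 1) r) : NatOp n r) (y n) := by
    rw [star₁, Finset.sum_range_succ', Finset.sum_range_succ' _ N, ← add_assoc,
      ← Finset.sum_add_distrib, MixedData.famD_zero]
    congr 1
    exact Finset.sum_congr rfl fun n _ => (congrArg (fun t => t (y (n + 1))) (map_add (ev Y)
      ((opData r).b n (x n r) : NatOp (n + 1) r) ((opData r).B (n + 1) (x (n + 2) r))))
  rw [h1, h2, Finset.sum_congr rfl fun n _ => ev_opData_b Y (x n r) (y (n + 1)),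
    Finset.sum_congr rfl fun n _ => ev_opData_B Y (x (n + 1) r) (y n), Finset.sum_range_succ,
    Finset.sum_range_succ _ N, hy N le_rfl, hy (N + 1) (by omega)]
  simp only [map_zero, add_zero]
  rw [add_comm]

end Star

/-- The homotopy on sequences of operations. -/
abbrev opHomotopy : (MixedData.pi opData.{w}).Homotopy :=
  MixedData.Homotopy.pi fun r => (opContraction r).toHomotopy

/-- A sequence of operations that commutes with `b + B` and starts with the identity is
null-homotopic to the identity. -/
lemma exists_homotopy_idOp {e : ∀ n, (MixedData.pi opData.{w}).obj n}
    (hs : ∀ n, MixedData.SuppLE 0 (e n)) (ht : ∀ n, e n n = gen n)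
    (he : ∀ n, postD₁ n (e n) = (MixedData.pi opData).famD e n) :
    ∃ k : ∀ n, (MixedData.pi opData.{w}).obj n, (∀ n, MixedData.SuppLE 3 (k n)) ∧
      ∀ n, e n = idOp n + (postD₁ n (k n) + (MixedData.pi opData).famD k n) := by
  obtain ⟨g, hge⟩ : ∃ g : ∀ n, (MixedData.pi opData.{w}).obj n, ∀ n, e n = idOp n + g n :=
    ⟨fun n => e n - idOp n, fun n => (add_sub_cancel (idOp n) (e n)).symm⟩
  have hg : ∀ n, MixedData.SuppLE 2 (g n) := by
    intro n r h
    have h1 := congrFun (hge n) r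
    rw [Pi.add_apply] at h1
    by_cases hr : r = n
    · subst hr
      rw [ht, idOp, Pi.single_eq_same] at h1
      exact left_eq_add.1 h1
    · rw [hs n r, idOp, Pi.single_eq_of_ne hr, zero_add] at h1
      · exact h1.symm
      · rintro (_ | i) hi
        · exact hr (by omega)
        · exact h i (by omega)
  have hk : ∀ n, MixedData.SuppLE 3 (MixedData.perturb opHomotopy.{w} postD₁ 1 g n) :=
    MixedData.SuppLE.perturb postD₁_isLocal hg
  refine ⟨_, hk, fun n => ?_⟩
  rw [hge, MixedData.perturb_spec (c := opHomotopy.{w}) (A := postD₁) (ε := 1) (g := g)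
    (MixedData.IsMixed.pi opData_isMixed) (one_mul 1) (fun n x => postD₁_B x)
    (fun n x => postD₁_b x) (fun n x => postD₁_postD₁ x) ?_ ?_ n |>.symm.trans (by rw [one_smul])]
  · intro n
    have h1 := he n
    have h2 : (MixedData.pi opData).famD e n = (MixedData.pi opData).famD idOp n +
        (MixedData.pi opData).famD g n := by
      rw [funext hge]
      exact congrFun (map_add (MixedData.pi opData).famD idOp g) n
    rw [h2, hge, map_add, postD₁_idOp] at h1
    rw [one_smul]
    exact funext fun r => add_left_cancel (G := NatOp n r) (congrFun h1 r)
  · intro n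
    match n with
    | 0 =>
      have : g 0 = 0 := funext fun r => hg 0 r fun i hi => by omega
      rw [MixedData.perturbRhs, this, smul_zero, map_zero]
    | 1 =>
      have k1 : MixedData.perturb opHomotopy.{w} postD₁ 1 g 1 = 0 :=
        funext fun r => hk 1 r fun i hi => by omega
      have : g 1 = 0 := funext fun r => hg 1 r fun i hi => by omega
      rw [MixedData.perturbRhs_one this k1, map_zero]
    | n + 2 =>
      funext r
      change (opContraction r).P (n + 2) _ = 0
      rw [opContraction_P]
      rfl

end NatOp

/-! ### Products with an invariant cochain of degree zero -/

namespace CocyclicData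

/-- Composition of maps of cocyclic modules. -/
def Hom.comp {X : CocyclicData.{u}} {Y : CocyclicData.{v}} {Z : CocyclicData.{w}} (g : Y.Hom Z)
    (f : X.Hom Y) : X.Hom Z where
  app n := g.app n ∘ₗ f.app n
  app_δ n i h := by
    rw [LinearMap.comp_assoc, f.app_δ n i h, ← LinearMap.comp_assoc, g.app_δ n i h,
      LinearMap.comp_assoc]
  app_σ n j h := by
    rw [LinearMap.comp_assoc, f.app_σ n j h, ← LinearMap.comp_assoc, g.app_σ n j h,
      LinearMap.comp_assoc]
  app_τ n := by
    rw [LinearMap.comp_assoc, f.app_τ n, ← LinearMap.comp_assoc, g.app_τ n, LinearMap.comp_assoc]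

/-- The constant cocyclic module. -/
abbrev _root_.HopfCyclic.constModule : CocyclicModule.{w} where
  toCocyclicData := constData
  laws := by
    constructor <;> intros <;> try rfl
    exact one_pow _

/-- The unit isomorphism `ℂ ⊗ Z = Z`. -/
def constMul (Z : CocyclicData.{w}) : (constData.{w}.diag Z).Hom Z where
  app n := TensorProduct.lid ℂ (Z.obj n) ∘ₗ ULift.moduleEquiv.toLinearMap.rTensor (Z.obj n)
  app_δ n i _ := TensorProduct.ext' fun c z => (map_smul (Z.δ n i) c.down z).symm
  app_σ n i _ := TensorProduct.ext' fun c z => (map_smul (Z.σ n i) c.down z).symm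
  app_τ n := TensorProduct.ext' fun c z => (map_smul (Z.τ n) c.down z).symm

section ConstHom
variable {X : CocyclicData.{w}}

/-- For a cocycle of degree zero, the condition `δ₀ φ = δ₁ φ` makes the coface `δ₀` act like the others. -/
lemma IsCocyclic.δ_vertex (hX : X.IsCocyclic) {φ : X.obj 0} (hφ : X.mixed.b 0 φ = 0) {n i : ℕ}
    (h : i ≤ n + 1) : X.δ n i (X.vertex n φ) = X.vertex (n + 1) φ := by
  rcases i with _ | i
  · clear h
    induction n with
    | zero =>
      rw [mixed_b_apply, Finset.sum_range_succ, Finset.sum_range_one] at hφ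
      have h01 : X.δ 0 0 φ = X.δ 0 1 φ := by simpa [← sub_eq_add_neg, sub_eq_zero] using hφ
      exact h01
    | succ n ih =>
      have := hX.isCosimplicial.δ_δ n 0 (n + 2) (X.vertex n φ) (by omega) (by omega)
      rw [ih] at this
      exact this.symm
  · exact hX.isCosimplicial.δ_vertex (by omega) φ

lemma IsCocyclic.τ_vertex (hX : X.IsCocyclic) {φ : X.obj 0} (hφ : X.mixed.b 0 φ = 0) (n : ℕ) :
    X.τ n (X.vertex n φ) = X.vertex n φ := by
  induction n with
  | zero =>
    have := LinearMap.congr_fun (hX.τ_pow 0) φ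
    rwa [zero_add, pow_one] at this
  | succ n ih =>
    have := LinearMap.congr_fun (hX.τ_δ n (n + 1) (by omega) le_rfl) (X.vertex n φ)
    simp only [LinearMap.comp_apply, Nat.add_sub_cancel] at this
    rw [vertex_succ, this, ih, hX.δ_vertex hφ (by omega), ← vertex_succ]

/-- The map from the constant cocyclic module that is given by a cocycle of degree zero. -/
def constHom (hX : X.IsCocyclic) (φ : X.obj 0) (hφ : X.mixed.b 0 φ = 0) : constData.{w}.Hom X where
  app n := LinearMap.toSpanSingleton ℂ _ (X.vertex n φ) ∘ₗ ULift.moduleEquiv.toLinearMap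
  app_δ n i h := LinearMap.ext fun c => by
    change c.down • X.vertex (n + 1) φ = X.δ n i (c.down • X.vertex n φ)
    rw [map_smul, hX.δ_vertex hφ h]
  app_σ n j h := LinearMap.ext fun c => by
    change c.down • X.vertex n φ = X.σ n j (c.down • X.vertex (n + 1) φ)
    rw [map_smul, hX.isCosimplicial.σ_vertex h]
  app_τ n := LinearMap.ext fun c => by
    change c.down • X.vertex n φ = X.τ n (c.down • X.vertex n φ)
    rw [map_smul, hX.τ_vertex hφ]

/-- The product with a cocycle of degree zero. -/
def mulHom (hX : X.IsCocyclic) (φ : X.obj 0) (hφ : X.mixed.b 0 φ = 0) (Y : CocyclicData.{w'}) :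
    Y.Hom (X.diag Y) where
  app n := TensorProduct.mk ℂ _ _ (X.vertex n φ)
  app_δ n i h := LinearMap.ext fun y =>
    congrArg (· ⊗ₜ[ℂ] Y.δ n i y) (hX.δ_vertex hφ h).symm
  app_σ n j h := LinearMap.ext fun y =>
    congrArg (· ⊗ₜ[ℂ] Y.σ n j y) (hX.isCosimplicial.σ_vertex h φ).symm
  app_τ n := LinearMap.ext fun y => congrArg (· ⊗ₜ[ℂ] Y.τ n y) (hX.τ_vertex hφ n).symm

end ConstHom
end CocyclicData

namespace NatOp
variable {p q r n : ℕ}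

/-- The value of the first factor of an operation in two variables on the constant cochain. -/
def augHom (n : ℕ) : (bi.{w} 0 n).Hom (freeData.{w} n) :=
  (CocyclicData.constMul (freeData n)).comp ((evHom constModule (ULift.up (1 : ℂ))).diag
    (CocyclicData.Hom.refl (freeData n)))

lemma augHom_tmul (a : NatOp.{w} 0 r) (b : NatOp.{w} n r) :
    (augHom n).app r (a ⊗ₜ b) = (ev constModule a (ULift.up (1 : ℂ)) : ULift ℂ).down • b := rfl

lemma augHom_right {q q' : ℕ} (l : NatOp.{w} q q') (t : NatOp.{w} 0 r ⊗[ℂ] NatOp.{w} q' r) :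
    (augHom q).app r ((precomp l r).lTensor _ t) = precomp l r ((augHom q').app r t : NatOp q' r) := by
  induction t with
  | zero => simp only [map_zero]
  | add a b ha hb => simp only [map_add, ha, hb]
  | tmul a b => exact (map_smul (precomp l r) _ b).symm

lemma b_const : constModule.{w}.mixed.b 0 (ULift.up (1 : ℂ)) = 0 := by
  rw [CocyclicData.mixed_b_apply, Finset.sum_range_succ, Finset.sum_range_one]
  exact ULift.ext _ _ (by simp)

lemma augHom_left (t : NatOp.{w} 1 r ⊗[ℂ] NatOp.{w} q r) :
    (augHom q).app r (((opData r).B 0).rTensor _ t) = 0 := by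
  induction t with
  | zero => simp only [map_zero]
  | add a b ha hb => rw [map_add, map_add, ha, hb, add_zero]
  | tmul a b =>
    rw [LinearMap.rTensor_tmul, augHom_tmul, ev_opData_B, b_const, map_zero]
    exact zero_smul ℂ b

/-- The operations in the second variable that an operation in two variables induces on the products
with a cocycle of degree zero. -/
def augOp (f : ∀ n, (MixedData.pi biData.{w}).obj n) (n : ℕ) : (MixedData.pi opData.{w}).obj n :=
  fun r => (augHom n).app r ((opData r).tensorAt (opData r) (f n r) 0 n (Nat.zero_add n))

lemma postD₁_augOp {f : ∀ n, (MixedData.pi biData.{w}).obj n} (hf : IsCyclicAW f) (n : ℕ) :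
    postD₁ n (augOp f n) = (MixedData.pi opData).famD (augOp f) n := by
  funext r
  have h1 : postD₁ n (augOp f n) r = (augHom n).app r ((opData r).tensorAt (opData r)
      (postD n (f n) r) 0 n (Nat.zero_add n)) := (augHom n).app_famD _ r
  rw [h1, hf.chain]
  have hB : ∀ m (z : (biData.{w} r).obj (m + 1)), (augHom m).app r ((opData r).tensorAt (opData r)
      ((biData r).B m z) 0 m (Nat.zero_add m)) = (opData r).B m ((augHom (m + 1)).app r
        ((opData r).tensorAt (opData r) z 0 (m + 1) (Nat.zero_add _))) := by
    intro m z
    rw [MixedData.tensorAt_B, map_add, map_smul, augHom_left, smul_zero, zero_add]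
    exact augHom_right _ _
  have hb : ∀ m (z : (biData.{w} r).obj m), (augHom (m + 1)).app r ((opData r).tensorAt (opData r)
      ((biData r).b m z) 0 (m + 1) (Nat.zero_add _)) = (opData r).b m ((augHom m).app r
        ((opData r).tensorAt (opData r) z 0 m (Nat.zero_add _))) := by
    intro m z
    rw [MixedData.tensorAt_b, MixedData.bLeft_zero, zero_add, MixedData.bRight_succ]
    exact augHom_right _ _
  rcases n with _ | n
  · exact hB 0 (f 1 r)
  · exact (map_add ((augHom (n + 1)).app r) _ _).trans (congrArg₂ (· + ·) (hb n (f n r))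
      (hB (n + 1) (f (n + 2) r)))

lemma augOp_supp {f : ∀ n, (MixedData.pi biData.{w}).obj n} (hf : IsCyclicAW f) (n : ℕ) :
    MixedData.SuppLE 0 (augOp f n) := fun r h => by
  rw [augOp, hf.supp n r h]
  exact map_zero _

lemma zeroFaces_const (q p n : ℕ) (h : p + q = n) (c : ULift.{w} ℂ) :
    constData.{w}.zeroFaces q p n h c = c := by
  induction q generalizing p with
  | zero => subst h; rfl
  | succ q ih => exact ih (p + 1) (by omega)

lemma augOp_top {f : ∀ n, (MixedData.pi biData.{w}).obj n} (hf : IsCyclicAW f) (n : ℕ) :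
    augOp f n n = gen n := by
  have key : ∀ m (h : 0 + n = m), (augHom n).app m ((opData m).tensorAt (opData m) (f m m) 0 n h) =
      ((free n).lastFaces 0 n m h (gen n) : NatOp n m) := by
    rintro _ rfl
    rw [hf.leading 0 n, augHom_tmul, ev_zeroFaces, zeroFaces_const]
    exact one_smul ℂ _
  exact key n (Nat.zero_add n)

section
variable {X Y : CocyclicModule.{w}}

lemma act_vertex (φ : X.obj 0) (hφ : X.mixed.b 0 φ = 0) (t : NatOp.{w} 0 r ⊗[ℂ] NatOp.{w} n r)
    (y : Y.obj n) : act X Y 0 n r t (φ ⊗ₜ y) =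
      X.vertex r φ ⊗ₜ ev Y ((augHom n).app r t : NatOp n r) y := by
  have hv : ∀ a : NatOp.{w} 0 r, ev X a φ =
      (ev constModule a (ULift.up (1 : ℂ)) : ULift ℂ).down • X.vertex r φ := by
    intro a
    have h1 := ev_hom (X := constModule) (CocyclicData.constHom X.laws φ hφ) a (ULift.up (1 : ℂ))
    have h2 : (CocyclicData.constHom X.laws φ hφ).app 0 (ULift.up (1 : ℂ)) = φ := one_smul ℂ φ
    rw [h2] at h1
    exact h1.symm
  induction t with
  | zero => simp only [map_zero, LinearMap.zero_apply, TensorProduct.tmul_zero]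
  | add a b ha hb => simp only [map_add, LinearMap.add_apply, ha, hb, TensorProduct.tmul_add]
  | tmul a b =>
    rw [act_tmul_tmul, hv, augHom_tmul, map_smul, LinearMap.smul_apply, TensorProduct.tmul_smul,
      TensorProduct.smul_tmul']

end
end NatOp

namespace CyclicAW
open NatOp
variable (F : CyclicAW.{w}) {X Y : CocyclicModule.{w}} {n : ℕ}

/-- The exterior product with a cocycle of degree zero, followed by a cyclic Alexander-Whitney map,
is cohomologous to the product with that cocycle. -/
lemma uMap_ofZero_sub_mem_bdry (φ : X.obj 0) (hφ : X.mixed.b 0 φ = 0) (x : X.mixed.TC 0)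
    (hx : MixedData.fam x 0 = φ) (y : Y.mixed.TC n) (hy : Y.mixed.d n y = 0) :
    X.uMap Y.toCocyclicData (F.comp X Y) n (MixedData.prodTC x y) -
      (CocyclicData.mulHom X.laws φ hφ Y.toCocyclicData).tc n y ∈
        (X.diag Y.toCocyclicData).mixed.bdry n := by
  let L := CocyclicData.mulHom X.laws φ hφ Y.toCocyclicData
  obtain ⟨k, hk, he⟩ := exists_homotopy_idOp (augOp_supp F.isCyclicAW) (augOp_top F.isCyclicAW)
    (postD₁_augOp F.isCyclicAW)
  have e1 : ∀ r, star X Y (n + 3) F.ops (MixedData.fam (MixedData.prodTC (n := n) x y)) r =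
      L.app r (star₁ Y (n + 3) (augOp F.ops) (MixedData.fam y) r) := by
    intro r
    rw [NatOp.star, star₁, map_sum]
    refine Finset.sum_congr rfl fun m _ => ?_
    rw [pair, sumAnti_single _ 0 m (Nat.zero_add m), MixedData.tensorAt_fam_prodTC (Nat.zero_add n),
      hx, act_vertex φ hφ]
    · rfl
    · intro p' q' h' hp
      rw [MixedData.tensorAt_fam_prodTC (Nat.zero_add n), MixedData.fam_of_ne x fun i => by omega,
        TensorProduct.zero_tmul, map_zero]
  have e2 : ∀ r, r ≤ n → star₁ Y (n + 3) (augOp F.ops) (MixedData.fam y) r = MixedData.fam y r +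
      Y.mixed.famD (star₁ Y (n + 3) k (MixedData.fam y)) r := by
    intro r hr
    have h0 : star₁ Y (n + 2 + 1) k (Y.mixed.famD (MixedData.fam y)) r = 0 := by
      rw [← MixedData.fam_d, hy, MixedData.fam_zero]
      exact Finset.sum_eq_zero fun m _ => map_zero _
    rw [star₁_famD (n + 2) k _ fun m hm => fam_eq_zero y (by omega)] at h0
    rw [funext he, star₁_add_left, star₁_add_left, star₁_idOp _ _ (by omega), h0, add_zero,
      famD_star₁]
  have hs : ∀ r, n < r + 3 → star₁ Y (n + 3) k (MixedData.fam y) r = 0 := by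
    intro r hr
    refine Finset.sum_eq_zero fun m hm => ?_
    rcases Nat.lt_or_ge n m with h' | h'
    · rw [fam_eq_zero y h', map_zero]
    · rw [hk m _ fun i hi => by omega]
      exact LinearMap.congr_fun (map_zero (ev Y)) _
  have e3 : X.uMap Y.toCocyclicData (F.comp X Y) n (MixedData.prodTC x y) - L.tc n y =
      L.tc n (MixedData.restr n (Y.mixed.famD (star₁ Y (n + 3) k (MixedData.fam y)))) := by
    rw [F.uMap_eq (show n < n + 3 by omega)]
    funext ⟨⟨r, i⟩, h⟩
    change star X Y (n + 3) F.ops (MixedData.fam (MixedData.prodTC (n := n) x y)) r -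
      L.app r (y ⟨(r, i), h⟩) = L.app r _
    rw [e1, ← map_sub, e2 r (by dsimp only at h; omega), MixedData.fam_of_eq y h,
      add_sub_cancel_left]
    rfl
  rw [e3]
  rcases n with _ | n
  · have : MixedData.restr 0 (Y.mixed.famD (star₁ Y (0 + 3) k (MixedData.fam y))) = 0 := by
      funext ⟨⟨m, l⟩, h⟩
      obtain ⟨rfl, rfl⟩ : m = 0 ∧ l = 0 := by omega
      change Y.mixed.famD (star₁ Y (0 + 3) k (MixedData.fam y)) 0 = 0
      rw [MixedData.famD_zero, hs _ (by omega), map_zero]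
    rw [this, map_zero]
    exact zero_mem _
  · rw [← MixedData.d_restr n _ (hs _ (by omega)), ← L.tc_d]
    exact ⟨_, rfl⟩

/-- The cup product with the class of a cocycle of degree zero. -/
lemma cup_ofZero {Z : CocyclicData.{w'}} (Ψ : (X.diag Y.toCocyclicData).Hom Z) (φ : X.obj 0)
    (hφ : X.mixed.b 0 φ = 0) (y : Y.HC n) :
    cup F Ψ (Nat.zero_add n) (MixedData.HC.ofZero φ hφ) y =
      Ψ.hc n ((CocyclicData.mulHom X.laws φ hφ Y.toCocyclicData).hc n y) := by
  induction y using Submodule.Quotient.induction_on with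
  | H y =>
    refine congrArg (Ψ.hc n) ((Submodule.Quotient.eq _).2 ?_)
    exact F.uMap_ofZero_sub_mem_bdry φ hφ _ rfl y.1 y.2

end CyclicAW

/-! ### Simplicial identities on tensor powers -/

section Alg
variable {A : Type u} [Ring A] [Algebra ℂ A]

lemma mulAt_snoc {n i : ℕ} (h : i ≤ n) (x : TP A (n + 2)) (a : A) :
    mulAt (n + 1) i (snoc x a) = snoc (mulAt n i x) a := by
  induction i generalizing n with
  | zero =>
    induction x using TP.cons_cons_induction with
    | hadd x y hx hy => simp only [map_add, add_snoc, hx, hy]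
    | h b c y => rw [snoc_cons, snoc_cons, mulAt_zero_cons, mulAt_zero_cons, snoc_cons]
  | succ i ih =>
    obtain ⟨n, rfl⟩ : ∃ k, n = k + 1 := ⟨n - 1, by omega⟩
    induction x using TP.cons_induction with
    | hadd x y hx hy => simp only [map_add, add_snoc, hx, hy]
    | h b y => rw [snoc_cons, mulAt_succ_cons, mulAt_succ_cons, ih (by omega), snoc_cons]

lemma oneAt_snoc {n i : ℕ} (h : i ≤ n) (x : TP A n) (a : A) :
    oneAt (n + 1) i (snoc x a) = snoc (oneAt n i x) a := by
  induction i generalizing n with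
  | zero => rw [oneAt_zero, oneAt_zero, snoc_cons]
  | succ i ih =>
    obtain ⟨n, rfl⟩ : ∃ k, n = k + 1 := ⟨n - 1, by omega⟩
    induction x using TP.cons_induction with
    | hadd x y hx hy => simp only [map_add, add_snoc, hx, hy]
    | h b y => rw [snoc_cons, oneAt_succ_cons, oneAt_succ_cons, ih (by omega), snoc_cons]

lemma oneAt_self (n : ℕ) (x : TP A n) : oneAt n n x = snoc x 1 := by
  induction n with
  | zero => rw [oneAt_zero, snoc_nil]
  | succ n ih =>
    induction x using TP.cons_induction with
    | hadd x y hx hy => simp only [map_add, add_snoc, hx, hy]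
    | h b y => rw [oneAt_succ_cons, ih, snoc_cons]

lemma mulAt_mulAt {n i k : ℕ} (h : i ≤ k) (hk : k ≤ n) (x : TP A (n + 3)) :
    mulAt n i (mulAt (n + 1) (k + 1) x) = mulAt n k (mulAt (n + 1) i x) := by
  induction i generalizing n k with
  | zero =>
    induction x using TP.cons_cons_induction with
    | hadd x y hx hy => simp only [map_add, hx, hy]
    | h a b y =>
      rw [mulAt_succ_cons, mulAt_zero_cons]
      cases k with
      | zero =>
        induction y using TP.cons_induction with
        | hadd x y hx hy => simp only [map_add, cons_add, hx, hy]
        | h c y => rw [mulAt_zero_cons, mulAt_zero_cons, mulAt_zero_cons, mul_assoc]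
      | succ k =>
        obtain ⟨n, rfl⟩ : ∃ k, n = k + 1 := ⟨n - 1, by omega⟩
        rw [mulAt_succ_cons, mulAt_zero_cons, mulAt_succ_cons]
  | succ i ih =>
    obtain ⟨k, rfl⟩ : ∃ l, k = l + 1 := ⟨k - 1, by omega⟩
    obtain ⟨n, rfl⟩ : ∃ l, n = l + 1 := ⟨n - 1, by omega⟩
    induction x using TP.cons_induction with
    | hadd x y hx hy => simp only [map_add, hx, hy]
    | h a y =>
      rw [mulAt_succ_cons, mulAt_succ_cons, mulAt_succ_cons, mulAt_succ_cons,
        ih (by omega) (by omega)]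

lemma oneAt_oneAt {n i k : ℕ} (h : i ≤ k) (hk : k ≤ n) (x : TP A n) :
    oneAt (n + 1) i (oneAt n k x) = oneAt (n + 1) (k + 1) (oneAt n i x) := by
  induction i generalizing n k with
  | zero => rw [oneAt_zero, oneAt_zero, oneAt_succ_cons]
  | succ i ih =>
    obtain ⟨k, rfl⟩ : ∃ l, k = l + 1 := ⟨k - 1, by omega⟩
    obtain ⟨n, rfl⟩ : ∃ l, n = l + 1 := ⟨n - 1, by omega⟩
    induction x using TP.cons_induction with
    | hadd x y hx hy => simp only [map_add, hx, hy]
    | h a y =>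
      rw [oneAt_succ_cons, oneAt_succ_cons, oneAt_succ_cons, oneAt_succ_cons,
        ih (by omega) (by omega)]

lemma mulAt_oneAt_of_lt {n i k : ℕ} (h : i ≤ k) (hk : k ≤ n) (x : TP A (n + 2)) :
    mulAt (n + 1) i (oneAt (n + 2) (k + 2) x) = oneAt (n + 1) (k + 1) (mulAt n i x) := by
  induction i generalizing n k with
  | zero =>
    induction x using TP.cons_cons_induction with
    | hadd x y hx hy => simp only [map_add, hx, hy]
    | h a b y =>
      rw [oneAt_succ_cons, oneAt_succ_cons, mulAt_zero_cons, mulAt_zero_cons, oneAt_succ_cons]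
  | succ i ih =>
    obtain ⟨k, rfl⟩ : ∃ l, k = l + 1 := ⟨k - 1, by omega⟩
    obtain ⟨n, rfl⟩ : ∃ l, n = l + 1 := ⟨n - 1, by omega⟩
    induction x using TP.cons_induction with
    | hadd x y hx hy => simp only [map_add, hx, hy]
    | h a y =>
      rw [oneAt_succ_cons, mulAt_succ_cons, mulAt_succ_cons, oneAt_succ_cons,
        ih (by omega) (by omega)]

lemma mulAt_oneAt_of_gt {n i k : ℕ} (h : k ≤ i) (hi : i ≤ n) (x : TP A (n + 2)) :
    mulAt (n + 1) (i + 1) (oneAt (n + 2) k x) = oneAt (n + 1) k (mulAt n i x) := by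
  induction k generalizing n i with
  | zero => rw [oneAt_zero, oneAt_zero, mulAt_succ_cons]
  | succ k ih =>
    obtain ⟨i, rfl⟩ : ∃ l, i = l + 1 := ⟨i - 1, by omega⟩
    obtain ⟨n, rfl⟩ : ∃ l, n = l + 1 := ⟨n - 1, by omega⟩
    induction x using TP.cons_induction with
    | hadd x y hx hy => simp only [map_add, hx, hy]
    | h a y =>
      rw [oneAt_succ_cons, mulAt_succ_cons, mulAt_succ_cons, oneAt_succ_cons,
        ih (by omega) (by omega)]

lemma mulAt_oneAt_succ {n i : ℕ} (h : i ≤ n) (x : TP A (n + 1)) :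
    mulAt n i (oneAt (n + 1) (i + 1) x) = x := by
  induction i generalizing n with
  | zero =>
    induction x using TP.cons_induction with
    | hadd x y hx hy => simp only [map_add, hx, hy]
    | h a y => rw [oneAt_succ_cons, oneAt_zero, mulAt_zero_cons, mul_one]
  | succ i ih =>
    obtain ⟨n, rfl⟩ : ∃ l, n = l + 1 := ⟨n - 1, by omega⟩
    induction x using TP.cons_induction with
    | hadd x y hx hy => simp only [map_add, hx, hy]
    | h a y => rw [oneAt_succ_cons, mulAt_succ_cons, ih (by omega)]

lemma mulAt_oneAt_self {n i : ℕ} (h : i ≤ n) (x : TP A (n + 1)) :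
    mulAt n i (oneAt (n + 1) i x) = x := by
  induction i generalizing n with
  | zero =>
    induction x using TP.cons_induction with
    | hadd x y hx hy => simp only [map_add, hx, hy]
    | h a y => rw [oneAt_zero, mulAt_zero_cons, one_mul]
  | succ i ih =>
    obtain ⟨n, rfl⟩ : ∃ l, n = l + 1 := ⟨n - 1, by omega⟩
    induction x using TP.cons_induction with
    | hadd x y hx hy => simp only [map_add, hx, hy]
    | h a y => rw [oneAt_succ_cons, mulAt_succ_cons, ih (by omega)]

end Alg

section Coalg
variable {C : Type u} [AddCommGroup C] [Module ℂ C]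

lemma snoc_cons₂ {n : ℕ} (x : TP C n) (t : C ⊗[ℂ] C) (c : C) :
    snoc (cons₂ x t) c = cons₂ (snoc x c) t := by
  induction t with
  | zero => simp [snoc]
  | add s t hs ht => simp only [map_add, add_snoc, hs, ht]
  | tmul a b => rw [cons₂_tmul, cons₂_tmul, snoc_cons, snoc_cons]

variable [Coalgebra ℂ C]

lemma comulAt_succ_succ_cons₂ {n i : ℕ} (x : TP C (n + 1)) (t : C ⊗[ℂ] C) :
    comulAt (n + 2) (i + 2) (cons₂ x t) = cons₂ (comulAt n i x) t := by
  induction t with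
  | zero => simp
  | add s t hs ht => simp only [map_add, hs, ht]
  | tmul a b => rw [cons₂_tmul, cons₂_tmul, comulAt_succ_cons, comulAt_succ_cons]

lemma counitAt_succ_succ_cons₂ {n i : ℕ} (x : TP C (n + 1)) (t : C ⊗[ℂ] C) :
    counitAt (n + 2) (i + 2) (cons₂ x t) = cons₂ (counitAt n i x) t := by
  induction t with
  | zero => simp
  | add s t hs ht => simp only [map_add, hs, ht]
  | tmul a b => rw [cons₂_tmul, cons₂_tmul, counitAt_succ_cons, counitAt_succ_cons]

lemma comulAt_snoc {n i : ℕ} (h : i ≤ n) (x : TP C (n + 1)) (c : C) :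
    comulAt (n + 1) i (snoc x c) = snoc (comulAt n i x) c := by
  induction i generalizing n with
  | zero =>
    induction x using TP.cons_induction with
    | hadd x y hx hy => simp only [map_add, add_snoc, hx, hy]
    | h b y => rw [snoc_cons, comulAt_zero_cons, comulAt_zero_cons, snoc_cons₂]
  | succ i ih =>
    obtain ⟨n, rfl⟩ : ∃ k, n = k + 1 := ⟨n - 1, by omega⟩
    induction x using TP.cons_induction with
    | hadd x y hx hy => simp only [map_add, add_snoc, hx, hy]
    | h b y => rw [snoc_cons, comulAt_succ_cons, comulAt_succ_cons, ih (by omega), snoc_cons]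

lemma counitAt_snoc {n i : ℕ} (h : i ≤ n) (x : TP C (n + 1)) (c : C) :
    counitAt (n + 1) i (snoc x c) = snoc (counitAt n i x) c := by
  induction i generalizing n with
  | zero =>
    induction x using TP.cons_induction with
    | hadd x y hx hy => simp only [map_add, add_snoc, hx, hy]
    | h b y => rw [snoc_cons, counitAt_zero_cons, counitAt_zero_cons, smul_snoc]
  | succ i ih =>
    obtain ⟨n, rfl⟩ : ∃ k, n = k + 1 := ⟨n - 1, by omega⟩
    induction x using TP.cons_induction with
    | hadd x y hx hy => simp only [map_add, add_snoc, hx, hy]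
    | h b y => rw [snoc_cons, counitAt_succ_cons, counitAt_succ_cons, ih (by omega), snoc_cons]

lemma counitAt_snoc_self (n : ℕ) (x : TP C n) (c : C) :
    counitAt n n (snoc x c) = counit (R := ℂ) c • x := by
  induction n with
  | zero => rw [snoc_nil, counitAt_zero_cons]
  | succ n ih =>
    induction x using TP.cons_induction with
    | hadd x y hx hy => simp only [map_add, add_snoc, hx, hy, smul_add]
    | h b y => rw [snoc_cons, counitAt_succ_cons, ih, cons_smul]

lemma comulAt_comulAt {n i k : ℕ} (h : i ≤ k) (hk : k ≤ n) (x : TP C (n + 1)) :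
    comulAt (n + 1) (k + 1) (comulAt n i x) = comulAt (n + 1) i (comulAt n k x) := by
  induction i generalizing n k with
  | zero =>
    induction x using TP.cons_induction with
    | hadd x y hx hy => simp only [map_add, hx, hy]
    | h c y =>
      rw [comulAt_zero_cons]
      cases k with
      | zero =>
        let Φ : C ⊗[ℂ] (C ⊗[ℂ] C) →ₗ[ℂ] TP C (n + 3) :=
          (consE C (n + 2)).toLinearMap ∘ₗ (cons₂ y).lTensor C
        have e1 : ∀ t : C ⊗[ℂ] C, comulAt (n + 1) 1 (cons₂ y t) = Φ (comul.lTensor C t) := by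
          intro t
          induction t with
          | zero => simp
          | add s t hs ht => simp only [map_add, hs, ht]
          | tmul a b => rw [cons₂_tmul, comulAt_succ_cons, comulAt_zero_cons]; rfl
        have e2 : ∀ t : C ⊗[ℂ] C, comulAt (n + 1) 0 (cons₂ y t) =
            Φ (TensorProduct.assoc ℂ C C C (comul.rTensor C t)) := by
          intro t
          induction t with
          | zero => simp
          | add s t hs ht => simp only [map_add, hs, ht]
          | tmul a b =>
            rw [cons₂_tmul, comulAt_zero_cons, LinearMap.rTensor_tmul]
            generalize comul (R := ℂ) a = s
            induction s with
            | zero => simp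
            | add s t hs ht => simp only [map_add, TensorProduct.add_tmul, hs, ht]
            | tmul a a' =>
              rw [cons₂_tmul, TensorProduct.assoc_tmul]
              simp only [Φ, LinearMap.comp_apply, LinearMap.lTensor_tmul, cons₂_tmul]
              rfl
        rw [comulAt_zero_cons, e1, e2, Coalgebra.coassoc_apply]
      | succ k =>
        obtain ⟨n, rfl⟩ : ∃ k, n = k + 1 := ⟨n - 1, by omega⟩
        rw [comulAt_succ_succ_cons₂, comulAt_succ_cons, comulAt_zero_cons]
  | succ i ih =>
    obtain ⟨k, rfl⟩ : ∃ l, k = l + 1 := ⟨k - 1, by omega⟩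
    obtain ⟨n, rfl⟩ : ∃ l, n = l + 1 := ⟨n - 1, by omega⟩
    induction x using TP.cons_induction with
    | hadd x y hx hy => simp only [map_add, hx, hy]
    | h a y =>
      rw [comulAt_succ_cons, comulAt_succ_cons, comulAt_succ_cons, comulAt_succ_cons,
        ih (by omega) (by omega)]

lemma counitAt_counitAt {n i k : ℕ} (h : i ≤ k) (hk : k ≤ n) (x : TP C (n + 2)) :
    counitAt n k (counitAt (n + 1) i x) = counitAt n i (counitAt (n + 1) (k + 1) x) := by
  induction i generalizing n k with
  | zero =>
    induction x using TP.cons_induction with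
    | hadd x y hx hy => simp only [map_add, hx, hy]
    | h c y =>
      rw [counitAt_zero_cons, counitAt_succ_cons, counitAt_zero_cons, map_smul]
  | succ i ih =>
    obtain ⟨k, rfl⟩ : ∃ l, k = l + 1 := ⟨k - 1, by omega⟩
    obtain ⟨n, rfl⟩ : ∃ l, n = l + 1 := ⟨n - 1, by omega⟩
    induction x using TP.cons_induction with
    | hadd x y hx hy => simp only [map_add, hx, hy]
    | h a y =>
      rw [counitAt_succ_cons, counitAt_succ_cons, counitAt_succ_cons, counitAt_succ_cons,
        ih (by omega) (by omega)]

lemma counitAt_comulAt_of_lt {n i k : ℕ} (h : i ≤ k) (hk : k ≤ n) (x : TP C (n + 2)) :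
    counitAt (n + 2) (k + 2) (comulAt (n + 1) i x) = comulAt n i (counitAt (n + 1) (k + 1) x) := by
  induction i generalizing n k with
  | zero =>
    induction x using TP.cons_induction with
    | hadd x y hx hy => simp only [map_add, hx, hy]
    | h c y =>
      rw [comulAt_zero_cons, counitAt_succ_succ_cons₂, counitAt_succ_cons, comulAt_zero_cons]
  | succ i ih =>
    obtain ⟨k, rfl⟩ : ∃ l, k = l + 1 := ⟨k - 1, by omega⟩
    obtain ⟨n, rfl⟩ : ∃ l, n = l + 1 := ⟨n - 1, by omega⟩
    induction x using TP.cons_induction with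
    | hadd x y hx hy => simp only [map_add, hx, hy]
    | h a y =>
      rw [comulAt_succ_cons, counitAt_succ_cons, counitAt_succ_cons, comulAt_succ_cons,
        ih (by omega) (by omega)]

lemma counitAt_comulAt_of_gt {n i k : ℕ} (h : k ≤ i) (hi : i ≤ n) (x : TP C (n + 2)) :
    counitAt (n + 2) k (comulAt (n + 1) (i + 1) x) = comulAt n i (counitAt (n + 1) k x) := by
  induction k generalizing n i with
  | zero =>
    induction x using TP.cons_induction with
    | hadd x y hx hy => simp only [map_add, hx, hy]
    | h c y => rw [comulAt_succ_cons, counitAt_zero_cons, counitAt_zero_cons, map_smul]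
  | succ k ih =>
    obtain ⟨i, rfl⟩ : ∃ l, i = l + 1 := ⟨i - 1, by omega⟩
    obtain ⟨n, rfl⟩ : ∃ l, n = l + 1 := ⟨n - 1, by omega⟩
    induction x using TP.cons_induction with
    | hadd x y hx hy => simp only [map_add, hx, hy]
    | h a y =>
      rw [comulAt_succ_cons, counitAt_succ_cons, counitAt_succ_cons, comulAt_succ_cons,
        ih (by omega) (by omega)]

lemma counitAt_comulAt_succ {n i : ℕ} (h : i ≤ n) (x : TP C (n + 1)) :
    counitAt (n + 1) (i + 1) (comulAt n i x) = x := by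
  induction i generalizing n with
  | zero =>
    induction x using TP.cons_induction with
    | hadd x y hx hy => simp only [map_add, hx, hy]
    | h a y =>
      rw [comulAt_zero_cons]
      have e : ∀ t : C ⊗[ℂ] C, counitAt (n + 1) 1 (cons₂ y t) =
          consL y (TensorProduct.rid ℂ C ((counit (R := ℂ)).lTensor C t)) := by
        intro t
        induction t with
        | zero => simp
        | add s t hs ht => simp only [map_add, hs, ht]
        | tmul a b =>
          rw [cons₂_tmul, counitAt_succ_cons, counitAt_zero_cons, LinearMap.lTensor_tmul,
            TensorProduct.rid_tmul, map_smul, cons_smul]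
          rfl
      rw [e, Coalgebra.lTensor_counit_comul, TensorProduct.rid_tmul, one_smul]
      rfl
  | succ i ih =>
    obtain ⟨n, rfl⟩ : ∃ l, n = l + 1 := ⟨n - 1, by omega⟩
    induction x using TP.cons_induction with
    | hadd x y hx hy => simp only [map_add, hx, hy]
    | h a y => rw [comulAt_succ_cons, counitAt_succ_cons, ih (by omega)]

lemma counitAt_comulAt_self {n i : ℕ} (h : i ≤ n) (x : TP C (n + 1)) :
    counitAt (n + 1) i (comulAt n i x) = x := by
  induction i generalizing n with
  | zero =>
    induction x using TP.cons_induction with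
    | hadd x y hx hy => simp only [map_add, hx, hy]
    | h a y =>
      rw [comulAt_zero_cons]
      have e : ∀ t : C ⊗[ℂ] C, counitAt (n + 1) 0 (cons₂ y t) =
          consL y (TensorProduct.lid ℂ C ((counit (R := ℂ)).rTensor C t)) := by
        intro t
        induction t with
        | zero => simp
        | add s t hs ht => simp only [map_add, hs, ht]
        | tmul a b =>
          rw [cons₂_tmul, counitAt_zero_cons, LinearMap.rTensor_tmul, TensorProduct.lid_tmul,
            map_smul]
          rfl
      rw [e, Coalgebra.rTensor_counit_comul, TensorProduct.lid_tmul, one_smul]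
      rfl
  | succ i ih =>
    obtain ⟨n, rfl⟩ : ∃ l, n = l + 1 := ⟨n - 1, by omega⟩
    induction x using TP.cons_induction with
    | hadd x y hx hy => simp only [map_add, hx, hy]
    | h a y => rw [comulAt_succ_cons, counitAt_succ_cons, ih (by omega)]

end Coalg

/-! ### Iterated rotations -/

section Rot
variable {V : Type u} [AddCommGroup V] [Module ℂ V]

/-- `v₀ ⊗ v₁ ⊗ ⋯ ⊗ vₙ ↦ v₁ ⊗ ⋯ ⊗ vₙ ⊗ v₀`. -/
def rot (n : ℕ) : TP V (n + 1) →ₗ[ℂ] TP V (n + 1) :=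
  (snocE V n).toLinearMap ∘ₗ (TensorProduct.comm ℂ V (TP V n)).toLinearMap ∘ₗ
    (consE V n).symm.toLinearMap

lemma rot_cons {n : ℕ} (v : V) (x : TP V n) : rot n (cons v x) = snoc x v := by
  simp [rot, cons, snoc]

lemma rot_pow_tprod (n k : ℕ) (x : Fin (n + 1) → V) :
    (rot n ^ k) (PiTensorProduct.tprod ℂ x) =
      PiTensorProduct.tprod ℂ fun i => x (i + Fin.ofNat (n + 1) k) := by
  have h1 : ∀ x : Fin (n + 1) → V, rot n (PiTensorProduct.tprod ℂ x) =
      PiTensorProduct.tprod ℂ fun i => x (i + 1) := by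
    intro x
    rw [← Fin.cons_self_tail x, ← cons_tprod, rot_cons, snoc_tprod]
    congr 1
    funext i
    refine Fin.lastCases ?_ (fun j => ?_) i
    · simp
    · simp
  induction k with
  | zero => simp
  | succ k ih =>
    rw [pow_succ', Module.End.mul_apply, ih, h1]
    congr 1
    funext i
    congr 1
    ext
    simp [Fin.val_add, Nat.add_assoc, Nat.add_comm 1]

lemma rot_pow (n : ℕ) : (rot n : Module.End ℂ (TP V (n + 1))) ^ (n + 1) = 1 := by
  refine PiTensorProduct.ext (MultilinearMap.ext fun x => ?_)
  refine (rot_pow_tprod n (n + 1) x).trans ?_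
  congr 1
  funext i
  congr 1
  ext
  simp

end Rot

section Tail
variable (H : Type u) [Ring H] [HopfAlgebra ℂ H]
variable (V : Type u) [AddCommGroup V] [Module ℂ V] [Module H V] [IsScalarTower ℂ H V]

/-- The diagonal action on the last `k` factors of the `n`-th tensor power, for `k ≤ n`. -/
def tailAct : (n k : ℕ) → H →ₗ[ℂ] Module.End ℂ (TP V n)
  | _, 0 => (Algebra.linearMap ℂ _) ∘ₗ counit (R := ℂ)
  | 0, _ + 1 => 0
  | n + 1, k + 1 => ((snocE V n).conjAlgEquiv ℂ).toLinearMap ∘ₗ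
      TensorProduct.homTensorHomMap (RingHom.id ℂ) _ _ _ _ ∘ₗ
      TensorProduct.map (tailAct n k) (lAct H V).toLinearMap ∘ₗ comul

variable {H V}

/-- `h ⊗ g ↦ (h x) ⊗ (g v)`, with `h` acting on the last `k` factors of `x`. -/
def snocTail {n : ℕ} (k : ℕ) (x : TP V n) (v : V) : H ⊗[ℂ] H →ₗ[ℂ] TP V (n + 1) :=
  (snocE V n).toLinearMap ∘ₗ TensorProduct.map ((tailAct H V n k).flip x)
    ((lAct H V).toLinearMap.flip v)

lemma snocTail_tmul {n : ℕ} (k : ℕ) (x : TP V n) (v : V) (h g : H) :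
    snocTail k x v (h ⊗ₜ g) = snoc (tailAct H V n k h x) (g • v) := rfl

lemma tailAct_zero (n : ℕ) (h : H) (x : TP V n) :
    tailAct H V n 0 h x = counit (R := ℂ) h • x := by
  cases n <;> simp [tailAct, Algebra.algebraMap_eq_smul_one]

lemma tailAct_snoc {n k : ℕ} (h : H) (x : TP V n) (v : V) :
    tailAct H V (n + 1) (k + 1) h (snoc x v) = snocTail k x v (comul h) := by
  simp only [tailAct, LinearMap.comp_apply]
  generalize comul (R := ℂ) h = t
  induction t with
  | zero => simp
  | add s t hs ht => simp only [map_add, LinearMap.add_apply, hs, ht]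
  | tmul a b =>
    rw [snocTail_tmul]
    simp [snoc, LinearEquiv.conjAlgEquiv]

lemma tailAct_cons {n k : ℕ} (hk : k ≤ n) (h : H) (v : V) (x : TP V n) :
    tailAct H V (n + 1) k h (cons v x) = cons v (tailAct H V n k h x) := by
  induction k generalizing n h with
  | zero => rw [tailAct_zero, tailAct_zero, cons_smul]
  | succ k ih =>
    obtain ⟨n, rfl⟩ : ∃ l, n = l + 1 := ⟨n - 1, by omega⟩
    induction x using TP.snoc_induction with
    | hadd x y hx hy => simp only [map_add, cons_add, hx, hy]
    | h x w =>
      rw [← snoc_cons, tailAct_snoc, tailAct_snoc]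
      generalize comul (R := ℂ) h = t
      induction t with
      | zero => simp [cons]
      | add s t hs ht => simp only [map_add, cons_add, hs, ht]
      | tmul a b => rw [snocTail_tmul, snocTail_tmul, ih (by omega), snoc_cons]

lemma tailAct_self (n : ℕ) (h : H) : tailAct H V n n h = diagAct H V n h := by
  induction n generalizing h with
  | zero => exact LinearMap.ext fun x => by rw [tailAct_zero, diagAct_zero]
  | succ n ih =>
    refine LinearMap.ext fun x => ?_
    induction x using TP.snoc_induction with
    | hadd x y hx hy => simp only [map_add, hx, hy]
    | h x v =>
      rw [tailAct_snoc, diagAct_snoc]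
      generalize comul (R := ℂ) h = t
      induction t with
      | zero => simp
      | add s t hs ht => simp only [map_add, hs, ht]
      | tmul a b => rw [snocTail_tmul, snocAct_tmul, ih]

end Tail

section Cyc
variable {H : Type u} [Ring H] [HopfAlgebra ℂ H]
variable {M : Type v} [AddCommGroup M] [Module ℂ M]
variable {V : Type u} [AddCommGroup V] [Module ℂ V] [Module H V] [IsScalarTower ℂ H V]

/-- `h ⊗ m ↦ m ⊗ h x`, with `h` acting on the last `k` factors of `x`. -/
def coactTail (M : Type v) [AddCommGroup M] [Module ℂ M] {n : ℕ} (k : ℕ) (x : TP V n) :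
    H ⊗[ℂ] M →ₗ[ℂ] M ⊗[ℂ] TP V n :=
  (TensorProduct.comm ℂ _ M).toLinearMap ∘ₗ ((tailAct H V n k).flip x).rTensor M

lemma coactTail_tmul {n : ℕ} (k : ℕ) (x : TP V n) (h : H) (m : M) :
    coactTail M k x (h ⊗ₜ m) = m ⊗ₜ tailAct H V n k h x := rfl

variable [Module Hᵐᵒᵖ M] [IsScalarTower ℂ Hᵐᵒᵖ M] [SAYD H M]

/-- The rotation lets the coaction act on one more factor of the tensor power. -/
lemma cyc_coactTail {n k : ℕ} (hk : k ≤ n) (m : M) (x : TP V (n + 1)) :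
    cyc H M V n (coactTail M k x (SAYD.coact (H := H) m)) =
      coactTail M (k + 1) (rot n x) (SAYD.coact (H := H) m) := by
  induction x using TP.cons_induction with
  | hadd x y hx hy =>
    have e : ∀ (k : ℕ) (x y : TP V (n + 1)) (t : H ⊗[ℂ] M),
        coactTail M k (x + y) t = coactTail M k x t + coactTail M k y t := by
      intro k x y t
      induction t with
      | zero => simp
      | add s t hs ht => simp only [map_add, hs, ht]; abel
      | tmul a b => rw [coactTail_tmul, coactTail_tmul, coactTail_tmul, map_add,
          TensorProduct.tmul_add]
    rw [map_add, e, e, map_add, hx, hy]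
  | h v y =>
    let Φ : H ⊗[ℂ] (H ⊗[ℂ] M) →ₗ[ℂ] M ⊗[ℂ] TP V (n + 1) :=
      (TensorProduct.comm ℂ _ M).toLinearMap ∘ₗ (snocTail k y v).rTensor M ∘ₗ
        (TensorProduct.assoc ℂ H H M).symm.toLinearMap
    have e1 : ∀ t : H ⊗[ℂ] M, cyc H M V n (coactTail M k (cons v y) t) =
        Φ (SAYD.coact.lTensor H t) := by
      intro t
      induction t with
      | zero => simp
      | add s t hs ht => simp only [map_add, hs, ht]
      | tmul h m =>
        rw [coactTail_tmul, tailAct_cons hk, rotL_cons, twist_tmul, LinearMap.lTensor_tmul]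
        generalize SAYD.coact (H := H) m = t
        induction t with
        | zero => simp
        | add s t hs ht => simp only [map_add, TensorProduct.tmul_add, hs, ht]
        | tmul g m => rfl
    have e2 : ∀ t : H ⊗[ℂ] M, coactTail M (k + 1) (rot n (cons v y)) t =
        Φ (TensorProduct.assoc ℂ H H M (comul.rTensor M t)) := by
      intro t
      induction t with
      | zero => simp
      | add s t hs ht => simp only [map_add, hs, ht]
      | tmul h m =>
        rw [coactTail_tmul, rot_cons, tailAct_snoc]
        simp only [Φ, LinearMap.comp_apply, LinearEquiv.coe_coe, LinearEquiv.symm_apply_apply]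
        rfl
    rw [e1, e2, SAYD.coassoc]

/-- The powers of the cyclic operator: the factors which have been moved to the end carry the
diagonal action of the coaction of the coefficients. -/
lemma cyc_pow {n k : ℕ} (hk : k ≤ n + 1) (m : M) (x : TP V (n + 1)) :
    (cyc H M V n ^ k) (m ⊗ₜ x) = coactTail M k ((rot n ^ k) x) (SAYD.coact (H := H) m) := by
  induction k with
  | zero =>
    have e : ∀ t : H ⊗[ℂ] M, coactTail M 0 x t =
        (TensorProduct.lid ℂ M (counit.rTensor M t)) ⊗ₜ[ℂ] x := by
      intro t
      induction t with
      | zero => simp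
      | add s t hs ht => simp only [map_add, TensorProduct.add_tmul, hs, ht]
      | tmul h m => simp [coactTail_tmul, tailAct_zero, TensorProduct.smul_tmul']
    rw [pow_zero, pow_zero, Module.End.one_apply, Module.End.one_apply, e, SAYD.counit_coact]
  | succ k ih =>
    rw [pow_succ', pow_succ', Module.End.mul_apply, Module.End.mul_apply, ih (by omega),
      cyc_coactTail (by omega)]

/-- Stability: the `(n + 1)`-st power of the cyclic operator is the identity of the coinvariants. -/
lemma mkQ_cyc_pow (n : ℕ) (z : M ⊗[ℂ] TP V (n + 1)) :
    (relSub H V M (n + 1)).mkQ ((cyc H M V n ^ (n + 1)) z) = (relSub H V M (n + 1)).mkQ z := by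
  induction z with
  | zero => simp
  | add s t hs ht => simp only [map_add, hs, ht]
  | tmul m x =>
    rw [cyc_pow le_rfl, rot_pow, Module.End.one_apply]
    have e : ∀ t : H ⊗[ℂ] M, (relSub H V M (n + 1)).mkQ (coactTail M (n + 1) x t) =
        (relSub H V M (n + 1)).mkQ (TensorProduct.lift (rAct H M) t ⊗ₜ x) := by
      intro t
      induction t with
      | zero => simp
      | add s t hs ht => simp only [map_add, TensorProduct.add_tmul, hs, ht]
      | tmul h m =>
        rw [coactTail_tmul, tailAct_self, ← mkQ_rel, TensorProduct.lift.tmul, rAct_apply]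
    rw [e, SAYD.stable]

lemma twist_counit {f : H →ₗ[ℂ] H} {v : V}
    (hf : ∀ h : H, f h • v = counit (R := ℂ) h • v) (m : M) :
    twist H M V f (m ⊗ₜ v) = m ⊗ₜ v := by
  have e : ∀ t : H ⊗[ℂ] M, twistAux M f v t =
      (TensorProduct.lid ℂ M (counit.rTensor M t)) ⊗ₜ[ℂ] v := by
    intro t
    induction t with
    | zero => simp
    | add s t hs ht => simp only [map_add, TensorProduct.add_tmul, hs, ht]
    | tmul h m =>
      rw [twistAux_tmul, hf, LinearMap.rTensor_tmul, TensorProduct.lid_tmul,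
        TensorProduct.smul_tmul]
  rw [twist_tmul, e, SAYD.counit_coact]

/-- Two twists are inverse to each other if `f(h₍₂₎) g(h₍₁₎) = ε(h)`. -/
lemma twist_twist {f g : H →ₗ[ℂ] H}
    (hfg : ∀ h : H, LinearMap.mul' ℂ H (TensorProduct.comm ℂ H H (TensorProduct.map g f (comul h))) =
      counit (R := ℂ) h • (1 : H)) (t : M ⊗[ℂ] V) :
    twist H M V f (twist H M V g t) = t := by
  induction t with
  | zero => simp
  | add s t hs ht => rw [map_add, map_add, hs, ht]
  | tmul m v =>
    let μ : H ⊗[ℂ] H →ₗ[ℂ] H := LinearMap.mul' ℂ H ∘ₗ (TensorProduct.comm ℂ H H).toLinearMap ∘ₗ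
      TensorProduct.map g f
    let Φ : H ⊗[ℂ] (H ⊗[ℂ] M) →ₗ[ℂ] M ⊗[ℂ] V := twistAux M LinearMap.id v ∘ₗ μ.rTensor M ∘ₗ
      (TensorProduct.assoc ℂ H H M).symm.toLinearMap
    have e1 : ∀ t : H ⊗[ℂ] M, twist H M V f (twistAux M g v t) =
        Φ (SAYD.coact.lTensor H t) := by
      intro t
      induction t with
      | zero => simp
      | add s t hs ht => simp only [map_add, hs, ht]
      | tmul h m =>
        rw [twistAux_tmul, twist_tmul, LinearMap.lTensor_tmul]
        generalize SAYD.coact (H := H) m = t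
        induction t with
        | zero => simp
        | add s t hs ht => simp only [map_add, TensorProduct.tmul_add, hs, ht]
        | tmul a m => simp [Φ, μ, twistAux_tmul, mul_smul]
    have e2 : ∀ t : H ⊗[ℂ] M, Φ (TensorProduct.assoc ℂ H H M (comul.rTensor M t)) =
        twistAux M (Algebra.linearMap ℂ H ∘ₗ counit) v t := by
      intro t
      induction t with
      | zero => simp
      | add s t hs ht => simp only [map_add, hs, ht]
      | tmul h m =>
        simp only [Φ, LinearMap.comp_apply, LinearEquiv.coe_coe, LinearEquiv.symm_apply_apply,
          LinearMap.rTensor_tmul, twistAux_tmul]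
        have : μ (comul h) = counit (R := ℂ) h • (1 : H) := hfg h
        rw [this]
        simp [Algebra.algebraMap_eq_smul_one]
    rw [twist_tmul, e1, ← SAYD.coassoc, e2, ← twist_tmul]
    exact twist_counit (fun h => by simp [Algebra.algebraMap_eq_smul_one]) m

section Inverse
variable [BijectiveAntipode H]

lemma counit_antipodeInv (h : H) : counit (R := ℂ) (antipodeInv H h) = counit (R := ℂ) h := by
  rw [← counit_antipode (R := ℂ) (antipodeInv H h), antipode_antipodeInv]

/-- The two rotations are inverse to each other as `S⁻¹(h₍₂₎) h₍₁₎ = ε(h)`. -/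
lemma cycInv_cyc (n : ℕ) (z : M ⊗[ℂ] TP V (n + 1)) :
    cycInv H M V n (cyc H M V n z) = z := by
  induction z with
  | zero => simp
  | add s t hs ht => rw [map_add, map_add, hs, ht]
  | tmul m x =>
    induction x using TP.cons_induction with
    | hadd x y hx hy => rw [TensorProduct.tmul_add, map_add, map_add, hx, hy]
    | h v x =>
      rw [rotL_cons, rotR_withR, twist_twist, withL_tmul]
      intro h
      apply (BijectiveAntipode.bijective (H := H)).1
      have : ∀ t : H ⊗[ℂ] H, antipode ℂ (LinearMap.mul' ℂ H (TensorProduct.comm ℂ H H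
          (TensorProduct.map LinearMap.id (antipodeInv H) t))) =
            LinearMap.mul' ℂ H ((antipode ℂ).rTensor H t) := by
        intro t
        induction t with
        | zero => simp
        | add s t hs ht => simp only [map_add, hs, ht]
        | tmul a b => simp [antipode_mul_antidistrib, antipode_antipodeInv]
      rw [this, HopfAlgebra.mul_antipode_rTensor_comul_apply, map_smul, antipode_one,
        Algebra.algebraMap_eq_smul_one]

lemma cyc_cycInv (n : ℕ) (z : M ⊗[ℂ] TP V (n + 1)) :
    cyc H M V n (cycInv H M V n z) = z := by
  induction z with
  | zero => simp
  | add s t hs ht => rw [map_add, map_add, hs, ht]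
  | tmul m x =>
    induction x using TP.snoc_induction with
    | hadd x y hx hy => rw [TensorProduct.tmul_add, map_add, map_add, hx, hy]
    | h x v =>
      rw [rotR_snoc, rotL_withL, twist_twist, withR_tmul]
      intro h
      apply (BijectiveAntipode.bijective (H := H)).1
      have : ∀ t : H ⊗[ℂ] H, antipode ℂ (LinearMap.mul' ℂ H (TensorProduct.comm ℂ H H
          (TensorProduct.map (antipodeInv H) LinearMap.id t))) =
            LinearMap.mul' ℂ H ((antipode ℂ).lTensor H t) := by
        intro t
        induction t with
        | zero => simp
        | add s t hs ht => simp only [map_add, hs, ht]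
        | tmul a b => simp [antipode_mul_antidistrib, antipode_antipodeInv]
      rw [this, HopfAlgebra.mul_antipode_lTensor_comul_apply, map_smul, antipode_one,
        Algebra.algebraMap_eq_smul_one]

end Inverse
end Cyc

/-! ### The cocyclic modules of algebras and coalgebras -/

section RotationIdentities
variable {M : Type v} [AddCommGroup M] [Module ℂ M]

section
variable {A : Type u} [Ring A] [Algebra ℂ A] (θ : M ⊗[ℂ] A →ₗ[ℂ] M ⊗[ℂ] A)

lemma mulAt_succ_rotR {n i : ℕ} (h : i + 1 ≤ n) (z : M ⊗[ℂ] TP A (n + 2)) :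
    (mulAt n (i + 1)).lTensor M (rotR θ (n + 1) z) = rotR θ n ((mulAt n i).lTensor M z) := by
  obtain ⟨n, rfl⟩ : ∃ l, n = l + 1 := ⟨n - 1, by omega⟩
  induction z with
  | zero => simp
  | add s t hs ht => simp only [map_add, hs, ht]
  | tmul m x =>
    induction x using TP.snoc_induction with
    | hadd x y hx hy => simp only [map_add, TensorProduct.tmul_add, hx, hy]
    | h x a =>
      rw [rotR_snoc, LinearMap.lTensor_tmul, mulAt_snoc (by omega), rotR_snoc]
      generalize θ (m ⊗ₜ a) = t
      induction t with
      | zero => simp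
      | add s t hs ht => simp only [map_add, hs, ht]
      | tmul m a => rw [withL_tmul, withL_tmul, LinearMap.lTensor_tmul, mulAt_succ_cons]

lemma oneAt_succ_rotR {n i : ℕ} (h : i ≤ n) (z : M ⊗[ℂ] TP A (n + 1)) :
    (oneAt (n + 1) (i + 1)).lTensor M (rotR θ n z) =
      rotR θ (n + 1) ((oneAt (n + 1) i).lTensor M z) := by
  induction z with
  | zero => simp
  | add s t hs ht => simp only [map_add, hs, ht]
  | tmul m x =>
    induction x using TP.snoc_induction with
    | hadd x y hx hy => simp only [map_add, TensorProduct.tmul_add, hx, hy]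
    | h x a =>
      rw [rotR_snoc, LinearMap.lTensor_tmul, oneAt_snoc h, rotR_snoc]
      generalize θ (m ⊗ₜ a) = t
      induction t with
      | zero => simp
      | add s t hs ht => simp only [map_add, hs, ht]
      | tmul m a => rw [withL_tmul, withL_tmul, LinearMap.lTensor_tmul, oneAt_succ_cons]

end

section
variable {C : Type u} [AddCommGroup C] [Module ℂ C] [Coalgebra ℂ C] (κ : M ⊗[ℂ] C →ₗ[ℂ] M ⊗[ℂ] C)

lemma rotL_comulAt_succ {n i : ℕ} (h : i + 1 ≤ n) (z : M ⊗[ℂ] TP C (n + 1)) :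
    rotL κ (n + 1) ((comulAt n (i + 1)).lTensor M z) = (comulAt n i).lTensor M (rotL κ n z) := by
  obtain ⟨n, rfl⟩ : ∃ l, n = l + 1 := ⟨n - 1, by omega⟩
  induction z with
  | zero => simp
  | add s t hs ht => simp only [map_add, hs, ht]
  | tmul m x =>
    induction x using TP.cons_induction with
    | hadd x y hx hy => simp only [map_add, TensorProduct.tmul_add, hx, hy]
    | h c x =>
      rw [rotL_cons, LinearMap.lTensor_tmul, comulAt_succ_cons, rotL_cons]
      generalize κ (m ⊗ₜ c) = t
      induction t with
      | zero => simp
      | add s t hs ht => simp only [map_add, hs, ht]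
      | tmul m c => rw [withR_tmul, withR_tmul, LinearMap.lTensor_tmul, comulAt_snoc (by omega)]

lemma rotL_counitAt_succ {n i : ℕ} (h : i ≤ n) (z : M ⊗[ℂ] TP C (n + 2)) :
    rotL κ n ((counitAt (n + 1) (i + 1)).lTensor M z) =
      (counitAt (n + 1) i).lTensor M (rotL κ (n + 1) z) := by
  induction z with
  | zero => simp
  | add s t hs ht => simp only [map_add, hs, ht]
  | tmul m x =>
    induction x using TP.cons_induction with
    | hadd x y hx hy => simp only [map_add, TensorProduct.tmul_add, hx, hy]
    | h c x =>
      rw [rotL_cons, LinearMap.lTensor_tmul, counitAt_succ_cons, rotL_cons]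
      generalize κ (m ⊗ₜ c) = t
      induction t with
      | zero => simp
      | add s t hs ht => simp only [map_add, hs, ht]
      | tmul m c => rw [withR_tmul, withR_tmul, LinearMap.lTensor_tmul, counitAt_snoc h]

end

lemma lTensor_eq_lTensor {E F F' G : Type*} [AddCommGroup E] [Module ℂ E] [AddCommGroup F]
    [Module ℂ F] [AddCommGroup F'] [Module ℂ F'] [AddCommGroup G] [Module ℂ G]
    {f : E →ₗ[ℂ] F} {g : F →ₗ[ℂ] G} {f' : E →ₗ[ℂ] F'} {g' : F' →ₗ[ℂ] G}
    (h : ∀ x, g (f x) = g' (f' x)) (z : M ⊗[ℂ] E) :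
    g.lTensor M (f.lTensor M z) = g'.lTensor M (f'.lTensor M z) := by
  rw [← LinearMap.lTensor_comp_apply, ← LinearMap.lTensor_comp_apply,
    show g ∘ₗ f = g' ∘ₗ f' from LinearMap.ext h]

lemma lTensor_eq_self {E F : Type*} [AddCommGroup E] [Module ℂ E] [AddCommGroup F] [Module ℂ F]
    {f : E →ₗ[ℂ] F} {g : F →ₗ[ℂ] E} (h : ∀ x, g (f x) = x) (z : M ⊗[ℂ] E) :
    g.lTensor M (f.lTensor M z) = z := by
  rw [← LinearMap.lTensor_comp_apply, show g ∘ₗ f = LinearMap.id from LinearMap.ext h,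
    LinearMap.lTensor_id, LinearMap.id_apply]

end RotationIdentities

section AlgData
variable (H : Type u) [Ring H] [HopfAlgebra ℂ H] [BijectiveAntipode H]
variable (M : Type v) [AddCommGroup M] [Module ℂ M] [Module Hᵐᵒᵖ M] [IsScalarTower ℂ Hᵐᵒᵖ M]
  [SAYD H M]
variable (A : Type u) [Ring A] [Algebra ℂ A] [Module H A] [IsScalarTower ℂ H A] [ModuleAlgebra H A]

/-- The rotation for the algebra is inverse to the one for the coalgebra, whose power is the identity
modulo the relations that invariant forms respect. -/
lemma algData_τ_pow (n : ℕ) : (algData H M A).τ n ^ (n + 1) = 1 := by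
  have h1 : ∀ (k : ℕ) (φ : invForms H M A (n + 1)) (z : M ⊗[ℂ] TP A (n + 1)),
      (((algData H M A).τ n ^ k) φ).1 z = φ.1 ((cycInv H M A n ^ k) z) := by
    intro k
    induction k with
    | zero => intro φ z; rfl
    | succ k ih =>
      intro φ z
      rw [pow_succ, Module.End.mul_apply, ih, pow_succ']
      rfl
  refine LinearMap.ext fun φ => Subtype.ext (LinearMap.ext fun z => ?_)
  rw [h1]
  have h2 : ∀ z, (cyc H M A n ^ (n + 1)) ((cycInv H M A n ^ (n + 1)) z) = z := by
    intro z
    have : Function.LeftInverse (cyc H M A n) (cycInv H M A n) := cyc_cycInv n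
    have := this.iterate (n + 1)
    rw [Module.End.pow_apply, Module.End.pow_apply]
    exact this z
  have hφ := (mem_invForms_iff φ.1).1 φ.2
  have h3 := mkQ_cyc_pow (H := H) n ((cycInv H M A n ^ (n + 1)) z)
  rw [h2, Submodule.mkQ_apply, Submodule.mkQ_apply, Submodule.Quotient.eq] at h3
  have h4 := hφ h3
  rw [LinearMap.mem_ker, map_sub, sub_eq_zero] at h4
  exact h4.symm

lemma algData_δ {n i : ℕ} (h : i ≤ n) (φ : invForms H M A (n + 1)) (z : M ⊗[ℂ] TP A (n + 2)) :
    ((algData H M A).δ n i φ).1 z = φ.1 ((mulAt n i).lTensor M z) := by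
  change ((if i ≤ n then _ else _ : invForms H M A (n + 1) →ₗ[ℂ] invForms H M A (n + 2)) φ).1 z = _
  rw [if_pos h]
  rfl

lemma algData_δ_last (n : ℕ) (φ : invForms H M A (n + 1)) (z : M ⊗[ℂ] TP A (n + 2)) :
    ((algData H M A).δ n (n + 1) φ).1 z =
      φ.1 ((mulAt n 0).lTensor M (cycInv H M A (n + 1) z)) := by
  change ((if n + 1 ≤ n then _ else _ :
    invForms H M A (n + 1) →ₗ[ℂ] invForms H M A (n + 2)) φ).1 z = _
  rw [if_neg (by omega)]
  rfl

theorem algData_isCocyclic : (algData H M A).IsCocyclic := by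
  have hδ := @algData_δ H _ _ _ M _ _ _ _ _ A _ _ _ _ _
  have hσ : ∀ n j (φ : invForms H M A (n + 2)) z, ((algData H M A).σ n j φ).1 z =
      φ.1 ((oneAt (n + 1) (j + 1)).lTensor M z) := fun n j φ z => rfl
  have hτ : ∀ n (φ : invForms H M A (n + 1)) z, ((algData H M A).τ n φ).1 z =
      φ.1 (cycInv H M A n z) := fun n φ z => rfl
  apply CocyclicData.IsCocyclic.of_reduced
  · intro n i j φ h hj
    obtain ⟨j, rfl⟩ : ∃ l, j = l + 1 := ⟨j - 1, by omega⟩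
    refine Subtype.ext (LinearMap.ext fun z => ?_)
    rw [hδ hj, hδ (by omega), hδ (by omega),
      Nat.add_sub_cancel, hδ (by omega)]
    exact congrArg φ.1 (lTensor_eq_lTensor (fun x => mulAt_mulAt (by omega) (by omega) x) z)
  · intro n i j φ h hj
    refine Subtype.ext (LinearMap.ext fun z => ?_)
    rw [hσ, hσ, hσ, hσ]
    exact congrArg φ.1 (lTensor_eq_lTensor (fun x => oneAt_oneAt (by omega) (by omega) x) z)
  · intro n i j φ h hj
    obtain ⟨j, rfl⟩ : ∃ l, j = l + 1 := ⟨j - 1, by omega⟩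
    refine Subtype.ext (LinearMap.ext fun z => ?_)
    rw [hσ, hδ (by omega), hδ (by omega), hσ, Nat.add_sub_cancel]
    exact congrArg φ.1
      (lTensor_eq_lTensor (fun x => mulAt_oneAt_of_lt (by omega) (by omega) x) z)
  · intro n j φ h
    refine Subtype.ext (LinearMap.ext fun z => ?_)
    rw [hσ, hδ h]
    exact congrArg φ.1 (lTensor_eq_self (fun x => mulAt_oneAt_succ h x) z)
  · intro n j φ h
    refine Subtype.ext (LinearMap.ext fun z => ?_)
    rw [hσ, hδ h]
    exact congrArg φ.1 (lTensor_eq_self (fun x => mulAt_oneAt_self h x) z)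
  · intro n i j φ h hi
    obtain ⟨i, rfl⟩ : ∃ l, i = l + 1 := ⟨i - 1, by omega⟩
    refine Subtype.ext (LinearMap.ext fun z => ?_)
    rw [hσ, hδ (by omega), Nat.add_sub_cancel, hδ (by omega), hσ]
    exact congrArg φ.1
      (lTensor_eq_lTensor (fun x => mulAt_oneAt_of_gt (by omega) (by omega) x) z)
  · intro n i φ h
    refine Subtype.ext (LinearMap.ext fun z => ?_)
    rw [hτ, hδ h, hδ (by omega), hτ]
    exact congrArg φ.1 (mulAt_succ_rotR _ h z)
  · intro n φ
    refine Subtype.ext (LinearMap.ext fun z => ?_)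
    rw [hτ, hδ (Nat.zero_le _), algData_δ_last]
  · intro n i φ h
    refine Subtype.ext (LinearMap.ext fun z => ?_)
    rw [hτ, hσ, hσ, hτ]
    exact congrArg φ.1 (oneAt_succ_rotR _ h z)
  · exact algData_τ_pow H M A
  · intro φ
    refine Subtype.ext (LinearMap.ext fun z => ?_)
    rw [hσ, algData_δ_last]
    refine congrArg φ.1 ?_
    induction z with
    | zero => simp
    | add s t hs ht => simp only [map_add, hs, ht]
    | tmul m x =>
      rw [LinearMap.lTensor_tmul, oneAt_self, rotR_snoc, twist_counit, withL_tmul,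
        LinearMap.lTensor_tmul, ← oneAt_zero, mulAt_oneAt_self le_rfl]
      intro h
      rw [ModuleAlgebra.smul_one, counit_antipodeInv]

end AlgData

section PlainData
variable (B : Type u) [Ring B] [Algebra ℂ B]

lemma rotate_snoc {n : ℕ} (x : TP B n) (b : B) : rotate B n (snoc x b) = cons b x := by
  simp [rotate, cons, snoc]

lemma rotate_rot (n : ℕ) (x : TP B (n + 1)) : rot n (rotate B n x) = x := by
  induction x using TP.snoc_induction with
  | hadd x y hx hy => rw [map_add, map_add, hx, hy]
  | h x b => rw [rotate_snoc, rot_cons]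

lemma mulAt_succ_rotate {n i : ℕ} (h : i + 1 ≤ n) (x : TP B (n + 2)) :
    mulAt n (i + 1) (rotate B (n + 1) x) = rotate B n (mulAt n i x) := by
  obtain ⟨n, rfl⟩ : ∃ l, n = l + 1 := ⟨n - 1, by omega⟩
  induction x using TP.snoc_induction with
  | hadd x y hx hy => simp only [map_add, hx, hy]
  | h x a => rw [rotate_snoc, mulAt_snoc (by omega), rotate_snoc, mulAt_succ_cons]

lemma oneAt_succ_rotate {n i : ℕ} (h : i ≤ n) (x : TP B (n + 1)) :
    oneAt (n + 1) (i + 1) (rotate B n x) = rotate B (n + 1) (oneAt (n + 1) i x) := by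
  induction x using TP.snoc_induction with
  | hadd x y hx hy => simp only [map_add, hx, hy]
  | h x a => rw [rotate_snoc, oneAt_snoc h, rotate_snoc, oneAt_succ_cons]

lemma rotate_pow (n : ℕ) (x : TP B (n + 1)) : (rotate B n ^ (n + 1)) x = x := by
  have h : Function.LeftInverse (rot n) (rotate B n) := rotate_rot B n
  have h1 := h.iterate (n + 1) x
  rwa [← Module.End.pow_apply, rot_pow, Module.End.one_apply, ← Module.End.pow_apply] at h1

lemma plainData_δ {n i : ℕ} (h : i ≤ n) (φ : Module.Dual ℂ (TP B (n + 1))) (x : TP B (n + 2)) :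
    (plainData B).δ n i φ x = φ (mulAt n i x) := by
  change (if i ≤ n then _ else _ :
    Module.Dual ℂ (TP B (n + 1)) →ₗ[ℂ] Module.Dual ℂ (TP B (n + 2))) φ x = _
  rw [if_pos h]
  rfl

lemma plainData_δ_last (n : ℕ) (φ : Module.Dual ℂ (TP B (n + 1))) (x : TP B (n + 2)) :
    (plainData B).δ n (n + 1) φ x = φ (mulAt n 0 (rotate B (n + 1) x)) := by
  change (if n + 1 ≤ n then _ else _ :
    Module.Dual ℂ (TP B (n + 1)) →ₗ[ℂ] Module.Dual ℂ (TP B (n + 2))) φ x = _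
  rw [if_neg (by omega)]
  rfl

theorem plainData_isCocyclic : (plainData B).IsCocyclic := by
  have hδ := @plainData_δ B _ _
  have hσ : ∀ n j (φ : Module.Dual ℂ (TP B (n + 2))) x, (plainData B).σ n j φ x =
      φ (oneAt (n + 1) (j + 1) x) := fun n j φ z => rfl
  have hτ : ∀ n (φ : Module.Dual ℂ (TP B (n + 1))) x, (plainData B).τ n φ x =
      φ (rotate B n x) := fun n φ z => rfl
  apply CocyclicData.IsCocyclic.of_reduced
  · intro n i j φ h hj
    obtain ⟨j, rfl⟩ : ∃ l, j = l + 1 := ⟨j - 1, by omega⟩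
    refine LinearMap.ext fun x => ?_
    rw [hδ hj, hδ (by omega), hδ (by omega), Nat.add_sub_cancel, hδ (by omega)]
    exact congrArg φ (mulAt_mulAt (by omega) (by omega) x)
  · intro n i j φ h hj
    refine LinearMap.ext fun x => ?_
    rw [hσ, hσ, hσ, hσ]
    exact congrArg φ (oneAt_oneAt (by omega) (by omega) x)
  · intro n i j φ h hj
    obtain ⟨j, rfl⟩ : ∃ l, j = l + 1 := ⟨j - 1, by omega⟩
    refine LinearMap.ext fun x => ?_
    rw [hσ, hδ (by omega), hδ (by omega), hσ, Nat.add_sub_cancel]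
    exact congrArg φ (mulAt_oneAt_of_lt (by omega) (by omega) x)
  · intro n j φ h
    refine LinearMap.ext fun x => ?_
    rw [hσ, hδ h, mulAt_oneAt_succ h]
  · intro n j φ h
    refine LinearMap.ext fun x => ?_
    rw [hσ, hδ h, mulAt_oneAt_self h]
  · intro n i j φ h hi
    obtain ⟨i, rfl⟩ : ∃ l, i = l + 1 := ⟨i - 1, by omega⟩
    refine LinearMap.ext fun x => ?_
    rw [hσ, hδ (by omega), Nat.add_sub_cancel, hδ (by omega), hσ]
    exact congrArg φ (mulAt_oneAt_of_gt (by omega) (by omega) x)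
  · intro n i φ h
    refine LinearMap.ext fun x => ?_
    rw [hτ, hδ h, hδ (by omega), hτ, mulAt_succ_rotate B h]
  · intro n φ
    refine LinearMap.ext fun x => ?_
    rw [hτ, hδ (Nat.zero_le _), plainData_δ_last]
  · intro n i φ h
    refine LinearMap.ext fun x => ?_
    rw [hτ, hσ, hσ, hτ, oneAt_succ_rotate B h]
  · intro n
    have h1 : ∀ (k : ℕ) (φ : Module.Dual ℂ (TP B (n + 1))) x,
        ((plainData B).τ n ^ k) φ x = φ ((rotate B n ^ k) x) := by
      intro k
      induction k with
      | zero => intro φ x; rfl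
      | succ k ih =>
        intro φ x
        rw [pow_succ, Module.End.mul_apply, ih, pow_succ']
        rfl
    refine LinearMap.ext fun φ => LinearMap.ext fun x => ?_
    rw [h1, rotate_pow]
    rfl
  · intro φ
    refine LinearMap.ext fun x => ?_
    rw [hσ, plainData_δ_last, oneAt_self, rotate_snoc, ← oneAt_zero, mulAt_oneAt_self le_rfl]

end PlainData

section CoalgData
variable (H : Type u) [Ring H] [HopfAlgebra ℂ H]
variable (C : Type u) [AddCommGroup C] [Module ℂ C] [Coalgebra ℂ C] [Module H C]
  [IsScalarTower ℂ H C] [ModuleCoalgebra H C]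
variable (M : Type v) [AddCommGroup M] [Module ℂ M] [Module Hᵐᵒᵖ M] [IsScalarTower ℂ Hᵐᵒᵖ M]
  [SAYD H M]

lemma coalgData_δ {n i : ℕ} (h : i ≤ n) (z : M ⊗[ℂ] TP C (n + 1)) :
    (coalgData H C M).δ n i ((relSub H C M (n + 1)).mkQ z) =
      (relSub H C M (n + 2)).mkQ ((comulAt n i).lTensor M z) := by
  change (if i ≤ n then _ else _ :
    CoinvTP H M C (n + 1) →ₗ[ℂ] CoinvTP H M C (n + 2)) _ = _
  rw [if_pos h]
  rfl

lemma coalgData_δ_last (n : ℕ) (z : M ⊗[ℂ] TP C (n + 1)) :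
    (coalgData H C M).δ n (n + 1) ((relSub H C M (n + 1)).mkQ z) =
      (relSub H C M (n + 2)).mkQ (cyc H M C (n + 1) ((comulAt n 0).lTensor M z)) := by
  change (if n + 1 ≤ n then _ else _ :
    CoinvTP H M C (n + 1) →ₗ[ℂ] CoinvTP H M C (n + 2)) _ = _
  rw [if_neg (by omega)]
  rfl

theorem coalgData_isCocyclic : (coalgData H C M).IsCocyclic := by
  have hδ := @coalgData_δ H _ _ C _ _ _ _ _ _ M _ _ _ _ _
  have hσ : ∀ n j (z : M ⊗[ℂ] TP C (n + 2)), (coalgData H C M).σ n j ((relSub H C M (n + 2)).mkQ z) =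
      (relSub H C M (n + 1)).mkQ ((counitAt (n + 1) (j + 1)).lTensor M z) := fun n j z => rfl
  have hτ : ∀ n (z : M ⊗[ℂ] TP C (n + 1)), (coalgData H C M).τ n ((relSub H C M (n + 1)).mkQ z) =
      (relSub H C M (n + 1)).mkQ (cyc H M C n z) := fun n z => rfl
  apply CocyclicData.IsCocyclic.of_reduced
  · intro n i j x h hj
    obtain ⟨j, rfl⟩ : ∃ l, j = l + 1 := ⟨j - 1, by omega⟩
    obtain ⟨z, rfl⟩ := Submodule.mkQ_surjective _ x
    rw [hδ (by omega), hδ hj, Nat.add_sub_cancel, hδ (by omega), hδ (by omega)]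
    exact congrArg _ (lTensor_eq_lTensor (fun x => comulAt_comulAt (by omega) (by omega) x) z)
  · intro n i j x h hj
    obtain ⟨z, rfl⟩ := Submodule.mkQ_surjective _ x
    rw [hσ, hσ, hσ, hσ]
    exact congrArg _ (lTensor_eq_lTensor (fun x => counitAt_counitAt (by omega) (by omega) x) z)
  · intro n i j x h hj
    obtain ⟨j, rfl⟩ : ∃ l, j = l + 1 := ⟨j - 1, by omega⟩
    obtain ⟨z, rfl⟩ := Submodule.mkQ_surjective _ x
    rw [hδ (by omega), hσ, hσ, hδ (by omega), Nat.add_sub_cancel]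
    exact congrArg _
      (lTensor_eq_lTensor (fun x => counitAt_comulAt_of_lt (by omega) (by omega) x) z)
  · intro n j x h
    obtain ⟨z, rfl⟩ := Submodule.mkQ_surjective _ x
    rw [hδ h, hσ]
    exact congrArg _ (lTensor_eq_self (fun x => counitAt_comulAt_succ h x) z)
  · intro n j x h
    obtain ⟨z, rfl⟩ := Submodule.mkQ_surjective _ x
    rw [hδ h, hσ]
    exact congrArg _ (lTensor_eq_self (fun x => counitAt_comulAt_self h x) z)
  · intro n i j x h hi
    obtain ⟨i, rfl⟩ : ∃ l, i = l + 1 := ⟨i - 1, by omega⟩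
    obtain ⟨z, rfl⟩ := Submodule.mkQ_surjective _ x
    rw [hδ (by omega), hσ, hσ, Nat.add_sub_cancel, hδ (by omega)]
    exact congrArg _
      (lTensor_eq_lTensor (fun x => counitAt_comulAt_of_gt (by omega) (by omega) x) z)
  · intro n i x h
    obtain ⟨z, rfl⟩ := Submodule.mkQ_surjective _ x
    rw [hδ h, hτ, hτ, hδ (by omega)]
    exact congrArg _ (rotL_comulAt_succ _ h z)
  · intro n x
    obtain ⟨z, rfl⟩ := Submodule.mkQ_surjective _ x
    rw [hδ (Nat.zero_le _), hτ, coalgData_δ_last]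
  · intro n i x h
    obtain ⟨z, rfl⟩ := Submodule.mkQ_surjective _ x
    rw [hσ, hτ, hτ, hσ]
    exact congrArg _ (rotL_counitAt_succ _ h z)
  · intro n
    have h1 : ∀ (k : ℕ) (z : M ⊗[ℂ] TP C (n + 1)), ((coalgData H C M).τ n ^ k)
        ((relSub H C M (n + 1)).mkQ z) = (relSub H C M (n + 1)).mkQ ((cyc H M C n ^ k) z) := by
      intro k
      induction k with
      | zero => intro z; rfl
      | succ k ih =>
        intro z
        rw [pow_succ, Module.End.mul_apply, hτ, ih, pow_succ]
        rfl
    refine LinearMap.ext fun x => ?_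
    obtain ⟨z, rfl⟩ := Submodule.mkQ_surjective _ x
    rw [h1, mkQ_cyc_pow]
    rfl
  · intro x
    obtain ⟨z, rfl⟩ := Submodule.mkQ_surjective _ x
    rw [coalgData_δ_last, hσ]
    refine congrArg _ ?_
    have key : ∀ (t : M ⊗[ℂ] TP C 2), (counitAt 1 1).lTensor M (cyc H M C 1 t) =
        (counitAt 1 0).lTensor M t := by
      intro t
      induction t with
      | zero => simp
      | add s t hs ht => simp only [map_add, hs, ht]
      | tmul m x =>
        induction x using TP.cons_induction with
        | hadd x y hx hy => simp only [map_add, TensorProduct.tmul_add, hx, hy]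
        | h c y =>
          have e : ∀ t : H ⊗[ℂ] M, (counitAt 1 1).lTensor M (withR y (twistAux M LinearMap.id c t)) =
              counit (R := ℂ) c • (TensorProduct.lid ℂ M (counit.rTensor M t)) ⊗ₜ[ℂ] y := by
            intro t
            induction t with
            | zero => simp
            | add s t hs ht => simp only [map_add, TensorProduct.add_tmul, smul_add, hs, ht]
            | tmul h m =>
              rw [twistAux_tmul, withR_tmul, LinearMap.lTensor_tmul, counitAt_snoc_self,
                LinearMap.id_apply, ModuleCoalgebra.counit_smul, LinearMap.rTensor_tmul,
                TensorProduct.lid_tmul, ← TensorProduct.smul_tmul', TensorProduct.tmul_smul,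
                smul_smul, mul_comm]
          rw [rotL_cons, twist_tmul, e, SAYD.counit_coact, LinearMap.lTensor_tmul,
            counitAt_zero_cons, TensorProduct.tmul_smul]
    rw [key]
    exact lTensor_eq_self (fun x => counitAt_comulAt_self le_rfl x) z

end CoalgData

/-! ### The pairings of Hopf-cyclic cochains -/

/-- It suffices to check the cofaces of a map of cocyclic modules which do not involve the cyclic
operator. -/
def CocyclicData.Hom.ofReduced {X : CocyclicData.{w}} {Y : CocyclicData.{w'}} (hX : X.IsCocyclic)
    (hY : Y.IsCocyclic) (app : ∀ n, X.obj n →ₗ[ℂ] Y.obj n)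
    (app_δ : ∀ n i, i ≤ n → app (n + 1) ∘ₗ X.δ n i = Y.δ n i ∘ₗ app n)
    (app_σ : ∀ n j, j ≤ n → app n ∘ₗ X.σ n j = Y.σ n j ∘ₗ app (n + 1))
    (app_τ : ∀ n, app n ∘ₗ X.τ n = Y.τ n ∘ₗ app n) : X.Hom Y where
  app := app
  app_δ n i h := by
    rcases Nat.lt_or_ge n i with h' | h'
    · obtain rfl : i = n + 1 := by omega
      rw [← hX.τ_δ_zero, ← hY.τ_δ_zero, ← LinearMap.comp_assoc, app_τ, LinearMap.comp_assoc,
        app_δ n 0 (Nat.zero_le _), LinearMap.comp_assoc]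
    · exact app_δ n i h'
  app_σ := app_σ
  app_τ := app_τ

/-- An action of an `H`-module coalgebra `C` on an algebra `F` with values in an `H`-module algebra
`A`: `(h c) f = h (c f)`, `c (f g) = (c₍₁₎ f) (c₍₂₎ g)` and `c 1 = ε(c) 1`. -/
structure ActionInto (H : Type u) [Ring H] [HopfAlgebra ℂ H] (C : Type u) [AddCommGroup C]
    [Module ℂ C] [Coalgebra ℂ C] [Module H C] (F : Type u) [Ring F] [Algebra ℂ F] (A : Type u)
    [Ring A] [Algebra ℂ A] [Module H A] where
  act : C →ₗ[ℂ] F →ₗ[ℂ] A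
  smul_act : ∀ (h : H) (c : C) (f : F), act (h • c) f = h • act c f
  act_mul : ∀ (c : C) (f g : F),
    act c (f * g) = LinearMap.mul' ℂ A (TensorProduct.map₂ act act (comul c) (f ⊗ₜ g))
  act_one : ∀ c : C, act c 1 = counit (R := ℂ) c • (1 : A)

namespace ActionInto
variable {H : Type u} [Ring H] [HopfAlgebra ℂ H]
variable {C : Type u} [AddCommGroup C] [Module ℂ C] [Coalgebra ℂ C] [Module H C]
variable {F : Type u} [Ring F] [Algebra ℂ F]
variable {A : Type u} [Ring A] [Algebra ℂ A] [Module H A]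
variable (e : ActionInto H C F A)

/-- The factorwise action of the tensor powers. -/
def pow (n : ℕ) : TP C n →ₗ[ℂ] TP F n →ₗ[ℂ] TP A n := PiTensorProduct.map₂ fun _ => e.act

lemma pow_tprod {n : ℕ} (c : Fin n → C) (f : Fin n → F) :
    e.pow n (PiTensorProduct.tprod ℂ c) (PiTensorProduct.tprod ℂ f) =
      PiTensorProduct.tprod ℂ fun i => e.act (c i) (f i) :=
  PiTensorProduct.map₂_tprod_tprod _ c f

lemma pow_cons {n : ℕ} (c : C) (x : TP C n) (f : F) (y : TP F n) :
    e.pow (n + 1) (cons c x) (cons f y) = cons (e.act c f) (e.pow n x y) := by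
  induction x using PiTensorProduct.induction_on with
  | add x x' hx hx' => simp only [cons_add, map_add, LinearMap.add_apply, hx, hx']
  | smul_tprod r x =>
    induction y using PiTensorProduct.induction_on with
    | add y y' hy hy' => simp only [cons_add, map_add, hy, hy']
    | smul_tprod s y =>
      simp only [cons_smul, map_smul, LinearMap.smul_apply, cons_tprod, pow_tprod]
      congr 3
      funext i
      exact Fin.cases rfl (fun j => rfl) i

lemma pow_snoc {n : ℕ} (c : C) (x : TP C n) (f : F) (y : TP F n) :
    e.pow (n + 1) (snoc x c) (snoc y f) = snoc (e.pow n x y) (e.act c f) := by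
  induction x using PiTensorProduct.induction_on with
  | add x x' hx hx' => simp only [add_snoc, map_add, LinearMap.add_apply, hx, hx']
  | smul_tprod r x =>
    induction y using PiTensorProduct.induction_on with
    | add y y' hy hy' => simp only [add_snoc, map_add, hy, hy']
    | smul_tprod s y =>
      simp only [smul_snoc, map_smul, LinearMap.smul_apply, snoc_tprod, pow_tprod]
      congr 3
      funext i
      refine Fin.lastCases ?_ (fun j => ?_) i <;> simp

lemma pow_comulAt {n i : ℕ} (h : i ≤ n) (x : TP C (n + 1)) (y : TP F (n + 2)) :
    mulAt n i (e.pow (n + 2) (comulAt n i x) y) = e.pow (n + 1) x (mulAt n i y) := by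
  induction i generalizing n with
  | zero =>
    induction x using TP.cons_induction with
    | hadd x x' hx hx' => simp only [map_add, LinearMap.add_apply, hx, hx']
    | h c x =>
      induction y using TP.cons_cons_induction with
      | hadd y y' hy hy' => simp only [map_add, hy, hy']
      | h f g y =>
        rw [comulAt_zero_cons, mulAt_zero_cons, pow_cons, e.act_mul]
        generalize comul (R := ℂ) c = t
        induction t with
        | zero => simp [cons]
        | add s t hs ht => simp only [map_add, LinearMap.add_apply, add_cons, hs, ht]
        | tmul a b =>
          rw [cons₂_tmul, pow_cons, pow_cons, mulAt_zero_cons, TensorProduct.map₂_apply_tmul,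
            TensorProduct.map_tmul, LinearMap.mul'_apply]
  | succ i ih =>
    obtain ⟨n, rfl⟩ : ∃ l, n = l + 1 := ⟨n - 1, by omega⟩
    induction x using TP.cons_induction with
    | hadd x x' hx hx' => simp only [map_add, LinearMap.add_apply, hx, hx']
    | h c x =>
      induction y using TP.cons_induction with
      | hadd y y' hy hy' => simp only [map_add, hy, hy']
      | h f y =>
        rw [comulAt_succ_cons, pow_cons, mulAt_succ_cons, mulAt_succ_cons, pow_cons, ih (by omega)]

lemma pow_counitAt {n i : ℕ} (h : i ≤ n) (x : TP C (n + 1)) (y : TP F n) :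
    oneAt n i (e.pow n (counitAt n i x) y) = e.pow (n + 1) x (oneAt n i y) := by
  induction i generalizing n with
  | zero =>
    induction x using TP.cons_induction with
    | hadd x x' hx hx' => simp only [map_add, LinearMap.add_apply, hx, hx']
    | h c x =>
      rw [counitAt_zero_cons, oneAt_zero, oneAt_zero, pow_cons, e.act_one, map_smul,
        LinearMap.smul_apply, cons_smul, smul_cons]
  | succ i ih =>
    obtain ⟨n, rfl⟩ : ∃ l, n = l + 1 := ⟨n - 1, by omega⟩
    induction x using TP.cons_induction with
    | hadd x x' hx hx' => simp only [map_add, LinearMap.add_apply, hx, hx']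
    | h c x =>
      induction y using TP.cons_induction with
      | hadd y y' hy hy' => simp only [map_add, hy, hy']
      | h f y =>
        rw [counitAt_succ_cons, pow_cons, oneAt_succ_cons, oneAt_succ_cons, pow_cons,
          ih (by omega)]

variable [IsScalarTower ℂ H C] [IsScalarTower ℂ H A]

lemma pow_diagAct {n : ℕ} (h : H) (x : TP C n) (y : TP F n) :
    e.pow n (diagAct H C n h x) y = diagAct H A n h (e.pow n x y) := by
  induction n generalizing h with
  | zero => rw [diagAct_zero, diagAct_zero, map_smul, LinearMap.smul_apply]
  | succ n ih =>
    induction x using TP.cons_induction with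
    | hadd x x' hx hx' => simp only [map_add, LinearMap.add_apply, hx, hx']
    | h c x =>
      induction y using TP.cons_induction with
      | hadd y y' hy hy' => simp only [map_add, hy, hy']
      | h f y =>
        rw [diagAct_cons, pow_cons, diagAct_cons]
        generalize comul (R := ℂ) h = t
        induction t with
        | zero => simp
        | add s t hs ht => simp only [map_add, LinearMap.add_apply, hs, ht]
        | tmul a b => rw [consAct_tmul, consAct_tmul, pow_cons, ih, e.smul_act]

variable (M : Type v) [AddCommGroup M] [Module ℂ M]

/-- The factorwise action with coefficients. -/
def coeffPow (n : ℕ) : M ⊗[ℂ] TP C n →ₗ[ℂ] TP F n →ₗ[ℂ] M ⊗[ℂ] TP A n :=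
  TensorProduct.lTensorHomToHomLTensor (RingHom.id ℂ) (TP F n) M (TP A n) ∘ₗ (e.pow n).lTensor M

variable {M}

omit [IsScalarTower ℂ H C] [IsScalarTower ℂ H A] in
lemma coeffPow_tmul {n : ℕ} (m : M) (x : TP C n) (y : TP F n) :
    e.coeffPow M n (m ⊗ₜ x) y = m ⊗ₜ e.pow n x y := rfl

variable [Module Hᵐᵒᵖ M] [IsScalarTower ℂ Hᵐᵒᵖ M]

/-- `φ ⊗ m ⊗ x ↦ (y ↦ φ(m ⊗ x y))`. -/
def pairing (n : ℕ) : invForms H M A n ⊗[ℂ] CoinvTP H M C n →ₗ[ℂ] Module.Dual ℂ (TP F n) :=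
  TensorProduct.lift
    { toFun := fun φ => (relSub H C M n).liftQ (LinearMap.llcomp ℂ _ _ _ φ.1 ∘ₗ e.coeffPow M n) (by
        refine relSub_le_comap _ ⊥ fun h m x => ?_
        rw [Submodule.mem_bot, sub_eq_zero]
        refine LinearMap.ext fun y => ?_
        have h1 := (mem_invForms_iff φ.1).1 φ.2
          (Submodule.subset_span ⟨h, m, e.pow n x y, rfl⟩)
        rw [LinearMap.mem_ker, map_sub, sub_eq_zero] at h1
        refine h1.trans ?_
        rw [← e.pow_diagAct]
        rfl)
      map_add' := fun φ ψ => by ext; rfl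
      map_smul' := fun r φ => by ext; rfl }

lemma pairing_tmul {n : ℕ} (φ : invForms H M A n) (z : M ⊗[ℂ] TP C n) (y : TP F n) :
    e.pairing n (φ ⊗ₜ[ℂ] (relSub H C M n).mkQ z) y = φ.1 (e.coeffPow M n z y) := rfl

variable [SAYD H M]

lemma coeffPow_cyc {n : ℕ} (z : M ⊗[ℂ] TP C (n + 1)) (y : TP F (n + 1)) :
    e.coeffPow M (n + 1) (cyc H M C n z) y =
      cyc H M A n (e.coeffPow M (n + 1) z (rotate F n y)) := by
  induction z with
  | zero => simp
  | add s t hs ht => simp only [map_add, LinearMap.add_apply, hs, ht]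
  | tmul m x =>
    induction x using TP.cons_induction with
    | hadd x x' hx hx' => simp only [TensorProduct.tmul_add, map_add, LinearMap.add_apply, hx, hx']
    | h c x =>
      induction y using TP.snoc_induction with
      | hadd y y' hy hy' => simp only [map_add, hy, hy']
      | h y f =>
        rw [rotate_snoc, coeffPow_tmul, pow_cons, rotL_cons, rotL_cons, twist_tmul, twist_tmul]
        generalize SAYD.coact (H := H) m = t
        induction t with
        | zero => simp
        | add s t hs ht => simp only [map_add, LinearMap.add_apply, hs, ht]
        | tmul g m =>
          rw [twistAux_tmul, twistAux_tmul, withR_tmul, withR_tmul, coeffPow_tmul, pow_snoc,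
            e.smul_act]

variable (M) [BijectiveAntipode H] [ModuleCoalgebra H C] [ModuleAlgebra H A]

/-- The map from the diagonal to the cochains of `F` that is induced by an action. -/
def pairingHom : ((algData H M A).diag (coalgData H C M)).Hom (plainData F) :=
  .ofReduced ((algData_isCocyclic H M A).diag (coalgData_isCocyclic H C M)) (plainData_isCocyclic F)
    (fun n => e.pairing (n + 1))
    (fun n i h => TensorProduct.ext' fun φ q => LinearMap.ext fun y => by
      obtain ⟨z, rfl⟩ := Submodule.mkQ_surjective _ q
      change e.pairing (n + 2) ((algData H M A).δ n i φ ⊗ₜ (coalgData H C M).δ n i _) y =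
        (plainData F).δ n i _ y
      rw [plainData_δ F h, coalgData_δ H C M h, pairing_tmul, pairing_tmul, algData_δ H M A h]
      refine congrArg φ.1 ?_
      induction z with
      | zero => simp
      | add s t hs ht => simp only [map_add, LinearMap.add_apply, hs, ht]
      | tmul m x =>
        rw [LinearMap.lTensor_tmul, coeffPow_tmul, coeffPow_tmul, LinearMap.lTensor_tmul,
          pow_comulAt e h])
    (fun n j h => TensorProduct.ext' fun φ q => LinearMap.ext fun y => by
      obtain ⟨z, rfl⟩ := Submodule.mkQ_surjective _ q
      change φ.1 ((oneAt (n + 1) (j + 1)).lTensor M (e.coeffPow M (n + 1)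
        ((counitAt (n + 1) (j + 1)).lTensor M z) y)) =
        φ.1 (e.coeffPow M (n + 2) z (oneAt (n + 1) (j + 1) y))
      refine congrArg φ.1 ?_
      induction z with
      | zero => simp
      | add s t hs ht => simp only [map_add, LinearMap.add_apply, hs, ht]
      | tmul m x =>
        rw [LinearMap.lTensor_tmul, coeffPow_tmul, coeffPow_tmul, LinearMap.lTensor_tmul,
          pow_counitAt e (by omega)])
    (fun n => TensorProduct.ext' fun φ q => LinearMap.ext fun y => by
      obtain ⟨z, rfl⟩ := Submodule.mkQ_surjective _ q
      change φ.1 (cycInv H M A n (e.coeffPow M (n + 1) (cyc H M C n z) y)) =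
        φ.1 (e.coeffPow M (n + 1) z (rotate F n y))
      rw [coeffPow_cyc, cycInv_cyc])

lemma pairingHom_app (n : ℕ) (φ : invForms H M A (n + 1)) (m : M) (c : Fin (n + 1) → C)
    (f : Fin (n + 1) → F) :
    (e.pairingHom M).app n (φ ⊗ₜ[ℂ] Submodule.Quotient.mk (m ⊗ₜ[ℂ] PiTensorProduct.tprod ℂ c))
        (PiTensorProduct.tprod ℂ f) =
      φ.1 (m ⊗ₜ[ℂ] PiTensorProduct.tprod ℂ fun i => e.act (c i) (f i)) := by
  refine (e.pairing_tmul φ _ _).trans ?_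
  rw [coeffPow_tmul, pow_tprod]

end ActionInto

/-! ### Actions of coalgebras on algebras -/

section Actions
variable {H : Type u} [Ring H] [HopfAlgebra ℂ H]
variable {C : Type u} [AddCommGroup C] [Module ℂ C] [Coalgebra ℂ C] [Module H C]
  [IsScalarTower ℂ H C]
variable {A : Type u} [Ring A] [Algebra ℂ A] [Module H A] [IsScalarTower ℂ H A]

/-- An action of `C` on `A`, as an action with values in `A`. -/
def CoalgebraAction.toInto (α : CoalgebraAction H C A) : ActionInto H C A A where
  act := α.act
  smul_act := α.smul_act
  act_mul := α.act_mul
  act_one := α.act_one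

variable (H C A) in
/-- The evaluation `C ⊗ Hom_H(C, A) → A`. -/
def evalInto [ModuleCoalgebra H C] [ModuleAlgebra H A] : ActionInto H C (convAlg H C A) A where
  act := LinearMap.mk₂ ℂ (fun c f => f.1.ofConv c) (fun c d f => map_add f.1.ofConv c d)
    (fun r c f => map_smul f.1.ofConv r c) (fun _ _ _ => rfl) (fun _ _ _ => rfl)
  smul_act h c f := f.2 h c
  act_mul c f g := by
    change LinearMap.mul' ℂ A (TensorProduct.map f.1.ofConv g.1.ofConv (comul c)) = _
    congr 1
    generalize comul (R := ℂ) c = t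
    induction t with
    | zero => simp
    | add s t hs ht => simp only [map_add, LinearMap.add_apply, hs, ht]
    | tmul c d => rfl
  act_one c := Algebra.algebraMap_eq_smul_one (A := A) (counit (R := ℂ) c)

/-- The action `(H ⊗_K ℂ) ⊗ A^K → A`. -/
def SubHopf.relInto (K : SubHopf H) [ModuleAlgebra H A] : ActionInto H K.Rel (K.invAlg A) A where
  act := LinearMap.flip
    { toFun := fun a => (K.relIdeal.liftQ (LinearMap.toSpanSingleton H A (a : A)) (by
        rw [SubHopf.relIdeal, Submodule.span_le]
        rintro _ ⟨k, hk, rfl⟩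
        rw [SetLike.mem_coe, LinearMap.mem_ker, LinearMap.toSpanSingleton_apply, sub_smul,
          a.2 k hk, smul_assoc, one_smul, sub_self])).restrictScalars ℂ
      map_add' := fun a b => by
        refine LinearMap.ext fun c => ?_
        induction c using Submodule.Quotient.induction_on with
        | H h => exact smul_add h (a : A) (b : A)
      map_smul' := fun r a => by
        refine LinearMap.ext fun c => ?_
        induction c using Submodule.Quotient.induction_on with
        | H h => exact smul_comm h r (a : A) }
  smul_act h c a := by
    induction c using Submodule.Quotient.induction_on with
    | H g => exact mul_smul h g (a : A)
  act_mul c a b := by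
    induction c using Submodule.Quotient.induction_on with
    | H h =>
      refine (ModuleAlgebra.smul_mul h (a : A) (b : A)).trans ?_
      change _ = LinearMap.mul' ℂ A (TensorProduct.map₂ _ _ (TensorProduct.map K.proj K.proj
        (comul (R := ℂ) h)) (a ⊗ₜ b))
      congr 1
      generalize comul (R := ℂ) h = t
      induction t with
      | zero => simp
      | add s t hs ht => simp only [map_add, LinearMap.add_apply, hs, ht]
      | tmul c d => rfl
  act_one c := by
    induction c using Submodule.Quotient.induction_on with
    | H h => exact ModuleAlgebra.smul_one h

end Actions

/-! ### The cocyclic module of Connes and Moscovici -/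

namespace CocyclicData
variable {X : CocyclicData.{w}} {Y : CocyclicData.{w'}}

/-- The identities of a cocyclic module pass to surjective images. -/
lemma IsCocyclic.of_surjective (f : X.Hom Y) (hf : ∀ n, Function.Surjective (f.app n))
    (hX : X.IsCocyclic) : Y.IsCocyclic := by
  have fδ : ∀ n i x, i ≤ n + 1 → Y.δ n i (f.app n x) = f.app (n + 1) (X.δ n i x) :=
    fun n i x h => (LinearMap.congr_fun (f.app_δ n i h) x).symm
  have fσ : ∀ n j x, j ≤ n → Y.σ n j (f.app (n + 1) x) = f.app n (X.σ n j x) :=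
    fun n j x h => (LinearMap.congr_fun (f.app_σ n j h) x).symm
  have fτ : ∀ n x, Y.τ n (f.app n x) = f.app n (X.τ n x) :=
    fun n x => (LinearMap.congr_fun (f.app_τ n) x).symm
  constructor
  · intro n i j h hj
    refine LinearMap.ext fun y => ?_
    obtain ⟨x, rfl⟩ := hf _ y
    simp only [LinearMap.comp_apply]
    rw [fδ _ _ _ (by omega), fδ _ _ _ (by omega), fδ _ _ _ (by omega), fδ _ _ _ (by omega)]
    exact congrArg _ (LinearMap.congr_fun (hX.δ_δ n i j h hj) x)
  · intro n i j h hj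
    refine LinearMap.ext fun y => ?_
    obtain ⟨x, rfl⟩ := hf _ y
    simp only [LinearMap.comp_apply]
    rw [fσ _ _ _ (by omega), fσ _ _ _ (by omega), fσ _ _ _ (by omega), fσ _ _ _ (by omega)]
    exact congrArg _ (LinearMap.congr_fun (hX.σ_σ n i j h hj) x)
  · intro n i j h hj
    refine LinearMap.ext fun y => ?_
    obtain ⟨x, rfl⟩ := hf _ y
    simp only [LinearMap.comp_apply]
    rw [fδ _ _ _ (by omega), fσ _ _ _ (by omega), fσ _ _ _ (by omega), fδ _ _ _ (by omega)]
    exact congrArg _ (LinearMap.congr_fun (hX.σ_δ_lt n i j h hj) x)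
  · intro n j h
    refine LinearMap.ext fun y => ?_
    obtain ⟨x, rfl⟩ := hf _ y
    simp only [LinearMap.comp_apply]
    rw [fδ _ _ _ (by omega), fσ _ _ _ (by omega)]
    exact congrArg _ (LinearMap.congr_fun (hX.σ_δ_self n j h) x)
  · intro n j h
    refine LinearMap.ext fun y => ?_
    obtain ⟨x, rfl⟩ := hf _ y
    simp only [LinearMap.comp_apply]
    rw [fδ _ _ _ (by omega), fσ _ _ _ (by omega)]
    exact congrArg _ (LinearMap.congr_fun (hX.σ_δ_succ n j h) x)
  · intro n i j h hi
    refine LinearMap.ext fun y => ?_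
    obtain ⟨x, rfl⟩ := hf _ y
    simp only [LinearMap.comp_apply]
    rw [fδ _ _ _ (by omega), fσ _ _ _ (by omega), fσ _ _ _ (by omega), fδ _ _ _ (by omega)]
    exact congrArg _ (LinearMap.congr_fun (hX.σ_δ_gt n i j h hi) x)
  · intro n i h hi
    refine LinearMap.ext fun y => ?_
    obtain ⟨x, rfl⟩ := hf _ y
    simp only [LinearMap.comp_apply]
    rw [fδ _ _ _ (by omega), fτ, fτ, fδ _ _ _ (by omega)]
    exact congrArg _ (LinearMap.congr_fun (hX.τ_δ n i h hi) x)
  · intro n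
    refine LinearMap.ext fun y => ?_
    obtain ⟨x, rfl⟩ := hf _ y
    simp only [LinearMap.comp_apply]
    rw [fδ _ _ _ (by omega), fτ, fδ _ _ _ (by omega)]
    exact congrArg _ (LinearMap.congr_fun (hX.τ_δ_zero n) x)
  · intro n i h hi
    refine LinearMap.ext fun y => ?_
    obtain ⟨x, rfl⟩ := hf _ y
    simp only [LinearMap.comp_apply]
    rw [fσ _ _ _ (by omega), fτ, fτ, fσ _ _ _ (by omega)]
    exact congrArg _ (LinearMap.congr_fun (hX.τ_σ n i h hi) x)
  · intro n
    refine LinearMap.ext fun y => ?_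
    obtain ⟨x, rfl⟩ := hf _ y
    simp only [LinearMap.comp_apply]
    rw [fσ _ _ _ (by omega), fτ, fτ, fτ, fσ _ _ _ (by omega)]
    exact congrArg _ (LinearMap.congr_fun (hX.τ_σ_zero n) x)
  · intro n
    have h1 : ∀ k x, (Y.τ n ^ k) (f.app n x) = f.app n ((X.τ n ^ k) x) := by
      intro k
      induction k with
      | zero => intro x; rfl
      | succ k ih =>
        intro x
        rw [pow_succ, Module.End.mul_apply, fτ, ih, pow_succ, Module.End.mul_apply]
    refine LinearMap.ext fun y => ?_
    obtain ⟨x, rfl⟩ := hf _ y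
    rw [h1, hX.τ_pow]
    rfl

/-- The inverse of an isomorphism of cocyclic modules. -/
def Hom.symm (f : X.Hom Y) (hf : ∀ n, Function.Bijective (f.app n)) : Y.Hom X where
  app n := (LinearEquiv.ofBijective (f.app n) (hf n)).symm.toLinearMap
  app_δ n i h := LinearMap.ext fun y => (hf (n + 1)).1 (by
    obtain ⟨x, rfl⟩ := (hf n).2 y
    have h1 := LinearMap.congr_fun (f.app_δ n i h) x
    simp only [LinearMap.comp_apply] at h1
    simp only [LinearMap.comp_apply, LinearEquiv.coe_coe, LinearEquiv.ofBijective_symm_apply_apply]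
    rw [h1]
    exact (LinearEquiv.ofBijective (f.app (n + 1)) (hf (n + 1))).apply_symm_apply _)
  app_σ n j h := LinearMap.ext fun y => (hf n).1 (by
    obtain ⟨x, rfl⟩ := (hf (n + 1)).2 y
    have h1 := LinearMap.congr_fun (f.app_σ n j h) x
    simp only [LinearMap.comp_apply] at h1
    simp only [LinearMap.comp_apply, LinearEquiv.coe_coe, LinearEquiv.ofBijective_symm_apply_apply]
    rw [h1]
    exact (LinearEquiv.ofBijective (f.app n) (hf n)).apply_symm_apply _)
  app_τ n := LinearMap.ext fun y => (hf n).1 (by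
    obtain ⟨x, rfl⟩ := (hf n).2 y
    have h1 := LinearMap.congr_fun (f.app_τ n) x
    simp only [LinearMap.comp_apply] at h1
    simp only [LinearMap.comp_apply, LinearEquiv.coe_coe, LinearEquiv.ofBijective_symm_apply_apply]
    rw [h1]
    exact (LinearEquiv.ofBijective (f.app n) (hf n)).apply_symm_apply _)

lemma Hom.symm_app (f : X.Hom Y) (hf : ∀ n, Function.Bijective (f.app n)) (n : ℕ) (x : X.obj n) :
    (f.symm hf).app n (f.app n x) = x :=
  (LinearEquiv.ofBijective (f.app n) (hf n)).symm_apply_apply x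

end CocyclicData

namespace ModularPair
variable {H : Type u} [Ring H] [HopfAlgebra ℂ H] (p : ModularPair H)

lemma twistedAntipode_one (δ : H →ₐ[ℂ] ℂ) : twistedAntipode H δ 1 = 1 := by
  simp [twistedAntipode, Algebra.TensorProduct.one_def]

/-- `h ⊗ x ↦ S_δ(h) x`. -/
def untwist (n : ℕ) : TP H (n + 1) →ₗ[ℂ] TP H n :=
  TensorProduct.lift ((diagAct H H n).toLinearMap ∘ₗ twistedAntipode H p.δ) ∘ₗ
    (consE H n).symm.toLinearMap

lemma untwist_cons {n : ℕ} (h : H) (x : TP H n) :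
    p.untwist n (cons h x) = diagAct H H n (twistedAntipode H p.δ h) x := by
  simp [untwist, cons]

lemma untwist_diagAct {n : ℕ} (h : H) (x : TP H (n + 1)) :
    p.untwist n (diagAct H H (n + 1) h x) = p.δ h • p.untwist n x := by
  induction x using TP.cons_induction with
  | hadd x y hx hy => simp only [map_add, smul_add, hx, hy]
  | h g x =>
    have e : ∀ t : H ⊗[ℂ] H, p.untwist n (consAct g x t) =
        diagAct H H n (twistedAntipode H p.δ g *
          LinearMap.mul' ℂ H ((twistedAntipode H p.δ).rTensor H t)) x := by
      intro t
      induction t with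
      | zero => simp
      | add s t hs ht => simp only [map_add, mul_add, LinearMap.add_apply, hs, ht]
      | tmul a b =>
        rw [consAct_tmul, untwist_cons, smul_eq_mul, twistedAntipode_mul, LinearMap.rTensor_tmul,
          LinearMap.mul'_apply, ← mul_assoc, map_mul _ _ b]
        rfl
    rw [diagAct_cons, e, mul_twistedAntipode, Algebra.algebraMap_eq_smul_one, mul_smul_comm,
      mul_one, map_smul, untwist_cons]
    rfl

/-- The map `z ⊗ h⁰ ⊗ ⋯ ⊗ hⁿ ↦ z S_δ(h⁰) (h¹ ⊗ ⋯ ⊗ hⁿ)` on coinvariants. -/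
def coinvIso (n : ℕ) : CoinvTP H p.Coeff H (n + 1) →ₗ[ℂ] TP H n :=
  (relSub H H p.Coeff (n + 1)).liftQ
    (TensorProduct.lift (LinearMap.toSpanSingleton ℂ _ (p.untwist n) ∘ₗ
      p.coeff.symm.toLinearMap)) (by
    refine relSub_le_comap _ ⊥ fun h z x => ?_
    rw [Submodule.mem_bot, sub_eq_zero, p.op_smul, ← TensorProduct.smul_tmul', map_smul]
    change p.δ h • (p.coeff.symm z • p.untwist n x) =
      p.coeff.symm z • p.untwist n (diagAct H H (n + 1) h x)
    rw [untwist_diagAct, smul_comm])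

lemma coinvIso_mk {n : ℕ} (z : ℂ) (x : TP H (n + 1)) :
    p.coinvIso n ((relSub H H p.Coeff (n + 1)).mkQ (p.coeff z ⊗ₜ[ℂ] x)) = z • p.untwist n x := rfl

/-- The inverse of `coinvIso`: `x ↦ 1 ⊗ 1 ⊗ x`. -/
def coinvInv (n : ℕ) (x : TP H n) : CoinvTP H p.Coeff H (n + 1) :=
  (relSub H H p.Coeff (n + 1)).mkQ (p.coeff 1 ⊗ₜ[ℂ] cons 1 x)

lemma coinvIso_coinvInv {n : ℕ} (x : TP H n) : p.coinvIso n (p.coinvInv n x) = x := by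
  rw [coinvInv, coinvIso_mk, one_smul, untwist_cons, twistedAntipode_one, map_one]
  rfl

/-- Modulo the action of `H`, the first factor can be moved to the others by the twisted antipode. -/
lemma mkQ_cons {n : ℕ} (z : p.Coeff) (h : H) (x : TP H n) :
    (relSub H H p.Coeff (n + 1)).mkQ (z ⊗ₜ[ℂ] cons h x) =
      (relSub H H p.Coeff (n + 1)).mkQ
        (z ⊗ₜ[ℂ] cons 1 (diagAct H H n (twistedAntipode H p.δ h) x)) := by
  obtain ⟨s, hs⟩ := TensorProduct.exists_finset (comul (R := ℂ) h)
  have h1 : cons h x = consAct (1 : H) x (h ⊗ₜ[ℂ] (1 : H)) := by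
    rw [consAct_tmul, smul_eq_mul, mul_one, map_one]
    rfl
  have h2 : ∀ (r : H) (t : H ⊗[ℂ] H), consAct (1 : H) x ((LinearMap.mulRight ℂ r).lTensor H t) =
      consAct (1 : H) (diagAct H H n r x) t := by
    intro r t
    induction t with
    | zero => simp
    | add s t hs ht => simp only [map_add, hs, ht]
    | tmul a b =>
      rw [LinearMap.lTensor_tmul, consAct_tmul, consAct_tmul, LinearMap.mulRight_apply, map_mul]
      rfl
  have h3 : twistedAntipode H p.δ h = ∑ i ∈ s, p.δ i.1 • antipode ℂ i.2 := by
    rw [twistedAntipode, LinearMap.comp_apply, LinearMap.comp_apply, hs, map_sum, map_sum]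
    exact Finset.sum_congr rfl fun i _ => by simp [Algebra.algebraMap_eq_smul_one]
  have h4 : cons (1 : H) (diagAct H H n (twistedAntipode H p.δ h) x) =
      ∑ i ∈ s, p.δ i.1 • cons (1 : H) (diagAct H H n (antipode ℂ i.2) x) := by
    rw [h3, map_sum, LinearMap.sum_apply, cons, TensorProduct.tmul_sum, map_sum]
    refine Finset.sum_congr rfl fun i _ => ?_
    rw [map_smul, LinearMap.smul_apply]
    exact cons_smul _ _ _
  rw [h1, ← sum_lTensor_antipode h s (fun i => i.1) (fun i => i.2) hs, map_sum, h4,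
    TensorProduct.tmul_sum, TensorProduct.tmul_sum, map_sum, map_sum]
  refine Finset.sum_congr rfl fun i _ => ?_
  rw [h2, ← diagAct_cons, ← mkQ_rel, p.op_smul, TensorProduct.smul_tmul]

lemma coinvInv_surjective (n : ℕ) : Function.Surjective (p.coinvInv n) := by
  intro q
  refine ⟨p.coinvIso n q, ?_⟩
  obtain ⟨t, rfl⟩ := Submodule.mkQ_surjective _ q
  have hadd : ∀ x y, p.coinvInv n (x + y) = p.coinvInv n x + p.coinvInv n y := fun x y => by
    rw [coinvInv, cons_add, TensorProduct.tmul_add, map_add]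
    rfl
  induction t with
  | zero => simp [coinvInv, cons]
  | add s t hs ht => rw [map_add, map_add, hadd, hs, ht]
  | tmul z x =>
    induction x using TP.cons_induction with
    | hadd x y hx hy => rw [TensorProduct.tmul_add, map_add, map_add, hadd, hx, hy]
    | h h x =>
      rw [mkQ_cons, ← p.coeff.apply_symm_apply z, coinvIso_mk, untwist_cons,
        twistedAntipode_one, map_one, Module.End.one_apply, coinvInv, cons_smul,
        ← TensorProduct.smul_tmul, ← map_smul, smul_eq_mul, mul_one]

lemma coinvIso_bijective (n : ℕ) : Function.Bijective (p.coinvIso n) := by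
  refine ⟨fun q q' h => ?_, fun x => ⟨_, p.coinvIso_coinvInv x⟩⟩
  obtain ⟨x, rfl⟩ := p.coinvInv_surjective n q
  obtain ⟨x', rfl⟩ := p.coinvInv_surjective n q'
  rw [coinvIso_coinvInv, coinvIso_coinvInv] at h
  rw [h]

lemma counit_twistedAntipode_σ : counit (R := ℂ) (twistedAntipode H p.δ p.σ) = 1 := by
  simp [twistedAntipode, p.groupLike.comul_eq_tmul_self, p.δ_σ, p.groupLike.counit_eq_one]

lemma cyc_coeff {n : ℕ} (z : p.Coeff) (h : H) (x : TP H n) :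
    cyc H p.Coeff H n (z ⊗ₜ[ℂ] cons h x) = z ⊗ₜ snoc x (p.σ * h) := by
  rw [rotL_cons]
  rfl

lemma cmCyc_cons {n : ℕ} (h : H) (x : TP H n) :
    p.cmCyc (n + 1) (cons h x) = diagAct H H (n + 1) (twistedAntipode H p.δ h) (snoc x p.σ) := by
  simp only [cmCyc, cons, LinearMap.comp_apply, LinearEquiv.coe_coe, LinearEquiv.symm_apply_apply]
  rfl

/-- The isomorphism `z ⊗ h⁰ ⊗ ⋯ ⊗ hⁿ ↦ z S_δ(h⁰) (h¹ ⊗ ⋯ ⊗ hⁿ)` of cocyclic modules. -/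
def coinvHom : (coalgData H H p.Coeff).Hom p.cmData where
  app := p.coinvIso
  app_δ n i h := by
    refine LinearMap.ext fun q => ?_
    obtain ⟨x, rfl⟩ := p.coinvInv_surjective n q
    simp only [LinearMap.comp_apply]
    rw [coinvIso_coinvInv]
    rcases i with _ | i
    · rw [coinvInv, coalgData_δ H H p.Coeff (Nat.zero_le _), LinearMap.lTensor_tmul,
        comulAt_zero_cons, Bialgebra.comul_one, Algebra.TensorProduct.one_def, cons₂_tmul]
      exact (p.coinvIso_coinvInv _).trans (oneAt_zero n x).symm
    · rcases Nat.lt_or_ge n (i + 1) with h' | h'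
      · obtain rfl : i = n := by omega
        have e : p.cmData.δ i (i + 1) x = snoc x p.σ := by
          change (if i + 1 = 0 then oneAt i 0 else if i + 1 ≤ i then cmInner i (i + 1)
            else snocR p.σ i) x = _
          rw [if_neg (by omega), if_neg (by omega)]
          rfl
        rw [e, coinvInv, coalgData_δ_last, LinearMap.lTensor_tmul,
          comulAt_zero_cons, Bialgebra.comul_one, Algebra.TensorProduct.one_def, cons₂_tmul,
          cyc_coeff, mul_one, snoc_cons]
        exact p.coinvIso_coinvInv _
      · obtain ⟨n, rfl⟩ : ∃ l, n = l + 1 := ⟨n - 1, by omega⟩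
        have e : p.cmData.δ (n + 1) (i + 1) x = comulAt n i x := by
          change (if i + 1 = 0 then oneAt (n + 1) 0 else if i + 1 ≤ n + 1 then comulAt n i
            else snocR p.σ (n + 1)) x = _
          rw [if_neg (by omega), if_pos h']
        rw [e, coinvInv, coalgData_δ H H p.Coeff h', LinearMap.lTensor_tmul, comulAt_succ_cons]
        exact p.coinvIso_coinvInv _
  app_σ n j h := by
    refine LinearMap.ext fun q => ?_
    obtain ⟨x, rfl⟩ := p.coinvInv_surjective (n + 1) q
    simp only [LinearMap.comp_apply]
    rw [coinvIso_coinvInv]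
    change p.coinvIso n ((relSub H H p.Coeff (n + 1)).mkQ
      ((counitAt (n + 1) (j + 1)).lTensor _ (p.coeff 1 ⊗ₜ[ℂ] cons 1 x))) = counitAt n j x
    rw [LinearMap.lTensor_tmul, counitAt_succ_cons]
    exact p.coinvIso_coinvInv _
  app_τ n := by
    refine LinearMap.ext fun q => ?_
    obtain ⟨x, rfl⟩ := p.coinvInv_surjective n q
    simp only [LinearMap.comp_apply]
    rw [coinvIso_coinvInv]
    change p.coinvIso n ((relSub H H p.Coeff (n + 1)).mkQ
      (cyc H p.Coeff H n (p.coeff 1 ⊗ₜ[ℂ] cons 1 x))) = p.cmCyc n x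
    rw [cyc_coeff, mul_one, coinvIso_mk, one_smul]
    rcases n with _ | n
    · rw [snoc_nil, untwist_cons, diagAct_zero, counit_twistedAntipode_σ, one_smul]
      rfl
    · induction x using TP.cons_induction with
      | hadd x y hx hy => simp only [add_snoc, map_add, hx, hy]
      | h h x => rw [snoc_cons, untwist_cons, cmCyc_cons]

theorem cmData_isCocyclic : p.cmData.IsCocyclic :=
  (coalgData_isCocyclic H H p.Coeff).of_surjective p.coinvHom fun n => (p.coinvIso_bijective n).2

end ModularPair

/-! ### Invariant traces and the characteristic map -/

namespace CocyclicData
variable {X : CocyclicData.{u}} {Y : CocyclicData.{v}} {Y' : CocyclicData.{w}}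
  {Z : CocyclicData.{w'}}

lemma Hom.hc_hc_congr {f : X.Hom Y} {g : Y.Hom Z} {f' : X.Hom Y'} {g' : Y'.Hom Z}
    (h : ∀ n x, g.app n (f.app n x) = g'.app n (f'.app n x)) (n : ℕ) (x : X.HC n) :
    g.hc n (f.hc n x) = g'.hc n (f'.hc n x) := by
  induction x using Submodule.Quotient.induction_on with
  | H x => exact congrArg Submodule.Quotient.mk (Subtype.ext (funext fun s => h s.1.1 (x.1 s)))

end CocyclicData

namespace ModularPair
variable {H : Type u} [Ring H] [HopfAlgebra ℂ H] (p : ModularPair H)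

lemma coinvHom_app {n : ℕ} (z : ℂ) (h : Fin (n + 1) → H) :
    p.coinvHom.app n (Submodule.Quotient.mk (p.coeff z ⊗ₜ[ℂ] PiTensorProduct.tprod ℂ h)) =
      z • diagAct H H n (twistedAntipode H p.δ (h 0))
        (PiTensorProduct.tprod ℂ fun i : Fin n => h i.succ) := by
  refine (p.coinvIso_mk z _).trans ?_
  rw [← Fin.cons_self_tail h, ← cons_tprod, untwist_cons]
  rfl

lemma σ_mul_antipodeInv [BijectiveAntipode H] :
    p.σ * antipodeInv H p.σ = 1 := by
  apply (BijectiveAntipode.bijective (H := H)).1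
  rw [antipode_mul_antidistrib, antipode_antipodeInv, antipode_one,
    p.groupLike.mul_antipode_cancel]

variable {p}
variable {A : Type u} [Ring A] [Algebra ℂ A] [Module H A] [IsScalarTower ℂ H A]

namespace InvTrace
variable (t : p.InvTrace A)

/-- The linear form `z ⊗ a ↦ z tr(a)`. -/
def form : Module.Dual ℂ (p.Coeff ⊗[ℂ] TP A 1) :=
  TensorProduct.lift (LinearMap.toSpanSingleton ℂ _ (LinearMap.mul' ℂ ℂ ∘ₗ
    TensorProduct.map t.tr (nilE A).toLinearMap ∘ₗ (consE A 0).symm.toLinearMap) ∘ₗ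
      p.coeff.symm.toLinearMap)

lemma form_cons (z : p.Coeff) (a : A) (y : TP A 0) :
    t.form (z ⊗ₜ[ℂ] cons a y) = p.coeff.symm z * (t.tr a * nilE A y) := by
  simp [form, cons]

lemma form_smul (z : p.Coeff) (h : H) (a : A) (y : TP A 0) :
    t.form (z ⊗ₜ[ℂ] cons (h • a) y) = p.δ h * t.form (z ⊗ₜ[ℂ] cons a y) := by
  rw [form_cons, form_cons, t.tr_smul]
  ring

lemma form_tprod (z : ℂ) (a : Fin 1 → A) :
    t.form (p.coeff z ⊗ₜ[ℂ] PiTensorProduct.tprod ℂ a) = z * t.tr (a 0) := by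
  have h : nilE A (PiTensorProduct.tprod ℂ (Fin.tail a)) = 1 :=
    PiTensorProduct.isEmptyEquiv_apply_tprod _ _
  rw [← Fin.cons_self_tail a, ← cons_tprod, form_cons, h, mul_one]
  rfl

lemma form_mem [ModuleAlgebra H A] : t.form ∈ invForms H p.Coeff A 1 := by
  rw [mem_invForms_iff]
  refine relSub_le_comap _ ⊥ fun h z x => ?_
  rw [Submodule.mem_bot, sub_eq_zero, p.op_smul]
  induction x using TP.cons_induction with
  | hadd x y hx hy => simp only [TensorProduct.tmul_add, map_add, hx, hy]
  | h a y =>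
    have e : ∀ s : H ⊗[ℂ] H, consAct a y s =
        cons (TensorProduct.rid ℂ H ((counit (R := ℂ)).lTensor H s) • a) y := by
      intro s
      induction s with
      | zero => simp [cons]
      | add s s' hs hs' => simp only [map_add, add_smul, add_cons, hs, hs']
      | tmul g g' =>
        rw [consAct_tmul, diagAct_zero, LinearMap.lTensor_tmul, TensorProduct.rid_tmul, smul_assoc,
          smul_cons, cons_smul]
    rw [diagAct_cons, e, Coalgebra.lTensor_counit_comul, TensorProduct.rid_tmul, one_smul,
      form_smul, ← TensorProduct.smul_tmul', map_smul, smul_eq_mul]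

variable [BijectiveAntipode H]

lemma cycInv_coeff {n : ℕ} (z : p.Coeff) (x : TP A n) (a : A) :
    cycInv H p.Coeff A n (z ⊗ₜ[ℂ] snoc x a) = z ⊗ₜ cons (antipodeInv H p.σ • a) x := by
  rw [rotR_snoc]
  rfl

variable [ModuleAlgebra H A]

/-- The cochain `z ⊗ a ↦ z tr(a)`. -/
def cochain : (algData H p.Coeff A).obj 0 := ⟨t.form, t.form_mem⟩

lemma b_cochain : (algData H p.Coeff A).mixed.b 0 t.cochain = 0 := by
  rw [CocyclicData.mixed_b_apply, Finset.sum_range_succ, Finset.sum_range_one, pow_zero, one_smul,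
    pow_one, neg_one_smul, ← sub_eq_add_neg, sub_eq_zero]
  refine Subtype.ext (LinearMap.ext fun w => ?_)
  rw [algData_δ H p.Coeff A le_rfl, algData_δ_last]
  change t.form _ = t.form _
  induction w with
  | zero => simp
  | add s t hs ht => simp only [map_add, hs, ht]
  | tmul z x =>
    induction x using TP.cons_cons_induction with
    | hadd x y hx hy => simp only [TensorProduct.tmul_add, map_add, hx, hy]
    | h a b y =>
      have e : cons a (cons b y) = snoc (cons a y) b := by rw [snoc_cons, snoc_nil]
      rw [LinearMap.lTensor_tmul, mulAt_zero_cons, form_cons, e, cycInv_coeff,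
        LinearMap.lTensor_tmul, mulAt_zero_cons, form_cons, t.tr_mul _ a, smul_smul,
        p.σ_mul_antipodeInv, one_smul]

lemma τ_cochain : (algData H p.Coeff A).τ 0 t.cochain = t.cochain := by
  refine Subtype.ext (LinearMap.ext fun w => ?_)
  change t.form (cycInv H p.Coeff A 0 w) = t.form w
  have h1 : p.δ (antipodeInv H p.σ) = 1 := by
    have := congrArg p.δ p.σ_mul_antipodeInv
    rwa [map_mul, p.δ_σ, one_mul, map_one] at this
  induction w with
  | zero => simp
  | add s t hs ht => simp only [map_add, hs, ht]
  | tmul z x =>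
    induction x using TP.cons_induction with
    | hadd x y hx hy => simp only [TensorProduct.tmul_add, map_add, hx, hy]
    | h a y => rw [← snoc_nil, cycInv_coeff, form_smul, h1, one_mul, snoc_nil]

/-- The iterated cofaces of the cocycle are `z ⊗ a⁰ ⊗ ⋯ ⊗ aⁿ ↦ z tr(a⁰ ⋯ aⁿ)`. -/
lemma vertex_cochain (n : ℕ) (z : ℂ) (a : Fin (n + 1) → A) :
    ((algData H p.Coeff A).vertex n t.cochain).1 (p.coeff z ⊗ₜ[ℂ] PiTensorProduct.tprod ℂ a) =
      z * t.tr (List.ofFn a).prod := by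
  induction n with
  | zero =>
    refine (t.form_tprod z a).trans ?_
    simp
  | succ n ih =>
    rw [← (algData_isCocyclic H p.Coeff A).δ_vertex t.b_cochain (Nat.zero_le _),
      algData_δ H p.Coeff A (Nat.zero_le _), LinearMap.lTensor_tmul]
    have e : mulAt n 0 (PiTensorProduct.tprod ℂ a) = PiTensorProduct.tprod ℂ
        (Fin.cons (a 0 * a 1) fun i => a i.succ.succ : Fin (n + 1) → A) := by
      rw [← cons_tprod, ← mulAt_zero_cons, cons_tprod, cons_tprod]
      congr 2
      funext i
      refine Fin.cases rfl (fun i => Fin.cases rfl (fun i => rfl) i) i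
    rw [e, ih]
    simp [List.ofFn_succ, mul_assoc]

/-- The characteristic map `h¹ ⊗ ⋯ ⊗ hⁿ ↦ (a⁰ ⊗ ⋯ ⊗ aⁿ ↦ tr(a⁰ h¹(a¹) ⋯ hⁿ(aⁿ)))`. -/
def charHom : p.cmData.Hom (plainData A) :=
  ((selfAction H A).toInto.pairingHom p.Coeff).comp
    ((CocyclicData.mulHom (algData_isCocyclic H p.Coeff A) t.cochain t.b_cochain _).comp
      (p.coinvHom.symm p.coinvIso_bijective))

lemma charHom_app (n : ℕ) (h : Fin n → H) (a : Fin (n + 1) → A) :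
    t.charHom.app n (PiTensorProduct.tprod ℂ h) (PiTensorProduct.tprod ℂ a) =
      t.tr (a 0 * (List.ofFn fun i : Fin n => h i • a i.succ).prod) := by
  have h1 : (p.coinvHom.symm p.coinvIso_bijective).app n (PiTensorProduct.tprod ℂ h) =
      p.coinvInv n (PiTensorProduct.tprod ℂ h) := by
    have := p.coinvHom.symm_app p.coinvIso_bijective n (p.coinvInv n (PiTensorProduct.tprod ℂ h))
    rwa [show p.coinvHom.app n (p.coinvInv n (PiTensorProduct.tprod ℂ h)) =
      PiTensorProduct.tprod ℂ h from p.coinvIso_coinvInv _] at this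
  change ((selfAction H A).toInto.pairingHom p.Coeff).app n
    ((algData H p.Coeff A).vertex n t.cochain ⊗ₜ[ℂ]
      (p.coinvHom.symm p.coinvIso_bijective).app n (PiTensorProduct.tprod ℂ h)) _ = _
  rw [h1, coinvInv, cons_tprod]
  refine ((selfAction H A).toInto.pairingHom_app p.Coeff n _ _ _ a).trans ?_
  rw [vertex_cochain, one_mul, List.ofFn_succ, List.prod_cons]
  refine congrArg (fun b => t.tr (b * _)) ?_
  exact one_smul H (a 0)

/-- The characteristic map is the product with the trace, for every description of the pairing. -/
lemma charHom_coinvHom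
    (Ψ : ((algData H p.Coeff A).diag (coalgData H H p.Coeff)).Hom (plainData A))
    (hΨ : ∀ (n : ℕ) (φ : invForms H p.Coeff A (n + 1)) (m : p.Coeff) (c : Fin (n + 1) → H)
      (a : Fin (n + 1) → A),
      Ψ.app n (φ ⊗ₜ[ℂ] Submodule.Quotient.mk (m ⊗ₜ[ℂ] PiTensorProduct.tprod ℂ c))
          (PiTensorProduct.tprod ℂ a) =
        φ.1 (m ⊗ₜ[ℂ] PiTensorProduct.tprod ℂ fun i => c i • a i))
    (n : ℕ) (x : (coalgData H H p.Coeff).obj n) :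
    Ψ.app n ((CocyclicData.mulHom (algData_isCocyclic H p.Coeff A) t.cochain t.b_cochain
      (coalgData H H p.Coeff)).app n x) = t.charHom.app n (p.coinvHom.app n x) := by
  have h1 : Ψ.app n = ((selfAction H A).toInto.pairingHom p.Coeff).app n := by
    refine TensorProduct.ext' fun φ q => ?_
    refine PiTensorProduct.ext (MultilinearMap.ext fun a => ?_)
    obtain ⟨w, rfl⟩ := Submodule.mkQ_surjective _ q
    induction w with
    | zero => simp
    | add s t hs ht =>
      simp only [map_add, TensorProduct.tmul_add, LinearMap.add_apply,
        LinearMap.compMultilinearMap_apply] at hs ht ⊢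
      rw [hs, ht]
    | tmul m c =>
      induction c using PiTensorProduct.induction_on with
      | add c c' hc hc' =>
        simp only [map_add, TensorProduct.tmul_add, LinearMap.add_apply,
          LinearMap.compMultilinearMap_apply] at hc hc' ⊢
        rw [hc, hc']
      | smul_tprod r c =>
        simp only [map_smul, TensorProduct.tmul_smul, LinearMap.smul_apply,
          LinearMap.compMultilinearMap_apply]
        refine congrArg (r • ·) ((hΨ n φ m c a).trans ?_)
        exact ((selfAction H A).toInto.pairingHom_app p.Coeff n φ m c a).symm
  rw [h1]
  exact congrArg (fun y => ((selfAction H A).toInto.pairingHom p.Coeff).app n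
    ((algData H p.Coeff A).vertex n t.cochain ⊗ₜ[ℂ] y))
      (p.coinvHom.symm_app p.coinvIso_bijective n x).symm

/-- The cup product with the class of the trace is the characteristic map. -/
lemma cup_cochain (hA : (algData H p.Coeff A).IsCocyclic)
    (hH : (coalgData H H p.Coeff).IsCocyclic)
    (Ψ : ((algData H p.Coeff A).diag (coalgData H H p.Coeff)).Hom (plainData A))
    (hΨ : ∀ (n : ℕ) (φ : invForms H p.Coeff A (n + 1)) (m : p.Coeff) (c : Fin (n + 1) → H)
      (a : Fin (n + 1) → A),
      Ψ.app n (φ ⊗ₜ[ℂ] Submodule.Quotient.mk (m ⊗ₜ[ℂ] PiTensorProduct.tprod ℂ c))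
          (PiTensorProduct.tprod ℂ a) =
        φ.1 (m ⊗ₜ[ℂ] PiTensorProduct.tprod ℂ fun i => c i • a i))
    (AW : CyclicAW.{u}) (n : ℕ) (x : (coalgData H H p.Coeff).HC n) :
    cup AW (X := ⟨_, hA⟩) (Y := ⟨_, hH⟩) Ψ (Nat.zero_add n)
        (MixedData.HC.ofZero t.cochain t.b_cochain) x =
      t.charHom.hc n (p.coinvHom.hc n x) := by
  rw [AW.cup_ofZero (X := ⟨_, hA⟩) (Y := ⟨_, hH⟩) Ψ t.cochain t.b_cochain x]
  apply CocyclicData.Hom.hc_hc_congr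
  exact t.charHom_coinvHom Ψ hΨ

end InvTrace
end ModularPair

/-! ### Compatibility and independence -/

section Natural
variable {H : Type u} [Ring H] [HopfAlgebra ℂ H] [BijectiveAntipode H]
variable {C : Type u} [AddCommGroup C] [Module ℂ C] [Coalgebra ℂ C] [Module H C]
  [IsScalarTower ℂ H C] [ModuleCoalgebra H C]
variable {A : Type u} [Ring A] [Algebra ℂ A] [Module H A] [IsScalarTower ℂ H A] [ModuleAlgebra H A]

/-- The pairing for the action on `A` is the one for the evaluation, pulled back along `natural`. -/
lemma pairingHom_natural (α : CoalgebraAction H C A) (M : Type v) [AddCommGroup M] [Module ℂ M]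
    [Module Hᵐᵒᵖ M] [IsScalarTower ℂ Hᵐᵒᵖ M] [SAYD H M] (n : ℕ)
    (z : ((algData H M A).diag (coalgData H C M)).obj n) (a : Fin (n + 1) → A) :
    (α.toInto.pairingHom M).app n z (PiTensorProduct.tprod ℂ a) =
      ((evalInto H C A).pairingHom M).app n z (PiTensorProduct.tprod ℂ fun i => α.natural (a i)) := by
  have h : ∀ c : TP C (n + 1), α.toInto.pow (n + 1) c (PiTensorProduct.tprod ℂ a) =
      (evalInto H C A).pow (n + 1) c (PiTensorProduct.tprod ℂ fun i => α.natural (a i)) := by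
    intro c
    induction c using PiTensorProduct.induction_on with
    | add c c' hc hc' => rw [map_add, map_add, LinearMap.add_apply, LinearMap.add_apply, hc, hc']
    | smul_tprod r c =>
      rw [map_smul, map_smul, LinearMap.smul_apply, LinearMap.smul_apply, ActionInto.pow_tprod,
        ActionInto.pow_tprod]
      rfl
  induction z using TensorProduct.induction_on with
  | zero => simp
  | add s t hs ht => rw [map_add, map_add, LinearMap.add_apply, LinearMap.add_apply, hs, ht]
  | tmul φ q =>
    obtain ⟨w, rfl⟩ := Submodule.mkQ_surjective _ q
    refine congrArg φ.1 ?_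
    induction w with
    | zero => simp
    | add s t hs ht => rw [map_add, map_add, LinearMap.add_apply, LinearMap.add_apply, hs, ht]
    | tmul m c => rw [ActionInto.coeffPow_tmul, ActionInto.coeffPow_tmul, h]

end Natural

/-- There is one product that all cyclic Alexander-Whitney maps give. -/
lemma CyclicAW.exists_cup_eq {X Y : CocyclicModule.{w}} {Z : CocyclicData.{w'}}
    (Ψ : (X.diag Y.toCocyclicData).Hom Z) :
    ∃ U : ∀ p q n : ℕ, p + q = n → X.HC p →ₗ[ℂ] Y.HC q →ₗ[ℂ] Z.HC n,
      ∀ (AW : CyclicAW.{w}) (p q n : ℕ) (h : p + q = n), cup AW Ψ h = U p q n h :=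
  NatOp.nonempty_cyclicAW.elim fun F =>
    ⟨fun _ _ _ h => cup F Ψ h, fun AW _ _ _ h => AW.cup_eq F Ψ h⟩

/-- The cup product that is given by an action of a module coalgebra does not depend on the cyclic
Alexander-Whitney map. -/
lemma ActionInto.exists_cup_eq {H : Type u} [Ring H] [HopfAlgebra ℂ H] [BijectiveAntipode H]
    {C : Type u} [AddCommGroup C] [Module ℂ C] [Coalgebra ℂ C] [Module H C] [IsScalarTower ℂ H C]
    [ModuleCoalgebra H C] {F : Type u} [Ring F] [Algebra ℂ F] {A : Type u} [Ring A] [Algebra ℂ A]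
    [Module H A] [IsScalarTower ℂ H A] [ModuleAlgebra H A] (e : ActionInto H C F A) (M : Type v)
    [AddCommGroup M] [Module ℂ M] [Module Hᵐᵒᵖ M] [IsScalarTower ℂ Hᵐᵒᵖ M] [SAYD H M] :
    ∃ U : ∀ p q n : ℕ, p + q = n → (algData H M A).HC p →ₗ[ℂ] (coalgData H C M).HC q →ₗ[ℂ]
        (plainData F).HC n,
      ∀ (AW : CyclicAW.{max u v}) (p q n : ℕ) (h : p + q = n),
        cup AW (X := ⟨_, algData_isCocyclic H M A⟩) (Y := ⟨_, coalgData_isCocyclic H C M⟩)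
          (e.pairingHom M) h = U p q n h :=
  CyclicAW.exists_cup_eq (X := ⟨_, algData_isCocyclic H M A⟩)
    (Y := ⟨_, coalgData_isCocyclic H C M⟩) (e.pairingHom M)

end HopfCyclic
end

theorem mainTheorem2 (H A : Type u) [Ring H] [HopfAlgebra ℂ H]
    [HopfCyclic.BijectiveAntipode H] [Ring A] [Algebra ℂ A] [Module H A] [IsScalarTower ℂ H A]
    [HopfCyclic.ModuleAlgebra H A] :
    -- cyclic Alexander-Whitney maps exist
    (Nonempty HopfCyclic.CyclicAW.{max u v} ∧ Nonempty HopfCyclic.CyclicAW.{u}) ∧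
    -- `Ψ_c` and `Ψ`, and their cup products
    (∀ (C : Type u) [AddCommGroup C] [Module ℂ C] [Coalgebra ℂ C] [Module H C]
      [IsScalarTower ℂ H C] [HopfCyclic.ModuleCoalgebra H C]
      (α : HopfCyclic.CoalgebraAction H C A)
      (M : Type v) [AddCommGroup M] [Module ℂ M] [Module Hᵐᵒᵖ M] [IsScalarTower ℂ Hᵐᵒᵖ M]
      [HopfCyclic.SAYD H M],
      ∃ (hA : (HopfCyclic.algData H M A).IsCocyclic) (hC : (HopfCyclic.coalgData H C M).IsCocyclic)
        (Ψc : ((HopfCyclic.algData H M A).diag (HopfCyclic.coalgData H C M)).Hom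
          (HopfCyclic.plainData (HopfCyclic.convAlg H C A)))
        (Ψ : ((HopfCyclic.algData H M A).diag (HopfCyclic.coalgData H C M)).Hom
          (HopfCyclic.plainData A)),
        (HopfCyclic.plainData (HopfCyclic.convAlg H C A)).IsCocyclic ∧
        (HopfCyclic.plainData A).IsCocyclic ∧
        (∀ (n : ℕ) (φ : HopfCyclic.invForms H M A (n + 1)) (m : M) (c : Fin (n + 1) → C)
          (f : Fin (n + 1) → HopfCyclic.convAlg H C A),
          Ψc.app n (φ ⊗ₜ[ℂ] Submodule.Quotient.mk (m ⊗ₜ[ℂ] PiTensorProduct.tprod ℂ c))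
              (PiTensorProduct.tprod ℂ f) =
            φ.1 (m ⊗ₜ[ℂ] PiTensorProduct.tprod ℂ fun i => (f i).1.ofConv (c i))) ∧
        (∀ (n : ℕ) (φ : HopfCyclic.invForms H M A (n + 1)) (m : M) (c : Fin (n + 1) → C)
          (a : Fin (n + 1) → A),
          Ψ.app n (φ ⊗ₜ[ℂ] Submodule.Quotient.mk (m ⊗ₜ[ℂ] PiTensorProduct.tprod ℂ c))
              (PiTensorProduct.tprod ℂ a) =
            φ.1 (m ⊗ₜ[ℂ] PiTensorProduct.tprod ℂ fun i => α.act (c i) (a i))) ∧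
        (∀ (n : ℕ) z (a : Fin (n + 1) → A),
          Ψ.app n z (PiTensorProduct.tprod ℂ a) =
            Ψc.app n z (PiTensorProduct.tprod ℂ fun i => α.natural (a i))) ∧
        (∃ U : ∀ p q n : ℕ, p + q = n → (HopfCyclic.algData H M A).HC p →ₗ[ℂ]
            (HopfCyclic.coalgData H C M).HC q →ₗ[ℂ] (HopfCyclic.plainData A).HC n,
          ∀ (AW : HopfCyclic.CyclicAW.{max u v}) (p q n : ℕ) (h : p + q = n),
            HopfCyclic.cup AW (X := ⟨_, hA⟩) (Y := ⟨_, hC⟩) Ψ h = U p q n h) ∧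
        (∃ U : ∀ p q n : ℕ, p + q = n → (HopfCyclic.algData H M A).HC p →ₗ[ℂ]
            (HopfCyclic.coalgData H C M).HC q →ₗ[ℂ]
              (HopfCyclic.plainData (HopfCyclic.convAlg H C A)).HC n,
          ∀ (AW : HopfCyclic.CyclicAW.{max u v}) (p q n : ℕ) (h : p + q = n),
            HopfCyclic.cup AW (X := ⟨_, hA⟩) (Y := ⟨_, hC⟩) Ψc h = U p q n h)) ∧
    -- `Ψ_r` and its cup product
    (∀ (K : HopfCyclic.SubHopf H)
      (M : Type v) [AddCommGroup M] [Module ℂ M] [Module Hᵐᵒᵖ M] [IsScalarTower ℂ Hᵐᵒᵖ M]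
      [HopfCyclic.SAYD H M],
      ∃ (hA : (HopfCyclic.algData H M A).IsCocyclic)
        (hK : (HopfCyclic.coalgData H K.Rel M).IsCocyclic)
        (Ψr : ((HopfCyclic.algData H M A).diag (HopfCyclic.coalgData H K.Rel M)).Hom
          (HopfCyclic.plainData (K.invAlg A))),
        (HopfCyclic.plainData (K.invAlg A)).IsCocyclic ∧
        (∀ (n : ℕ) (φ : HopfCyclic.invForms H M A (n + 1)) (m : M) (h : Fin (n + 1) → H)
          (a : Fin (n + 1) → K.invAlg A),
          Ψr.app n (φ ⊗ₜ[ℂ] Submodule.Quotient.mk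
              (m ⊗ₜ[ℂ] PiTensorProduct.tprod ℂ fun i => (Submodule.Quotient.mk (h i) : K.Rel)))
              (PiTensorProduct.tprod ℂ a) =
            φ.1 (m ⊗ₜ[ℂ] PiTensorProduct.tprod ℂ fun i => h i • (a i : A))) ∧
        (∃ U : ∀ p q n : ℕ, p + q = n → (HopfCyclic.algData H M A).HC p →ₗ[ℂ]
            (HopfCyclic.coalgData H K.Rel M).HC q →ₗ[ℂ] (HopfCyclic.plainData (K.invAlg A)).HC n,
          ∀ (AW : HopfCyclic.CyclicAW.{max u v}) (p q n : ℕ) (h : p + q = n),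
            HopfCyclic.cup AW (X := ⟨_, hA⟩) (Y := ⟨_, hK⟩) Ψr h = U p q n h)) ∧
    -- the characteristic map of Connes and Moscovici is the cup product with the class of a trace
    (∀ p : HopfCyclic.ModularPair H,
      p.cmData.IsCocyclic ∧
      ∃ I : (HopfCyclic.coalgData H H p.Coeff).Hom p.cmData,
        (∀ n, Function.Bijective (I.app n)) ∧
        (∀ (n : ℕ) (z : ℂ) (h : Fin (n + 1) → H),
          I.app n (Submodule.Quotient.mk (p.coeff z ⊗ₜ[ℂ] PiTensorProduct.tprod ℂ h)) =
            z • HopfCyclic.diagAct H H n (HopfCyclic.twistedAntipode H p.δ (h 0))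
              (PiTensorProduct.tprod ℂ fun i : Fin n => h i.succ)) ∧
        ∀ t : p.InvTrace A, ∃ χ : p.cmData.Hom (HopfCyclic.plainData A),
          (∀ (n : ℕ) (h : Fin n → H) (a : Fin (n + 1) → A),
            χ.app n (PiTensorProduct.tprod ℂ h) (PiTensorProduct.tprod ℂ a) =
              t.tr (a 0 * (List.ofFn fun i : Fin n => h i • a i.succ).prod)) ∧
          ∃ (φ : (HopfCyclic.algData H p.Coeff A).obj 0)
            (hφ : (HopfCyclic.algData H p.Coeff A).mixed.b 0 φ = 0),
            (HopfCyclic.algData H p.Coeff A).τ 0 φ = φ ∧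
            (∀ (z : ℂ) (a : Fin 1 → A),
              φ.1 (p.coeff z ⊗ₜ[ℂ] PiTensorProduct.tprod ℂ a) = z * t.tr (a 0)) ∧
            ∀ (hA : (HopfCyclic.algData H p.Coeff A).IsCocyclic)
              (hH : (HopfCyclic.coalgData H H p.Coeff).IsCocyclic)
              (Ψ : ((HopfCyclic.algData H p.Coeff A).diag (HopfCyclic.coalgData H H p.Coeff)).Hom
                (HopfCyclic.plainData A)),
              (∀ (n : ℕ) (φ : HopfCyclic.invForms H p.Coeff A (n + 1)) (m : p.Coeff)
                (c : Fin (n + 1) → H) (a : Fin (n + 1) → A),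
                Ψ.app n (φ ⊗ₜ[ℂ] Submodule.Quotient.mk (m ⊗ₜ[ℂ] PiTensorProduct.tprod ℂ c))
                    (PiTensorProduct.tprod ℂ a) =
                  φ.1 (m ⊗ₜ[ℂ] PiTensorProduct.tprod ℂ fun i => c i • a i)) →
              ∀ (AW : HopfCyclic.CyclicAW.{u}) (n : ℕ)
                (x : (HopfCyclic.coalgData H H p.Coeff).HC n),
                HopfCyclic.cup AW (X := ⟨_, hA⟩) (Y := ⟨_, hH⟩) Ψ (Nat.zero_add n)
                    (HopfCyclic.MixedData.HC.ofZero φ hφ) x =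
                  χ.hc n (I.hc n x)) := by
  refine ⟨⟨HopfCyclic.NatOp.nonempty_cyclicAW, HopfCyclic.NatOp.nonempty_cyclicAW⟩, ?_, ?_, ?_⟩
  · intro C _ _ _ _ _ _ α M _ _ _ _ _
    refine ⟨HopfCyclic.algData_isCocyclic H M A, HopfCyclic.coalgData_isCocyclic H C M,
      (HopfCyclic.evalInto H C A).pairingHom M, α.toInto.pairingHom M,
      HopfCyclic.plainData_isCocyclic _, HopfCyclic.plainData_isCocyclic A,
      fun n φ m c f => (HopfCyclic.evalInto H C A).pairingHom_app M n φ m c f,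
      fun n φ m c a => α.toInto.pairingHom_app M n φ m c a, ?_,
      α.toInto.exists_cup_eq M, (HopfCyclic.evalInto H C A).exists_cup_eq M⟩
    exact fun n z a => HopfCyclic.pairingHom_natural α M n z a
  · intro K M _ _ _ _ _
    exact ⟨HopfCyclic.algData_isCocyclic H M A, HopfCyclic.coalgData_isCocyclic H K.Rel M,
      (K.relInto (A := A)).pairingHom M, HopfCyclic.plainData_isCocyclic _,
      fun n φ m h a => (K.relInto (A := A)).pairingHom_app M n φ m _ a,
      (K.relInto (A := A)).exists_cup_eq M⟩
  · intro p
    refine ⟨p.cmData_isCocyclic, p.coinvHom, p.coinvIso_bijective, fun n z h => p.coinvHom_app z h,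
      fun t => ⟨t.charHom, t.charHom_app, t.cochain, t.b_cochain, t.τ_cochain, t.form_tprod, ?_⟩⟩
    intro hA hH Ψ hΨ AW n x
    exact t.cup_cochain hA hH Ψ hΨ AW n x
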